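/- Let $p$ be a prime and $f(x)=\alpha_0\prod_{i=1}^{r}(x-\alpha_i)^{e_i}\in\mathbb{Z}[x]$ a non-constant polynomial in one variable, of degree $d$, with splitting field $\mathbb{Q}$ (the $\alpha_i\in\mathbb{Q}$ distinct, $e_i\ge 1$). Let $$Z(s,f)=\int_{\mathbb{Z}_p}|f(x)|_p^s\,|dx|,\qquad \operatorname{Re}(s)>0,$$ where $|dx|$ is the Haar measure of total mass $1$. Put $\|f\|=\sqrt{\sum_i a_i^2}$ for $f=\sum_i a_ix^i$, $f_+=\prod_{v_p(\alpha_i)\ge 0}(x-\alpha_i)^{e_i}$, and $v=v_p\bigl(\alpha_0\prod_{v_p(\alpha_i)<0}\alpha_i^{e_i}\bigr)$. Let $l_f=1+\max v_p(\alpha_i-\alpha_j)$, the maximum over pairs $i\ne j$ with $v_p(\alpha_i),v_p(\alpha_j)\ge 0$, and $l_f=1$ if there is no such pair. Let $B$ be the maximum of all $|c|,|d'|$ where $c/d'=\alpha_j-\alpha_i$ in lowest terms, $i\neq j$ (if $r=1$, drop the terms with $B$ below). *The tree.* $T=T(f_+,l_f)$ is the finite rooted tree whose vertices are the root $\{0\}$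 (level $0$) and the residue classes $\alpha_i \bmod p^m$ (level $m$), $1\le m\le l_f+1$, $v_p(\alpha_i)\ge0$; write $u\ge w$ if the class $w$ is the reduction of the class $u$. For a vertex $u$ of level $l(u)$ let $W(u)=\sum_{\alpha_i\equiv u \bmod p^{l(u)}}e_i$, the sum over the roots of $f_+$, if $l(u)\ge1$, and $W(u)=0$ if $l(u)=0$; let $Val(u)$ be the number of vertices $w\ge u$ of $T$ of level $l(u)+1$; let $W^*(B_u)=\sum_{w\in T,\,w\le u}W(w)$. Put $G(s,T,p)=\sum_{u\in T}L_u(p^{-s})$, where $$L_u(p^{-s})=\begin{cases}\dfrac{(1-p^{-1})\,p^{-l(u)-W^*(B_u)s}}{1-p^{-1-W(u)s}} & l(u)=1+l_f,\ W(u)\ge2,\\[2mm] p^{-1}(p-Val(u))\,p^{-l(u)-W^*(B_u)s} & l(u)\le l_f,\ W(u)\ne1,\\[1mm] \dfrac{(1-p^{-1})\,p^{-l(u)-W^*(B_u)s}}{1-p^{-1-s}} & W(u)=1,\ W(w)\neq1\text{ for all }w<u\text{ in }T,\\[1mm] 0&\text{otherwise.}\end{cases}$$ *The algorithm* $\mathrm{Compute\_}Z(s,f)$,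 on input $p$ and the coefficients of $f$, (1) factors $f$ over $\mathbb{Q}$ and computes $v$; (2) computes $l_f$; (3) computes the $p$-adic expansions modulo $p^{l_f+1}$ of the roots of $f_+$; (4) computes the tree $T$ with the numbers $W(u)$, $Val(u)$, $W^*(B_u)$; (5) computes the summands $L_u$ of $G(s,T,p)$; (6) returns $p^{-vs}\,G(s,T,p)$, given by $v$ and the list of the summands $L_u$. **Theorem.** The rational function $p^{-vs}G(s,T,p)$ of $p^{-s}$ returned by the algorithm is the meromorphic continuation of $Z(s,f)$ to $\mathbb{C}$. The algorithm can be carried out, by one program for all $p$ and $f$ on a random access machine over the integers, with $$O\bigl(d^6+d^9\log\|f\|+l_f^2d^3+d^2\log\max\{B,p\}\bigr)$$ operations (arithmetic operations, comparisons, memory accesses and output), and the integers on which these operations are performed have binary length $$O\bigl(\max\{\log p,\ \log (l_fd),\ \log B,\ d^3+d^2\log\|f\|\}\bigr).$$ The implied constants are absolute. -/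

import Mathlib

open Polynomial MeasureTheory

noncomputable section

namespace IgusaZeta

/-! ### Igusa's local zeta function -/

instance padicIntMeasurableSpace (p : ℕ) [Fact p.Prime] : MeasurableSpace ℤ_[p] := borel _

instance padicIntBorelSpace (p : ℕ) [Fact p.Prime] : BorelSpace ℤ_[p] := ⟨rfl⟩

/-- The Haar measure on `ℤ_[p]` of total mass one. -/
def haar (p : ℕ) [Fact p.Prime] : Measure ℤ_[p] := Measure.addHaarMeasure ⊤

/-- The integrand `|f(x)|_p ^ s`. -/
def integrand (p : ℕ) [Fact p.Prime] (f : ℤ[X]) (s : ℂ) (x : ℤ_[p]) : ℂ :=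
  ((‖aeval x f‖ : ℝ) : ℂ) ^ s

/-- `Z(s, f) = ∫ |f(x)|_p ^ s dx` over the `p`-adic integers (meant for `0 < re s`). -/
def localZeta (p : ℕ) [Fact p.Prime] (f : ℤ[X]) (s : ℂ) : ℂ :=
  ∫ x : ℤ_[p], integrand p f s x ∂(haar p)

/-- `s ↦ R(p ^ (-s))` is the meromorphic continuation of `Z(s, f)` to the complex plane:
it is meromorphic, and for `0 < re s` the integral converges, `p ^ (-s)` is not a pole of `R`,
and `R(p ^ (-s))` is the integral. -/
structure IsMeromorphicContinuation (p : ℕ) [Fact p.Prime] (f : ℤ[X]) (R : RatFunc ℚ) :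
    Prop where
  meromorphic : MeromorphicOn
    (fun s : ℂ => RatFunc.eval (algebraMap ℚ ℂ) ((p : ℂ) ^ (-s)) R) Set.univ
  integrable : ∀ s : ℂ, 0 < s.re → Integrable (integrand p f s) (haar p)
  no_pole : ∀ s : ℂ, 0 < s.re → R.denom.eval₂ (algebraMap ℚ ℂ) ((p : ℂ) ^ (-s)) ≠ 0
  eq_integral : ∀ s : ℂ, 0 < s.re →
    localZeta p f s = RatFunc.eval (algebraMap ℚ ℂ) ((p : ℂ) ^ (-s)) R

/-! ### Roots, and the reduction to polynomials whose roots are `p`-adic integers -/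

/-- `f`, viewed in `ℚ[X]`. -/
def toRat (f : ℤ[X]) : ℚ[X] := f.map (Int.castRingHom ℚ)

/-- The set of the distinct (rational) roots `α_i`; the multiplicity `e_i` is
`rootMultiplicity`. -/
def rootSet (g : ℚ[X]) : Finset ℚ := g.roots.toFinset

/-- `f_+`: the product of the `(x - α_i) ^ e_i` with `0 ≤ v_p(α_i)`. -/
def plusPart (p : ℕ) (g : ℚ[X]) : ℚ[X] :=
  ∏ α ∈ (rootSet g).filter (fun α => 0 ≤ padicValRat p α), (X - C α) ^ g.rootMultiplicity α

/-- The `p`-adic order of the constant `α_0 * ∏ α_i ^ e_i`, the product being over the roots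
with `v_p(α_i) < 0`. With `v` this order, `|f(x)|_p = p ^ (-v) * |f_+(x)|_p` on the `p`-adic
integers. -/
def shift (p : ℕ) (g : ℚ[X]) : ℤ :=
  padicValRat p (g.leadingCoeff *
    ∏ α ∈ (rootSet g).filter (fun α => padicValRat p α < 0), α ^ g.rootMultiplicity α)

/-- `l_g = 1 + max v_p(α_i - α_j)` over pairs of distinct roots, and `l_g = 1` if there is no
such pair, for `g` all of whose roots satisfy `0 ≤ v_p(α_i)`. -/
def depth (p : ℕ) (g : ℚ[X]) : ℕ :=
  1 + (rootSet g).offDiag.sup (fun a => (padicValRat p (a.1 - a.2)).toNat)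

/-- `B`: the maximum of `|c|` and `|d|`, for the differences `α_j - α_i = c / d` (in lowest
terms) of distinct roots. -/
def differenceHeight (g : ℚ[X]) : ℕ :=
  (rootSet g).offDiag.sup (fun a => max (a.1 - a.2).num.natAbs (a.1 - a.2).den)

/-- `‖f‖ = √(∑ a_i ^ 2)`. -/
def euclNorm (f : ℤ[X]) : ℝ := √(∑ i ∈ f.support, ((f.coeff i : ℤ) : ℝ) ^ 2)

/-! ### The tree of residue classes and the weighted tree of a polynomial -/

/-- The vertices of the tree of residue classes: a vertex of level `m` is an element of
`ℤ / p ^ m`. -/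
abbrev Vertex (p : ℕ) : Type := Σ m : ℕ, ZMod (p ^ m)

/-- The residue class modulo `p ^ m` of a rational number `α` with `0 ≤ v_p(α)`. -/
def residue (p m : ℕ) (α : ℚ) : ZMod (p ^ m) := (α.num : ZMod (p ^ m)) * (α.den : ZMod (p ^ m))⁻¹

/-- The `m` digits `a_0, …, a_{m-1}` of the `p`-adic expansion of `α` modulo `p ^ m`. -/
def digits (p m : ℕ) (α : ℚ) : List ℕ :=
  (List.range m).map (fun j => (residue p m α).val / p ^ j % p)

/-- `u ≥ v`: the vertex `v` lies on the path from `u` to the root `{0}`, that is, the class `v`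
is the reduction of the class `u`. -/
def Vertex.Ge {p : ℕ} (u v : Vertex p) : Prop :=
  ∃ h : v.1 ≤ u.1, ZMod.castHom (pow_dvd_pow p h) (ZMod (p ^ v.1)) u.2 = v.2

/-- `T(g, l)`: the union of the stalks of the `p`-adic expansions modulo `p ^ (l + 1)` of the
roots of `g`; it always contains the root `{0}`. -/
def tree (p : ℕ) (g : ℚ[X]) (l : ℕ) : Finset (Vertex p) :=
  insert ⟨0, 0⟩
    ((Finset.range (l + 2) ×ˢ rootSet g).image (fun a => ⟨a.1, residue p a.1 a.2⟩))

open Classical in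
/-- `W(u)`. -/
def weight (p : ℕ) (g : ℚ[X]) (u : Vertex p) : ℕ :=
  if u.1 = 0 then 0
  else ∑ α ∈ (rootSet g).filter (fun α => residue p u.1 α = u.2), g.rootMultiplicity α

open Classical in
/-- `Val(u)`: the number of edges of `T(g, l)` whose end point is `u`. -/
def valence (p : ℕ) (g : ℚ[X]) (l : ℕ) (u : Vertex p) : ℕ :=
  ((tree p g l).filter (fun v => v.1 = u.1 + 1 ∧ v.Ge u)).card

open Classical in
/-- `W*(B_u)`: the sum of the weights of the vertices `v ≤ u` of `T(g, l)`. -/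
def stalkWeight (p : ℕ) (g : ℚ[X]) (l : ℕ) (u : Vertex p) : ℕ :=
  ∑ v ∈ (tree p g l).filter (fun v => u.Ge v), weight p g v

/-- The set `M_T`: `u ∈ T` of weight one with no `v ∈ T` of weight one such that `u > v`. -/
def IsFirstSimple (p : ℕ) (g : ℚ[X]) (l : ℕ) (u : Vertex p) : Prop :=
  u ∈ tree p g l ∧ weight p g u = 1 ∧
    ¬ ∃ v ∈ tree p g l, weight p g v = 1 ∧ u.Ge v ∧ u ≠ v

/-! ### The generating function, in the variable `X = p ^ (-s)` -/

open Classical in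
/-- `L_u`, as a rational function of `X = p ^ (-s)`. -/
def vertexFunction (p : ℕ) (g : ℚ[X]) (l : ℕ) (u : Vertex p) : RatFunc ℚ :=
  if u.1 = 1 + l ∧ 2 ≤ weight p g u then
    RatFunc.C ((1 - (p : ℚ)⁻¹) * ((p : ℚ) ^ u.1)⁻¹) * RatFunc.X ^ stalkWeight p g l u /
      (1 - RatFunc.C (p : ℚ)⁻¹ * RatFunc.X ^ weight p g u)
  else if u.1 ≤ l ∧ weight p g u ≠ 1 then
    RatFunc.C ((p : ℚ)⁻¹ * ((p : ℚ) - valence p g l u) * ((p : ℚ) ^ u.1)⁻¹) *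
      RatFunc.X ^ stalkWeight p g l u
  else if IsFirstSimple p g l u then
    RatFunc.C ((1 - (p : ℚ)⁻¹) * ((p : ℚ) ^ u.1)⁻¹) * RatFunc.X ^ stalkWeight p g l u /
      (1 - RatFunc.C (p : ℚ)⁻¹ * RatFunc.X)
  else 0

/-- `G(s, T(g, l), p) = ∑ L_u`. -/
def generatingFunction (p : ℕ) (g : ℚ[X]) (l : ℕ) : RatFunc ℚ :=
  ∑ u ∈ tree p g l, vertexFunction p g l u

/-- The rational function returned by the algorithm: `p ^ (-v s) * G(s, T(f_+, l), p)`, where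
`v = shift p f` and `l = l_{f_+}`. -/
def computedZeta (p : ℕ) (f : ℤ[X]) : RatFunc ℚ :=
  RatFunc.X ^ shift p (toRat f) *
    generatingFunction p (plusPart p (toRat f)) (depth p (plusPart p (toRat f)))

/-! ### Random access programs over the integers, with operation count and word length -/

/-- The arithmetic operations: addition, subtraction, multiplication, quotient and remainder of
the division with remainder. -/
inductive Op
  | add | sub | mul | quo | rem

def Op.eval : Op → ℤ → ℤ → ℤ
  | .add, a, b => a + b
  | .sub, a, b => a - b
  | .mul, a, b => a * b
  | .quo, a, b => a / b
  | .rem, a, b => a % b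

/-- The comparisons. -/
inductive Test
  | lt | le | eq

def Test.Holds : Test → ℤ → ℤ → Prop
  | .lt, a, b => a < b
  | .le, a, b => a ≤ b
  | .eq, a, b => a = b

/-- Programs over integer registers `0, 1, 2, …` and integer arrays `0, 1, 2, …`.
The numbers of the registers and arrays used are written in the program; only array entries
are addressed indirectly. -/
inductive Program
  | skip
  /-- register `i` becomes the integer `c` -/
  | const (i : ℕ) (c : ℤ)
  /-- register `i` becomes `o` applied to the registers `j` and `k` -/
  | arith (i : ℕ) (o : Op) (j k : ℕ)
  /-- register `i` becomes the entry of array `a` whose index is in register `j` -/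
  | load (i a j : ℕ)
  /-- the entry of array `a` whose index is in register `j` becomes register `k` -/
  | store (a j k : ℕ)
  /-- register `i` is appended to the output -/
  | emit (i : ℕ)
  | seq (P Q : Program)
  /-- run `P` if the test holds for the registers `j` and `k`, otherwise `Q` -/
  | ite (r : Test) (j k : ℕ) (P Q : Program)
  /-- run `P` as long as the test holds for the registers `j` and `k` -/
  | loop (r : Test) (j k : ℕ) (P : Program)

/-- A state of the machine: registers, arrays, output written so far. -/
structure State where
  reg : ℕ → ℤ
  arr : ℕ → ℤ → ℤ
  out : List ℤ

def State.setReg (σ : State) (i : ℕ) (z : ℤ) : State :=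
  { σ with reg := Function.update σ.reg i z }

def State.setArr (σ : State) (a : ℕ) (j z : ℤ) : State :=
  { σ with arr := Function.update σ.arr a (Function.update (σ.arr a) j z) }

/-- `z` has binary length at most `β`. -/
def Fits (β : ℕ) (z : ℤ) : Prop := z.natAbs.size ≤ β

/-- `Runs β P σ τ n`: started in the state `σ`, the program `P` halts in the state `τ` after
exactly `n` operations (arithmetic operations, comparisons, transfers to and from arrays,
loading of constants, and output all count), and all integers on which these operations are
performed, array indices and results included, have binary length at most `β`. -/
inductive Runs (β : ℕ) : Program → State → State → ℕ → Prop
  | skip (σ : State) : Runs β .skip σ σ 0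
  | const (σ : State) (i : ℕ) (c : ℤ) (hc : Fits β c) :
      Runs β (.const i c) σ (σ.setReg i c) 1
  | arith (σ : State) (i : ℕ) (o : Op) (j k : ℕ)
      (hj : Fits β (σ.reg j)) (hk : Fits β (σ.reg k))
      (hr : Fits β (o.eval (σ.reg j) (σ.reg k)))
      (hdiv : o = .quo ∨ o = .rem → σ.reg k ≠ 0) :
      Runs β (.arith i o j k) σ (σ.setReg i (o.eval (σ.reg j) (σ.reg k))) 1
  | load (σ : State) (i a j : ℕ) (hj : Fits β (σ.reg j)) (hr : Fits β (σ.arr a (σ.reg j))) :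
      Runs β (.load i a j) σ (σ.setReg i (σ.arr a (σ.reg j))) 1
  | store (σ : State) (a j k : ℕ) (hj : Fits β (σ.reg j)) (hk : Fits β (σ.reg k)) :
      Runs β (.store a j k) σ (σ.setArr a (σ.reg j) (σ.reg k)) 1
  | emit (σ : State) (i : ℕ) (hi : Fits β (σ.reg i)) :
      Runs β (.emit i) σ { σ with out := σ.out ++ [σ.reg i] } 1
  | seq {P Q : Program} {σ τ υ : State} {m n : ℕ}
      (hP : Runs β P σ τ m) (hQ : Runs β Q τ υ n) : Runs β (.seq P Q) σ υ (m + n)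
  | ite_true {r : Test} {j k : ℕ} {P Q : Program} {σ τ : State} {n : ℕ}
      (hj : Fits β (σ.reg j)) (hk : Fits β (σ.reg k)) (hr : r.Holds (σ.reg j) (σ.reg k))
      (hP : Runs β P σ τ n) : Runs β (.ite r j k P Q) σ τ (n + 1)
  | ite_false {r : Test} {j k : ℕ} {P Q : Program} {σ τ : State} {n : ℕ}
      (hj : Fits β (σ.reg j)) (hk : Fits β (σ.reg k)) (hr : ¬ r.Holds (σ.reg j) (σ.reg k))
      (hQ : Runs β Q σ τ n) : Runs β (.ite r j k P Q) σ τ (n + 1)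
  | loop_done {r : Test} {j k : ℕ} {P : Program} {σ : State}
      (hj : Fits β (σ.reg j)) (hk : Fits β (σ.reg k)) (hr : ¬ r.Holds (σ.reg j) (σ.reg k)) :
      Runs β (.loop r j k P) σ σ 1
  | loop_step {r : Test} {j k : ℕ} {P : Program} {σ τ υ : State} {m n : ℕ}
      (hj : Fits β (σ.reg j)) (hk : Fits β (σ.reg k)) (hr : r.Holds (σ.reg j) (σ.reg k))
      (hP : Runs β P σ τ m) (hloop : Runs β (.loop r j k P) τ υ n) :
      Runs β (.loop r j k P) σ υ (m + n + 1)

/-- The initial state: `p` in register `0`, the degree `d` of `f` in register `1`, the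
coefficients of `f` in the entries `0, …, d` of array `0`, everything else zero, no output. -/
def inputState (p : ℕ) (f : ℤ[X]) : State where
  reg := fun i => if i = 0 then (p : ℤ) else if i = 1 then (f.natDegree : ℤ) else 0
  arr := fun a j => if a = 0 ∧ 0 ≤ j then f.coeff j.toNat else 0
  out := []

/-! ### What the steps of the algorithm write -/

/-- A summand of the generating function as it is written by the algorithm: four integers
`c, k, a, b`, standing for `c * p ^ (-k) * X ^ a / (1 - p ^ (-1) * X ^ b)` with `X = p ^ (-s)`,
where `b = 0` means that there is no denominator. -/
structure Term where
  c : ℤ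
  k : ℕ
  a : ℕ
  b : ℕ

def Term.toRatFunc (p : ℕ) (L : Term) : RatFunc ℚ :=
  RatFunc.C ((L.c : ℚ) * ((p : ℚ) ^ L.k)⁻¹) * RatFunc.X ^ L.a /
    (if L.b = 0 then 1 else 1 - RatFunc.C (p : ℚ)⁻¹ * RatFunc.X ^ L.b)

/-- The list `F` of pairs `(α_i, e_i)` is the factorization
`g = α_0 * ∏ (x - α_i) ^ e_i` with distinct `α_i` and positive `e_i`. -/
structure IsFactorization (g : ℚ[X]) (F : List (ℚ × ℕ)) : Prop where
  distinct : (F.map Prod.fst).Nodup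
  pos : ∀ x ∈ F, 0 < x.2
  eq_prod : g = C g.leadingCoeff * (F.map (fun x => (X - C x.1) ^ x.2)).prod

/-- The factorization: `α_0`, the number `r` of distinct roots, and for each of them its
numerator, its denominator and its multiplicity. -/
def writeFactorization (f : ℤ[X]) (F : List (ℚ × ℕ)) : List ℤ :=
  f.leadingCoeff :: (F.length : ℤ) ::
    F.flatMap (fun x => [x.1.num, (x.1.den : ℤ), (x.2 : ℤ)])

/-- The `p`-adic expansions modulo `p ^ (l + 1)` of those `α_i` that are `p`-adic integers. -/
def writeDigits (p l : ℕ) (F : List (ℚ × ℕ)) : List ℤ :=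
  (F.filter (fun x => decide (0 ≤ padicValRat p x.1))).flatMap
    (fun x => (digits p (l + 1) x.1).map (fun a => (a : ℤ)))

/-- The weighted tree: the number of vertices, and for each vertex `u` its level, the
representative in `{0, …, p ^ level - 1}` of its residue class, `W(u)`, `Val(u)` and
`W*(B_u)`. -/
def writeTree (p : ℕ) (g : ℚ[X]) (l : ℕ) (V : List (Vertex p)) : List ℤ :=
  (V.length : ℤ) :: V.flatMap (fun u => [(u.1 : ℤ), (u.2.val : ℤ), (weight p g u : ℤ),
    (valence p g l u : ℤ), (stalkWeight p g l u : ℤ)])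

/-- The generating function: its summands. -/
def writeTerms (L : List Term) : List ℤ :=
  L.flatMap (fun t => [t.c, (t.k : ℤ), (t.a : ℤ), (t.b : ℤ)])

/-- `w` is an output of the algorithm on `(f, p)`: it consists, in this order, of
a factorization of `f` over `ℚ`; the order `v` of the constant by which `|f|_p` and `|f_+|_p`
differ; the integer `l = l_{f_+}`; the `p`-adic expansions modulo `p ^ (l + 1)` of the roots of
`f_+`; the weighted tree `T(f_+, l)`, its vertices being listed in some order; and the summands
`L_u` of `G(s, T(f_+, l), p)` in the same order. -/
def IsComputeZetaOutput (p : ℕ) (f : ℤ[X]) (w : List ℤ) : Prop :=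
  let g := plusPart p (toRat f)
  let l := depth p g
  ∃ (F : List (ℚ × ℕ)) (V : List (Vertex p)) (L : List Term),
    IsFactorization (toRat f) F ∧
    (V.Nodup ∧ ∀ u, u ∈ V ↔ u ∈ tree p g l) ∧
    List.Forall₂ (fun u t => t.toRatFunc p = vertexFunction p g l u) V L ∧
    w = writeFactorization f F ++ [shift p (toRat f), (l : ℤ)] ++ writeDigits p l F ++
      writeTree p g l V ++ writeTerms L

end IgusaZeta

end

/-! The theorem has two independent halves: a formula for the integral, and a program together with
the analysis of its cost.

The integral. For a root `α` with `|α|_p > 1` one has `|x - α|_p = |α|_p` on the `p`-adic integers,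
so `|f|_p` is `p ^ (-v) * |f_+|_p` there (`norm_aeval`). For an integral root `α ≠ x`, the order of
`x - α` is the number of levels `≥ 1` at which `x` and `α` lie in the same residue class. Summed
over the roots with multiplicity, this makes the order of `f_+(x)` a sum of weights along the path
of classes of `x` (`sum_weight_cls`). Descending along that path, exactly one of three things
happens at exactly one level (`existsUnique_level`): a first vertex of weight one is met, the path
leaves the tree from a vertex of weight other than one, or level `l + 1` is reached with weight at
least two. This partitions the `p`-adic integers into pieces indexed by the vertices. On a piece of
the second kind the integrand is constant and the measure is `p⁻¹ (p - Val(u)) p ^ (-l(u))`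
(`setIntegral_off_tree`). In the other two cases the piece is a ball containing a single root,
because the roots are distinct modulo `p ^ l`, and the integral is a geometric series
(`setIntegral_ball`, `setIntegral_ball_of_weight`). Thus the integral over the piece of `u` is
`L_u`, and `integral_rootCpow` adds them up. A rational function of `p ^ (-s)` is meromorphic in
`s`, which gives the continuation.

The program. If `a` is the leading coefficient and `S = ‖f‖ ^ 2`, the numbers `a * α` are integers
of absolute value at most `2 * S`, and they are the roots of a monic integral polynomial
(`exists_integer_roots`). Since all roots are rational, factoring is root finding: Newton's
iteration with integral rounding, started at `2 * S`, moves to the left, never passes a root, and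
covers at least a `d`-th part of the distance to the nearest root in each step. A logarithmic
potential therefore drops by one in every round, Newton step or deflation alike (`newton_step`,
`newton_spec`), so that `O(d ^ 2 log S)` rounds of `O(d)` operations suffice. The rest consists of
Euclid's algorithm (lowest terms, inverses modulo `p ^ (l + 1)`), valuations by repeated division,
and loops over the residues of the roots. As `p ^ (l + 1) ≤ 4 * S * p ^ 2` (`pow_depth_le`), all
numbers are at most `wordBound`, whose logarithm is `O(d + d log ‖f‖ + log p)`.

The program is written in a small structured language compiled to the machine. The triples `Tri`
express termination, an operation count, a bound on all numbers and a postcondition at once. What a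
program leaves alone is read off its text (`Runs.frame`), so that preservation of variables is
mostly proved by `rfl`. -/

namespace IgusaZeta

/-! ### A small structured language on top of the random access programs

The registers with even numbers hold the variables (variable `i` is register `2 * i`), those with
odd numbers are scratch space for the evaluation of expressions. -/

/-- `z` is at most `M` in absolute value. -/
def Within (M : ℕ) (z : ℤ) : Prop := -(M : ℤ) ≤ z ∧ z ≤ M

theorem Within.of_nonneg {M : ℕ} {z : ℤ} (h₀ : 0 ≤ z) (h : z ≤ M) : Within M z :=
  ⟨by omega, h⟩

theorem Within.of_abs {M : ℕ} {z : ℤ} (h : |z| ≤ M) : Within M z := abs_le.1 h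

theorem Within.natCast {M n : ℕ} (h : n ≤ M) : Within M n := ⟨by omega, by exact_mod_cast h⟩

@[simp] theorem within_zero (M : ℕ) : Within M 0 := ⟨by simp, by simp⟩

@[simp] theorem within_one_iff {M : ℕ} : Within M 1 ↔ 1 ≤ M := by simp only [Within]; omega

/-- Expressions in the variables and the array entries. -/
inductive Ex
  | lit (c : ℤ)
  | var (i : ℕ)
  | bin (o : Op) (a b : Ex)
  | get (a : ℕ) (e : Ex)

namespace Ex

instance : Add Ex := ⟨bin .add⟩
instance : Sub Ex := ⟨bin .sub⟩
instance : Mul Ex := ⟨bin .mul⟩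
instance : Div Ex := ⟨bin .quo⟩
instance : Mod Ex := ⟨bin .rem⟩

/-- The value of an expression. -/
def eval : Ex → State → ℤ
  | lit c, _ => c
  | var i, s => s.reg i
  | bin o a b, s => o.eval (a.eval s) (b.eval s)
  | get a e, s => s.arr a (e.eval s)

/-- No value computed in the evaluation of the expression exceeds `M`, and no division is by
zero. -/
def Ok (M : ℕ) : Ex → State → Prop
  | lit c, _ => Within M c
  | var _, _ => True
  | bin o a b, s => a.Ok M s ∧ b.Ok M s ∧ Within M (o.eval (a.eval s) (b.eval s)) ∧
      (o = .quo ∨ o = .rem → b.eval s ≠ 0)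
  | get _ e, s => e.Ok M s

/-- The number of operations in the evaluation of the expression. -/
def cost : Ex → ℕ
  | lit _ => 1
  | var _ => 2
  | bin _ a b => a.cost + b.cost + 1
  | get _ e => e.cost + 1

/-- The program that writes the value of the expression to the scratch register `t`, not using
the scratch registers before `t`. -/
def compile : Ex → ℕ → Program
  | lit c, t => .const (2 * t + 1) c
  -- The machine has no move instruction: a register is copied by adding it to zero, hence the cost
  -- two of a variable.
  | var i, t => .seq (.const (2 * t + 1) 0) (.arith (2 * t + 1) .add (2 * t + 1) (2 * i))
  | bin o a b, t => .seq (a.compile t)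
      (.seq (b.compile (t + 1)) (.arith (2 * t + 1) o (2 * t + 1) (2 * (t + 1) + 1)))
  | get a e, t => .seq (e.compile t) (.load (2 * t + 1) a (2 * t + 1))

section simp_lemmas
variable (M : ℕ) (a b : Ex) (s : State)

@[simp] theorem eval_lit (c : ℤ) : (lit c).eval s = c := rfl
@[simp] theorem eval_var (i : ℕ) : (var i).eval s = s.reg i := rfl
@[simp] theorem eval_get (i : ℕ) : (get i a).eval s = s.arr i (a.eval s) := rfl
@[simp] theorem eval_add : (a + b).eval s = a.eval s + b.eval s := rfl
@[simp] theorem eval_sub : (a - b).eval s = a.eval s - b.eval s := rfl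
@[simp] theorem eval_mul : (a * b).eval s = a.eval s * b.eval s := rfl
@[simp] theorem eval_div : (a / b).eval s = a.eval s / b.eval s := rfl
@[simp] theorem eval_mod : (a % b).eval s = a.eval s % b.eval s := rfl
@[simp] theorem ok_lit (c : ℤ) : (lit c).Ok M s ↔ Within M c := Iff.rfl
@[simp] theorem ok_var (i : ℕ) : (var i).Ok M s ↔ True := Iff.rfl
@[simp] theorem ok_get (i : ℕ) : (get i a).Ok M s ↔ a.Ok M s := Iff.rfl
@[simp] theorem ok_add : (a + b).Ok M s ↔ a.Ok M s ∧ b.Ok M s ∧ Within M (a.eval s + b.eval s) := by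
  change _ ∧ _ ∧ _ ∧ _ ↔ _; simp [Op.eval]
@[simp] theorem ok_sub : (a - b).Ok M s ↔ a.Ok M s ∧ b.Ok M s ∧ Within M (a.eval s - b.eval s) := by
  change _ ∧ _ ∧ _ ∧ _ ↔ _; simp [Op.eval]
@[simp] theorem ok_mul : (a * b).Ok M s ↔ a.Ok M s ∧ b.Ok M s ∧ Within M (a.eval s * b.eval s) := by
  change _ ∧ _ ∧ _ ∧ _ ↔ _; simp [Op.eval]
@[simp] theorem ok_div : (a / b).Ok M s ↔
    a.Ok M s ∧ b.Ok M s ∧ Within M (a.eval s / b.eval s) ∧ b.eval s ≠ 0 := by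
  change _ ∧ _ ∧ _ ∧ _ ↔ _; simp [Op.eval]
@[simp] theorem ok_mod : (a % b).Ok M s ↔
    a.Ok M s ∧ b.Ok M s ∧ Within M (a.eval s % b.eval s) ∧ b.eval s ≠ 0 := by
  change _ ∧ _ ∧ _ ∧ _ ↔ _; simp [Op.eval]
@[simp] theorem cost_lit (c : ℤ) : (lit c).cost = 1 := rfl
@[simp] theorem cost_var (i : ℕ) : (var i).cost = 2 := rfl
@[simp] theorem cost_get (i : ℕ) : (get i a).cost = a.cost + 1 := rfl
@[simp] theorem cost_add : (a + b).cost = a.cost + b.cost + 1 := rfl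
@[simp] theorem cost_sub : (a - b).cost = a.cost + b.cost + 1 := rfl
@[simp] theorem cost_mul : (a * b).cost = a.cost + b.cost + 1 := rfl
@[simp] theorem cost_div : (a / b).cost = a.cost + b.cost + 1 := rfl
@[simp] theorem cost_mod : (a % b).cost = a.cost + b.cost + 1 := rfl

end simp_lemmas

end Ex

/-! ### States, their variables, and bounds for their entries. -/

namespace State

/-- All registers and array entries are at most `M` in absolute value. -/
structure Bounded (M : ℕ) (σ : State) : Prop where
  reg : ∀ i, Within M (σ.reg i)
  arr : ∀ a j, Within M (σ.arr a j)

/-- The variables, arrays and output of a state. -/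
def vars (σ : State) : State where
  reg := fun i => σ.reg (2 * i)
  arr := σ.arr
  out := σ.out

/-- Append a number to the output. -/
def emit (s : State) (v : ℤ) : State := { s with out := s.out ++ [v] }

section simp_lemmas
variable (s : State) (x y a b : ℕ) (v j k : ℤ)

@[simp] theorem emit_reg : (s.emit v).reg = s.reg := rfl
@[simp] theorem emit_arr : (s.emit v).arr = s.arr := rfl
@[simp] theorem emit_out : (s.emit v).out = s.out ++ [v] := rfl

@[simp] theorem setReg_reg : (s.setReg x v).reg y = if y = x then v else s.reg y := by
  simp [setReg, Function.update_apply]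
@[simp] theorem setReg_arr : (s.setReg x v).arr = s.arr := rfl
@[simp] theorem setReg_out : (s.setReg x v).out = s.out := rfl
@[simp] theorem setArr_reg : (s.setArr a j v).reg = s.reg := rfl
@[simp] theorem setArr_out : (s.setArr a j v).out = s.out := rfl
theorem setArr_arr : (s.setArr a j v).arr b =
    if b = a then Function.update (s.arr a) j v else s.arr b := by
  simp only [setArr, Function.update_apply]
@[simp] theorem setArr_arr_self :
    (s.setArr a j v).arr a = Function.update (s.arr a) j v := by
  simp [setArr]

end simp_lemmas

theorem vars_setReg_even (σ : State) (i : ℕ) (v : ℤ) :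
    (σ.setReg (2 * i) v).vars = σ.vars.setReg i v := by
  simp only [vars, setReg, State.mk.injEq, and_true]
  funext k
  by_cases h : k = i <;> simp [h]

theorem vars_setReg_odd (σ : State) (i : ℕ) (v : ℤ) :
    (σ.setReg (2 * i + 1) v).vars = σ.vars := by
  simp only [vars, setReg, State.mk.injEq, and_true]
  funext k
  rw [Function.update_apply, if_neg (by omega)]

theorem Bounded.setReg {M : ℕ} {σ : State} (h : σ.Bounded M) {v : ℤ} (hv : Within M v) (i : ℕ) :
    (σ.setReg i v).Bounded M :=
  ⟨fun k => by rw [setReg_reg]; split_ifs <;> [exact hv; exact h.reg k], h.arr⟩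

theorem Bounded.setArr {M : ℕ} {σ : State} (h : σ.Bounded M) {v : ℤ} (hv : Within M v) (a : ℕ)
    (j : ℤ) : (σ.setArr a j v).Bounded M :=
  ⟨h.reg, fun b k => by
    rw [setArr_arr]
    split_ifs
    · rw [Function.update_apply]
      split_ifs <;> [exact hv; exact h.arr _ k]
    · exact h.arr b k⟩

end State

/-- Binary length is monotone, so all statements about word length are reduced to one bound `M` on
absolute values, with `M.size` as the word length. -/
theorem fits_size {M : ℕ} {z : ℤ} (h : Within M z) : Fits M.size z :=
  Nat.size_le_size (by obtain ⟨h₁, h₂⟩ := h; omega)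

/-- Induction on the expression. The last clause, that earlier scratch registers survive, is what
allows the right operand of an operation to be evaluated in the scratch register `t + 1` while the
left one waits in `t`. -/
theorem Ex.compile_runs {M : ℕ} (e : Ex) : ∀ (t : ℕ) (σ : State), σ.Bounded M → e.Ok M σ.vars →
    ∃ τ : State, Runs M.size (e.compile t) σ τ e.cost ∧ τ.Bounded M ∧ τ.vars = σ.vars ∧
      τ.reg (2 * t + 1) = e.eval σ.vars ∧
      ∀ t' < t, τ.reg (2 * t' + 1) = σ.reg (2 * t' + 1) := by
  have keep : ∀ (σ : State) (v : ℤ) (t t' : ℕ), t' < t →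
      (σ.setReg (2 * t + 1) v).reg (2 * t' + 1) = σ.reg (2 * t' + 1) := fun σ v t t' h => by
    rw [State.setReg_reg, if_neg (by omega)]
  induction e with
  | lit c =>
    intro t σ hσ h
    exact ⟨_, .const _ _ _ (fits_size h), hσ.setReg h _, σ.vars_setReg_odd _ _, by simp,
      keep _ _ _⟩
  | var i =>
    intro t σ hσ _
    have h0 : Within M 0 := by simp
    have hv : Op.add.eval ((σ.setReg (2 * t + 1) 0).reg (2 * t + 1))
        ((σ.setReg (2 * t + 1) 0).reg (2 * i)) = σ.reg (2 * i) := by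
      simp [Op.eval, State.setReg_reg, show 2 * i ≠ 2 * t + 1 by omega]
    refine ⟨_, .seq (.const _ _ _ (fits_size h0)) (.arith _ _ .add _ _
      (fits_size ((hσ.setReg h0 _).reg _)) (fits_size ((hσ.setReg h0 _).reg _))
      (hv.symm ▸ fits_size (hσ.reg _)) (by simp)), ?_, ?_, ?_, ?_⟩
    · exact (hσ.setReg h0 _).setReg (hv.symm ▸ hσ.reg _) _
    · rw [State.vars_setReg_odd, State.vars_setReg_odd]
    · rw [hv]; simp [State.vars]
    · intro t' h
      rw [keep _ _ _ _ h, keep _ _ _ _ h]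
  | bin o a b iha ihb =>
    intro t σ hσ ⟨ha, hb, hr, hdiv⟩
    obtain ⟨σ₁, r₁, b₁, v₁, e₁, k₁⟩ := iha t σ hσ ha
    obtain ⟨σ₂, r₂, b₂, v₂, e₂, k₂⟩ := ihb (t + 1) σ₁ b₁ (v₁ ▸ hb)
    rw [v₁] at e₂
    have e₁' : σ₂.reg (2 * t + 1) = a.eval σ.vars := by rw [k₂ t (by omega), e₁]
    refine ⟨σ₂.setReg (2 * t + 1) (o.eval (σ₂.reg (2 * t + 1)) (σ₂.reg (2 * (t + 1) + 1))), ?_,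
      b₂.setReg ?_ _, ?_, ?_, ?_⟩
    · have := Runs.seq r₁ (Runs.seq r₂ (Runs.arith σ₂ (2 * t + 1) o (2 * t + 1) (2 * (t + 1) + 1)
        (fits_size (b₂.reg _)) (fits_size (b₂.reg _)) ?_ ?_))
      · exact this
      · rw [e₁', e₂]; exact fits_size hr
      · rw [e₂]; exact hdiv
    · rw [e₁', e₂]; exact hr
    · rw [State.vars_setReg_odd, v₂, v₁]
    · simp [e₁', e₂, eval]
    · intro t' h
      rw [keep _ _ _ _ h, k₂ t' (by omega), k₁ t' h]
  | get a e ih =>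
    intro t σ hσ he
    obtain ⟨σ₁, r₁, b₁, v₁, e₁, k₁⟩ := ih t σ hσ he
    have ha : σ₁.arr = σ.arr := (congrArg State.arr v₁ :)
    refine ⟨_, .seq r₁ (.load _ _ _ _ (fits_size (b₁.reg _)) (fits_size (b₁.arr _ _))),
      b₁.setReg (b₁.arr _ _) _, ?_, ?_, ?_⟩
    · rw [State.vars_setReg_odd, v₁]
    · simp [e₁, eval, ha, State.vars]
    · intro t' h
      rw [keep _ _ _ _ h, k₁ t' h]

/-! ### Statements -/

namespace Program

/-- `x := e` -/
def assign (x : ℕ) (e : Ex) : Program :=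
  .seq (e.compile 0) (.seq (.const 3 0) (.arith (2 * x) .add 1 3))

/-- The array `a` at the index `i` becomes `e`. -/
def put (a : ℕ) (i e : Ex) : Program :=
  .seq (i.compile 0) (.seq (e.compile 1) (.store a 1 3))

/-- `e` is appended to the output. -/
def write (e : Ex) : Program := .seq (e.compile 0) (.emit 1)

/-- Evaluate two expressions for a comparison. -/
def both (a b : Ex) : Program := .seq (a.compile 0) (b.compile 1)

/-- Branching on a comparison of two expressions. -/
def cond (r : Test) (a b : Ex) (P Q : Program) : Program := .seq (both a b) (.ite r 1 3 P Q)

/-- Repetition as long as a comparison of two expressions holds. -/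
def rep (r : Test) (a b : Ex) (P : Program) : Program :=
  -- The machine's loop compares registers only, so both sides are evaluated before it and again at
  -- the end of every round.
  .seq (both a b) (.loop r 1 3 (.seq P (both a b)))

/-- `for i = 0, …, n - 1`, where `n` is a variable. -/
def forTo (i n : ℕ) (P : Program) : Program :=
  .seq (assign i (.lit 0)) (rep .lt (.var i) (.var n) (.seq P (assign i (.var i + .lit 1))))

/-- Sequences of programs. -/
def block : List Program → Program
  | [] => .skip
  | P :: l => .seq P (block l)

/-- Does the program write to the register? -/
def writesReg (i : ℕ) : Program → Bool
  | const k _ => i == k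
  | arith k _ _ _ => i == k
  | load k _ _ => i == k
  | seq P Q => P.writesReg i || Q.writesReg i
  | ite _ _ _ P Q => P.writesReg i || Q.writesReg i
  | loop _ _ _ P => P.writesReg i
  | _ => false

/-- Does the program write to the array? -/
def writesArr (a : ℕ) : Program → Bool
  | store k _ _ => a == k
  | seq P Q => P.writesArr a || Q.writesArr a
  | ite _ _ _ P Q => P.writesArr a || Q.writesArr a
  | loop _ _ _ P => P.writesArr a
  | _ => false

/-- Does the program write to the output? -/
def emits : Program → Bool
  | emit _ => true
  | seq P Q => P.emits || Q.emits
  | ite _ _ _ P Q => P.emits || Q.emits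
  | loop _ _ _ P => P.emits
  | _ => false

end Program

/-! ### Frame conditions, and triples with operation count. -/

open Program

/-- What the program does not write is the same in the states `s` and `t` of the variables. -/
structure Frame (P : Program) (s t : State) : Prop where
  reg : ∀ i, P.writesReg (2 * i) = false → t.reg i = s.reg i
  arr : ∀ a, P.writesArr a = false → t.arr a = s.arr a
  out : P.emits = false → t.out = s.out

theorem Frame.refl (P : Program) (s : State) : Frame P s s :=
  ⟨fun _ _ => rfl, fun _ _ => rfl, fun _ => rfl⟩

theorem Frame.trans {P : Program} {s t u : State} (h : Frame P s t) (h' : Frame P t u) :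
    Frame P s u :=
  ⟨fun i hi => (h'.reg i hi).trans (h.reg i hi), fun a ha => (h'.arr a ha).trans (h.arr a ha),
    fun ho => (h'.out ho).trans (h.out ho)⟩

theorem Frame.mono {P Q : Program} {s t : State} (h : Frame P s t)
    (hr : ∀ i, Q.writesReg i = false → P.writesReg i = false)
    (ha : ∀ i, Q.writesArr i = false → P.writesArr i = false)
    (ho : Q.emits = false → P.emits = false) : Frame Q s t :=
  ⟨fun i hi => h.reg i (hr _ hi), fun i hi => h.arr i (ha _ hi), fun h' => h.out (ho h')⟩

/-- `writesReg`, `writesArr` and `emits` over-approximate the effects of a program syntactically, so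
induction over the run suffices. For a concrete program the hypotheses are closed by `rfl`. -/
theorem Runs.frame {β : ℕ} {P : Program} {σ τ : State} {n : ℕ} (h : Runs β P σ τ n) :
    (∀ i, P.writesReg i = false → τ.reg i = σ.reg i) ∧
    (∀ a, P.writesArr a = false → τ.arr a = σ.arr a) ∧
    (P.emits = false → τ.out = σ.out) := by
  induction h with
  | skip | loop_done => simp
  | const | arith | load => simp +contextual [writesReg, State.setReg_reg]
  | store => simp +contextual [writesArr, State.setArr_arr]
  | emit => simp [emits]
  | seq _ _ h₁ h₂ =>
    simp only [writesReg, writesArr, emits, Bool.or_eq_false_iff]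
    exact ⟨fun i hi => (h₂.1 i hi.2).trans (h₁.1 i hi.1),
      fun i hi => (h₂.2.1 i hi.2).trans (h₁.2.1 i hi.1), fun h => (h₂.2.2 h.2).trans (h₁.2.2 h.1)⟩
  | ite_true _ _ _ _ h =>
    simp only [writesReg, writesArr, emits, Bool.or_eq_false_iff]
    exact ⟨fun i hi => h.1 i hi.1, fun i hi => h.2.1 i hi.1, fun h' => h.2.2 h'.1⟩
  | ite_false _ _ _ _ h =>
    simp only [writesReg, writesArr, emits, Bool.or_eq_false_iff]
    exact ⟨fun i hi => h.1 i hi.2, fun i hi => h.2.1 i hi.2, fun h' => h.2.2 h'.2⟩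
  | loop_step _ _ _ _ _ h₁ h₂ =>
    simp only [writesReg, writesArr, emits] at h₁ h₂ ⊢
    exact ⟨fun i hi => (h₂.1 i hi).trans (h₁.1 i hi),
      fun i hi => (h₂.2.1 i hi).trans (h₁.2.1 i hi), fun h => (h₂.2.2 h).trans (h₁.2.2 h)⟩

/-- Started in any state bounded by `M` whose variables are as in `s`, the program halts after at
most `c` operations, all on numbers bounded by `M`, in a state whose variables satisfy `Q`. -/
def Tri (M : ℕ) (P : Program) (c : ℕ) (s : State) (Q : State → Prop) : Prop :=
  ∀ σ : State, σ.vars = s → σ.Bounded M →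
    ∃ τ n, Runs M.size P σ τ n ∧ n ≤ c ∧ τ.Bounded M ∧ Q τ.vars

namespace Tri

variable {M c c' c₁ c₂ : ℕ} {P P₁ P₂ : Program} {s : State} {Q Q' : State → Prop}

theorem weaken (h : Tri M P c s Q) (hc : c ≤ c') : Tri M P c' s Q := fun σ hσ hb =>
  let ⟨τ, n, h₁, h₂, h₃⟩ := h σ hσ hb
  ⟨τ, n, h₁, h₂.trans hc, h₃⟩

/-- The frame condition comes for free with every triple. Hence specifications below are proved
without it and strengthened at once. -/
theorem frame (h : Tri M P c s Q) : Tri M P c s (fun t => Q t ∧ Frame P s t) := by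
  rintro σ rfl hb
  obtain ⟨τ, n, h₁, h₂, h₃, h₄⟩ := h σ rfl hb
  obtain ⟨f₁, f₂, f₃⟩ := h₁.frame
  exact ⟨τ, n, h₁, h₂, h₃, h₄, fun i hi => f₁ _ hi, f₂, f₃⟩

theorem imp (h : Tri M P c s Q) (hQ : ∀ t, Q t → Q' t) : Tri M P c s Q' := fun σ hσ hb =>
  let ⟨τ, n, h₁, h₂, h₃, h₄⟩ := h σ hσ hb
  ⟨τ, n, h₁, h₂, h₃, hQ _ h₄⟩

theorem imp_frame (h : Tri M P c s Q) (hQ : ∀ t, Q t → Frame P s t → Q' t) : Tri M P c s Q' :=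
  h.frame.imp fun t ht => hQ t ht.1 ht.2

/-- A starting state is bounded by `M` by the meaning of a triple; this makes the bound available
for the verification of the next instruction. -/
theorem bounded (h : s.Bounded M → Tri M P c s Q) : Tri M P c s Q := fun σ hσ hb =>
  h (hσ ▸ ⟨fun _ => hb.reg _, hb.arr⟩) σ hσ hb

theorem skip (h : Q s) : Tri M .skip 0 s Q := fun σ hσ hb =>
  ⟨σ, 0, .skip σ, le_rfl, hb, hσ ▸ h⟩

theorem seq (h : Tri M P₁ c₁ s (fun t => Tri M P₂ c₂ t Q)) :
    Tri M (.seq P₁ P₂) (c₁ + c₂) s Q := fun σ hσ hb =>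
  let ⟨τ, n, h₁, h₂, h₃, h₄⟩ := h σ hσ hb
  let ⟨υ, m, g₁, g₂, g₃, g₄⟩ := h₄ τ rfl h₃
  ⟨υ, n + m, .seq h₁ g₁, add_le_add h₂ g₂, g₃, g₄⟩

theorem assign {x : ℕ} {e : Ex} (he : e.Ok M s) (h : Q (s.setReg x (e.eval s))) :
    Tri M (assign x e) (e.cost + 2) s Q := by
  rintro σ rfl hb
  obtain ⟨τ, r, b, v, h₁, -⟩ := e.compile_runs 0 σ hb he
  have h0 : Within M 0 := by simp
  have hv : Op.add.eval ((τ.setReg 3 0).reg 1) ((τ.setReg 3 0).reg 3) = e.eval σ.vars := by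
    simpa [Op.eval, State.setReg_reg] using h₁
  have b' := b.setReg h0 3
  have hf : Within M (e.eval σ.vars) := h₁ ▸ b.reg _
  refine ⟨_, _, .seq r (.seq (.const _ _ _ (fits_size h0)) (.arith _ _ _ _ _
    (fits_size (b'.reg _)) (fits_size (b'.reg _)) (hv.symm ▸ fits_size hf) (by simp))), le_rfl,
    b'.setReg (hv.symm ▸ hf) _, ?_⟩
  rw [hv, State.vars_setReg_even, show 3 = 2 * 1 + 1 from rfl, State.vars_setReg_odd, v]
  exact h

theorem put {a : ℕ} {i e : Ex} (hi : i.Ok M s) (he : e.Ok M s)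
    (h : Q (s.setArr a (i.eval s) (e.eval s))) :
    Tri M (put a i e) (i.cost + (e.cost + 1)) s Q := by
  rintro σ rfl hb
  obtain ⟨τ, r, b, v, h₁, -⟩ := i.compile_runs 0 σ hb hi
  obtain ⟨τ', r', b', v', h₁', k⟩ := e.compile_runs 1 τ b (v ▸ he)
  refine ⟨_, _, .seq r (.seq r' (.store _ _ _ _ (fits_size (b'.reg _)) (fits_size (b'.reg _)))),
    le_rfl, b'.setArr (b'.reg _) _ _, ?_⟩
  rw [v] at v' h₁'
  rw [show τ'.reg 1 = _ from (k 0 one_pos).trans h₁, show τ'.reg 3 = _ from h₁']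
  convert h using 1
  rw [← v']
  rfl

theorem write {e : Ex} (he : e.Ok M s)
    (h : Q (s.emit (e.eval s))) :
    Tri M (write e) (e.cost + 1) s Q := by
  rintro σ rfl hb
  obtain ⟨τ, r, b, v, h₁, -⟩ := e.compile_runs 0 σ hb he
  refine ⟨_, _, .seq r (.emit _ _ (fits_size (b.reg _))), le_rfl, ⟨b.reg, b.arr⟩, ?_⟩
  rw [show τ.reg 1 = _ from h₁]
  convert h using 1
  rw [← v]
  rfl

theorem both_runs {a b : Ex} {σ : State} (hb : σ.Bounded M) (ha : a.Ok M σ.vars)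
    (hb' : b.Ok M σ.vars) : ∃ τ : State, Runs M.size (both a b) σ τ (a.cost + b.cost) ∧
      τ.Bounded M ∧ τ.vars = σ.vars ∧ τ.reg 1 = a.eval σ.vars ∧ τ.reg 3 = b.eval σ.vars := by
  obtain ⟨τ, r, b, v, h₁, -⟩ := a.compile_runs 0 σ hb ha
  obtain ⟨τ', r', b₁, v', h₁', k⟩ := Ex.compile_runs _ 1 τ b (v ▸ hb')
  exact ⟨τ', .seq r r', b₁, v'.trans v, (k 0 one_pos).trans h₁, v ▸ h₁'⟩

/-- The count adds the costs of both branches. Only one of them runs, but the loss is a constant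
factor and no maximum has to be carried along. -/
theorem cond {r : Test} {a b : Ex} (ha : a.Ok M s) (hb : b.Ok M s)
    (h₁ : r.Holds (a.eval s) (b.eval s) → Tri M P₁ c₁ s Q)
    (h₂ : ¬ r.Holds (a.eval s) (b.eval s) → Tri M P₂ c₂ s Q) :
    Tri M (cond r a b P₁ P₂) (a.cost + b.cost + (c₁ + c₂ + 1)) s Q := by
  rintro σ rfl hσ
  obtain ⟨τ, hr, hτ, v, e₁, e₂⟩ := both_runs hσ ha hb
  by_cases h : r.Holds (a.eval σ.vars) (b.eval σ.vars)
  · obtain ⟨υ, n, g₁, g₂, g₃⟩ := h₁ h τ v hτ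
    exact ⟨υ, _, .seq hr (.ite_true (fits_size (hτ.reg _)) (fits_size (hτ.reg _))
      (by rwa [e₁, e₂]) g₁), by omega, g₃⟩
  · obtain ⟨υ, n, g₁, g₂, g₃⟩ := h₂ h τ v hτ
    exact ⟨υ, _, .seq hr (.ite_false (fits_size (hτ.reg _)) (fits_size (hτ.reg _))
      (by rwa [e₁, e₂]) g₁), by omega, g₃⟩

/-- Loops, with an invariant `I k` that implies that at most `k` rounds are left. -/
theorem rep {r : Test} {a b : Ex} {I : ℕ → State → Prop} {k : ℕ} (h0 : I k s)
    (ha : ∀ j t, I j t → Frame P s t → a.Ok M t ∧ b.Ok M t)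
    (h₁ : ∀ j t, I j t → Frame P s t → r.Holds (a.eval t) (b.eval t) →
      ∃ i, j = i + 1 ∧ Tri M P c t (I i)) :
    Tri M (rep r a b P) (a.cost + b.cost + ((k + 1) * (c + (a.cost + b.cost) + 1))) s
      (fun t => (∃ j, I j t) ∧ ¬ r.Holds (a.eval t) (b.eval t) ∧ Frame P s t) := by
  rintro σ rfl hσ
  have key : ∀ (j : ℕ) (τ : State), τ.Bounded M → I j τ.vars → Frame P σ.vars τ.vars →
      τ.reg 1 = a.eval τ.vars → τ.reg 3 = b.eval τ.vars →
      ∃ υ n, Runs M.size (.loop r 1 3 (.seq P (both a b))) τ υ n ∧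
        n ≤ (j + 1) * (c + (a.cost + b.cost) + 1) ∧ υ.Bounded M ∧
        (∃ i, I i υ.vars) ∧ ¬ r.Holds (a.eval υ.vars) (b.eval υ.vars) ∧
        Frame P σ.vars υ.vars := by
    intro j
    induction j with
    -- With no rounds left the test must fail: otherwise `h₁` would give `0 = i + 1`.
    | zero =>
      intro τ hτ hI hF e₁ e₂
      by_cases h : r.Holds (a.eval τ.vars) (b.eval τ.vars)
      · obtain ⟨i, hi, -⟩ := h₁ _ _ hI hF h
        omega
      · exact ⟨τ, 1, .loop_done (fits_size (hτ.reg _)) (fits_size (hτ.reg _)) (by rwa [e₁, e₂]),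
          by omega, hτ, ⟨_, hI⟩, h, hF⟩
    | succ j ih =>
      intro τ hτ hI hF e₁ e₂
      by_cases h : r.Holds (a.eval τ.vars) (b.eval τ.vars)
      · obtain ⟨i, hi, hT⟩ := h₁ _ _ hI hF h
        obtain rfl : j = i := by omega
        obtain ⟨υ, n, g₁, g₂, g₃, g₄, g₅⟩ := hT.frame τ rfl hτ
        have hF' := hF.trans g₅
        obtain ⟨ha', hb'⟩ := ha _ _ g₄ hF'
        obtain ⟨υ', f₁, f₂, f₃, f₄, f₅⟩ := both_runs g₃ ha' hb'
        rw [← f₃] at g₄ hF' f₄ f₅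
        obtain ⟨ω, m, k₁, k₂, k₃⟩ := ih υ' f₂ g₄ hF' f₄ f₅
        refine ⟨ω, _, .loop_step (fits_size (hτ.reg _)) (fits_size (hτ.reg _)) (by rwa [e₁, e₂])
          (.seq g₁ f₁) k₁, ?_, k₃⟩
        rw [add_mul (j + 1)]
        omega
      · exact ⟨τ, 1, .loop_done (fits_size (hτ.reg _)) (fits_size (hτ.reg _)) (by rwa [e₁, e₂]),
          by rw [add_mul]; omega, hτ, ⟨_, hI⟩, h, hF⟩
  obtain ⟨ha', hb'⟩ := ha _ _ h0 (.refl _ _)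
  obtain ⟨υ', f₁, f₂, f₃, f₄, f₅⟩ := both_runs hσ ha' hb'
  rw [← f₃] at h0 f₄ f₅
  obtain ⟨ω, m, k₁, k₂, k₃⟩ := key k υ' f₂ h0 (f₃ ▸ .refl _ _) f₄ f₅
  exact ⟨ω, _, .seq f₁ k₁, by omega, k₃⟩

/-- Counting loops. -/
theorem forTo {i n : ℕ} {I : ℕ → State → Prop} (N : ℕ) (hn : s.reg n = N) (hN : N ≤ M)
    (hM : 1 ≤ M)
    (hP : (P.writesReg (2 * i) || P.writesReg (2 * n) || i == n) = false)
    (hI : ∀ j t v, I j t → I j (t.setReg i v)) (h0 : I 0 s)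
    (h : ∀ (j : ℕ) (t : State), j < N → t.reg i = j → I j t → Frame (Program.forTo i n P) s t →
      Tri M P c t (I (j + 1))) :
    Tri M (Program.forTo i n P) ((N + 1) * (c + 20)) s
      (fun t => I N t ∧ Frame (Program.forTo i n P) s t) := by
  simp only [Bool.or_eq_false_iff, beq_eq_false_iff_ne] at hP
  obtain ⟨⟨hPi, hPn⟩, hin⟩ := hP
  suffices Tri M (Program.forTo i n P) ((N + 1) * (c + 20)) s (I N) from this.frame
  refine weaken (seq (assign (by simp) (imp (rep
    -- While the counter is `j`, there are `k = N - j` rounds left. `I` has to survive the increment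
    -- of the counter, which is the role of `hI`.
    (I := fun k t => ∃ j, j + k = N ∧ t.reg i = j ∧ t.reg n = N ∧ I j t ∧
      Frame (Program.forTo i n P) s t)
    (c := c + 7) (k := N) ?_ ?_ ?_) ?_))) ?_
  rotate_right
  · simp only [Ex.cost_lit, Ex.cost_var]
    ring_nf
    omega
  · refine ⟨0, by simp, by simp, ?_, hI _ _ _ h0, ?_⟩
    · rw [State.setReg_reg, if_neg (Ne.symm hin), hn]
    · refine ⟨fun k hk => ?_, fun _ _ => rfl, fun _ => rfl⟩
      rw [State.setReg_reg, if_neg]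
      rintro rfl
      simp [Program.forTo, Program.assign, writesReg] at hk
  · intros; simp
  · rintro k t ⟨j, hj, h₁, h₂, h₃, h₄⟩ - ht
    simp only [Test.Holds, Ex.eval_var, h₁, h₂, Nat.cast_lt] at ht
    refine ⟨k - 1, by omega, weaken (seq (c₂ := 7) (imp_frame (h j t ht h₁ h₃ h₄)
      fun u hu hf => ?_)) le_rfl⟩
    have e₁ : u.reg i = j := (hf.reg _ hPi).trans h₁
    have e₂ : u.reg n = N := (hf.reg _ hPn).trans h₂
    refine weaken (assign ?_ ?_) (by simp)
    · have : Within M ((j : ℤ) + 1) := .of_nonneg (by omega) (by omega)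
      simpa [e₁, hM] using this
    · refine ⟨j + 1, by omega, by simp [e₁], ?_, hI _ _ _ hu, ?_⟩
      · rw [State.setReg_reg, if_neg (Ne.symm hin), e₂]
      · refine h₄.trans (.trans (hf.mono ?_ ?_ ?_) ⟨fun k hk => ?_, fun _ _ => rfl, fun _ => rfl⟩)
        · simp +contextual [Program.forTo, Program.rep, writesReg]
        · simp +contextual [Program.forTo, Program.rep, writesArr]
        · simp +contextual [Program.forTo, Program.rep, emits]
        · rw [State.setReg_reg, if_neg]
          rintro rfl
          simp [Program.forTo, Program.assign, writesReg] at hk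
  · rintro t ⟨⟨k, j, hj, h₁, h₂, h₃, h₄⟩, h₅, -⟩
    simp only [Test.Holds, Ex.eval_var, h₁, h₂, Nat.cast_lt] at h₅
    obtain rfl : j = N := by omega
    exact h₃

theorem nil (h : Q s) : Tri M (block []) c s Q := (skip h).weaken (Nat.zero_le _)

/-- The budget `c` of a block is spent statement by statement. Subtraction is truncated, so the side
condition `hc`, closed by `omega` for concrete costs, excludes an overdraft. -/
theorem cons {l : List Program} {Q₁ : State → Prop} (hP : Tri M P c₁ s Q₁)
    (h : ∀ t, Q₁ t → Frame P s t → Tri M (block l) (c - c₁) t Q)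
    (hc : c₁ ≤ c := by
      simp -failIfUnchanged only [Ex.cost_lit, Ex.cost_var, Ex.cost_get, Ex.cost_add, Ex.cost_sub,
        Ex.cost_mul, Ex.cost_div, Ex.cost_mod]
      omega) : Tri M (block (P :: l)) c s Q :=
  (seq (hP.imp_frame h)).weaken (by omega)

theorem assign_cons {l : List Program} {x : ℕ} {e : Ex} (he : e.Ok M s)
    (h : Tri M (block l) (c - (e.cost + 2)) (s.setReg x (e.eval s)) Q)
    (hc : e.cost + 2 ≤ c := by
      simp -failIfUnchanged only [Ex.cost_lit, Ex.cost_var, Ex.cost_get, Ex.cost_add, Ex.cost_sub,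
        Ex.cost_mul, Ex.cost_div, Ex.cost_mod]
      omega) : Tri M (block (.assign x e :: l)) c s Q :=
  (seq (assign he h)).weaken (by omega)

theorem put_cons {l : List Program} {a : ℕ} {i e : Ex} (hi : i.Ok M s) (he : e.Ok M s)
    (h : Tri M (block l) (c - (i.cost + e.cost + 1)) (s.setArr a (i.eval s) (e.eval s)) Q)
    (hc : i.cost + e.cost + 1 ≤ c := by
      simp -failIfUnchanged only [Ex.cost_lit, Ex.cost_var, Ex.cost_get, Ex.cost_add, Ex.cost_sub,
        Ex.cost_mul, Ex.cost_div, Ex.cost_mod]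
      omega) : Tri M (block (.put a i e :: l)) c s Q :=
  (seq (put hi he h)).weaken (by omega)

theorem write_cons {l : List Program} {e : Ex} (he : e.Ok M s)
    (h : Tri M (block l) (c - (e.cost + 1)) (s.emit (e.eval s)) Q)
    (hc : e.cost + 1 ≤ c := by
      simp -failIfUnchanged only [Ex.cost_lit, Ex.cost_var, Ex.cost_get, Ex.cost_add, Ex.cost_sub,
        Ex.cost_mul, Ex.cost_div, Ex.cost_mod]
      omega) : Tri M (block (.write e :: l)) c s Q :=
  (seq (write he h)).weaken (by omega)

end Tri

end IgusaZeta

namespace IgusaZeta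

open Ex Program

/-! ### Euclid's algorithm and valuations -/

/-- Variables 22, 23 become `g = gcd (u, w)` and some `s` with `s * w ≡ g` modulo `u`, where `u`,
`w` are the variables 20, 21. -/
def euclid : Program := block [
  assign 22 (var 20), assign 24 (var 21 % var 20), assign 23 (lit 0), assign 25 (lit 1),
  rep .lt (lit 0) (var 24) (block [
    assign 26 (var 22 / var 24), assign 27 (var 22 % var 24),
    assign 28 ((var 23 - var 26 * var 25) % var 20),
    assign 22 (var 24), assign 24 (var 27), assign 23 (var 25), assign 25 (var 28)])]

/-- Variable 22 becomes the valuation of variable 20 at the prime in variable 0. -/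
def valuation : Program := block [
  assign 22 (lit 0), assign 23 (var 20),
  rep .eq (var 23 % var 0) (lit 0) (block [
    assign 23 (var 23 / var 0), assign 22 (var 22 + lit 1)])]

theorem lt_two_pow_size {M : ℕ} {z : ℤ} (h : z ≤ M) : z < 2 ^ M.size := by
  have := M.lt_size_self
  zify at this
  omega

/-- Half of the extended algorithm: the invariants are `s₀ * w ≡ r₀` and `s₁ * w ≡ r₁` modulo `u`,
with the cofactors reduced modulo `u` in every round so that they do not grow. The product `r₀ * r₁`
halves in each round, which bounds the number of rounds by the binary length of `M`. -/
theorem euclid_spec {M : ℕ} {s : State} (u w : ℤ) (hu : 0 < u) (h20 : s.reg 20 = u)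
    (h21 : s.reg 21 = w) (hM : u * u + u ≤ M) :
    Tri M euclid (60 * (M.size + 2)) s (fun t => Frame euclid s t ∧ t.reg 22 = Int.gcd u w ∧
      0 ≤ t.reg 23 ∧ t.reg 23 ≤ u ∧ u ∣ t.reg 23 * w - Int.gcd u w) := by
  suffices Tri M euclid (60 * (M.size + 2)) s (fun t => t.reg 22 = Int.gcd u w ∧
      0 ≤ t.reg 23 ∧ t.reg 23 ≤ u ∧ u ∣ t.reg 23 * w - Int.gcd u w) from
    this.frame.imp fun t ht => ⟨ht.2, ht.1⟩
  have hM1 : 1 ≤ M := by zify; nlinarith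
  have hb : ∀ z : ℤ, 0 ≤ z → z ≤ u → Within M z := fun z h₁ h₂ => .of_nonneg h₁ (by nlinarith)
  have hw₁ := Int.emod_nonneg w hu.ne'
  have hw₂ := Int.emod_lt_of_pos w hu
  refine Tri.assign_cons (by simp) ?_
  refine Tri.assign_cons (by simpa [h20, h21, hu.ne'] using hb _ hw₁ hw₂.le) ?_
  refine Tri.assign_cons (by simp) ?_
  refine Tri.assign_cons (by simpa using hM1) ?_
  refine Tri.cons (Tri.rep (k := M.size) (c := 45)
    (I := fun k t => t.reg 20 = u ∧ ∃ r₀ r₁ s₀ s₁ : ℤ, t.reg 22 = r₀ ∧ t.reg 24 = r₁ ∧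
      t.reg 23 = s₀ ∧ t.reg 25 = s₁ ∧ 0 ≤ r₁ ∧ r₁ < r₀ ∧ r₀ ≤ u ∧ 0 ≤ s₀ ∧ s₀ ≤ u ∧ 0 ≤ s₁ ∧
      s₁ ≤ u ∧ Int.gcd r₀ r₁ = Int.gcd u w ∧ u ∣ s₀ * w - r₀ ∧ u ∣ s₁ * w - r₁ ∧
      r₀ * r₁ < 2 ^ k) ?_ ?_ ?_) ?_
  · refine ⟨by simp [h20], u, w % u, 0, 1, ?_⟩
    simp only [State.setReg_reg, Ex.eval_var, Ex.eval_lit, Ex.eval_mod, h20, h21]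
    refine ⟨by simp, by simp, by simp, by simp, hw₁, hw₂, le_rfl, le_rfl, hu.le, by simp,
      by omega, ?_, by simp, ?_, lt_two_pow_size (by nlinarith)⟩
    · rw [Int.gcd_comm u (w % u), Int.gcd_emod, Int.gcd_comm]
    · rw [one_mul]
      exact Int.dvd_self_sub_emod
  · intros; simp
  · rintro k t ⟨hu', r₀, r₁, s₀, s₁, e₀, e₁, e₂, e₃, h₁, h₂, h₃, h₄, h₅, h₆, h₇, hg, hd₀, hd₁,
      hk⟩ - ht
    simp only [Test.Holds, Ex.eval_lit, Ex.eval_var, e₁] at ht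
    have hq₀ : 0 ≤ r₀ / r₁ := Int.ediv_nonneg (by omega) h₁
    have hq₁ : r₀ / r₁ ≤ u := (Int.ediv_le_self _ (by omega)).trans h₃
    have hr₀ := Int.emod_nonneg r₀ ht.ne'
    have hr₁ := Int.emod_lt_of_pos r₀ ht
    have hdm := Int.mul_ediv_add_emod r₀ r₁
    have hq : 1 ≤ r₀ / r₁ := by
      by_contra! hlt
      have : r₀ / r₁ = 0 := by omega
      rw [this] at hdm
      omega
    -- This product is the largest intermediate number and the reason for the term `u * u` in `hM`.
    have hpr : 0 ≤ r₀ / r₁ * s₁ ∧ r₀ / r₁ * s₁ ≤ u * u := ⟨by positivity, by gcongr⟩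
    have hs₀ := Int.emod_nonneg (s₀ - r₀ / r₁ * s₁) hu.ne'
    have hs₁ := Int.emod_lt_of_pos (s₀ - r₀ / r₁ * s₁) hu
    cases k with
    | zero => nlinarith
    | succ k =>
      refine ⟨k, rfl, ?_⟩
      refine Tri.assign_cons (by simp [e₀, e₁, ht.ne', hb _ hq₀ hq₁]) ?_
      refine Tri.assign_cons (by simp [e₀, e₁, ht.ne', hb _ hr₀ (by omega)]) ?_
      refine Tri.assign_cons ?_ ?_
      · simp [e₀, e₁, e₂, e₃, hu', hu.ne', hb _ hs₀ hs₁.le]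
        constructor <;> constructor <;> linarith
      refine Tri.assign_cons (by simp) ?_
      refine Tri.assign_cons (by simp) ?_
      refine Tri.assign_cons (by simp) ?_
      refine Tri.assign_cons (by simp) (Tri.nil ?_)
      refine ⟨by simp [hu'], r₁, r₀ % r₁, s₁, (s₀ - r₀ / r₁ * s₁) % u, by simp [e₁],
        by simp [e₀, e₁], by simp [e₃], by simp [e₀, e₁, e₂, e₃, hu'], hr₀, hr₁, by omega, h₆, h₇,
        hs₀, hs₁.le, ?_, hd₁, ?_, ?_⟩
      · rw [← hg, Int.gcd_comm r₁ (r₀ % r₁), Int.gcd_emod, Int.gcd_comm]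
      · have h := Int.dvd_self_sub_emod (x := s₀ - r₀ / r₁ * s₁) (m := u)
        have := dvd_sub (dvd_sub hd₀ (hd₁.mul_left (r₀ / r₁))) (h.mul_right w)
        have e : (s₀ - r₀ / r₁ * s₁) % u * w - r₀ % r₁ = s₀ * w - r₀ - r₀ / r₁ * (s₁ * w - r₁) -
            (s₀ - r₀ / r₁ * s₁ - (s₀ - r₀ / r₁ * s₁) % u) * w := by linear_combination -hdm
        rwa [e]
      · rw [pow_succ] at hk
        -- The quotient is at least one, so `r₀ ≥ r₁ + r₀ % r₁ ≥ 2 * (r₀ % r₁)`.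
        have : 0 ≤ r₁ * (r₀ - 2 * (r₀ % r₁)) := mul_nonneg h₁ (by nlinarith)
        linarith
  · rintro t ⟨⟨k, hu', r₀, r₁, s₀, s₁, e₀, e₁, e₂, e₃, h₁, h₂, h₃, h₄, h₅, h₆, h₇, hg, hd₀, hd₁,
      hk⟩, ht, -⟩ -
    simp only [Test.Holds, Ex.eval_lit, Ex.eval_var, e₁] at ht
    obtain rfl : r₁ = 0 := by omega
    refine Tri.nil ?_
    have : ((Int.gcd u w : ℕ) : ℤ) = r₀ := by
      rw [← hg, Int.gcd_zero_right, Int.natAbs_of_nonneg (by omega)]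
    rw [this]
    exact ⟨e₀, e₂ ▸ h₄, e₂ ▸ h₅, e₂ ▸ hd₀⟩

/-- With `y * p ^ v = z` as invariant, each exact division by `p ≥ 2` at least halves `|y|`, so the
binary length of `M` bounds the rounds. The invariant `|y| + v ≤ |z|` keeps the counter `v` below
`M`. -/
theorem valuation_spec {M : ℕ} {s : State} (p : ℕ) [hp : Fact p.Prime] (z : ℤ) (hz : z ≠ 0)
    (h0 : s.reg 0 = p) (h20 : s.reg 20 = z) (hM : |z| ≤ M) (hpM : p ≤ M) :
    Tri M valuation (30 * (M.size + 2)) s (fun t => Frame valuation s t ∧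
      t.reg 22 = padicValInt p z) := by
  suffices Tri M valuation (30 * (M.size + 2)) s (fun t => t.reg 22 = padicValInt p z) from
    this.frame.imp fun t ht => ⟨ht.2, ht.1⟩
  have hp2 : (2 : ℤ) ≤ p := by exact_mod_cast hp.out.two_le
  have hpM' : (p : ℤ) ≤ M := by exact_mod_cast hpM
  have hmod : ∀ y : ℤ, Within M (y % (p : ℤ)) := fun y => by
    have := Int.emod_nonneg y (show (p : ℤ) ≠ 0 by omega)
    have := Int.emod_lt_of_pos y (show 0 < (p : ℤ) by omega)
    constructor <;> omega
  refine Tri.assign_cons (by simp) ?_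
  refine Tri.assign_cons (by simp) ?_
  refine Tri.cons (Tri.rep (k := M.size) (c := 16)
    (I := fun k t => t.reg 0 = p ∧ ∃ (y : ℤ) (v : ℕ), t.reg 23 = y ∧ t.reg 22 = v ∧
      y * p ^ v = z ∧ |y| < 2 ^ k ∧ |y| + v ≤ |z|) ?_ ?_ ?_) ?_
  · refine ⟨by simp [h0], z, 0, ?_⟩
    simp [h20, lt_two_pow_size hM]
  · rintro k t ⟨e₀, y, v, e₁, e₂, -⟩ -
    simp [e₀, e₁, hmod, hp.out.ne_zero]
  · rintro k t ⟨e₀, y, v, e₁, e₂, h₁, h₂, h₃⟩ - ht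
    simp only [Test.Holds, Ex.eval_lit, Ex.eval_mod, Ex.eval_var, e₀, e₁] at ht
    obtain ⟨y', rfl⟩ := Int.dvd_of_emod_eq_zero ht
    have hy : y' ≠ 0 := by rintro rfl; simp at h₁; exact hz h₁.symm
    have hy' := abs_pos.2 hy
    rw [abs_mul, Nat.abs_cast] at h₂ h₃
    have hd : (p * y' : ℤ) / p = y' := Int.mul_ediv_cancel_left _ (by omega)
    cases k with
    | zero => nlinarith
    | succ k =>
      refine ⟨k, rfl, ?_⟩
      refine Tri.assign_cons ?_ ?_
      · simp [e₀, e₁, hd, hp.out.ne_zero]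
        exact .of_abs (by nlinarith)
      refine Tri.assign_cons ?_ (Tri.nil ?_)
      · simp [e₂]
        constructor
        · omega
        · exact .of_nonneg (by omega) (by nlinarith)
      refine ⟨by simp [e₀], y', v + 1, by simp [e₀, e₁, hd], by simp [e₂],
        by rw [← h₁]; ring, ?_, ?_⟩
      · rw [pow_succ] at h₂
        nlinarith
      · push_cast
        nlinarith
  · rintro t ⟨⟨k, e₀, y, v, e₁, e₂, h₁, -, -⟩, ht, -⟩ -
    simp only [Test.Holds, Ex.eval_lit, Ex.eval_mod, Ex.eval_var, e₀, e₁] at ht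
    refine Tri.nil ?_
    have hy : ¬ (p : ℤ) ∣ y := fun h => ht (Int.emod_eq_zero_of_dvd h)
    have hy0 : y ≠ 0 := by rintro rfl; simp at hy
    rw [e₂, ← h₁, padicValInt.mul hy0 (by have := hp.out.ne_zero; positivity),
      padicValInt.eq_zero_of_not_dvd hy, zero_add, ← Nat.cast_pow, padicValInt.of_nat,
      padicValNat.prime_pow]

end IgusaZeta

namespace IgusaZeta

/-! ### Polynomials with integral roots -/

/-- The monic polynomial with given roots. -/
noncomputable def ofRoots (m : Multiset ℤ) : ℤ[X] := (m.map fun y => X - C y).prod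

@[simp] theorem ofRoots_zero : ofRoots 0 = 1 := by simp [ofRoots]

@[simp] theorem ofRoots_cons (y : ℤ) (m : Multiset ℤ) :
    ofRoots (y ::ₘ m) = (X - C y) * ofRoots m := by simp [ofRoots]

theorem natDegree_ofRoots (m : Multiset ℤ) : (ofRoots m).natDegree = m.card :=
  natDegree_multiset_prod_X_sub_C_eq_card m

theorem eval_ofRoots_eq_zero {m : Multiset ℤ} {x : ℤ} : (ofRoots m).eval x = 0 ↔ x ∈ m := by
  induction m using Multiset.induction_on with
  | empty => simp
  | cons y m ih => simp [ih, sub_eq_zero]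

theorem eval_ofRoots_pos {m : Multiset ℤ} {x : ℤ} (h : ∀ y ∈ m, y < x) :
    0 < (ofRoots m).eval x := by
  induction m using Multiset.induction_on with
  | empty => simp
  | cons y m ih =>
    simp only [Multiset.mem_cons, forall_eq_or_imp] at h
    simpa using mul_pos (sub_pos.2 h.1) (ih h.2)

theorem eval_derivative_ofRoots_cons (y x : ℤ) (m : Multiset ℤ) :
    (derivative (ofRoots (y ::ₘ m))).eval x =
      (ofRoots m).eval x + (x - y) * (derivative (ofRoots m)).eval x := by
  simp

theorem eval_derivative_ofRoots_nonneg {m : Multiset ℤ} {x : ℤ} (h : ∀ y ∈ m, y < x) :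
    0 ≤ (derivative (ofRoots m)).eval x := by
  induction m using Multiset.induction_on with
  | empty => simp
  | cons y m ih =>
    simp only [Multiset.mem_cons, forall_eq_or_imp] at h
    rw [eval_derivative_ofRoots_cons]
    have := eval_ofRoots_pos h.2
    have := mul_nonneg (sub_pos.2 h.1).le (ih h.2)
    omega

/-- To the right of all roots every term of the logarithmic derivative `∑ 1 / (x - z)` is positive,
so the sum is at least the term of `y`. Equivalently, the Newton step (value over derivative) is at
most `x - y`: no root is passed. -/
theorem eval_ofRoots_le_mul_derivative {m : Multiset ℤ} {x y : ℤ} (h : ∀ y ∈ m, y < x)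
    (hy : y ∈ m) : (ofRoots m).eval x ≤ (x - y) * (derivative (ofRoots m)).eval x := by
  obtain ⟨m, rfl⟩ := Multiset.exists_cons_of_mem hy
  simp only [Multiset.mem_cons, forall_eq_or_imp] at h
  rw [eval_derivative_ofRoots_cons, ofRoots_cons, eval_mul, mul_add]
  have := mul_nonneg (sub_pos.2 h.1).le
    (mul_nonneg (sub_pos.2 h.1).le (eval_derivative_ofRoots_nonneg h.2))
  simpa using this

/-- Each of the terms of `∑ 1 / (x - y)` is at most `1 / t`. Equivalently, the Newton step covers at
least the fraction `1 / deg` of the distance `t`. -/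
theorem mul_eval_derivative_ofRoots_le {m : Multiset ℤ} {x t : ℤ} (ht : 0 < t)
    (h : ∀ y ∈ m, t ≤ x - y) :
    t * (derivative (ofRoots m)).eval x ≤ m.card * (ofRoots m).eval x := by
  induction m using Multiset.induction_on with
  | empty => simp
  | cons y m ih =>
    simp only [Multiset.mem_cons, forall_eq_or_imp] at h
    have hp : 0 < (ofRoots m).eval x := eval_ofRoots_pos fun z hz => by
      have := h.2 z hz; omega
    have := mul_le_mul_of_nonneg_left (ih h.2) (ht.le.trans h.1)
    have := mul_le_mul_of_nonneg_right h.1 hp.le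
    rw [eval_derivative_ofRoots_cons, ofRoots_cons, eval_mul, Multiset.card_cons]
    simp only [eval_sub, eval_X, eval_C]
    push_cast
    linarith

/-- The coefficients are dominated by those of `∏ (X + |y|)`, whose sum is `∏ (1 + |y|)`; the
induction multiplies by one factor at a time. -/
theorem abs_coeff_ofRoots_le {A : ℤ} {m : Multiset ℤ} (h : ∀ y ∈ m, |y| + 1 ≤ A) (i : ℕ) :
    |(ofRoots m).coeff i| ≤ A ^ m.card := by
  induction m using Multiset.induction_on generalizing i with
  | empty => rw [ofRoots_zero, coeff_one]; split_ifs <;> simp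
  | cons y m ih =>
    simp only [Multiset.mem_cons, forall_eq_or_imp] at h
    have key : ∀ u v : ℤ, |u| ≤ A ^ m.card → |v| ≤ A ^ m.card → |u - y * v| ≤ A ^ (m.card + 1) :=
      fun u v hu hv => by
        have h1 : |y * v| ≤ |y| * A ^ m.card := by
          rw [abs_mul]; exact mul_le_mul_of_nonneg_left hv (abs_nonneg _)
        have h2 : (|y| + 1) * A ^ m.card ≤ A * A ^ m.card :=
          mul_le_mul_of_nonneg_right h.1 ((abs_nonneg u).trans hu)
        rw [pow_succ']
        have := abs_sub u (y * v)
        linarith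
    have h0 : |(0 : ℤ)| ≤ A ^ m.card := by simpa using (abs_nonneg _).trans (ih h.2 0)
    rw [ofRoots_cons, Multiset.card_cons, sub_mul]
    cases i with
    | zero => simpa using key 0 _ h0 (ih h.2 0)
    | succ i => simpa using key _ _ (ih h.2 i) (ih h.2 (i + 1))

/-! ### Horner's scheme -/

theorem coeff_iterate_divX {R : Type*} [Semiring R] (g : R[X]) (n i : ℕ) :
    (divX^[n] g).coeff i = g.coeff (n + i) := by
  induction n generalizing i with
  | zero => simp
  | succ n ih =>
    rw [Function.iterate_succ_apply', coeff_divX, ih]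
    congr 1
    ring

theorem iterate_divX_eq (g : ℤ[X]) (n : ℕ) :
    divX^[n] g = divX^[n + 1] g * X + C (g.coeff n) := by
  rw [Function.iterate_succ_apply']
  conv_lhs => rw [← divX_mul_X_add (divX^[n] g)]
  rw [coeff_iterate_divX, add_zero]

theorem iterate_divX_eq_zero {g : ℤ[X]} {n : ℕ} (h : g.natDegree < n) : divX^[n] g = 0 := by
  ext i
  rw [coeff_iterate_divX, coeff_eq_zero_of_natDegree_lt (by omega), coeff_zero]

/-- The values in Horner's scheme at a root are the coefficients of the quotient. -/
theorem eval_iterate_divX_X_sub_C_mul (g : ℤ[X]) (x : ℤ) (i : ℕ) :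
    (divX^[i + 1] ((X - C x) * g)).eval x = g.coeff i := by
  -- Descending induction on `i`, starting above the degree, where both sides vanish; `n` measures
  -- how far `i` is below that point.
  have key : ∀ n i, g.natDegree < i + n →
      (divX^[i + 1] ((X - C x) * g)).eval x = g.coeff i := by
    intro n
    induction n with
    | zero =>
      intro i hi
      rw [coeff_eq_zero_of_natDegree_lt (by omega : g.natDegree < i), iterate_divX_eq_zero,
        eval_zero]
      refine natDegree_mul_le.trans_lt ?_
      rw [natDegree_X_sub_C]
      omega
    | succ n ih =>
      intro i hi
      rw [iterate_divX_eq, eval_add, eval_mul, ih (i + 1) (by omega), sub_mul]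
      simp
      ring
  exact key (g.natDegree + 1) i (by omega)

/-! ### Newton's iteration, in integers, from the right of all the roots -/

/-- The potential by which the number of steps of Newton's iteration is bounded. -/
noncomputable def potential (d : ℕ) (m : Multiset ℤ) (x : ℤ) : ℝ :=
  (m.map fun y => 2 * d * Real.log (1 + (x - y : ℤ)) + 1).sum

/-- At `x` itself the logarithm vanishes and the summand is one. This one unit pays for the round in
which the root `x` is split off. -/
theorem potential_cons_self (d : ℕ) (m : Multiset ℤ) (x : ℤ) :
    potential d (x ::ₘ m) x = potential d m x + 1 := by
  simp [potential, add_comm]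

theorem potential_mono (d : ℕ) {m : Multiset ℤ} {x x' : ℤ} (h : ∀ y ∈ m, y ≤ x') (hx : x' ≤ x) :
    potential d m x' ≤ potential d m x := by
  refine Multiset.sum_map_le_sum_map _ _ fun y hy => ?_
  have h1 : (0 : ℝ) ≤ (x' - y : ℤ) := by exact_mod_cast sub_nonneg.2 (h y hy)
  have h2 : ((x' - y : ℤ) : ℝ) ≤ (x - y : ℤ) := by exact_mod_cast sub_le_sub_right hx y
  have := Real.log_le_log (by linarith) (add_le_add_right h2 1)
  have : 2 * (d : ℝ) * Real.log (1 + (x' - y : ℤ)) ≤ 2 * d * Real.log (1 + (x - y : ℤ)) := by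
    gcongr
  linarith

theorem potential_nonneg (d : ℕ) {m : Multiset ℤ} {x : ℤ} (h : ∀ y ∈ m, y ≤ x) :
    0 ≤ potential d m x := by
  refine Multiset.sum_nonneg fun z hz => ?_
  obtain ⟨y, hy, rfl⟩ := Multiset.mem_map.1 hz
  have h1 : (0 : ℝ) ≤ (x - y : ℤ) := by exact_mod_cast sub_nonneg.2 (h y hy)
  have := Real.log_nonneg (show (1 : ℝ) ≤ 1 + (x - y : ℤ) by linarith)
  positivity

/-- At the starting point this becomes the bound `O(d ^ 2 log S)` for the number of rounds. -/
theorem potential_le (d : ℕ) {m : Multiset ℤ} {x D : ℤ} (h : ∀ y ∈ m, y ≤ x)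
    (hD : ∀ y ∈ m, x - y ≤ D) :
    potential d m x ≤ m.card * (2 * d * Real.log (1 + D) + 1) := by
  rw [potential, ← nsmul_eq_mul, ← Multiset.card_map (fun y => 2 * (d : ℝ) *
    Real.log (1 + (x - y : ℤ)) + 1) m]
  refine Multiset.sum_le_card_nsmul _ _ fun z hz => ?_
  obtain ⟨y, hy, rfl⟩ := Multiset.mem_map.1 hz
  have h1 : (0 : ℝ) ≤ (x - y : ℤ) := by exact_mod_cast sub_nonneg.2 (h y hy)
  have h2 : ((x - y : ℤ) : ℝ) ≤ D := by exact_mod_cast hD y hy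
  gcongr

/-- By the two estimates of the logarithmic derivative, the distance `D ≥ 1` to the largest root
`y₀` becomes at most `(1 - 1 / d) * D`, and nothing is passed. So `log (1 + D)` drops by at least `D
/ (d * (1 + D)) ≥ 1 / (2 * d)`, and the summand of `y₀`, with its factor `2 * d`, by at least one.
The other summands do not increase. -/
theorem newton_step {d : ℕ} {m : Multiset ℤ} {x : ℤ} (hm : m ≠ 0) (hd : m.card ≤ d)
    (h : ∀ y ∈ m, y < x) :
    0 < (derivative (ofRoots m)).eval x ∧
    (∀ y ∈ m, y ≤ x + (-(ofRoots m).eval x) / (derivative (ofRoots m)).eval x) ∧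
    x + (-(ofRoots m).eval x) / (derivative (ofRoots m)).eval x ≤ x ∧
    potential d m (x + (-(ofRoots m).eval x) / (derivative (ofRoots m)).eval x) + 1 ≤
      potential d m x := by
  set r := (ofRoots m).eval x with hr
  set b := (derivative (ofRoots m)).eval x with hb
  have hr0 : 0 < r := eval_ofRoots_pos h
  obtain ⟨y₀, hy₀, hmax⟩ : ∃ y₀ ∈ m, ∀ y ∈ m, y ≤ y₀ := by
    obtain ⟨y, hy⟩ := Multiset.exists_mem_of_ne_zero hm
    obtain ⟨z, hz, hz'⟩ := Finset.exists_max_image m.toFinset id ⟨y, by simpa using hy⟩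
    exact ⟨z, by simpa using hz, fun w hw => hz' w (by simpa using hw)⟩
  have hb0 : 0 < b := by
    have h1 := eval_ofRoots_le_mul_derivative h hy₀
    have h2 := eval_derivative_ofRoots_nonneg h
    refine h2.lt_of_ne' fun h0 => ?_
    rw [h0, mul_zero] at h1
    omega
  have hle : ∀ y ∈ m, y ≤ x + (-r) / b := fun y hy => by
    have := eval_ofRoots_le_mul_derivative h hy
    -- The division rounds towards the left, but `y - x` is an integer, so it stays below the
    -- rounded quotient as well.
    have : y - x ≤ -r / b := by
      rw [Int.le_ediv_iff_mul_le hb0]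
      linarith
    omega
  have hx' : x + -r / b ≤ x := by
    have : -r / b < 0 := Int.ediv_neg_of_neg_of_pos (by omega) hb0
    omega
  refine ⟨hb0, hle, hx', ?_⟩
  obtain ⟨m', rfl⟩ := Multiset.exists_cons_of_mem hy₀
  have hD : 0 < x - y₀ := sub_pos.2 (h _ hy₀)
  have h3 := mul_eval_derivative_ofRoots_le (t := x - y₀) (x := x) hD
    (fun y hy => by have := hmax y hy; omega)
  rw [← hb, ← hr] at h3
  have hdm : 0 < (d : ℤ) := by
    have : 0 < (y₀ ::ₘ m').card := by simp
    omega
  have h4 : (x - y₀) * b ≤ d * r := h3.trans (by gcongr)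
  set x' := x + -r / b with hx'_def
  -- Rounding to the left only lengthens the step, so the lower bound for the exact Newton step
  -- remains valid.
  have h5 : (d : ℤ) * (x' - x) ≤ -(x - y₀) := by
    have h6 : b * (x' - x) ≤ -r := by
      rw [hx'_def, add_sub_cancel_left]; exact Int.mul_ediv_self_le hb0.ne'
    have : b * (d * (x' - x)) ≤ b * -(x - y₀) := by
      have := mul_le_mul_of_nonneg_left h6 hdm.le
      linarith
    exact le_of_mul_le_mul_left this hb0
  have hmono : potential d m' x' ≤ potential d m' x :=
    potential_mono d (fun y hy => hle y (Multiset.mem_cons_of_mem hy)) hx'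
  have hlog : 2 * (d : ℝ) * Real.log (1 + (x' - y₀ : ℤ)) + 1 ≤
      2 * d * Real.log (1 + (x - y₀ : ℤ)) := by
    have hdR : (0 : ℝ) < d := by exact_mod_cast hdm
    have p1 : (0 : ℝ) ≤ (x' - y₀ : ℤ) := by exact_mod_cast sub_nonneg.2 (hle _ hy₀)
    have p2 : (1 : ℝ) ≤ (x - y₀ : ℤ) := by exact_mod_cast hD
    have p3 : (d : ℝ) * ((x' - y₀ : ℤ) - (x - y₀ : ℤ)) ≤ -(x - y₀ : ℤ) := by
      have : ((d * (x' - x) : ℤ) : ℝ) ≤ (-(x - y₀) : ℤ) := by exact_mod_cast h5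
      push_cast at this ⊢
      linarith
    have p4 := Real.log_le_sub_one_of_pos
      (show (0 : ℝ) < (1 + (x' - y₀ : ℤ)) / (1 + (x - y₀ : ℤ)) by positivity)
    rw [Real.log_div (by linarith) (by linarith)] at p4
    -- This uses `D / (1 + D) ≥ 1 / 2`, valid because the integer `D = x - y₀` is at least one; here
    -- the `2` in the potential originates.
    have p5 : (1 + ((x' - y₀ : ℤ) : ℝ)) / (1 + (x - y₀ : ℤ)) - 1 ≤ -(1 / (2 * d)) := by
      rw [div_sub_one (by linarith), div_le_iff₀ (by linarith), neg_mul, one_div,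
        inv_mul_eq_div, le_neg, div_le_iff₀ (by linarith)]
      linarith
    have p6 : 2 * (d : ℝ) * (1 / (2 * d)) = 1 := by field_simp
    nlinarith
  simp only [potential, Multiset.map_cons, Multiset.sum_cons] at hmono ⊢
  linarith

end IgusaZeta

namespace IgusaZeta

open Ex Program

/-! ### The monic polynomial -/

/-- From the coefficients of `f` (array 0) and its degree (variable 1), compute the leading
coefficient (variable 2), the sum of squares of the coefficients (variable 3) and the
coefficients of the monic integral polynomial whose roots are those of `f` multiplied by the
leading coefficient (array 1). -/
def normalize : Program := block [
  assign 2 (get 0 (var 1)), assign 3 (var 2 * var 2), put 1 (var 1) (lit 1), assign 10 (lit 1),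
  forTo 9 1 (block [
    assign 11 (var 1 - lit 1 - var 9), assign 12 (get 0 (var 11)),
    put 1 (var 11) (var 12 * var 10), assign 10 (var 10 * var 2),
    assign 3 (var 3 + var 12 * var 12)])]

/-- With leading coefficient `a`, the polynomial `a ^ (d - 1) * f (X / a)` is monic with
coefficients `c i * a ^ (d - 1 - i)`. The loop descends from `i = d - 1`, so that the power of `a`
is updated by a single multiplication; the squares are summed on the way. -/
theorem normalize_spec {M : ℕ} {s : State} {d : ℕ} {c : ℕ → ℤ} {S : ℤ} (hd : 0 < d)
    (h1 : s.reg 1 = d) (hc : ∀ i ≤ d, s.arr 0 i = c i) (hcd : c d ≠ 0)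
    (hS : S = ∑ i ∈ Finset.range (d + 1), c i ^ 2) (hM : S ^ (d + 1) ≤ M) (hdM : d ≤ M) :
    Tri M normalize (100 * (d + 1)) s (fun t => Frame normalize s t ∧ t.reg 2 = c d ∧
      t.reg 3 = S ∧ t.arr 1 d = 1 ∧ ∀ i < d, t.arr 1 i = c i * c d ^ (d - 1 - i)) := by
  suffices Tri M normalize (100 * (d + 1)) s (fun t => t.reg 2 = c d ∧
      t.reg 3 = S ∧ t.arr 1 d = 1 ∧ ∀ i < d, t.arr 1 i = c i * c d ^ (d - 1 - i)) from
    this.frame.imp fun t ht => ⟨ht.2, ht.1⟩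
  have hsq : ∀ i ≤ d, c i ^ 2 ≤ S := fun i hi => by
    rw [hS]
    exact Finset.single_le_sum (f := fun i => c i ^ 2) (fun _ _ => sq_nonneg _) (by simp; omega)
  have habs : ∀ i ≤ d, |c i| ≤ S := fun i hi => by
    refine le_trans ?_ (hsq i hi)
    rw [← sq_abs]
    rcases eq_or_ne (c i) 0 with h | h
    · simp [h]
    · nlinarith [Int.one_le_abs h]
  have hS1 : 1 ≤ S := (Int.one_le_abs hcd).trans (habs d le_rfl)
  have hpow : ∀ j ≤ d + 1, S ^ j ≤ M := fun j hj => (pow_le_pow_right₀ hS1 hj).trans hM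
  have hSM : S ≤ M := by simpa using hpow 1 (by omega)
  have hM1 : 1 ≤ M := by zify; omega
  have hsqM : ∀ i ≤ d, Within M (c i * c i) := fun i hi =>
    .of_nonneg (mul_self_nonneg _) (by rw [← sq]; exact (hsq i hi).trans hSM)
  have hpart : ∀ j ≤ d, c d * c d + ∑ i ∈ Finset.range j, c (d - 1 - i) * c (d - 1 - i) ≤ S := by
    intro j hj
    have : ∑ i ∈ Finset.range j, c (d - 1 - i) * c (d - 1 - i) ≤
        ∑ i ∈ Finset.range d, c (d - 1 - i) * c (d - 1 - i) :=
      Finset.sum_le_sum_of_subset_of_nonneg (by simpa using hj) fun _ _ _ => mul_self_nonneg _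
    rw [Finset.sum_range_reflect (fun i => c i * c i)] at this
    simp only [hS, Finset.sum_range_succ, sq]
    linarith
  have hcp : ∀ i ≤ d, ∀ j ≤ d, Within M (c i * c d ^ j) := fun i hi j hj => .of_abs <| by
    refine le_trans ?_ (hpow (j + 1) (by omega))
    rw [abs_mul, abs_pow, pow_succ']
    gcongr
    exacts [habs i hi, habs d le_rfl]
  have hpw : ∀ j ≤ d, Within M (c d ^ j) := fun j hj => .of_abs <| by
    refine le_trans ?_ (hpow j (by omega))
    rw [abs_pow]
    gcongr
    exact habs d le_rfl
  refine Tri.assign_cons (by simp) ?_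
  refine Tri.assign_cons (by simpa [h1, hc d le_rfl] using hsqM d le_rfl) ?_
  refine Tri.put_cons (by simp) (by simpa using hM1) ?_
  refine Tri.assign_cons (by simpa using hM1) ?_
  refine Tri.cons (Tri.forTo (c := 50) (I := fun j t => t.reg 2 = c d ∧ t.reg 10 = c d ^ j ∧
      t.reg 3 = c d * c d + ∑ i ∈ Finset.range j, c (d - 1 - i) * c (d - 1 - i) ∧ t.arr 1 d = 1 ∧
      ∀ i < d, d ≤ i + j → t.arr 1 i = c i * c d ^ (d - 1 - i)) d (by simp [h1]) hdM hM1 rfl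
      (fun j t v h => by simpa using h) ?_ ?_) ?_
  · simp [h1, hc d le_rfl]
    omega
  · rintro j t hj e9 ⟨e2, e10, e3, ed, hi⟩ hf
    have e1 : t.reg 1 = d := (hf.reg 1 rfl).trans (by simp [h1])
    have e0 : t.arr 0 = s.arr 0 := hf.arr 0 rfl
    have e0' : t.arr 0 ((d - 1 - j : ℕ) : ℤ) = c (d - 1 - j) := by rw [e0, hc _ (by omega)]
    have hcast : (d : ℤ) - 1 - j = ((d - 1 - j : ℕ) : ℤ) := by omega
    refine Tri.assign_cons ?_ ?_
    · simp [e1, e9]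
      exact ⟨⟨hM1, .of_nonneg (by omega) (by omega)⟩, .of_nonneg (by omega) (by omega)⟩
    refine Tri.assign_cons (by simp) ?_
    refine Tri.put_cons (by simp) ?_ ?_
    · simp [e1, e9, hcast, e10, e0']
      exact hcp _ (by omega) _ hj.le
    refine Tri.assign_cons ?_ ?_
    · simp [e10, e2, ← pow_succ]
      exact hpw _ (by omega)
    refine Tri.assign_cons ?_ (Tri.nil ?_)
    · simp [e1, e9, hcast, e0', e3]
      refine ⟨hsqM _ (by omega), .of_nonneg ?_ ?_⟩
      · exact add_nonneg (add_nonneg (mul_self_nonneg _)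
          (Finset.sum_nonneg fun _ _ => mul_self_nonneg _)) (mul_self_nonneg _)
      · have := hpart (j + 1) (by omega)
        rw [Finset.sum_range_succ, ← add_assoc] at this
        exact this.trans hSM
    · simp only [State.setReg_reg, State.setReg_arr, State.setArr_reg, State.setArr_arr_self,
        Ex.eval_var, Ex.eval_add, Ex.eval_mul, Ex.eval_get, Ex.eval_sub, Ex.eval_lit, e1, e9, e2,
            e3,
        e10, hcast, reduceIte, Nat.reduceEqDiff, e0']
      refine ⟨trivial, (pow_succ _ _).symm, by rw [Finset.sum_range_succ]; ring, ?_, ?_⟩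
      · rw [Function.update_of_ne (by omega), ed]
      · intro i hid hij
        rw [Function.update_apply]
        split_ifs with h
        · have : i = d - 1 - j := by omega
          subst this
          rw [show d - 1 - (d - 1 - j) = j by omega]
        · exact hi i hid (by omega)
  · rintro t ⟨⟨e2, e10, e3, ed, hi⟩, -⟩ -
    refine Tri.nil ⟨e2, ?_, ed, fun i hid => hi i hid (by omega)⟩
    rw [e3, Finset.sum_range_reflect (fun i => c i * c i), hS, Finset.sum_range_succ]
    simp only [sq]
    ring

end IgusaZeta

namespace IgusaZeta

open Ex Program

/-! ### Finding the roots -/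

/-- Horner's scheme for the polynomial of degree at most `m` (variable 5) with coefficients in
array 1, at the point in variable 4: its value (variable 7), the value of its derivative
(variable 8), the intermediate values (array 2). -/
def horner : Program := block [
  assign 7 (lit 0), assign 8 (lit 0), assign 10 (var 5 + lit 1),
  forTo 9 10 (block [
    assign 11 (var 5 - var 9), assign 8 (var 8 * var 4 + var 7),
    assign 7 (var 7 * var 4 + get 1 (var 11)), put 2 (var 11) (var 7)])]

theorem abs_mul_add_le {A x u v : ℤ} {k : ℕ} (hx : |x| + 1 ≤ A) (hu : |u| ≤ A ^ k)
    (hv : |v| ≤ A ^ k) : |u * x| ≤ A ^ (k + 1) ∧ |u * x + v| ≤ A ^ (k + 1) := by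
  have h1 : |u * x| ≤ A ^ k * |x| := by
    rw [abs_mul]; exact mul_le_mul_of_nonneg_right hu (abs_nonneg _)
  have h2 : A ^ k * (|x| + 1) ≤ A ^ k * A :=
    mul_le_mul_of_nonneg_left hx ((abs_nonneg u).trans hu)
  have := abs_add_le (u * x) v
  have := (abs_nonneg u).trans hu
  rw [pow_succ]
  constructor <;> linarith

/-- The value and the derivative of `divX^[i] G` follow from those of `divX^[i + 1] G` by one
multiplication by `x` and one addition. Each such step costs a factor `A ≥ |x| + 1` in the bound;
starting from `A ^ m` for the coefficients, `m + 1` steps lead to `A ^ (2 * m + 1)`. -/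
theorem horner_spec {M m : ℕ} {s : State} {A x : ℤ} {G : ℤ[X]} (hG : G.natDegree ≤ m)
    (hx : |x| + 1 ≤ A) (hA : ∀ i, |G.coeff i| ≤ A ^ m) (hM : A ^ (2 * m + 1) ≤ M)
    (hmM : m + 1 ≤ M) (h4 : s.reg 4 = x) (h5 : s.reg 5 = m)
    (h1 : ∀ i ≤ m, s.arr 1 i = G.coeff i) :
    Tri M horner (60 * (m + 3)) s (fun t => Frame horner s t ∧ t.reg 7 = G.eval x ∧
      t.reg 8 = (derivative G).eval x ∧ ∀ i ≤ m, t.arr 2 i = (divX^[i] G).eval x) := by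
  suffices Tri M horner (60 * (m + 3)) s (fun t => t.reg 7 = G.eval x ∧
      t.reg 8 = (derivative G).eval x ∧ ∀ i ≤ m, t.arr 2 i = (divX^[i] G).eval x) from
    this.frame.imp fun t ht => ⟨ht.2, ht.1⟩
  have hM1 : 1 ≤ M := by omega
  have hA1 : 1 ≤ A := by have := abs_nonneg x; omega
  have hpow : ∀ {z : ℤ} {k : ℕ}, |z| ≤ A ^ k → k ≤ 2 * m + 1 → Within M z := fun h hk =>
    .of_abs (h.trans ((pow_le_pow_right₀ hA1 hk).trans hM))
  refine Tri.assign_cons (by simp) ?_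
  refine Tri.assign_cons (by simp) ?_
  refine Tri.assign_cons ?_ ?_
  · simp [h5, hM1]
    exact .of_nonneg (by omega) (by exact_mod_cast hmM)
  refine Tri.cons (Tri.forTo (c := 40) (I := fun j t =>
      t.reg 7 = (divX^[m + 1 - j] G).eval x ∧ |(divX^[m + 1 - j] G).eval x| ≤ A ^ (m + j) ∧
      t.reg 8 = (derivative (divX^[m + 1 - j] G)).eval x ∧
      |(derivative (divX^[m + 1 - j] G)).eval x| ≤ A ^ (m + j) ∧
      ∀ i ≤ m, m < i + j → t.arr 2 i = (divX^[i] G).eval x) (m + 1) (by simp [h5]) hmM hM1 rfl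
      (fun j t v h => by simpa using h) ?_ ?_) ?_
  · have : 0 ≤ A ^ m := by positivity
    simp [iterate_divX_eq_zero (show G.natDegree < m + 1 by omega), this]
    omega
  · rintro j t hj e9 ⟨e7, b7, e8, b8, e2⟩ hf
    have e5 : t.reg 5 = m := (hf.reg 5 rfl).trans (by simp [h5])
    have e4 : t.reg 4 = x := (hf.reg 4 rfl).trans (by simp [h4])
    have e1 : t.arr 1 ((m - j : ℕ) : ℤ) = G.coeff (m - j) := by
      rw [show t.arr 1 = s.arr 1 from hf.arr 1 rfl]; exact h1 _ (by omega)
    have hcast : (m : ℤ) - j = ((m - j : ℕ) : ℤ) := by omega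
    have hdiv := iterate_divX_eq G (m - j)
    rw [show m - j + 1 = m + 1 - j by omega] at hdiv
    obtain ⟨p1, p2⟩ := abs_mul_add_le hx b8 b7
    have hAj : |G.coeff (m - j)| ≤ A ^ (m + j) :=
      (hA _).trans (pow_le_pow_right₀ hA1 (by omega))
    obtain ⟨p3, p4⟩ := abs_mul_add_le hx b7 hAj
    have q1 : (divX^[m + 1 - (j + 1)] G).eval x =
        (divX^[m + 1 - j] G).eval x * x + G.coeff (m - j) := by
      rw [show m + 1 - (j + 1) = m - j by omega, hdiv]
      simp
    have q2 : (derivative (divX^[m + 1 - (j + 1)] G)).eval x =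
        (derivative (divX^[m + 1 - j] G)).eval x * x + (divX^[m + 1 - j] G).eval x := by
      rw [show m + 1 - (j + 1) = m - j by omega, hdiv]
      simp
    refine Tri.assign_cons ?_ ?_
    · simp [e5, e9]
      exact .of_nonneg (by omega) (by omega)
    refine Tri.assign_cons ?_ ?_
    · simp [e4, e7, e8]
      exact ⟨hpow p1 (by omega), hpow p2 (by omega)⟩
    refine Tri.assign_cons ?_ ?_
    · simp [e4, e5, e7, e9, hcast, e1]
      exact ⟨hpow p3 (by omega), hpow p4 (by omega)⟩
    refine Tri.put_cons (by simp) (by simp) (Tri.nil ?_)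
    simp only [State.setReg_reg, State.setReg_arr, State.setArr_reg, State.setArr_arr_self,
      Ex.eval_var, Ex.eval_add, Ex.eval_mul, Ex.eval_get, Ex.eval_sub, e4, e5, e7, e8, e9, e1,
      hcast, reduceIte, Nat.reduceEqDiff]
    refine ⟨q1.symm, q1 ▸ p4, q2.symm, q2 ▸ p2, fun i him hij => ?_⟩
    rw [Function.update_apply]
    split_ifs with h
    · rw [← q1]
      congr 2
      omega
    · exact e2 i him (by omega)
  · rintro t ⟨⟨e7, -, e8, -, e2⟩, -⟩ -
    rw [Nat.sub_self] at e7 e8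
    exact Tri.nil ⟨e7, e8, fun i hi => e2 i hi (by omega)⟩

end IgusaZeta

/-! ### Newton's iteration with deflation, and the table of roots. -/

namespace IgusaZeta

open Ex Program

/-- Copy the quotient found by Horner's scheme to array 1. -/
def deflate : Program := forTo 9 5 (put 1 (var 9) (get 2 (var 9 + lit 1)))

/-- Record the root in variable 4 (array 3 contains the distinct roots, array 4 their
multiplicities, both from the index 1 on, and variable 6 the number of distinct roots). -/
def record : Program := cond .eq (get 3 (var 6)) (var 4)
  (block [put 4 (var 6) (get 4 (var 6) + lit 1)])
  (block [assign 6 (var 6 + lit 1), put 3 (var 6) (var 4), put 4 (var 6) (lit 1)])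

/-- One step of Newton's iteration, or the deflation if a root is reached. -/
def newton : Program := block [horner,
  cond .eq (var 7) (lit 0) (block [deflate, assign 5 (var 5 - lit 1), record])
    (block [assign 4 (var 4 + (lit 0 - var 7) / var 8)])]

/-- All roots of a monic polynomial with integral roots, in descending order. -/
def findRoots : Program := block [
  -- The start `2 * S` lies to the right of all roots. Entry `0` of array 3 is a sentinel beyond
  -- that, so the first root found never equals the entry before it.
  assign 4 (var 3 + var 3), assign 5 (var 1), assign 6 (lit 0), put 3 (lit 0) (var 4 + lit 1),
  rep .lt (lit 0) (var 5) newton]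

/-- The table of the `r` distinct roots found so far, with their multiplicities, when `rest` are
the roots of the polynomial `g` (of degree `d`) still to be found, none of them beyond `x`. -/
structure RootTable (g : ℤ[X]) (d : ℕ) (B : ℤ) (rest : Multiset ℤ) (r : ℕ) (x : ℤ) (t : State) :
    Prop where
  num : t.reg 6 = r
  le : x ≤ B
  ge : -B ≤ x
  below : ∀ y ∈ rest, y ≤ x
  ge_rest : ∀ y ∈ rest, -B ≤ y
  first : t.arr 3 0 = B + 1
  anti : ∀ i j : ℕ, i < j → j ≤ r → t.arr 3 j < t.arr 3 i
  above : ∀ i : ℕ, i ≤ r → x ≤ t.arr 3 i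
  pos : ∀ i : ℕ, i < r → 0 < t.arr 4 (i + 1 : ℕ)
  sum : ∑ i ∈ Finset.range r, t.arr 4 (i + 1 : ℕ) + rest.card = d
  prod : (∏ i ∈ Finset.range r,
    (X - C (t.arr 3 (i + 1 : ℕ))) ^ (t.arr 4 (i + 1 : ℕ)).toNat) * ofRoots rest = g

namespace RootTable

variable {g : ℤ[X]} {d : ℕ} {B : ℤ} {rest : Multiset ℤ} {r : ℕ} {x x' : ℤ} {s t : State}

theorem congr (h : RootTable g d B rest r x s) (h6 : t.reg 6 = s.reg 6) (h3 : t.arr 3 = s.arr 3)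
    (h4 : t.arr 4 = s.arr 4) : RootTable g d B rest r x t := by
  obtain ⟨a1, a2, a3, a4, a5, a6, a7, a8, a9, a10, a11⟩ := h
  constructor <;> first | assumption | (rw [h6]; assumption) | (simpa only [h3, h4])

/-- The lower bound `-B` survives because some root is left, and it lies between `-B` and the new
point. -/
theorem move (h : RootTable g d B rest r x s) (hx : ∀ y ∈ rest, y ≤ x') (hx' : x' ≤ x)
    (hr : rest ≠ 0) : RootTable g d B rest r x' s := by
  obtain ⟨y, hy⟩ := Multiset.exists_mem_of_ne_zero hr
  obtain ⟨a1, a2, a3, a4, a5, a6, a7, a8, a9, a10, a11⟩ := h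
  exact ⟨a1, by omega, (a5 y hy).trans (hx y hy), hx, a5, a6, a7,
    fun i hi => hx'.trans (a8 i hi), a9, a10, a11⟩

theorem mult_le (h : RootTable g d B rest r x s) {i : ℕ} (hi : i < r) :
    s.arr 4 (i + 1 : ℕ) ≤ d - rest.card := by
  have h1 : s.arr 4 (i + 1 : ℕ) ≤ ∑ i ∈ Finset.range r, s.arr 4 (i + 1 : ℕ) :=
    Finset.single_le_sum (f := fun i : ℕ => s.arr 4 (i + 1 : ℕ))
      (fun i hi => (h.pos i (by simpa using hi)).le) (Finset.mem_range.2 hi)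
  have h2 := h.sum
  omega

theorem num_le (h : RootTable g d B rest r x s) : r + rest.card ≤ d := by
  have h1 := Finset.card_nsmul_le_sum (Finset.range r) (fun i : ℕ => s.arr 4 (i + 1 : ℕ)) 1
    (fun i hi => h.pos i (by simpa using hi))
  have h2 := h.sum
  simp only [Finset.card_range, nsmul_eq_mul, mul_one] at h1
  omega

/-- The roots are found in descending order, so one that has occurred before can only be the last
entry of the table; its multiplicity grows by one. -/
theorem again (h : RootTable g d B (x ::ₘ rest) (r + 1) x s) (hx : s.arr 3 (r + 1 : ℕ) = x) :
    RootTable g d B rest (r + 1) x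
      (s.setArr 4 (r + 1 : ℕ) (s.arr 4 (r + 1 : ℕ) + 1)) := by
  have hne : ∀ i ∈ Finset.range r, Function.update (s.arr 4) ((r + 1 : ℕ) : ℤ)
      (s.arr 4 ((r + 1 : ℕ) : ℤ) + 1) ((i + 1 : ℕ) : ℤ) = s.arr 4 (i + 1 : ℕ) := fun i hi => by
    rw [Finset.mem_range] at hi
    rw [Function.update_of_ne (by omega)]
  obtain ⟨a1, a2, a3, a4, a5, a6, a7, a8, a9, a10, a11⟩ := h
  have e3 : (s.setArr 4 (r + 1 : ℕ) (s.arr 4 (r + 1 : ℕ) + 1)).arr 3 = s.arr 3 := by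
    rw [State.setArr_arr, if_neg (by norm_num)]
  have hpos := a9 r (by omega)
  refine ⟨a1, a2, a3, fun y hy => a4 y (by simp [hy]), fun y hy => a5 y (by simp [hy]),
    by rwa [e3], by rwa [e3], by rwa [e3], ?_, ?_, ?_⟩
  · intro i hi
    rw [State.setArr_arr_self, Function.update_apply]
    split_ifs
    · omega
    · exact a9 i hi
  · rw [Finset.sum_range_succ] at a10
    rw [Finset.sum_range_succ, State.setArr_arr_self, Finset.sum_congr rfl hne,
      Function.update_self, ← a10, Multiset.card_cons]
    push_cast
    ring
  · rw [Finset.prod_range_succ] at a11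
    rw [Finset.prod_range_succ, e3, State.setArr_arr_self, ← a11, Function.update_self,
      Finset.prod_congr rfl fun i hi => by rw [hne i hi], hx, Int.toNat_add hpos.le zero_le_one,
      Int.toNat_one, pow_succ, ofRoots_cons]
    ring

/-- The last entry, which for an empty table is the sentinel, is at least `x` and different from it,
so appending `x` keeps the table strictly decreasing. -/
theorem new (h : RootTable g d B (x ::ₘ rest) r x s) (hx : s.arr 3 r ≠ x)
    (t : State) (h6 : t.reg 6 = (r + 1 : ℕ)) (h3 : t.arr 3 = Function.update (s.arr 3) (r + 1 : ℕ)
        x)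
    (h4 : t.arr 4 = Function.update (s.arr 4) (r + 1 : ℕ) 1) :
    RootTable g d B rest (r + 1) x t := by
  obtain ⟨a1, a2, a3, a4, a5, a6, a7, a8, a9, a10, a11⟩ := h
  have hne : ∀ (f : ℤ → ℤ) (z : ℤ) (i : ℕ), i ∈ Finset.range r →
      Function.update f ((r + 1 : ℕ) : ℤ) z ((i + 1 : ℕ) : ℤ) = f (i + 1 : ℕ) :=
    fun f z i hi => by
      rw [Finset.mem_range] at hi
      rw [Function.update_of_ne (by omega)]
  refine ⟨h6, a2, a3, fun y hy => a4 y (by simp [hy]), fun y hy => a5 y (by simp [hy]), ?_, ?_, ?_,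
    ?_, ?_, ?_⟩
  · rw [h3, Function.update_of_ne (by omega), a6]
  · intro i j hij hj
    rw [h3, Function.update_apply, Function.update_of_ne (by omega)]
    split_ifs with hjr
    · have hir : i ≤ r := by omega
      refine lt_of_lt_of_le (lt_of_le_of_ne (a8 r le_rfl) (Ne.symm hx)) ?_
      rcases hir.lt_or_eq with h | rfl
      · exact (a7 i r h le_rfl).le
      · exact le_rfl
    · exact a7 i j hij (by omega)
  · intro i hi
    rw [h3, Function.update_apply]
    split_ifs with hir
    · exact le_rfl
    · exact a8 i (by omega)
  · intro i hi
    rw [h4, Function.update_apply]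
    split_ifs with hir
    · exact one_pos
    · exact a9 i (by omega)
  · rw [h4, Finset.sum_range_succ, Finset.sum_congr rfl (hne _ _), Function.update_self, ← a10,
      Multiset.card_cons]
    push_cast
    ring
  · rw [h3, h4, Finset.prod_range_succ, Function.update_self, Function.update_self, ← a11,
      Finset.prod_congr rfl fun i hi => by rw [hne _ _ i hi, hne _ _ i hi], ofRoots_cons,
      Int.toNat_one, pow_one, mul_assoc]

end RootTable

/-- By `eval_iterate_divX_X_sub_C_mul` the values in Horner's scheme, shifted by one index, are the
coefficients of the quotient by `X - x`; the value with index `0` is the remainder and is dropped.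
-/
theorem deflate_spec {M m : ℕ} {s : State} {x : ℤ} {rest : Multiset ℤ} (hm : rest.card = m)
    (hM : m + 1 ≤ M) (h5 : s.reg 5 = (m + 1 : ℕ))
    (h2 : ∀ i : ℕ, i ≤ m + 1 → s.arr 2 i = (divX^[i] (ofRoots (x ::ₘ rest))).eval x) :
    Tri M deflate (40 * (m + 3)) s (fun t => Frame deflate s t ∧
      ∀ i : ℕ, i ≤ m → t.arr 1 i = (ofRoots rest).coeff i) := by
  refine Tri.weaken (Tri.imp (Tri.forTo (c := 20) (I := fun j t =>
      ∀ i : ℕ, i < j → t.arr 1 i = (ofRoots rest).coeff i) (m + 1) h5 hM (by omega) rfl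
      (fun j t v h => by simpa using h) (by simp) ?_) ?_) (by omega)
  · rintro j t hj e9 h1 hf
    have e2 : t.arr 2 (j + 1) = (ofRoots rest).coeff j := by
      rw [hf.arr 2 rfl]
      have := h2 (j + 1) (by omega)
      rw [ofRoots_cons, eval_iterate_divX_X_sub_C_mul] at this
      exact_mod_cast this
    refine Tri.weaken (Tri.put (by simp) ?_ ?_) (by simp)
    · simp [e9]
      exact ⟨by omega, .of_nonneg (by omega) (by omega)⟩
    · intro i hi
      simp only [Ex.eval_var, Ex.eval_get, Ex.eval_add, Ex.eval_lit, State.setArr_arr_self, e9, e2,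
        Function.update_apply, Nat.cast_inj]
      split_ifs with hij
      · rw [hij]
      · exact h1 i (by omega)
  · rintro t ⟨h, hf⟩
    exact ⟨hf, fun i hi => h i (by omega)⟩

theorem record_spec {M d r : ℕ} {g : ℤ[X]} {B x : ℤ} {rest : Multiset ℤ} {s : State}
    (h : RootTable g d B (x ::ₘ rest) r x s) (hM : d + 1 ≤ M) (h4 : s.reg 4 = x) :
    Tri M record 50 s (fun t => Frame record s t ∧ ∃ r, RootTable g d B rest r x t) := by
  suffices Tri M record 50 s (fun t => ∃ r, RootTable g d B rest r x t) from
    this.frame.imp fun t ht => ⟨ht.2, ht.1⟩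
  have hle := h.num_le
  rw [Multiset.card_cons] at hle
  refine Tri.weaken (Tri.cond (c₁ := 20) (c₂ := 20) (by simp) (by simp) (fun ht => ?_)
    (fun ht => ?_)) (by simp)
  · simp only [Test.Holds, Ex.eval_get, Ex.eval_var, h.num, h4] at ht
    cases r with
    -- An empty table cannot end in `x`: its last entry is the sentinel `B + 1`.
    | zero =>
      have := h.first
      have := h.le
      simp only [Nat.cast_zero] at ht
      omega
    | succ r =>
      refine Tri.put_cons (by simp) ?_ (Tri.nil ⟨r + 1, ?_⟩)
      · simp [h.num]
        have h1 := h.mult_le (i := r) (by omega)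
        have h2 := h.pos r (by omega)
        rw [Multiset.card_cons] at h1
        push_cast at h1 h2
        exact ⟨by omega, .of_nonneg (by omega) (by omega)⟩
      · have := h.again ht
        simpa [h.num] using this
  · simp only [Test.Holds, Ex.eval_get, Ex.eval_var, h.num, h4] at ht
    refine Tri.assign_cons ?_ ?_
    · simp [h.num]
      exact ⟨by omega, .of_nonneg (by omega) (by omega)⟩
    refine Tri.put_cons (by simp) (by simp) ?_
    refine Tri.put_cons (by simp) (by simp; omega) (Tri.nil ⟨r + 1, h.new ht _ ?_ ?_ ?_⟩)
    · simp [h.num]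
    · simp [h.num, State.setArr_arr, h4]
    · simp [h.num, State.setArr_arr]

/-- One round consumes one unit of potential. If `x` is a root, this is the constant term of its
summand; otherwise it is the drop in `newton_step`. As the remaining roots lie in `[-B, B]`, powers
of `B + 1` bound the coefficients and everything computed by Horner's scheme. -/
theorem newton_spec {M d r : ℕ} {g : ℤ[X]} {B x : ℤ} {rest : Multiset ℤ} {s : State} {k : ℕ}
    (h : RootTable g d B rest r x s) (hB : 0 ≤ B) (hM : (B + 1) ^ (2 * d + 1) ≤ M) (hdM : d + 1 ≤ M)
    (h4 : s.reg 4 = x) (h5 : s.reg 5 = rest.card) (h0 : rest ≠ 0)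
    (h1 : ∀ i : ℕ, i ≤ rest.card → s.arr 1 i = (ofRoots rest).coeff i)
    (hk : potential d rest x ≤ k) :
    Tri M newton (110 * (d + 4)) s (fun t => ∃ j, k = j + 1 ∧
      ∃ rest r x, RootTable g d B rest r x t ∧ t.reg 4 = x ∧ t.reg 5 = rest.card ∧
      (∀ i : ℕ, i ≤ rest.card → t.arr 1 i = (ofRoots rest).coeff i) ∧
      potential d rest x ≤ j) := by
  have hle : rest.card ≤ d := by have := h.num_le; omega
  have hcard : 0 < rest.card := Multiset.card_pos.2 h0
  have hB1 : 1 ≤ B + 1 := by omega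
  have hxB : |x| + 1 ≤ B + 1 := by have := abs_le.2 ⟨h.ge, h.le⟩; omega
  have hyB : ∀ y ∈ rest, |y| + 1 ≤ B + 1 := fun y hy => by
    have := abs_le.2 ⟨h.ge_rest y hy, (h.below y hy).trans h.le⟩
    omega
  have hBM : B + 1 ≤ M := (le_self_pow₀ hB1 (by omega)).trans hM
  refine Tri.cons (horner_spec (natDegree_ofRoots rest).le hxB (abs_coeff_ofRoots_le hyB)
    ((pow_le_pow_right₀ hB1 (by omega)).trans hM) (by omega) h4 h5 h1) ?_
  rintro t ⟨hf, e7, e8, e2⟩ -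
  have e4 : t.reg 4 = x := (hf.reg 4 rfl).trans h4
  have e5 : t.reg 5 = rest.card := (hf.reg 5 rfl).trans h5
  have ht : RootTable g d B rest r x t := h.congr (hf.reg 6 rfl) (hf.arr 3 rfl) (hf.arr 4 rfl)
  refine Tri.cons (Tri.cond (c₁ := 40 * (d + 3) + 60) (c₂ := 20) (by simp) (by simp)
    (fun hz => ?_) (fun hz => ?_)) (fun t ht _ => Tri.nil ht)
  · simp only [Test.Holds, Ex.eval_lit, Ex.eval_var, e7, eval_ofRoots_eq_zero] at hz
    obtain ⟨rest, rfl⟩ := Multiset.exists_cons_of_mem hz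
    rw [Multiset.card_cons] at hle e5 e2
    refine Tri.cons (deflate_spec rfl (by omega) e5 e2) ?_
    rintro u ⟨hf', e1⟩ -
    have ht' := ht.congr (hf'.reg 6 rfl) (hf'.arr 3 rfl) (hf'.arr 4 rfl)
    have e4' : u.reg 4 = x := (hf'.reg 4 rfl).trans e4
    have e5' : u.reg 5 = (rest.card + 1 : ℕ) := (hf'.reg 5 rfl).trans e5
    refine Tri.assign_cons ?_ ?_
    · simp [e5']
      exact ⟨by omega, .of_nonneg (by omega) (by omega)⟩
    refine Tri.cons (record_spec (ht'.congr ?_ rfl rfl) hdM ?_) ?_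
    · simp
    · simpa using e4'
    rintro w ⟨hf'', r', hr'⟩ -
    rw [potential_cons_self] at hk
    have hnn := potential_nonneg d hr'.below
    -- The potential afterwards is nonnegative, so it was at least one before the round.
    have hk0 : k ≠ 0 := by rintro rfl; simp only [Nat.cast_zero] at hk; linarith
    obtain ⟨j, rfl⟩ := Nat.exists_eq_succ_of_ne_zero hk0
    refine Tri.nil ⟨j, rfl, rest, r', x, hr', ?_, ?_, ?_, ?_⟩
    · rw [hf''.reg 4 rfl]; simpa using e4'
    · rw [hf''.reg 5 rfl]; simp [e5']
    · intro i hi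
      rw [hf''.arr 1 rfl]
      simpa using e1 i hi
    · push_cast at hk
      linarith
  · simp only [Test.Holds, Ex.eval_lit, Ex.eval_var, e7, eval_ofRoots_eq_zero] at hz
    obtain ⟨n1, n2, n3, n4⟩ := newton_step h0 hle
      fun y hy => lt_of_le_of_ne (h.below y hy) fun e => hz (e ▸ hy)
    -- The value of the polynomial is in a register already, hence at most `M`. This also bounds its
    -- negative, and the quotient by the derivative, which is at least one.
    refine Tri.bounded fun hb => ?_
    have hm := ht.move n2 n3 h0
    refine Tri.assign_cons ?_ (Tri.nil ?_)
    · have hb7 := hb.reg 7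
      rw [e7] at hb7
      have hr0 : 0 < (ofRoots rest).eval x :=
        eval_ofRoots_pos fun y hy => lt_of_le_of_ne (h.below y hy) fun e => hz (e ▸ hy)
      have hge := hm.ge
      have hle' := hm.le
      have hxle := h.le
      have hxge := h.ge
      simp [e4, e7, e8, n1.ne']
      refine ⟨⟨?_, ?_⟩, ?_⟩
      · obtain ⟨b1, b2⟩ := hb7; constructor <;> omega
      · constructor
        · have : -(M : ℤ) ≤ -(ofRoots rest).eval x := by have := hb7.2; omega
          refine this.trans ?_
          rw [Int.le_ediv_iff_mul_le n1]
          nlinarith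
        · omega
      · exact .of_abs (abs_le.2 ⟨by omega, by omega⟩)
    · have hnn := potential_nonneg d n2
      have hk0 : k ≠ 0 := by rintro rfl; simp only [Nat.cast_zero] at hk; linarith
      obtain ⟨j, rfl⟩ := Nat.exists_eq_succ_of_ne_zero hk0
      refine ⟨j, rfl, rest, r, _, hm.congr ?_ rfl rfl, ?_, ?_, ?_, ?_⟩
      · simp
      · simp [e4, e7, e8]
      · simpa using e5
      · intro i hi
        rw [State.setReg_arr, hf.arr 1 rfl]
        exact h1 i hi
      · push_cast at hk
        linarith

/-- The specification of the root finding program. -/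
theorem findRoots_spec {M d : ℕ} {S : ℤ} {ys : Multiset ℤ} {s : State} {k : ℕ} (hS : 1 ≤ S)
    (hM : (2 * S + 1) ^ (2 * d + 1) ≤ M) (hdM : d + 1 ≤ M) (hd : ys.card = d)
    (hy : ∀ y ∈ ys, |y| ≤ 2 * S) (h1 : s.reg 1 = d) (h3 : s.reg 3 = S)
    (ha : ∀ i : ℕ, i ≤ d → s.arr 1 i = (ofRoots ys).coeff i)
    (hk : d * (2 * d * Real.log (1 + 4 * S) + 1) ≤ k) :
    Tri M findRoots (120 * (d + 4) * (k + 1) + 30) s (fun t => Frame findRoots s t ∧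
      ∃ r x, RootTable (ofRoots ys) d (2 * S) 0 r x t) := by
  suffices Tri M findRoots (120 * (d + 4) * (k + 1) + 30) s (fun t =>
      ∃ r x, RootTable (ofRoots ys) d (2 * S) 0 r x t) from
    this.frame.imp fun t ht => ⟨ht.2, ht.1⟩
  have hSM : 2 * S + 1 ≤ M := (le_self_pow₀ (by omega) (by omega)).trans hM
  have hy' : ∀ y ∈ ys, -(2 * S) ≤ y ∧ y ≤ 2 * S := fun y h => abs_le.1 (hy y h)
  refine Tri.assign_cons ?_ ?_
  · simp [h3]
    constructor <;> omega
  refine Tri.assign_cons (by simp) ?_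
  refine Tri.assign_cons (by simp) ?_
  refine Tri.put_cons (by simp) ?_ ?_
  · simp [h3]
    exact ⟨by omega, by constructor <;> omega⟩
  refine Tri.cons (Tri.rep (k := k) (c := 110 * (d + 4)) (I := fun k t =>
    ∃ rest r x, RootTable (ofRoots ys) d (2 * S) rest r x t ∧ t.reg 4 = x ∧
      t.reg 5 = rest.card ∧ (∀ i : ℕ, i ≤ rest.card → t.arr 1 i = (ofRoots rest).coeff i) ∧
      potential d rest x ≤ k) ?_ ?_ ?_) ?_ ?_
  · refine ⟨ys, 0, 2 * S, ?_, ?_, ?_, ?_, ?_⟩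
    · exact ⟨by simp, le_rfl, by omega, fun y h => (hy' y h).2, fun y h => (hy' y h).1,
        by simp [h3]; ring, fun i j hij hj => by omega,
        fun i hi => by
          obtain rfl : i = 0 := by omega
          simp [h3]
          omega, fun i hi => by omega, by simp [hd], by simp⟩
    · simp [h3]; ring
    · simp [h1, hd]
    · intro i hi
      rw [State.setArr_arr, if_neg (by norm_num)]
      exact ha i (by omega)
    · refine le_trans ?_ hk
      have := potential_le d (D := 4 * S) (fun y h => (hy' y h).2)
        fun y h => by have := (hy' y h).1; omega
      rw [hd] at this
      exact_mod_cast this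
  · intros; simp
  · rintro k t ⟨rest, r, x, hT, e4, e5, e1, hp⟩ - ht
    simp only [Test.Holds, Ex.eval_lit, Ex.eval_var, e5] at ht
    have h0 : rest ≠ 0 := by rintro rfl; simp at ht
    have := newton_spec hT (by omega) hM hdM e4 e5 h0 e1 hp
    cases k with
    | zero =>
      -- `newton_spec` yields `k = j + 1` only in the final state, while the loop rule needs it
      -- before the round. A nonempty `rest` has potential at least one, from the constant term if
      -- `x` is a root and from `newton_step` otherwise.
      exfalso
      have hpos := potential_nonneg d hT.below
      by_cases hx : x ∈ rest
      · obtain ⟨rest, rfl⟩ := Multiset.exists_cons_of_mem hx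
        rw [potential_cons_self, Nat.cast_zero] at hp
        have := potential_nonneg d fun y hy => hT.below y (Multiset.mem_cons_of_mem hy)
        linarith
      · obtain ⟨-, n2, -, n4⟩ := newton_step (d := d) h0 (by have := hT.num_le; omega)
          fun y hy => lt_of_le_of_ne (hT.below y hy) fun e => hx (e ▸ hy)
        have := potential_nonneg d n2
        rw [Nat.cast_zero] at hp
        linarith
    | succ k =>
      refine ⟨k, rfl, this.imp ?_⟩
      rintro u ⟨j, hj, hu⟩
      obtain rfl : k = j := by omega
      exact hu
  · rintro t ⟨⟨k, rest, r, x, hT, e4, e5, e1, hp⟩, ht, -⟩ -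
    simp only [Test.Holds, Ex.eval_lit, Ex.eval_var, e5] at ht
    obtain rfl : rest = 0 := by
      rw [← Multiset.card_eq_zero]; omega
    exact Tri.nil ⟨r, x, hT⟩
  · simp only [Ex.cost_lit, Ex.cost_var, Ex.cost_add]
    have e : (k + 1) * (110 * (d + 4) + (1 + 2) + 1) = 110 * (d + 4) * (k + 1) + 4 * (k + 1) := by
      ring
    have e' : 120 * (d + 4) * (k + 1) = 110 * (d + 4) * (k + 1) + 10 * ((d + 4) * (k + 1)) := by
      ring
    have : k + 1 ≤ (d + 4) * (k + 1) := Nat.le_mul_of_pos_left _ (by omega)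
    omega

end IgusaZeta

namespace IgusaZeta

/-! ### Rational numbers in lowest terms -/

/-- `σ` is the sign of `a`. Cancelling the gcd leaves coprime numbers, and moving the sign to the
numerator makes the denominator positive, as required for `Rat.num` and `Rat.den`. -/
theorem lowest_terms {y a g σ : ℤ} (ha : a ≠ 0) (hσ : σ * a = |a|) (hσ' : σ = 1 ∨ σ = -1)
    (hg : g = Int.gcd |a| y) :
    ((y : ℚ) / a).num = σ * (y / g) ∧ (((y : ℚ) / a).den : ℤ) = |a| / g := by
  have ha' : 0 < |a| := abs_pos.2 ha
  have hg0 : 0 < g := by rw [hg]; exact_mod_cast Int.gcd_pos_of_ne_zero_left _ ha'.ne'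
  obtain ⟨u, hu⟩ : g ∣ |a| := hg ▸ Int.gcd_dvd_left _ _
  obtain ⟨w, hw⟩ : g ∣ y := hg ▸ Int.gcd_dvd_right _ _
  have hu0 : 0 < u := by
    rw [hu] at ha'; exact (pos_iff_pos_of_mul_pos ha').1 hg0
  have hcop : Int.gcd u w = 1 := by
    have h : (Int.gcd (g * u) (g * w) : ℤ) = g := by rw [← hu, ← hw, hg]
    rw [Int.gcd_mul_left, Nat.cast_mul, Int.natCast_natAbs, abs_of_pos hg0] at h
    have : (Int.gcd u w : ℤ) = 1 := by
      apply mul_left_cancel₀ hg0.ne'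
      rw [h, mul_one]
    exact_mod_cast this
  have hcop' : Nat.Coprime (σ * w).natAbs u.natAbs := by
    rw [Int.natAbs_mul, show σ.natAbs = 1 by rcases hσ' with rfl | rfl <;> rfl, one_mul]
    rw [Int.gcd_comm] at hcop
    exact hcop
  have hq : (y : ℚ) / a = ((σ * w : ℤ) : ℚ) / (u : ℤ) := by
    have h1 : (a : ℚ) ≠ 0 := by exact_mod_cast ha
    have h2 : (u : ℚ) ≠ 0 := by exact_mod_cast hu0.ne'
    rw [div_eq_div_iff h1 h2]
    have : y * u = σ * w * a := by
      have h3 : σ * a = g * u := hσ.trans hu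
      rw [hw]
      linear_combination -w * h3
    exact_mod_cast this
  rw [hq, Rat.num_div_eq_of_coprime hu0 hcop', Rat.den_div_eq_of_coprime hu0 hcop', hw, hu,
    Int.mul_ediv_cancel_left _ hg0.ne', Int.mul_ediv_cancel_left _ hg0.ne']
  simp

/-- In lowest terms `p` does not divide both numerator and denominator. The criterion replaces a
condition on valuations by one remainder computation. -/
theorem padicValRat_nonneg_iff (p : ℕ) [hp : Fact p.Prime] (α : ℚ) :
    0 ≤ padicValRat p α ↔ ¬ p ∣ α.den := by
  rw [padicValRat]
  constructor
  · intro h hd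
    have h1 : ¬ (p : ℤ) ∣ α.num := fun h' => by
      have := Nat.dvd_gcd (Int.natCast_dvd.1 h') hd
      rw [Nat.Coprime.gcd_eq_one α.reduced] at this
      exact hp.out.one_lt.ne' (Nat.dvd_one.1 this)
    have h2 : 1 ≤ padicValNat p α.den := one_le_padicValNat_of_dvd α.den_nz hd
    rw [padicValInt.eq_zero_of_not_dvd h1] at h
    omega
  · intro h
    rw [padicValNat.eq_zero_of_not_dvd h]
    omega

theorem padicValNat_le_self (p n : ℕ) : padicValNat p n ≤ n :=
  (padicValNat_le_nat_log n).trans (Nat.log_le_self _ _)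

/-! ### Arrays as lists -/

/-- The entries of the array with indices `0, 1, …` are those of the list. -/
def ArrayIs (f : ℤ → ℤ) (L : List ℤ) : Prop := ∀ i (h : i < L.length), f i = L[i]

theorem ArrayIs.nil (f : ℤ → ℤ) : ArrayIs f [] := fun _ h => by simp at h

theorem ArrayIs.concat {f : ℤ → ℤ} {L : List ℤ} (h : ArrayIs f L) {k : ℤ} (hk : k = L.length)
    (z : ℤ) : ArrayIs (Function.update f k z) (L ++ [z]) := by
  subst hk
  intro i hi
  rw [Function.update_apply, List.getElem_append]
  simp only [List.length_append, List.length_singleton] at hi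
  by_cases hiL : i < L.length
  · rw [if_neg (by omega), dif_pos hiL, h i hiL]
  · rw [if_pos (by omega), dif_neg hiL, List.getElem_singleton]

end IgusaZeta

namespace IgusaZeta

open Ex Program

/-! ### The factorization and the roots that are `p`-adic integers -/

/-- The processing of a root: write numerator, denominator and multiplicity, update the shift
(variable 15), append the root to the arrays 5, 6, 7 if it is a `p`-adic integer. -/
def processRoot : Program := block [
  assign 17 (get 3 (var 9 + lit 1)), assign 18 (get 4 (var 9 + lit 1)),
  assign 20 (var 13), assign 21 (var 17), euclid,
  assign 30 (var 14 * (var 17 / var 22)), assign 31 (var 13 / var 22),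
  write (var 30), write (var 31), write (var 18),
  -- The denominator has positive valuation exactly if the root is not a `p`-adic integer, and the
  -- order of such a root is minus that valuation. So subtracting for all roots accounts for the
  -- product over the non-integral ones.
  assign 20 (var 31), valuation, assign 15 (var 15 - var 18 * var 22),
  cond .eq (var 31 % var 0) (lit 0) (block [])
    (block [put 5 (var 16) (var 30), put 6 (var 16) (var 31), put 7 (var 16) (var 18),
      assign 16 (var 16 + lit 1)])]

/-- Write the factorization, compute the shift (variable 15), select the roots that are `p`-adic
integers (their number is variable 16). -/
def processRoots : Program := block [
  cond .lt (lit 0) (var 2) (block [assign 14 (lit 1)]) (block [assign 14 (lit 0 - lit 1)]),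
  assign 13 (var 14 * var 2), write (var 2), write (var 6),
  assign 20 (var 2), valuation, assign 15 (var 22), assign 16 (lit 0),
  forTo 9 6 processRoot]

/-- The state of the computation after the processing of the roots in the list `F`. -/
structure RootsProcessed (p : ℕ) (a : ℤ) (o : List ℤ) (F : List (ℚ × ℕ)) (t : State) :
    Prop where
  out : t.out = o ++ F.flatMap (fun x => [x.1.num, (x.1.den : ℤ), (x.2 : ℤ)])
  shift : t.reg 15 = padicValInt p a - (F.map fun x => (x.2 * padicValNat p x.1.den : ℤ)).sum
  num : t.reg 16 = (F.filter fun x => decide (0 ≤ padicValRat p x.1)).length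
  arr5 : ArrayIs (t.arr 5) ((F.filter fun x => decide (0 ≤ padicValRat p x.1)).map (·.1.num))
  arr6 : ArrayIs (t.arr 6)
    ((F.filter fun x => decide (0 ≤ padicValRat p x.1)).map (fun x => (x.1.den : ℤ)))
  arr7 : ArrayIs (t.arr 7)
    ((F.filter fun x => decide (0 ≤ padicValRat p x.1)).map (fun x => (x.2 : ℤ)))

/-- The crude estimate of a valuation by the number itself is enough to keep the register of the
shift within `M`. -/
theorem sum_mul_padicValNat_le {p : ℕ} {S : ℤ} {F : List (ℚ × ℕ)}
    (h : ∀ x ∈ F, (x.1.den : ℤ) ≤ S) :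
    (F.map fun x => (x.2 * padicValNat p x.1.den : ℤ)).sum ≤ (F.map Prod.snd).sum * S := by
  induction F with
  | nil => simp
  | cons x F ih =>
    simp only [List.mem_cons, forall_eq_or_imp] at h
    have h1 := ih h.2
    have h2 : (padicValNat p x.1.den : ℤ) ≤ S :=
      (Nat.cast_le.2 (padicValNat_le_self _ _)).trans h.1
    have h3 : (x.2 * padicValNat p x.1.den : ℤ) ≤ x.2 * S := by gcongr
    simp only [List.map_cons, List.sum_cons]
    rw [Nat.cast_add, add_mul]
    linarith

theorem processRoot_spec {M : ℕ} {p : ℕ} [hp : Fact p.Prime] {a y S σ : ℤ} {e : ℕ} {o : List ℤ}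
    {F : List (ℚ × ℕ)} {s : State} {j : ℕ} (h : RootsProcessed p a o F s) (ha : a ≠ 0)
    (haS : |a| ≤ S) (hσ : σ * a = |a|) (hσ' : σ = 1 ∨ σ = -1) (hy : |y| ≤ 2 * S)
    (hF : ∀ x ∈ F, (x.1.den : ℤ) ≤ S) (hM : 2 * S * S + 2 * S ≤ M)
    (hM' : ((F.map Prod.snd).sum + e + 1 : ℤ) * S ≤ M) (hFM : F.length + 1 ≤ M)
    (hjM : j + 1 ≤ M)
    (hpM : p ≤ M) (h0 : s.reg 0 = p) (h13 : s.reg 13 = |a|) (h14 : s.reg 14 = σ)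
    (h9 : s.reg 9 = j) (h3 : s.arr 3 (j + 1) = y) (h4 : s.arr 4 (j + 1) = e) :
    Tri M processRoot (90 * (M.size + 2) + 150) s
      (RootsProcessed p a o (F ++ [((y : ℚ) / a, e)])) := by
  have hS : 1 ≤ S := (Int.one_le_abs ha).trans haS
  have hSM : 2 * S ≤ M := by nlinarith
  have ha' := abs_pos.2 ha
  have hp0 := hp.out.pos
  refine Tri.assign_cons ?_ ?_
  · simp [h9]; exact ⟨by omega, .of_nonneg (by omega) (by omega)⟩
  refine Tri.assign_cons ?_ ?_
  · simp [h9]; exact ⟨by omega, .of_nonneg (by omega) (by omega)⟩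
  refine Tri.assign_cons (by simp) ?_
  refine Tri.assign_cons (by simp) ?_
  refine Tri.cons (euclid_spec |a| y ha' (by simp [h13]) (by simp [h9, h3]) (by nlinarith)) ?_
  rintro t ⟨hf, e22, -⟩ -
  obtain ⟨hnum, hden⟩ := lowest_terms ha hσ hσ' e22.symm.symm
  have hg0 : 0 < t.reg 22 := by
    rw [e22]; exact_mod_cast Int.gcd_pos_of_ne_zero_left _ ha'.ne'
  clear e22
  set α : ℚ := (y : ℚ) / a with hα
  have e0 : t.reg 0 = p := (hf.reg 0 rfl).trans (by simp [h0])
  have e13 : t.reg 13 = |a| := (hf.reg 13 rfl).trans (by simp [h13])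
  have e14 : t.reg 14 = σ := (hf.reg 14 rfl).trans (by simp [h14])
  have e15 : t.reg 15 = s.reg 15 := (hf.reg 15 rfl).trans (by simp)
  have e16 : t.reg 16 = s.reg 16 := (hf.reg 16 rfl).trans (by simp)
  have e17 : t.reg 17 = y := (hf.reg 17 rfl).trans (by simp [h9, h3])
  have e18 : t.reg 18 = e := (hf.reg 18 rfl).trans (by simp [h9, h4])
  have eo : t.out = s.out := hf.out rfl
  have ea : t.arr = s.arr := funext fun k => hf.arr k rfl
  clear hf
  have hd0 : 0 < (α.den : ℤ) := by exact_mod_cast α.den_pos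
  have hdS : (α.den : ℤ) ≤ S := by
    rw [hden]; exact (Int.ediv_le_self _ ha'.le).trans haS
  have hyg : |y / t.reg 22| ≤ 2 * S := (Int.abs_ediv_le_abs _ _).trans hy
  refine Tri.assign_cons ?_ ?_
  · simp [e14, e17, hg0.ne']
    refine ⟨.of_abs (hyg.trans hSM), .of_abs ?_⟩
    rw [abs_mul, show |σ| = 1 by rcases hσ' with rfl | rfl <;> rfl, one_mul]
    exact hyg.trans hSM
  refine Tri.assign_cons ?_ ?_
  · simp [e13, hg0.ne', ← hden]
    exact .of_nonneg hd0.le (by omega)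
  refine Tri.write_cons (by simp) ?_
  refine Tri.write_cons (by simp) ?_
  refine Tri.write_cons (by simp) ?_
  refine Tri.assign_cons (by simp) ?_
  refine Tri.cons (valuation_spec p (α.den : ℤ) hd0.ne' ?_ ?_ ?_ hpM) ?_
  · simp [e0]
  · simp [e13, hden]
  · rw [abs_of_pos hd0]; omega
  rintro u ⟨hf', e22'⟩ -
  rw [padicValInt.of_nat] at e22'
  have f0 : u.reg 0 = p := (hf'.reg 0 rfl).trans (by simp [e0])
  have f15 : u.reg 15 = s.reg 15 := (hf'.reg 15 rfl).trans (by simp [e15])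
  have f16 : u.reg 16 = s.reg 16 := (hf'.reg 16 rfl).trans (by simp [e16])
  have f18 : u.reg 18 = e := (hf'.reg 18 rfl).trans (by simp [e18])
  have f30 : u.reg 30 = α.num := (hf'.reg 30 rfl).trans (by simp [e14, e17, hnum])
  have f31 : u.reg 31 = α.den := (hf'.reg 31 rfl).trans (by simp [e13, hden])
  have fa : u.arr = s.arr := funext fun k => (hf'.arr k rfl).trans (by simp [ea])
  have fo : u.out = s.out ++ [α.num, (α.den : ℤ), (e : ℤ)] := by
    rw [hf'.out rfl]
    simp [eo, e13, e14, e17, e18, ← hnum, ← hden]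
  clear hf'
  have hv : (padicValNat p α.den : ℤ) ≤ S := by
    have := padicValNat_le_self p α.den
    omega
  have hsum : (0 : ℤ) ≤ (F.map fun x => (x.2 * padicValNat p x.1.den : ℤ)).sum :=
    List.sum_nonneg fun z hz => by
      obtain ⟨x, -, rfl⟩ := List.mem_map.1 hz
      positivity
  have hsum' := sum_mul_padicValNat_le (p := p) hF
  have hev : (e * padicValNat p α.den : ℤ) ≤ e * S := by gcongr
  have hev0 : (0 : ℤ) ≤ e * padicValNat p α.den := by positivity
  have hFS : 0 ≤ ((F.map Prod.snd).sum : ℤ) * S := mul_nonneg (Nat.cast_nonneg _) (by omega)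
  have heS : (0 : ℤ) ≤ e * S := mul_nonneg (Nat.cast_nonneg _) (by omega)
  have hva : (padicValInt p a : ℤ) ≤ S := by
    rw [padicValInt]
    refine le_trans ?_ haS
    rw [Int.abs_eq_natAbs]
    exact_mod_cast padicValNat_le_self p a.natAbs
  refine Tri.assign_cons ?_ ?_
  · simp [f15, f18, e22', h.shift]
    exact ⟨.of_nonneg hev0 (by linarith), by linarith, by linarith⟩
  have hmod : (α.den : ℤ) % p = 0 ↔ p ∣ α.den := by
    rw [← Int.dvd_iff_emod_eq_zero, Int.natCast_dvd_natCast]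
  refine Tri.cons (Q₁ := RootsProcessed p a o (F ++ [(α, e)])) (Tri.cond (c₁ := 0) (c₂ := 30)
    ?_ (by simp) (fun hz => ?_) (fun hz => ?_)) (fun t ht _ => Tri.nil ht)
  · simp [f31, f0, hp0.ne']
    exact .of_nonneg (Int.emod_nonneg _ (by omega))
      ((Int.emod_lt_of_pos _ (by omega)).le.trans (by exact_mod_cast hpM))
  · have hdvd : ¬ 0 ≤ padicValRat p α := by
      rw [padicValRat_nonneg_iff, not_not]
      simpa [Test.Holds, f31, f0, hmod] using hz
    refine Tri.nil ⟨?_, ?_, ?_, ?_, ?_, ?_⟩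
    · simp [fo, h.out]
    · simp [f15, f18, e22', h.shift]; ring
    · simp [f16, h.num, hdvd]
    · simpa [fa, hdvd] using h.arr5
    · simpa [fa, hdvd] using h.arr6
    · simpa [fa, hdvd] using h.arr7
  · have hdvd : 0 ≤ padicValRat p α := by
      rw [padicValRat_nonneg_iff]
      simpa [Test.Holds, f31, f0, hmod] using hz
    refine Tri.put_cons (by simp) (by simp) ?_
    refine Tri.put_cons (by simp) (by simp) ?_
    refine Tri.put_cons (by simp) (by simp) ?_
    refine Tri.assign_cons ?_ (Tri.nil ⟨?_, ?_, ?_, ?_, ?_, ?_⟩)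
    · have := List.length_filter_le (fun x : ℚ × ℕ => decide (0 ≤ padicValRat p x.1)) F
      simp only [Ex.ok_add, Ex.ok_var, Ex.ok_lit, Ex.eval_var, Ex.eval_lit,
        State.setArr_reg, State.setReg_reg, Nat.reduceEqDiff, reduceIte, f16, h.num, true_and,
        within_one_iff]
      exact ⟨by omega, .of_nonneg (by omega) (by omega)⟩
    · simp [fo, h.out]
    · simp [f15, f18, e22', h.shift]; ring
    · simp [f16, h.num, hdvd]
    · simpa [fa, f16, f30, hdvd, State.setArr_arr] using h.arr5.concat (by simpa using h.num) α.num
    · simpa [fa, f16, f31, hdvd, State.setArr_arr] using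
        h.arr6.concat (by simpa using h.num) (α.den : ℤ)
    · simpa [fa, f16, f18, hdvd, State.setArr_arr] using
        h.arr7.concat (by simpa using h.num) (e : ℤ)

theorem den_div_le {y a : ℤ} (ha : a ≠ 0) : (((y : ℚ) / a).den : ℤ) ≤ |a| := by
  rw [← Rat.divInt_eq_div]
  exact Int.le_of_dvd (abs_pos.2 ha) ((dvd_abs _ _).2 (Rat.den_dvd y a))

theorem processRoots_spec {M : ℕ} {p : ℕ} [hp : Fact p.Prime] {a S : ℤ} {r d : ℕ} {y : ℕ → ℤ}
    {e : ℕ → ℕ} {s : State} (ha : a ≠ 0) (haS : |a| ≤ S) (hy : ∀ i < r, |y i| ≤ 2 * S)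
    (he : ∑ i ∈ Finset.range r, e i = d) (hrd : r ≤ d) (hM : 2 * S * S + 2 * S ≤ M)
    (hM' : (d + 1 : ℤ) * S ≤ M) (hdM : d + 1 ≤ M) (hpM : p ≤ M) (h0 : s.reg 0 = p)
    (h2 : s.reg 2 = a) (h6 : s.reg 6 = r) (h3 : ∀ i < r, s.arr 3 (i + 1) = y i)
    (h4 : ∀ i < r, s.arr 4 (i + 1) = e i) :
    Tri M processRoots ((r + 1) * (90 * (M.size + 2) + 150 + 20) + (30 * (M.size + 2) + 100)) s
      (fun t => Frame processRoots s t ∧ RootsProcessed p a (s.out ++ [a, (r : ℤ)])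
        ((List.range r).map fun i => ((y i : ℚ) / a, e i)) t) := by
  suffices Tri M processRoots ((r + 1) * (90 * (M.size + 2) + 150 + 20) + (30 * (M.size + 2) +
      100)) s
      (RootsProcessed p a (s.out ++ [a, (r : ℤ)])
        ((List.range r).map fun i => ((y i : ℚ) / a, e i))) from
    this.frame.imp fun t ht => ⟨ht.2, ht.1⟩
  have hS : 1 ≤ S := (Int.one_le_abs ha).trans haS
  have hSM : S ≤ M := by nlinarith
  have ha' := abs_pos.2 ha
  refine Tri.cons (Q₁ := fun t => ∃ σ : ℤ, t.reg 14 = σ ∧ σ * a = |a| ∧ (σ = 1 ∨ σ = -1))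
    (Tri.cond (c₁ := 10) (c₂ := 10) (by simp) (by simp) (fun hz => ?_) (fun hz => ?_)) ?_
  · refine Tri.assign_cons (by simp; omega) (Tri.nil ⟨1, by simp, ?_, .inl rfl⟩)
    rw [one_mul, abs_of_pos (by simpa [Test.Holds, h2] using hz)]
  · refine Tri.assign_cons ?_ (Tri.nil ⟨-1, by simp, ?_, .inr rfl⟩)
    · simp; exact ⟨by omega, by constructor <;> omega⟩
    · rw [neg_one_mul, abs_of_nonpos (by simpa [Test.Holds, h2] using hz)]
  rintro t ⟨σ, e14, hσ, hσ'⟩ hf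
  have e0 : t.reg 0 = p := (hf.reg 0 rfl).trans h0
  have e2 : t.reg 2 = a := (hf.reg 2 rfl).trans h2
  have e6 : t.reg 6 = r := (hf.reg 6 rfl).trans h6
  have ea : t.arr = s.arr := funext fun k => hf.arr k rfl
  have eo : t.out = s.out := hf.out rfl
  clear hf
  refine Tri.assign_cons ?_ ?_
  · simp [e14, e2, hσ]
    exact .of_nonneg ha'.le (haS.trans hSM)
  refine Tri.write_cons (by simp) ?_
  refine Tri.write_cons (by simp) ?_
  refine Tri.assign_cons (by simp) ?_
  refine Tri.cons (valuation_spec p a ha ?_ ?_ (haS.trans hSM) hpM) ?_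
  · simp [e0]
  · simp [e2]
  rintro u ⟨hf, e22⟩ -
  have f0 : u.reg 0 = p := (hf.reg 0 rfl).trans (by simp [e0])
  have f6 : u.reg 6 = r := (hf.reg 6 rfl).trans (by simp [e6])
  have f13 : u.reg 13 = |a| := (hf.reg 13 rfl).trans (by simp [e14, e2, hσ])
  have f14 : u.reg 14 = σ := (hf.reg 14 rfl).trans (by simp [e14])
  have fa : u.arr = s.arr := funext fun k => (hf.arr k rfl).trans (by simp [ea])
  have fo : u.out = s.out ++ [a, (r : ℤ)] := by
    rw [hf.out rfl]; simp [eo, e2, e6]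
  clear hf
  refine Tri.assign_cons (by simp) ?_
  refine Tri.assign_cons (by simp) ?_
  refine Tri.cons (Tri.forTo (c := 90 * (M.size + 2) + 150) (I := fun j =>
    RootsProcessed p a (s.out ++ [a, (r : ℤ)])
      ((List.range j).map fun i => ((y i : ℚ) / a, e i))) r (by simp [f6]) (by omega) (by omega)
      rfl ?_ ?_ ?_) ?_
  · rintro j t v ⟨i1, i2, i3, i4, i5, i6⟩
    exact ⟨i1, by simpa using i2, by simpa using i3, i4, i5, i6⟩
  · refine ⟨by simp [fo], by simp [e22], by simp, ?_, ?_, ?_⟩ <;> exact ArrayIs.nil _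
  · rintro j t hj e9 hI hf
    have hsum : (((List.range j).map fun i => ((y i : ℚ) / a, e i)).map Prod.snd).sum =
        ∑ i ∈ Finset.range j, e i := by
      rw [List.map_map, ← List.sum_toFinset _ List.nodup_range, List.toFinset_range]
      rfl
    have hle : ∑ i ∈ Finset.range j, e i + e j ≤ d := by
      rw [← Finset.sum_range_succ, ← he]
      exact Finset.sum_le_sum_of_subset (by simpa using hj)
    have hle' : ((∑ i ∈ Finset.range j, e i : ℕ) + e j + 1 : ℤ) ≤ d + 1 := by
      have := Nat.succ_le_succ hle
      exact_mod_cast this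
    have := processRoot_spec (M := M) (j := j) (y := y j) (e := e j) (S := S) (σ := σ) hI ha haS
      hσ hσ' (hy j hj) ?_ hM ?_ ?_ (by omega) hpM ((hf.reg 0 rfl).trans (by simp [f0]))
      ((hf.reg 13 rfl).trans (by simp [f13])) ((hf.reg 14 rfl).trans (by simp [f14])) e9
      ?_ ?_
    · rw [List.range_succ, List.map_append]
      exact this
    · simp only [List.mem_map, forall_exists_index, and_imp]
      rintro _ i - rfl
      exact (den_div_le ha).trans haS
    · rw [hsum]
      exact (mul_le_mul_of_nonneg_right hle' (by omega)).trans hM'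
    · simp
      omega
    · rw [hf.arr 3 rfl]
      simpa [fa] using h3 j hj
    · rw [hf.arr 4 rfl]
      simpa [fa] using h4 j hj
  · exact fun t ht _ => Tri.nil ht.1

end IgusaZeta

namespace IgusaZeta

open Ex Program

/-! ### The depth and the residues -/

/-- Compute `l` (variable 19) from the numerators (array 5) and denominators (array 6). -/
def findDepth : Program := block [
  assign 19 (lit 1),
  forTo 9 16 (forTo 10 9 (block [
    assign 20 (get 5 (var 9) * get 6 (var 10) - get 5 (var 10) * get 6 (var 9)), valuation,
    cond .lt (var 19) (var 22 + lit 1) (block [assign 19 (var 22 + lit 1)]) (block [])]))]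

/-- The order of `α - β`, for `p`-adic integers `α` and `β`. -/
def pairOrder (p : ℕ) (α β : ℚ) : ℕ := padicValInt p (α.num * β.den - β.num * α.den)

/-- For `p`-adic integers the denominators are prime to `p`, so the order of a difference is that of
the integer `n_i * d_j - n_j * d_i`, nonzero as the roots are distinct. By symmetry pairs with `j <
i` suffice; a running maximum starts from `l = 1`. -/
theorem findDepth_spec {M : ℕ} {p : ℕ} [hp : Fact p.Prime] {q : ℕ} {T : ℤ} {α : ℕ → ℚ} {s : State}
    (hα : ∀ i < q, ∀ j < i, α i ≠ α j) (hN : ∀ i < q, |(α i).num| ≤ T)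
    (hD : ∀ i < q, ((α i).den : ℤ) ≤ T) (hM : 2 * T * T + 1 ≤ M) (hqM : q ≤ M) (hpM : p ≤ M)
    (h0 : s.reg 0 = p) (h16 : s.reg 16 = q) (h5 : ∀ i < q, s.arr 5 i = (α i).num)
    (h6 : ∀ i < q, s.arr 6 i = (α i).den) :
    Tri M findDepth ((q + 1) * ((q + 1) * ((30 * (M.size + 2) + 60) + 20) + 20) + 10) s
      (fun t => Frame findDepth s t ∧ t.reg 19 = ((1 + (Finset.range q).sup fun i =>
        (Finset.range i).sup fun j => pairOrder p (α i) (α j) : ℕ) : ℤ)) := by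
  suffices Tri M findDepth ((q + 1) * ((q + 1) * ((30 * (M.size + 2) + 60) + 20) + 20) + 10) s
      (fun t => t.reg 19 = ((1 + (Finset.range q).sup fun i =>
        (Finset.range i).sup fun j => pairOrder p (α i) (α j) : ℕ) : ℤ)) from
    this.frame.imp fun t ht => ⟨ht.2, ht.1⟩
  have hT : 0 ≤ 2 * T * T := by nlinarith [mul_self_nonneg T]
  have hM1 : 1 ≤ M := by omega
  refine Tri.assign_cons (by simpa using hM1) ?_
  refine Tri.cons (Tri.forTo (c := (q + 1) * ((30 * (M.size + 2) + 60) + 20)) (I := fun k t =>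
      t.reg 19 = ((1 + (Finset.range k).sup fun i =>
        (Finset.range i).sup fun j => pairOrder p (α i) (α j) : ℕ) : ℤ)) q (by simp [h16]) hqM hM1
      rfl (fun j t v h => by simpa using h) (by simp) ?_) (fun t ht _ => Tri.nil ht.1)
  rintro i t hi e9 e19 hf
  have e0 : t.reg 0 = p := (hf.reg 0 rfl).trans (by simp [h0])
  have e5 : t.arr 5 = s.arr 5 := hf.arr 5 rfl
  have e6 : t.arr 6 = s.arr 6 := hf.arr 6 rfl
  refine Tri.weaken (Tri.imp (Tri.forTo (c := 30 * (M.size + 2) + 60) (I := fun k t =>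
      t.reg 19 = ((1 + (((Finset.range i).sup fun i =>
        (Finset.range i).sup fun j => pairOrder p (α i) (α j)) ⊔
        (Finset.range k).sup fun j => pairOrder p (α i) (α j)) : ℕ) : ℤ)) i e9 (by omega) hM1
      rfl (fun j t v h => by simpa using h) (by simpa using e19) ?_) ?_)
      (Nat.mul_le_mul_right _ (by omega))
  · rintro j u hj e10 e19' hf'
    have f0 : u.reg 0 = p := (hf'.reg 0 rfl).trans e0
    have f9 : u.reg 9 = i := (hf'.reg 9 rfl).trans e9
    have f5 : u.arr 5 = s.arr 5 := (hf'.arr 5 rfl).trans e5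
    have f6 : u.arr 6 = s.arr 6 := (hf'.arr 6 rfl).trans e6
    have b1 : |(α i).num * (α j).den| ≤ T * T := by
      rw [abs_mul, Nat.abs_cast]
      have := (abs_nonneg _).trans (hN i hi)
      gcongr
      exacts [hN i hi, hD j (hj.trans hi)]
    have b2 : |(α j).num * (α i).den| ≤ T * T := by
      rw [abs_mul, Nat.abs_cast]
      have := (abs_nonneg _).trans (hN i hi)
      gcongr
      exacts [hN j (hj.trans hi), hD i hi]
    have b3 := (abs_sub ((α i).num * (α j).den) ((α j).num * (α i).den)).trans (add_le_add b1 b2)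
    have hne : (α i).num * (α j).den - (α j).num * (α i).den ≠ 0 :=
      sub_ne_zero.2 fun h => hα i hi j hj (Rat.eq_iff_mul_eq_mul.2 h)
    refine Tri.assign_cons ?_ ?_
    · simp [e10, f9, f5, f6, h5 i hi, h6 i hi, h5 j (hj.trans hi), h6 j (hj.trans hi)]
      exact ⟨.of_abs (by linarith), .of_abs (by linarith), .of_abs (by linarith)⟩
    refine Tri.cons (valuation_spec p _ hne ?_ ?_ (by linarith) hpM) ?_
    · simp [f0]
    · simp [e10, f9, f5, f6, h5 i hi, h6 i hi, h5 j (hj.trans hi), h6 j (hj.trans hi)]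
    rintro w ⟨hf'', e22⟩ -
    have g19 : w.reg 19 = u.reg 19 := (hf''.reg 19 rfl).trans (by simp)
    have hv : (padicValInt p ((α i).num * (α j).den - (α j).num * (α i).den) : ℤ) + 1 ≤ M := by
      have : (padicValInt p ((α i).num * (α j).den - (α j).num * (α i).den) : ℤ) ≤
          |(α i).num * (α j).den - (α j).num * (α i).den| := by
        rw [Int.abs_eq_natAbs]
        exact_mod_cast padicValNat_le_self p _
      linarith
    rw [Finset.range_add_one, Finset.sup_insert]
    refine Tri.cons (Tri.cond (c₁ := 10) (c₂ := 0) (by simp) ?_ (fun hz => ?_) (fun hz => ?_))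
      (fun t ht _ => Tri.nil ht)
    · simp [e22]
      exact ⟨hM1, .of_nonneg (by positivity) hv⟩
    · refine Tri.assign_cons ?_ (Tri.nil ?_)
      · simp [e22]
        exact ⟨hM1, .of_nonneg (by positivity) hv⟩
      · simp only [Test.Holds, Ex.eval_var, Ex.eval_add, Ex.eval_lit, g19, e19', e22] at hz
        simp only [State.setReg_reg, Ex.eval_var, Ex.eval_add, Ex.eval_lit, e22, reduceIte]
        rw [← pairOrder] at hz ⊢
        norm_cast at hz ⊢
        omega
    · refine Tri.nil ?_
      simp only [Test.Holds, Ex.eval_var, Ex.eval_add, Ex.eval_lit, g19, e19', e22] at hz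
      rw [g19, e19']
      rw [← pairOrder] at hz
      norm_cast at hz ⊢
      omega
  · rintro u ⟨hu, -⟩
    rw [hu, Finset.range_add_one, Finset.sup_insert, sup_comm]

/-- Compute the power `p ^ (l + 1)` (variable 29), write the shift and `l`. -/
def findModulus : Program := block [
  write (var 15), write (var 19), assign 29 (var 0), forTo 9 19 (assign 29 (var 29 * var 0)),
  assign 32 (var 19 + lit 1)]

theorem findModulus_spec {M p l : ℕ} {s : State} (hp : 1 ≤ p) (hM : p ^ (l + 1) ≤ M)
    (hlM : l + 1 ≤ M) (h0 : s.reg 0 = p) (h19 : s.reg 19 = l) :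
    Tri M findModulus ((l + 1) * (10 + 20) + 50) s (fun t => Frame findModulus s t ∧
      t.reg 29 = (p ^ (l + 1) : ℕ) ∧ t.reg 32 = (l + 1 : ℕ) ∧
      t.out = s.out ++ [s.reg 15, (l : ℤ)]) := by
  suffices Tri M findModulus ((l + 1) * (10 + 20) + 50) s (fun t =>
      t.reg 29 = (p ^ (l + 1) : ℕ) ∧ t.reg 32 = (l + 1 : ℕ) ∧
      t.out = s.out ++ [s.reg 15, (l : ℤ)]) from
    this.frame.imp fun t ht => ⟨ht.2, ht.1⟩
  have hM1 : 1 ≤ M := by omega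
  refine Tri.write_cons (by simp) ?_
  refine Tri.write_cons (by simp) ?_
  refine Tri.assign_cons (by simp) ?_
  refine Tri.cons (Tri.forTo (c := 10) (I := fun k t => t.reg 29 = (p ^ (k + 1) : ℕ)) l
    (by simp [h19]) (by omega) hM1 rfl (fun j t v h => by simpa using h) (by simp [h0]) ?_) ?_
  · rintro j t hj e9 e29 hf
    have e0 : t.reg 0 = p := (hf.reg 0 rfl).trans (by simp [h0])
    refine Tri.weaken (Tri.assign ?_ ?_) (by simp)
    · simp only [Ex.ok_mul, Ex.ok_var, Ex.eval_var, true_and, e29, e0]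
      rw [← Nat.cast_mul, ← pow_succ]
      exact .natCast ((Nat.pow_le_pow_right hp (by omega)).trans hM)
    · simp [e29, e0, pow_succ]
  · rintro t ⟨e29, hf⟩ -
    have e19 : t.reg 19 = l := (hf.reg 19 rfl).trans (by simp [h19])
    refine Tri.assign_cons ?_ (Tri.nil ⟨by simp [e29], by simp [e19], ?_⟩)
    · simp [e19]
      exact ⟨hM1, .of_nonneg (by omega) (by omega)⟩
    · rw [State.setReg_out, hf.out rfl]
      simp [h19]

/-- Compute the residues modulo `p ^ (l + 1)` of the roots (array 8), write their digits. -/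
def findResidues : Program := forTo 9 16 (block [
  assign 20 (var 29), assign 21 (get 6 (var 9)), euclid,
  assign 30 (get 5 (var 9) * var 23 % var 29), put 8 (var 9) (var 30),
  forTo 10 32 (block [write (var 30 % var 0), assign 30 (var 30 / var 0)])])

/-- `z` is an inverse of the denominator modulo `p ^ m`, so the class of `α` is that of `α.num * z`.
-/
theorem val_residue {p m : ℕ} {α : ℚ} [hp : Fact p.Prime] (hα : ¬ p ∣ α.den) {z : ℤ}
    (hz : ((p ^ m : ℕ) : ℤ) ∣ z * α.den - 1) :
    ((residue p m α).val : ℤ) = α.num * z % (p ^ m : ℕ) := by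
  have hcop : Nat.Coprime α.den (p ^ m) :=
    Nat.Coprime.pow_right _ ((Nat.Prime.coprime_iff_not_dvd hp.out).2 hα).symm
  have : (residue p m α) = ((α.num * z : ℤ) : ZMod (p ^ m)) := by
    have h1 : ((z * α.den - 1 : ℤ) : ZMod (p ^ m)) = 0 :=
      (ZMod.intCast_zmod_eq_zero_iff_dvd _ _).2 hz
    have h2 : (α.den : ZMod (p ^ m)) * (α.den : ZMod (p ^ m))⁻¹ = 1 :=
      ZMod.coe_mul_inv_eq_one _ hcop
    push_cast at h1 ⊢
    rw [residue]
    linear_combination (α.num : ZMod (p ^ m)) * (z * h2 - (α.den : ZMod (p ^ m))⁻¹ * h1)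
  rw [this]
  have : NeZero (p ^ m) := ⟨pow_ne_zero _ hp.out.ne_zero⟩
  exact ZMod.val_intCast _

/-- The denominators are coprime to `p ^ (l + 1)`, so the cofactor found by `euclid` inverts them.
The digits of the residue then come off by repeated division by `p`. -/
theorem findResidues_spec {M p q l : ℕ} [hp : Fact p.Prime] {T : ℤ} {α : ℕ → ℚ} {s : State}
    (hα : ∀ i < q, ¬ p ∣ (α i).den) (hN : ∀ i < q, |(α i).num| ≤ T)
    (hM : (p ^ (l + 1) : ℤ) * p ^ (l + 1) + p ^ (l + 1) ≤ M) (hTM : T * p ^ (l + 1) ≤ M)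
    (hqM : q ≤ M) (hlM : l + 1 ≤ M) (h0 : s.reg 0 = p) (h16 : s.reg 16 = q)
    (h29 : s.reg 29 = (p ^ (l + 1) : ℕ)) (h32 : s.reg 32 = (l + 1 : ℕ))
    (h5 : ∀ i < q, s.arr 5 i = (α i).num) (h6 : ∀ i < q, s.arr 6 i = (α i).den) :
    Tri M findResidues
      ((q + 1) * ((60 * (M.size + 2) + 40 + (l + 2) * (20 + 20)) + 20)) s
      (fun t => (∀ i < q, t.arr 8 i = (residue p (l + 1) (α i)).val) ∧
        t.out = s.out ++ (List.range q).flatMap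
          (fun i => (digits p (l + 1) (α i)).map (Nat.cast : ℕ → ℤ))) := by
  have hP : 0 < p ^ (l + 1) := pow_pos hp.out.pos _
  have hP' : (0 : ℤ) < ((p ^ (l + 1) : ℕ) : ℤ) := by exact_mod_cast hP
  have hp' : (0 : ℤ) < p := by exact_mod_cast hp.out.pos
  have hPM : ((p ^ (l + 1) : ℕ) : ℤ) ≤ M := by push_cast; nlinarith
  have hpM : (p : ℤ) ≤ M := by
    refine le_trans ?_ hPM
    exact_mod_cast Nat.le_self_pow (by omega) p
  have : NeZero (p ^ (l + 1)) := ⟨hP.ne'⟩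
  refine Tri.imp (Tri.forTo (I := fun k t =>
    (∀ i : ℕ, i < k → t.arr 8 i = (residue p (l + 1) (α i)).val) ∧
      t.out = s.out ++ (List.range k).flatMap
        (fun i => (digits p (l + 1) (α i)).map (Nat.cast : ℕ → ℤ))) q h16 hqM (by omega) rfl
    (fun j t v h => by simpa using h) (by simp) ?_) (fun t ht => ht.1)
  rintro i t hi e9 ⟨e8, eo⟩ hf
  have e0 : t.reg 0 = p := (hf.reg 0 rfl).trans h0
  have e29 : t.reg 29 = (p ^ (l + 1) : ℕ) := (hf.reg 29 rfl).trans h29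
  have e32 : t.reg 32 = (l + 1 : ℕ) := (hf.reg 32 rfl).trans h32
  have e5 : t.arr 5 i = (α i).num := by rw [hf.arr 5 rfl, h5 i hi]
  have e6 : t.arr 6 i = (α i).den := by rw [hf.arr 6 rfl, h6 i hi]
  refine Tri.assign_cons (by simp) ?_
  refine Tri.assign_cons (by simp) ?_
  refine Tri.cons (euclid_spec _ ((α i).den : ℤ) hP' (by simp [e29]) (by simp [e9, e6])
    (by push_cast; exact hM)) ?_
  rintro u ⟨hf', -, hs0, hs1, hs⟩ -
  rw [Int.gcd_natCast_natCast, Nat.Coprime.gcd_eq_one (Nat.Coprime.pow_left _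
    ((Nat.Prime.coprime_iff_not_dvd hp.out).2 (hα i hi))), Nat.cast_one] at hs
  have hres := val_residue (hα i hi) hs
  have f0 : u.reg 0 = p := (hf'.reg 0 rfl).trans (by simp [e0])
  have f9 : u.reg 9 = i := (hf'.reg 9 rfl).trans (by simp [e9])
  have f29 : u.reg 29 = (p ^ (l + 1) : ℕ) := (hf'.reg 29 rfl).trans (by simp [e29])
  have f32 : u.reg 32 = (l + 1 : ℕ) := (hf'.reg 32 rfl).trans (by simp [e32])
  have fa : u.arr = t.arr := funext fun k => (hf'.arr k rfl).trans (by simp)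
  have fo : u.out = t.out := (hf'.out rfl).trans (by simp)
  have hdig : digits p (l + 1) (α i) =
      (List.range (l + 1)).map fun j => (residue p (l + 1) (α i)).val / p ^ j % p := rfl
  have hRlt := (residue p (l + 1) (α i)).val_lt
  generalize hR : (residue p (l + 1) (α i)).val = R at hres hdig hRlt
  have hRM : (R : ℤ) ≤ M := le_trans (by exact_mod_cast hRlt.le) hPM
  refine Tri.assign_cons ?_ ?_
  · simp only [Ex.ok_mod, Ex.ok_mul, Ex.ok_var, Ex.ok_get, Ex.eval_mul, Ex.eval_get, Ex.eval_var,
      f9, f29, fa, e5, ← hres, true_and]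
    refine ⟨.of_abs ?_, .natCast (by exact_mod_cast hRM), hP'.ne'⟩
    rw [abs_mul, abs_of_nonneg hs0]
    refine le_trans ?_ hTM
    have h1 := hN i hi
    have := (abs_nonneg _).trans h1
    have h2 : u.reg 23 ≤ p ^ (l + 1) := by exact_mod_cast hs1
    gcongr
  refine Tri.put_cons (by simp) (by simp) ?_
  refine Tri.cons (Tri.forTo (c := 20) (I := fun k w => w.reg 30 = (R / p ^ k : ℕ) ∧
      w.out = u.out ++ (List.range k).map (fun j => ((R / p ^ j % p : ℕ) : ℤ))) (l + 1)
      (by simp [f32]) hlM (by omega) rfl (fun j t v h => by simpa using h)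
      ?_ ?_) ?_
  · simp only [State.setArr_reg, State.setReg_reg, Ex.eval_mod, Ex.eval_mul, Ex.eval_get,
      Ex.eval_var, f9, f29, fa, e5, ← hres]
    simp
  · rintro j w hj e10 ⟨g30, go⟩ hg
    have g0 : w.reg 0 = p := (hg.reg 0 rfl).trans (by simp [f0])
    refine Tri.write_cons ?_ ?_
    · simp only [Ex.ok_mod, Ex.ok_var, Ex.eval_var, true_and, g30, g0]
      exact ⟨.of_nonneg (Int.emod_nonneg _ hp'.ne') ((Int.emod_lt_of_pos _ hp').le.trans hpM),
        hp'.ne'⟩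
    refine Tri.assign_cons ?_ (Tri.nil ⟨?_, ?_⟩)
    · simp only [Ex.ok_div, Ex.ok_var, Ex.eval_var, true_and, State.emit_reg, g30, g0]
      rw [← Int.natCast_ediv]
      refine ⟨.natCast ?_, hp'.ne'⟩
      exact ((Nat.div_le_self _ _).trans (Nat.div_le_self _ _)).trans (by exact_mod_cast hRM)
    · simp only [State.setReg_reg, State.emit_reg, Ex.eval_div, Ex.eval_var, g30, g0, reduceIte]
      rw [← Int.natCast_ediv, Nat.div_div_eq_div_mul, pow_succ]
    · simp [go, List.range_succ, g30, g0]
  · rintro w ⟨⟨-, go⟩, hg⟩ -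
    refine Tri.nil ⟨fun k hk => ?_, ?_⟩
    · rw [hg.arr 8 rfl]
      simp only [State.setArr_arr_self, State.setReg_reg, Ex.eval_mod, Ex.eval_mul, Ex.eval_get,
        Ex.eval_var, State.setReg_arr, f9, f29, fa, e5, ← hres, Function.update_apply, Nat.cast_inj,
        Nat.reduceEqDiff, reduceIte]
      split_ifs with hki
      · rw [hki, hR]
      · exact e8 k (by omega)
    · rw [go, fo, eo, List.range_succ (n := i), List.flatMap_append, List.flatMap_singleton, hdig,
        List.map_map, List.append_assoc]
      rfl

end IgusaZeta

namespace IgusaZeta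

open Ex Program

/-! ### The tree -/

/-- Variable 42 becomes the sum of the multiplicities of the roots congruent to variable 41 modulo
variable 40. -/
def classWeight : Program := block [
  assign 42 (lit 0),
  forTo 43 16 (cond .eq (get 8 (var 43) % var 40) (var 41 % var 40)
    (block [assign 42 (var 42 + get 7 (var 43))]) (block []))]

/-- The weights of the reductions of the residue class of variable 41 modulo `p ^ m`, where `m` is
variable 33: the last weight (variable 42), their sum (variable 44), the number of those equal to
one (variable 45). -/
def pathWeights : Program := block [
  assign 42 (lit 0), assign 44 (lit 0), assign 45 (lit 0), assign 40 (lit 1),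
  forTo 46 33 (block [
    assign 40 (var 40 * var 0), classWeight, assign 44 (var 44 + var 42),
    cond .eq (var 42) (lit 1) (block [assign 45 (var 45 + lit 1)]) (block [])])]

/-- Variable 49 becomes one if no root before the one with the number in variable 47 is congruent
to it modulo variable 48, and zero otherwise. -/
def testFirst : Program := block [
  assign 49 (lit 1),
  forTo 50 47 (cond .eq (get 8 (var 50) % var 48) (get 8 (var 47) % var 48)
    (block [assign 49 (lit 0)]) (block []))]

/-- Variable 51 becomes the number of children of the vertex of level `m` (variable 33) given by
the residue in variable 41 modulo `p ^ m` (variable 34). -/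
def countChildren : Program := block [
  assign 51 (lit 0),
  cond .le (var 33) (var 19)
    (block [assign 48 (var 34 * var 0),
      forTo 47 16 (cond .eq (get 8 (var 47) % var 34) (var 41)
        (block [testFirst, assign 51 (var 51 + var 49)]) (block []))])
    (block [])]

/-! ### The data of the tree as functions of the residues of the roots. -/

section functions

variable (p l q : ℕ) (R e : ℕ → ℕ)

/-- The sum of the `e j` with `R j` congruent to `z` modulo `n`. -/
def classSum (n z : ℕ) : ℕ := ∑ j ∈ Finset.range q, if R j % n = z % n then e j else 0

/-- No earlier member of the sequence is congruent modulo `n`. -/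
def IsFirst (n j : ℕ) : Prop := ∀ h < j, R h % n ≠ R j % n

instance (n j : ℕ) : Decidable (IsFirst R n j) := Nat.decidableBallLT _ _

/-- The weight, in terms of residues. -/
def weightN (m z : ℕ) : ℕ := if m = 0 then 0 else classSum q R e (p ^ m) z

/-- The sum of the weights on the path to the root, in terms of residues. -/
def pathSum (m z : ℕ) : ℕ := ∑ k ∈ Finset.range m, classSum q R e (p ^ (k + 1)) z

/-- The number of vertices of weight one on the path to the root, in terms of residues. -/
def pathOnes (m z : ℕ) : ℕ :=
  ∑ k ∈ Finset.range m, if classSum q R e (p ^ (k + 1)) z = 1 then 1 else 0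

/-- The number of children, in terms of residues. -/
def childrenN (m z : ℕ) : ℕ := if m ≤ l then
  ∑ j ∈ Finset.range q, if R j % p ^ m = z ∧ IsFirst R (p ^ (m + 1)) j then 1 else 0 else 0

end functions

/-- The arrays and variables on which the treatment of the tree is based: there are `q` roots,
with residues `R j` and multiplicities `e j`. -/
structure TreeData (p l q : ℕ) (R e : ℕ → ℕ) (s : State) : Prop where
  reg0 : s.reg 0 = p
  reg16 : s.reg 16 = q
  reg19 : s.reg 19 = l
  reg32 : s.reg 32 = (l + 1 : ℕ)
  arr7 : ∀ j < q, s.arr 7 j = e j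
  arr8 : ∀ j < q, s.arr 8 j = R j

/-- Variable `i` is register `2 * i`: the registers `32`, `38` and `64` are the variables `16`, `19`
and `32`. -/
theorem TreeData.of_frame {p l q : ℕ} {R e : ℕ → ℕ} {P : Program} {s t : State}
    (h : TreeData p l q R e s) (hf : Frame P s t)
    (hP : (P.writesReg 0 || P.writesReg 32 || P.writesReg 38 || P.writesReg 64 || P.writesArr 7 ||
      P.writesArr 8) = false) : TreeData p l q R e t := by
  simp only [Bool.or_eq_false_iff] at hP
  obtain ⟨⟨⟨⟨⟨h1, h2⟩, h3⟩, h4⟩, h5⟩, h6⟩ := hP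
  exact ⟨(hf.reg 0 h1).trans h.reg0, (hf.reg 16 h2).trans h.reg16, (hf.reg 19 h3).trans h.reg19,
    (hf.reg 32 h4).trans h.reg32, hf.arr 7 h5 ▸ h.arr7, hf.arr 8 h6 ▸ h.arr8⟩

theorem TreeData.setReg {p l q : ℕ} {R e : ℕ → ℕ} {s : State} (h : TreeData p l q R e s) {i : ℕ}
    {z : ℤ} (hi : (i == 0 || i == 16 || i == 19 || i == 32) = false) :
    TreeData p l q R e (s.setReg i z) := by
  simp only [Bool.or_eq_false_iff, beq_eq_false_iff_ne] at hi
  obtain ⟨⟨⟨h1, h2⟩, h3⟩, h4⟩ := hi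
  exact ⟨by rw [State.setReg_reg, if_neg h1.symm, h.reg0],
    by rw [State.setReg_reg, if_neg h2.symm, h.reg16],
    by rw [State.setReg_reg, if_neg h3.symm, h.reg19],
    by rw [State.setReg_reg, if_neg h4.symm, h.reg32], h.arr7, h.arr8⟩

/-- The bounds needed for the treatment of the tree. -/
structure TreeBounds (M p l q d : ℕ) (R e : ℕ → ℕ) : Prop where
  p_pos : 0 < p
  sum : ∑ j ∈ Finset.range q, e j ≤ d
  power : p ^ (l + 1) ≤ M
  weight : (l + 1) * d + l + 2 ≤ M
  -- Each vertex occupies five entries of the list of vertices, and there are at most `q` of them on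
  -- each of the levels `1, …, l + 1`, besides the root.
  size : 5 * ((l + 1) * q + 1) ≤ M

section specs

variable {M p l q d : ℕ} {R e : ℕ → ℕ} {s : State}

theorem TreeBounds.q_le (hB : TreeBounds M p l q d R e) : q ≤ M := by
  have := hB.size; nlinarith

theorem TreeBounds.one_le (hB : TreeBounds M p l q d R e) : 1 ≤ M := by
  have := hB.weight; omega

theorem TreeBounds.d_le (hB : TreeBounds M p l q d R e) : d ≤ M := by
  have := hB.weight; nlinarith

theorem TreeBounds.pow_le (hB : TreeBounds M p l q d R e) {m : ℕ} (hm : m ≤ l + 1) : p ^ m ≤ M :=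
  (Nat.pow_le_pow_right hB.p_pos hm).trans hB.power

theorem classSum_le (hB : TreeBounds M p l q d R e) (n z : ℕ) : classSum q R e n z ≤ d :=
  (Finset.sum_le_sum fun j _ => by split_ifs <;> omega).trans hB.sum

theorem classWeight_spec (h : TreeData p l q R e s) (hB : TreeBounds M p l q d R e) {n z : ℕ}
    (hn : 0 < n) (hnM : n ≤ M) (h40 : s.reg 40 = n) (h41 : s.reg 41 = z) :
    Tri M classWeight ((q + 1) * (30 + 20) + 10) s (fun t => Frame classWeight s t ∧
      t.reg 42 = classSum q R e n z) := by
  suffices Tri M classWeight ((q + 1) * (30 + 20) + 10) s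
      (fun t => t.reg 42 = classSum q R e n z) from this.frame.imp fun t ht => ⟨ht.2, ht.1⟩
  refine Tri.assign_cons (by simp) ?_
  refine Tri.cons (Tri.forTo (c := 30) (I := fun k t => t.reg 42 =
    (∑ j ∈ Finset.range k, if R j % n = z % n then e j else 0 : ℕ)) q (by simp [h.reg16]) hB.q_le
    hB.one_le rfl (fun j t v h => by simpa using h) (by simp) ?_) (fun t ht _ => Tri.nil ht.1)
  rintro j t hj e43 e42 hf
  have e40 : t.reg 40 = n := (hf.reg 40 rfl).trans (by simp [h40])
  have e41 : t.reg 41 = z := (hf.reg 41 rfl).trans (by simp [h41])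
  have e7 : t.arr 7 j = e j := by rw [hf.arr 7 rfl]; simpa using h.arr7 j hj
  have e8 : t.arr 8 j = R j := by rw [hf.arr 8 rfl]; simpa using h.arr8 j hj
  have hle : ∀ x : ℕ, Within M ((x : ℤ) % n) := fun x => by
    rw [← Int.natCast_mod]
    exact .natCast ((Nat.mod_lt _ hn).le.trans hnM)
  refine Tri.weaken (Tri.cond (c₁ := 12) (c₂ := 0) ?_ ?_ (fun hz => ?_) (fun hz => ?_)) (by simp)
  · simp [e43, e40, e8, hn.ne', hle]
  · simp [e41, e40, hn.ne', hle]
  · simp only [Test.Holds, Ex.eval_mod, Ex.eval_get, Ex.eval_var, e43, e40, e41, e8] at hz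
    norm_cast at hz
    refine Tri.assign_cons ?_ (Tri.nil ?_)
    · simp only [Ex.ok_add, Ex.ok_var, Ex.ok_get, Ex.eval_var, Ex.eval_get, true_and, e42, e43, e7]
      rw [← Nat.cast_add]
      refine .natCast (le_trans ?_ hB.d_le)
      refine le_trans ?_ ((Finset.sum_le_sum_of_subset (f := e)
        (Finset.range_subset_range.2 (show j + 1 ≤ q from hj))).trans hB.sum)
      rw [Finset.sum_range_succ]
      gcongr
      split_ifs <;> omega
    · simp [e42, e43, e7, Finset.sum_range_succ, hz]
  · simp only [Test.Holds, Ex.eval_mod, Ex.eval_get, Ex.eval_var, e43, e40, e41, e8] at hz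
    norm_cast at hz
    refine Tri.nil ?_
    simp [e42, Finset.sum_range_succ, hz]

theorem pathWeights_spec (h : TreeData p l q R e s) (hB : TreeBounds M p l q d R e) {m z : ℕ}
    (hm : m ≤ l + 1) (h33 : s.reg 33 = m) (h41 : s.reg 41 = z) :
    Tri M pathWeights ((l + 2) * (((q + 1) * (30 + 20) + 60) + 20) + 30) s
      (fun t => Frame pathWeights s t ∧ t.reg 42 = weightN p q R e m z ∧
        t.reg 44 = pathSum p q R e m z ∧ t.reg 45 = pathOnes p q R e m z) := by
  suffices Tri M pathWeights ((l + 2) * (((q + 1) * (30 + 20) + 60) + 20) + 30) s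
      (fun t => t.reg 42 = weightN p q R e m z ∧
        t.reg 44 = pathSum p q R e m z ∧ t.reg 45 = pathOnes p q R e m z) from
    this.frame.imp fun t ht => ⟨ht.2, ht.1⟩
  have hM1 := hB.one_le
  have hmM : m + 1 ≤ M := by have := hB.weight; nlinarith
  have hSM : ∀ j ≤ m, pathSum p q R e j z ≤ M := fun j hj => by
    have : pathSum p q R e j z ≤ j * d := by
      unfold pathSum
      simpa using Finset.sum_le_card_nsmul (Finset.range j)
        (fun k => classSum q R e (p ^ (k + 1)) z) d fun k _ => classSum_le hB (p ^ (k + 1)) z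
    refine (this.trans (Nat.mul_le_mul_right d (hj.trans hm))).trans ?_
    have := hB.weight
    omega
  have hOM : ∀ j ≤ m, pathOnes p q R e j z ≤ j := fun j hj => by
    unfold pathOnes
    rw [Finset.sum_boole]
    simpa using (Finset.card_filter_le (Finset.range j) _)
  refine Tri.assign_cons (by simp) ?_
  refine Tri.assign_cons (by simp) ?_
  refine Tri.assign_cons (by simp) ?_
  refine Tri.assign_cons (by simpa using hM1) ?_
  refine Tri.cons (Tri.weaken (c' := (l + 2) * (((q + 1) * (30 + 20) + 60) + 20))
    (Tri.forTo (c := (q + 1) * (30 + 20) + 60) (I := fun k t =>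
    t.reg 40 = (p ^ k : ℕ) ∧ t.reg 42 = weightN p q R e k z ∧
        t.reg 44 = pathSum p q R e k z ∧ t.reg 45 = pathOnes p q R e k z) m (by simp [h33])
        (by omega) hM1 rfl (fun j t v h => by simpa using h)
        (by simp [weightN, pathSum, pathOnes]) ?_)
        (Nat.mul_le_mul_right _ (by omega))) (fun t ht _ => Tri.nil ht.1.2)
  rintro j t hj e46 ⟨e40, e42, e44, e45⟩ hf
  have e0 : t.reg 0 = p := (hf.reg 0 rfl).trans (by simp [h.reg0])
  have e41 : t.reg 41 = z := (hf.reg 41 rfl).trans (by simp [h41])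
  have hT : TreeData p l q R e t := by
    refine TreeData.of_frame ?_ hf rfl
    exact (((h.setReg rfl).setReg rfl).setReg rfl).setReg rfl
  have hpj : ((p ^ j : ℕ) : ℤ) * p = (p ^ (j + 1) : ℕ) := by rw [pow_succ, Nat.cast_mul]
  refine Tri.assign_cons ?_ ?_
  · simp only [Ex.ok_mul, Ex.ok_var, Ex.eval_var, true_and, e40, e0, hpj]
    exact .natCast (hB.pow_le (by omega))
  refine Tri.cons (classWeight_spec (n := p ^ (j + 1)) (z := z) (hT.setReg rfl) hB (pow_pos
      hB.p_pos _) (hB.pow_le (by omega))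
    ?_ ?_) ?_
  · simp only [State.setReg_reg, Ex.eval_mul, Ex.eval_var, reduceIte, e40, e0, hpj]
  · simp [e41]
  rintro u ⟨hf', f42⟩ -
  have f40 : u.reg 40 = (p ^ (j + 1) : ℕ) := (hf'.reg 40 rfl).trans
    (by simp only [State.setReg_reg, Ex.eval_mul, Ex.eval_var, reduceIte, e40, e0, hpj])
  have f44 : u.reg 44 = pathSum p q R e j z := (hf'.reg 44 rfl).trans (by simp [e44])
  have f45 : u.reg 45 = pathOnes p q R e j z := (hf'.reg 45 rfl).trans (by simp [e45])
  have hw : weightN p q R e (j + 1) z = classSum q R e (p ^ (j + 1)) z := by simp [weightN]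
  have hS : pathSum p q R e (j + 1) z = pathSum p q R e j z + classSum q R e (p ^ (j + 1)) z := by
    rw [pathSum, Finset.sum_range_succ, pathSum]
  have hO : pathOnes p q R e (j + 1) z = pathOnes p q R e j z +
      if classSum q R e (p ^ (j + 1)) z = 1 then 1 else 0 := by
    rw [pathOnes, Finset.sum_range_succ, pathOnes]
  refine Tri.assign_cons ?_ ?_
  · simp only [Ex.ok_add, Ex.ok_var, Ex.eval_var, true_and, f44, f42]
    rw [← Nat.cast_add, ← hS]
    exact .natCast (hSM _ (by omega))
  refine Tri.cons (Q₁ := fun t => t.reg 40 = (p ^ (j + 1) : ℕ) ∧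
    t.reg 42 = weightN p q R e (j + 1) z ∧
    t.reg 44 = pathSum p q R e (j + 1) z ∧ t.reg 45 = pathOnes p q R e (j + 1) z)
    (Tri.cond (c₁ := 10) (c₂ := 0) (by simp) (by simpa using hM1) (fun hz => ?_) (fun hz => ?_))
    (fun t ht _ => Tri.nil ht)
  · simp only [Test.Holds, Ex.eval_var, Ex.eval_lit, State.setReg_reg, f42, Nat.reduceEqDiff,
      reduceIte] at hz
    norm_cast at hz
    refine Tri.assign_cons ?_ (Tri.nil ⟨?_, ?_, ?_, ?_⟩)
    · simp [f45, hM1]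
      have := hOM j hj.le
      exact .of_nonneg (by omega) (by omega)
    · simpa using f40
    · simp [f42, hw]
    · simp [f42, f44, hS]
    · simp [f45, hO, hz]
  · simp only [Test.Holds, Ex.eval_var, Ex.eval_lit, State.setReg_reg, f42, Nat.reduceEqDiff,
      reduceIte] at hz
    norm_cast at hz
    refine Tri.nil ⟨?_, ?_, ?_, ?_⟩
    · simpa using f40
    · simp [f42, hw]
    · simp [f42, f44, hS]
    · simp [f45, hO, hz]

theorem testFirst_spec (h : TreeData p l q R e s) (hB : TreeBounds M p l q d R e) {n j : ℕ}
    (hn : 0 < n) (hnM : n ≤ M) (hj : j < q) (h47 : s.reg 47 = j) (h48 : s.reg 48 = n) :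
    Tri M testFirst ((q + 1) * (30 + 20) + 10) s (fun t => Frame testFirst s t ∧
      t.reg 49 = if IsFirst R n j then 1 else 0) := by
  suffices Tri M testFirst ((q + 1) * (30 + 20) + 10) s (fun t =>
      t.reg 49 = if IsFirst R n j then 1 else 0) from this.frame.imp fun t ht => ⟨ht.2, ht.1⟩
  have hqM := hB.q_le
  refine Tri.assign_cons (by simpa using hB.one_le) ?_
  refine Tri.cons (Tri.weaken (c' := (q + 1) * (30 + 20)) (Tri.forTo (c := 30) (I := fun k t =>
    t.reg 49 = if ∀ h < k, R h % n ≠ R j % n then 1 else 0) j (by simp [h47])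
    (by omega) hB.one_le rfl (fun j t v h => by simpa using h) (by simp) ?_)
    (Nat.mul_le_mul_right _ (by omega))) (fun t ht _ => Tri.nil ht.1)
  rintro k t hk e50 e49 hf
  have e47 : t.reg 47 = j := (hf.reg 47 rfl).trans (by simp [h47])
  have e48 : t.reg 48 = n := (hf.reg 48 rfl).trans (by simp [h48])
  have e8 : ∀ j < q, t.arr 8 j = R j := by rw [hf.arr 8 rfl]; simpa using h.arr8
  have e8j := e8 j hj
  have e8k := e8 k (hk.trans hj)
  have hle : ∀ x : ℕ, Within M ((x : ℤ) % n) := fun x => by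
    rw [← Int.natCast_mod]
    exact .natCast ((Nat.mod_lt _ hn).le.trans hnM)
  refine Tri.weaken (Tri.cond (c₁ := 4) (c₂ := 0) ?_ ?_ (fun hz => ?_) (fun hz => ?_)) (by simp)
  · simp [e50, e48, e8k, hn.ne', hle]
  · simp [e47, e48, e8j, hn.ne', hle]
  · simp only [Test.Holds, Ex.eval_mod, Ex.eval_get, Ex.eval_var, e50, e47, e48, e8j, e8k] at hz
    norm_cast at hz
    refine Tri.assign_cons (by simp) (Tri.nil ?_)
    rw [if_neg fun hall => hall k (by omega) hz]
    simp
  · simp only [Test.Holds, Ex.eval_mod, Ex.eval_get, Ex.eval_var, e50, e47, e48, e8j, e8k] at hz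
    norm_cast at hz
    refine Tri.nil ?_
    rw [e49]
    refine if_congr ⟨fun hall h hh => ?_, fun hall h hh => hall h (by omega)⟩ rfl rfl
    rcases Nat.lt_succ_iff_lt_or_eq.1 hh with h' | rfl
    exacts [hall h h', hz]

/-- A child of a class modulo `p ^ m` is a class modulo `p ^ (m + 1)` of some root; it is counted at
the first root that represents it. On level `l + 1` the tree ends and the count is zero. -/
theorem countChildren_spec (h : TreeData p l q R e s) (hB : TreeBounds M p l q d R e) {m z : ℕ}
    (h33 : s.reg 33 = m) (h34 : s.reg 34 = (p ^ m : ℕ)) (h41 : s.reg 41 = z) :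
    Tri M countChildren ((q + 1) * (((q + 1) * (30 + 20) + 60) + 20) + 30) s
      (fun t => Frame countChildren s t ∧ t.reg 51 = childrenN p l q R m z) := by
  suffices Tri M countChildren ((q + 1) * (((q + 1) * (30 + 20) + 60) + 20) + 30) s
      (fun t => t.reg 51 = childrenN p l q R m z) from this.frame.imp fun t ht => ⟨ht.2, ht.1⟩
  have hqM := hB.q_le
  refine Tri.assign_cons (by simp) ?_
  refine Tri.cons (Tri.cond (c₁ := (q + 1) * (((q + 1) * (30 + 20) + 60) + 20) + 10) (c₂ := 0)
    (by simp) (by simp) (fun hz => ?_) (fun hz => ?_)) (fun t ht _ => Tri.nil ht)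
  · simp [Test.Holds, h33, h.reg19] at hz
    have hpj : ((p ^ m : ℕ) : ℤ) * p = (p ^ (m + 1) : ℕ) := by rw [pow_succ, Nat.cast_mul]
    refine Tri.assign_cons ?_ ?_
    · simp only [Ex.ok_mul, Ex.ok_var, Ex.eval_var, true_and, State.setReg_reg, Nat.reduceEqDiff,
        reduceIte, h34, h.reg0, hpj]
      exact .natCast (hB.pow_le (by omega))
    refine Tri.cons (Tri.forTo (c := (q + 1) * (30 + 20) + 60) (I := fun k t => t.reg 51 =
      (∑ j ∈ Finset.range k, if R j % p ^ m = z ∧ IsFirst R (p ^ (m + 1)) j then 1 else 0 : ℕ)) q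
      (by simp [h.reg16]) hB.q_le hB.one_le rfl (fun j t v h => by simpa using h) (by simp) ?_)
      (fun t ht _ => Tri.nil (by rw [ht.1, childrenN, if_pos hz]))
    rintro j t hj e47 e51 hf
    have e34 : t.reg 34 = (p ^ m : ℕ) := (hf.reg 34 rfl).trans (by simp [h34])
    have e41 : t.reg 41 = z := (hf.reg 41 rfl).trans (by simp [h41])
    have e48 : t.reg 48 = (p ^ (m + 1) : ℕ) :=
      (hf.reg 48 rfl).trans (by simp only [State.setReg_reg, Ex.eval_mul, Ex.eval_var,
        Nat.reduceEqDiff, reduceIte, h34, h.reg0, hpj])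
    have hT : TreeData p l q R e t := by
      refine TreeData.of_frame ?_ hf rfl
      exact (h.setReg rfl).setReg rfl
    have e8 := hT.arr8 j hj
    have hp0 : 0 < p ^ m := pow_pos hB.p_pos _
    refine Tri.weaken (Tri.cond (c₁ := (q + 1) * (30 + 20) + 20) (c₂ := 0) ?_ (by simp)
      (fun hz => ?_) (fun hz => ?_)) (by simp; omega)
    · simp only [Ex.ok_mod, Ex.ok_get, Ex.ok_var, Ex.eval_get, Ex.eval_var, e47, e34, e8, true_and]
      rw [← Int.natCast_mod]
      exact ⟨.natCast ((Nat.mod_lt _ hp0).le.trans (hB.pow_le (by omega))),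
        by exact_mod_cast hp0.ne'⟩
    · simp only [Test.Holds, Ex.eval_mod, Ex.eval_get, Ex.eval_var, e47, e34, e41, e8] at hz
      rw [← Int.natCast_mod, Nat.cast_inj] at hz
      refine Tri.cons (testFirst_spec hT hB (pow_pos hB.p_pos _) (hB.pow_le (by omega)) hj e47 e48)
        ?_
      rintro u ⟨hf', f49⟩ -
      have f51 := (hf'.reg 51 rfl).trans e51
      refine Tri.assign_cons ?_ (Tri.nil ?_)
      · simp only [Ex.ok_add, Ex.ok_var, Ex.eval_var, true_and, f51, f49]
        have h1 := Finset.sum_le_card_nsmul (Finset.range j) (fun j =>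
          if R j % p ^ m = z ∧ IsFirst R (p ^ (m + 1)) j then 1 else 0) 1 (fun k _ => by
            split_ifs <;> simp)
        rw [Finset.card_range, nsmul_eq_mul, mul_one] at h1
        simp only [Nat.cast_id] at h1
        refine .of_nonneg (by positivity) ?_
        split_ifs <;> omega
      · simp only [State.setReg_reg, Ex.eval_add, Ex.eval_var, f51, f49, reduceIte,
          Finset.sum_range_succ, hz, true_and]
        push_cast
        rfl
    · simp only [Test.Holds, Ex.eval_mod, Ex.eval_get, Ex.eval_var, e47, e34, e41, e8] at hz
      rw [← Int.natCast_mod, Nat.cast_inj] at hz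
      exact Tri.nil (by rw [e51, Finset.sum_range_succ, if_neg (by simp [hz]), add_zero])
  · simp [Test.Holds, h33, h.reg19] at hz
    exact Tri.nil (by simp [childrenN, hz])

end specs

end IgusaZeta

/-! ### Listing the vertices and the summands. -/

namespace IgusaZeta

open Ex Program

/-- Append the values of the variables `is` to the array `a`, whose length is in variable `n`. -/
def pushVars (a n : ℕ) (is : List ℕ) : Program :=
  block (is.flatMap fun i => [put a (var n) (var i), assign n (var n + lit 1)])

/-- The array `a`, with its length in variable `n`, holds the list `L`. -/
structure Tape (a n : ℕ) (L : List ℤ) (s : State) : Prop where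
  len : s.reg n = L.length
  entries : ArrayIs (s.arr a) L

theorem Tape.of_eq {a n : ℕ} {L : List ℤ} {s t : State} (h : Tape a n L s)
    (hr : t.reg n = s.reg n) (ha : t.arr a = s.arr a) : Tape a n L t :=
  ⟨hr.trans h.len, ha ▸ h.entries⟩

/-- The length register changes while the values are appended, so it must not be among them. -/
theorem pushVars_spec {M a n : ℕ} (is : List ℕ) (hn : n ∉ is) : ∀ {L : List ℤ} {s : State},
    Tape a n L s → L.length + is.length ≤ M →
    Tri M (pushVars a n is) (is.length * 20) s (fun t => Frame (pushVars a n is) s t ∧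
      Tape a n (L ++ is.map s.reg) t) := by
  suffices ∀ {L : List ℤ} {s : State}, Tape a n L s → L.length + is.length ≤ M →
      Tri M (pushVars a n is) (is.length * 20) s (Tape a n (L ++ is.map s.reg)) from
    fun {_ _} h hM => (this h hM).frame.imp fun t ht => ⟨ht.2, ht.1⟩
  induction is with
  | nil => intro L s h _; exact Tri.nil (by simpa using h)
  | cons i is ih =>
    intro L s h hM
    simp only [List.mem_cons, not_or] at hn
    simp only [List.length_cons] at hM ⊢
    rw [pushVars, List.flatMap_cons]
    have hb : Within M ((L.length : ℤ) + 1) := .of_nonneg (by omega) (by omega)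
    refine Tri.put_cons (by simp) (by simp) (Tri.assign_cons ?_ ?_ ?_) ?_
    · simpa [h.len, show 1 ≤ M by omega] using hb
    · refine Tri.imp ((ih hn.2 (L := L ++ [s.reg i]) ⟨?_, ?_⟩ ?_).weaken ?_) ?_
      · simp [h.len]
      · rw [State.setReg_arr, State.setArr_arr_self]
        exact h.entries.concat h.len _
      · simp; omega
      · simp; omega
      · intro t ht
        rw [List.append_assoc] at ht
        convert ht using 3
        simp only [List.map_cons, List.singleton_append, List.cons.injEq, true_and]
        refine List.map_congr_left fun k hk => ?_
        rw [State.setReg_reg, if_neg (by rintro rfl; exact hn.2 hk), State.setArr_reg]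
    · simp; omega
    · simp; omega

/-- Append the data of the vertex given by the level `m` in variable 33, by `p ^ m` in variable 34
and by the residue in variable 41 to the lists of the vertices and of the summands. -/
def vertex : Program := block [
  pathWeights, countChildren, pushVars 9 52 [33, 41, 42, 51, 44],
  -- The exponent is the level plus one, so that the coefficients become integers: `(1 - p⁻¹) * p ^
  -- (-m) = (p - 1) * p ^ (-(m + 1))`, and likewise with `p - Val(u)`.
  assign 35 (var 33 + lit 1),
  -- Variable 45 counts the weight-one vertices on the path, the vertex itself included. If its own
  -- weight is one, the count is one exactly when no vertex before it has weight one; otherwise its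
  -- summand is zero.
  cond .eq (var 42) (lit 1)
    (block [cond .eq (var 45) (lit 1)
      (block [assign 55 (var 0 - lit 1), assign 56 (lit 1)])
      (block [assign 55 (lit 0), assign 56 (lit 0)])])
    (block [cond .le (var 33) (var 19)
      (block [assign 55 (var 0 - var 51), assign 56 (lit 0)])
      (block [assign 55 (var 0 - lit 1), assign 56 (var 42)])]),
  pushVars 10 53 [55, 35, 44, 56],
  assign 54 (var 54 + lit 1)]

/-- List the vertices of the tree. -/
def buildTree : Program := block [
  assign 52 (lit 0), assign 53 (lit 0), assign 54 (lit 0), assign 33 (lit 0), assign 34 (lit 1),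
  assign 41 (lit 0), vertex,
  forTo 57 32 (block [
    assign 33 (var 57 + lit 1), assign 34 (var 34 * var 0),
    forTo 58 16 (block [
      assign 47 (var 58), assign 48 (var 34), testFirst,
      cond .eq (var 49) (lit 1)
        (block [assign 41 (get 8 (var 58) % var 34), vertex]) (block [])])])]

/-- Write the tree and the summands of the generating function. -/
def writeLists : Program := block [
  write (var 54), forTo 59 52 (write (get 9 (var 59))), forTo 59 53 (write (get 10 (var 59)))]

section functions

variable (p l q : ℕ) (R e : ℕ → ℕ)

/-- The numerator of the summand of a vertex. -/
def termNum (m z : ℕ) : ℤ :=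
  if weightN p q R e m z = 1 then (if pathOnes p q R e m z = 1 then p - 1 else 0)
  else if m ≤ l then p - childrenN p l q R m z else p - 1

/-- The exponent in the denominator of the summand of a vertex. -/
def termExp (m z : ℕ) : ℕ :=
  if weightN p q R e m z = 1 then (if pathOnes p q R e m z = 1 then 1 else 0)
  else if m ≤ l then 0 else weightN p q R e m z

/-- The data of a vertex. -/
def vertexRow (u : ℕ × ℕ) : List ℤ :=
  [(u.1 : ℤ), (u.2 : ℤ), (weightN p q R e u.1 u.2 : ℤ), (childrenN p l q R u.1 u.2 : ℤ),
    (pathSum p q R e u.1 u.2 : ℤ)]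

/-- The summand of a vertex. -/
def termRow (u : ℕ × ℕ) : List ℤ :=
  [termNum p l q R e u.1 u.2, ((u.1 + 1 : ℕ) : ℤ), (pathSum p q R e u.1 u.2 : ℤ),
    (termExp p l q R e u.1 u.2 : ℤ)]

/-- The vertices of level `k + 1` that come from the first `j` roots. -/
def levelVertices (k j : ℕ) : List (ℕ × ℕ) :=
  ((List.range j).filter fun i => decide (IsFirst R (p ^ (k + 1)) i)).map
    fun i => (k + 1, R i % p ^ (k + 1))

/-- The vertices of level at most `k`. -/
def verticesUpTo (k : ℕ) : List (ℕ × ℕ) :=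
  (0, 0) :: (List.range k).flatMap fun i => levelVertices p R i q

/-- The lists built so far. -/
structure TreeTapes (V : List (ℕ × ℕ)) (s : State) : Prop where
  rows : Tape 9 52 (V.flatMap (vertexRow p l q R e)) s
  terms : Tape 10 53 (V.flatMap (termRow p l q R e)) s
  num : s.reg 54 = V.length

theorem levelVertices_succ (k j : ℕ) : levelVertices p R k (j + 1) = levelVertices p R k j ++
    if IsFirst R (p ^ (k + 1)) j then [(k + 1, R j % p ^ (k + 1))] else [] := by
  unfold levelVertices
  rw [List.range_succ, List.filter_append, List.map_append]
  split_ifs with h <;> simp [h]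

theorem length_levelVertices_le (k j : ℕ) : (levelVertices p R k j).length ≤ j := by
  rw [levelVertices, List.length_map]
  exact (List.length_filter_le _ _).trans (by simp)

theorem verticesUpTo_succ (k : ℕ) :
    verticesUpTo p q R (k + 1) = verticesUpTo p q R k ++ levelVertices p R k q := by
  simp [verticesUpTo, List.range_succ, List.flatMap_append]

theorem length_verticesUpTo_le (k : ℕ) : (verticesUpTo p q R k).length ≤ k * q + 1 := by
  induction k with
  | zero => simp [verticesUpTo]
  | succ k ih =>
    rw [verticesUpTo_succ, List.length_append, Nat.succ_mul]
    have := length_levelVertices_le p R k q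
    omega

theorem length_vertexRows (V : List (ℕ × ℕ)) :
    (V.flatMap (vertexRow p l q R e)).length = 5 * V.length := by
  induction V with
  | nil => rfl
  | cons u V ih => rw [List.flatMap_cons, List.length_append, ih]; simp [vertexRow]; ring

theorem length_termRows (V : List (ℕ × ℕ)) :
    (V.flatMap (termRow p l q R e)).length = 4 * V.length := by
  induction V with
  | nil => rfl
  | cons u V ih => rw [List.flatMap_cons, List.length_append, ih]; simp [termRow]; ring

end functions

/-- The registers `104`, `106`, `108` are the variables `52`, `53`, `54`. -/
theorem TreeTapes.of_frame {p l q : ℕ} {R e : ℕ → ℕ} {P : Program} {V : List (ℕ × ℕ)}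
    {s t : State} (h : TreeTapes p l q R e V s) (hf : Frame P s t)
    (hP : (P.writesReg 104 || P.writesReg 106 || P.writesReg 108 || P.writesArr 9 ||
      P.writesArr 10) = false) : TreeTapes p l q R e V t := by
  simp only [Bool.or_eq_false_iff] at hP
  obtain ⟨⟨⟨⟨h1, h2⟩, h3⟩, h4⟩, h5⟩ := hP
  exact ⟨h.rows.of_eq (hf.reg 52 h1) (hf.arr 9 h4), h.terms.of_eq (hf.reg 53 h2) (hf.arr 10 h5),
    (hf.reg 54 h3).trans h.num⟩

theorem TreeTapes.setReg {p l q : ℕ} {R e : ℕ → ℕ} {V : List (ℕ × ℕ)} {s : State}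
    (h : TreeTapes p l q R e V s) {i : ℕ} {z : ℤ}
    (hi : (i == 52 || i == 53 || i == 54) = false) :
    TreeTapes p l q R e V (s.setReg i z) := by
  simp only [Bool.or_eq_false_iff, beq_eq_false_iff_ne] at hi
  obtain ⟨⟨h1, h2⟩, h3⟩ := hi
  exact ⟨h.rows.of_eq (by rw [State.setReg_reg, if_neg h1.symm]) rfl,
    h.terms.of_eq (by rw [State.setReg_reg, if_neg h2.symm]) rfl,
    by rw [State.setReg_reg, if_neg h3.symm, h.num]⟩

/-- A bound for the cost of the treatment of a vertex. -/
def vertexCost (l q : ℕ) : ℕ :=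
  (l + 2) * (((q + 1) * (30 + 20) + 60) + 20) +
    (q + 1) * (((q + 1) * (30 + 20) + 60) + 20) + 400

section specs

variable {M p l q d : ℕ} {R e : ℕ → ℕ} {s : State}

theorem childrenN_le (m z : ℕ) : childrenN p l q R m z ≤ q := by
  unfold childrenN
  split_ifs
  · rw [Finset.sum_boole]
    simpa using Finset.card_filter_le (Finset.range q) _
  · simp

theorem vertex_spec {V : List (ℕ × ℕ)} (h : TreeData p l q R e s) (hB : TreeBounds M p l q d R e)
    {m z : ℕ} (hm : m ≤ l + 1) (h33 : s.reg 33 = m) (h34 : s.reg 34 = (p ^ m : ℕ))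
    (h41 : s.reg 41 = z) (hV : V.length ≤ (l + 1) * q) (hT : TreeTapes p l q R e V s) :
    Tri M vertex (vertexCost l q) s
      (fun t => Frame vertex s t ∧ TreeTapes p l q R e (V ++ [(m, z)]) t) := by
  suffices Tri M vertex (vertexCost l q) s (TreeTapes p l q R e (V ++ [(m, z)])) from
    this.frame.imp fun t ht => ⟨ht.2, ht.1⟩
  have hM1 := hB.one_le
  have hqM := hB.q_le
  have hmM : m + 1 ≤ M := by have := hB.weight; nlinarith
  have hVM : 5 * (V.length + 1) ≤ M := by have := hB.size; omega
  have hpM : p ≤ M := by simpa using hB.pow_le (m := 1) (by omega)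
  have hp0 := hB.p_pos
  unfold vertexCost
  refine Tri.cons (pathWeights_spec h hB hm h33 h41) ?_
  rintro t ⟨hf, e42, e44, e45⟩ -
  refine Tri.cons (countChildren_spec (h.of_frame hf rfl) hB ((hf.reg 33 rfl).trans h33)
    ((hf.reg 34 rfl).trans h34) ((hf.reg 41 rfl).trans h41)) ?_
  rintro u ⟨hf', e51⟩ -
  have hT' := (hT.of_frame hf rfl).of_frame hf' rfl
  have hF := h.of_frame hf rfl |>.of_frame hf' rfl
  have f33 : u.reg 33 = m := (hf'.reg 33 rfl).trans ((hf.reg 33 rfl).trans h33)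
  have f41 : u.reg 41 = z := (hf'.reg 41 rfl).trans ((hf.reg 41 rfl).trans h41)
  have f42 := (hf'.reg 42 rfl).trans e42
  have f44 := (hf'.reg 44 rfl).trans e44
  have f45 := (hf'.reg 45 rfl).trans e45
  clear hf hf' e42 e44 e45 hT h h33 h34 h41
  refine Tri.cons (c₁ := 100) (pushVars_spec [33, 41, 42, 51, 44] (by simp) hT'.rows (by
    rw [length_vertexRows]; simp; omega)) ?_
  rintro v ⟨hf, hrows⟩ -
  have hterms : Tape 10 53 (V.flatMap (termRow p l q R e)) v :=
    hT'.terms.of_eq (hf.reg 53 rfl) (hf.arr 10 rfl)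
  have hnum : v.reg 54 = V.length := (hf.reg 54 rfl).trans hT'.num
  have hF' := hF.of_frame hf rfl
  have g33 := (hf.reg 33 rfl).trans f33
  have g42 := (hf.reg 42 rfl).trans f42
  have g44 := (hf.reg 44 rfl).trans f44
  have g45 := (hf.reg 45 rfl).trans f45
  have g51 := (hf.reg 51 rfl).trans e51
  have hrows' : Tape 9 52 ((V ++ [(m, z)]).flatMap (vertexRow p l q R e)) v := by
    rw [List.flatMap_append, List.flatMap_singleton]
    simpa only [List.map_cons, List.map_nil, f33, f41, f42, e51, f44, vertexRow] using hrows
  clear hf hF hT' f33 f41 f42 f44 f45 e51 hrows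
  have hm1 : Within M ((m : ℤ) + 1) := .of_nonneg (by omega) (by omega)
  have hp1 : Within M ((p : ℤ) - 1) := .of_nonneg (by omega) (by omega)
  refine Tri.assign_cons (by simpa [g33, hM1] using hm1) ?_
  refine Tri.cons (c₁ := 100) (Q₁ := fun t => t.reg 55 = termNum p l q R e m z ∧
    t.reg 56 = termExp p l q R e m z)
    (Tri.weaken (Tri.cond (c₁ := 30) (c₂ := 30) (by simp) (by simpa using hM1)
    (fun hz => ?_) (fun hz => ?_)) (by simp)) ?_
  · simp [Test.Holds, g42] at hz
    refine Tri.cons (Tri.cond (c₁ := 10) (c₂ := 10) (by simp) (by simpa using hM1)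
      (fun hz' => ?_) (fun hz' => ?_)) (fun t ht _ => Tri.nil ht)
    · simp [Test.Holds, g45] at hz'
      refine Tri.assign_cons (by simpa [hF'.reg0, hM1] using hp1) ?_
      exact Tri.assign_cons (by simpa using hM1)
        (Tri.nil (by simp [termNum, termExp, hz, hz', hF'.reg0]))
    · simp [Test.Holds, g45] at hz'
      refine Tri.assign_cons (by simp) ?_
      exact Tri.assign_cons (by simp) (Tri.nil (by simp [termNum, termExp, hz, hz']))
  · simp [Test.Holds, g42] at hz
    refine Tri.cons (Tri.cond (c₁ := 10) (c₂ := 10) (by simp) (by simp)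
      (fun hz' => ?_) (fun hz' => ?_)) (fun t ht _ => Tri.nil ht)
    · simp [Test.Holds, g33, hF'.reg19] at hz'
      -- Only `childrenN ≤ q ≤ M` enters, so it is not needed here that a vertex has at most `p`
      -- children.
      have := childrenN_le (p := p) (l := l) (q := q) (R := R) m z
      have : Within M ((p : ℤ) - childrenN p l q R m z) := ⟨by omega, by omega⟩
      refine Tri.assign_cons (by simpa [hF'.reg0, g51] using this) ?_
      exact Tri.assign_cons (by simp)
        (Tri.nil (by simp [termNum, termExp, hz, hz', hF'.reg0, g51]))
    · simp [Test.Holds, g33, hF'.reg19] at hz'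
      refine Tri.assign_cons (by simpa [hF'.reg0, hM1] using hp1) ?_
      exact Tri.assign_cons (by simp)
        (Tri.nil (by simp [termNum, termExp, hz, hz'.not_ge, hF'.reg0, g42]))
  rintro w ⟨e55, e56⟩ hf
  have k35 : w.reg 35 = ((m + 1 : ℕ) : ℤ) := (hf.reg 35 rfl).trans (by simp [g33])
  have k44 : w.reg 44 = pathSum p q R e m z := (hf.reg 44 rfl).trans (by simp [g44])
  have k54 : w.reg 54 = V.length := (hf.reg 54 rfl).trans (by simp [hnum])
  have hrows : Tape 9 52 ((V ++ [(m, z)]).flatMap (vertexRow p l q R e)) w :=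
    hrows'.of_eq ((hf.reg 52 rfl).trans (by simp)) ((hf.arr 9 rfl).trans (by simp))
  have hterms' : Tape 10 53 (V.flatMap (termRow p l q R e)) w :=
    hterms.of_eq ((hf.reg 53 rfl).trans (by simp)) ((hf.arr 10 rfl).trans (by simp))
  refine Tri.cons (c₁ := 80) (pushVars_spec [55, 35, 44, 56] (by simp) hterms' (by
    rw [length_termRows]; simp; omega)) ?_
  rintro x ⟨hf', hx⟩ -
  have x54 := (hf'.reg 54 rfl).trans k54
  have hb : Within M ((V.length : ℤ) + 1) := .of_nonneg (by omega) (by omega)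
  refine Tri.assign_cons (by simpa [x54, hM1] using hb) (Tri.nil ⟨?_, ?_, by simp [x54]⟩)
  · exact hrows.of_eq ((hf'.reg 52 rfl).symm ▸ by simp) ((hf'.arr 9 rfl).symm ▸ by simp)
  · rw [List.flatMap_append, List.flatMap_singleton]
    refine Tape.of_eq (s := x) ?_ (by simp) (by simp)
    simpa only [List.map_cons, List.map_nil, k35, k44, e55, e56, termRow] using hx

/-- A level is traversed root by root, and a class is listed only at the first root representing it,
so no class is listed twice. The outer loop carries `p ^ k` along in variable 34. -/
theorem buildTree_spec (h : TreeData p l q R e s) (hB : TreeBounds M p l q d R e) :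
    Tri M buildTree ((l + 1 + 1) * (((q + 1) * ((vertexCost l q + ((q + 1) * (30 + 20)) + 60) +
        20) +
      20) + 20) + vertexCost l q + 40) s
      (fun t => Frame buildTree s t ∧ TreeTapes p l q R e (verticesUpTo p q R (l + 1)) t) := by
  suffices Tri M buildTree ((l + 1 + 1) * (((q + 1) * ((vertexCost l q + ((q + 1) * (30 + 20)) +
      60) +
      20) + 20) + 20) + vertexCost l q + 40) s
      (TreeTapes p l q R e (verticesUpTo p q R (l + 1))) from
    this.frame.imp fun t ht => ⟨ht.2, ht.1⟩
  have hM1 := hB.one_le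
  have hqM := hB.q_le
  have hlM : l + 1 + 1 ≤ M := by have := hB.weight; nlinarith
  refine Tri.assign_cons (by simp) ?_
  refine Tri.assign_cons (by simp) ?_
  refine Tri.assign_cons (by simp) ?_
  refine Tri.assign_cons (by simp) ?_
  refine Tri.assign_cons (by simpa using hM1) ?_
  refine Tri.assign_cons (by simp) ?_
  refine Tri.cons (vertex_spec (V := []) (m := 0) (z := 0)
    ((((((h.setReg rfl).setReg rfl).setReg rfl).setReg rfl).setReg rfl).setReg rfl) hB (by simp)
    (by simp) (by simp) (by simp) (by simp) ⟨⟨by simp, .nil _⟩, ⟨by simp, .nil _⟩, by simp⟩) ?_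
  rintro t ⟨hf, hT⟩ -
  have hD : TreeData p l q R e t := TreeData.of_frame
    ((((((h.setReg rfl).setReg rfl).setReg rfl).setReg rfl).setReg rfl).setReg rfl) hf rfl
  have e34 : t.reg 34 = 1 := (hf.reg 34 rfl).trans (by simp)
  clear hf
  refine Tri.cons (Tri.forTo (c := (q + 1) * ((vertexCost l q + ((q + 1) * (30 + 20)) + 60) +
      20) + 20) (I := fun k t => t.reg 34 = (p ^ k : ℕ) ∧
        TreeTapes p l q R e (verticesUpTo p q R k) t) (l + 1) hD.reg32
      (by omega) hM1 rfl (fun j t v h => ⟨by simpa using h.1, h.2.setReg rfl⟩)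
      ⟨by simp [e34], by simpa [verticesUpTo] using hT⟩ ?_) (fun t ht _ => Tri.nil ht.1.2)
  rintro k u hk e57 ⟨f34, hU⟩ hf
  have hD' := hD.of_frame hf rfl
  have hk1 : Within M ((k : ℤ) + 1) := .of_nonneg (by omega) (by omega)
  have hpj : ((p ^ k : ℕ) : ℤ) * p = (p ^ (k + 1) : ℕ) := by rw [pow_succ, Nat.cast_mul]
  clear hf hT hD e34
  refine Tri.assign_cons (by simpa [e57, hM1] using hk1) ?_
  refine Tri.assign_cons ?_ ?_
  · simp only [Ex.ok_mul, Ex.ok_var, Ex.eval_var, true_and, State.setReg_reg, Nat.reduceEqDiff,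
      reduceIte, f34, hD'.reg0, hpj]
    exact .natCast (hB.pow_le (by omega))
  have hv := length_verticesUpTo_le p q R k
  have hkq : k * q + q ≤ (l + 1) * q := by nlinarith
  refine Tri.cons (Tri.forTo (c := vertexCost l q + ((q + 1) * (30 + 20)) + 60)
    (I := fun j t => TreeTapes p l q R e (verticesUpTo p q R k ++ levelVertices p R k j) t) q
    (by simp [hD'.reg16]) hqM hM1 rfl (fun j t v h => h.setReg rfl) ?_ ?_) ?_
  · simpa [levelVertices] using (hU.setReg rfl).setReg rfl
  · rintro j v hj e58 hV hf
    have hD : TreeData p l q R e v := TreeData.of_frame ((hD'.setReg rfl).setReg rfl) hf rfl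
    have e33 : v.reg 33 = (k + 1 : ℕ) := (hf.reg 33 rfl).trans (by simp [e57])
    have e34 : v.reg 34 = (p ^ (k + 1) : ℕ) := (hf.reg 34 rfl).trans (by
      simp only [State.setReg_reg, Ex.eval_mul, Ex.eval_var,
        Nat.reduceEqDiff, reduceIte, f34, hD'.reg0, hpj])
    clear hf
    have hpk : 0 < p ^ (k + 1) := pow_pos hB.p_pos _
    have hl := length_levelVertices_le p R k j
    refine Tri.assign_cons (by simp) ?_
    refine Tri.assign_cons (by simp) ?_
    refine Tri.cons (testFirst_spec (n := p ^ (k + 1)) ((hD.setReg rfl).setReg rfl) hB hpk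
      (hB.pow_le (by omega)) hj (by simp [e58]) (by simp only [State.setReg_reg, reduceIte,
        Ex.eval_var, Nat.reduceEqDiff, e34])) ?_
    rintro w ⟨hf, e49⟩ -
    have hDw : TreeData p l q R e w := TreeData.of_frame ((hD.setReg rfl).setReg rfl) hf rfl
    have hW := TreeTapes.of_frame ((hV.setReg rfl).setReg rfl) hf rfl
    have k33 : w.reg 33 = (k + 1 : ℕ) := (hf.reg 33 rfl).trans (by simp [e33])
    have k34 : w.reg 34 = (p ^ (k + 1) : ℕ) := (hf.reg 34 rfl).trans (by
      simp only [State.setReg_reg, Nat.reduceEqDiff, reduceIte, e34])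
    have k58 : w.reg 58 = j := (hf.reg 58 rfl).trans (by simp [e58])
    clear hf
    have e8 : w.arr 8 j = R j := hDw.arr8 j hj
    refine Tri.cons (Tri.cond (c₁ := vertexCost l q + 20) (c₂ := 0) (by simp) (by simpa using hM1)
      (fun hz => ?_) (fun hz => ?_)) (fun t ht _ => Tri.nil ht)
    · have hz' : IsFirst R (p ^ (k + 1)) j := by
        by_contra hc
        simp [Test.Holds, e49, hc] at hz
      refine Tri.assign_cons ?_ ?_
      · simp only [Ex.ok_mod, Ex.ok_get, Ex.ok_var, Ex.eval_get, Ex.eval_var, k58, k34, e8,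
          true_and]
        rw [← Int.natCast_mod]
        exact ⟨.natCast ((Nat.mod_lt _ hpk).le.trans (hB.pow_le (by omega))),
          by exact_mod_cast hpk.ne'⟩
      refine Tri.cons (vertex_spec (m := k + 1) (z := R j % p ^ (k + 1)) (hDw.setReg rfl) hB
        (by omega) (by simp [k33]) (by simp only [State.setReg_reg, Nat.reduceEqDiff, reduceIte,
          k34]) ?_ ?_ (hW.setReg rfl)) (fun t ht _ => Tri.nil ?_)
      · simp only [State.setReg_reg, reduceIte, Ex.eval_mod, Ex.eval_get, Ex.eval_var, k58, k34, e8]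
        rw [Int.natCast_mod]
      · rw [List.length_append]
        omega
      · rw [levelVertices_succ, if_pos hz', ← List.append_assoc]
        exact ht.2
    · have hz' : ¬ IsFirst R (p ^ (k + 1)) j := by
        intro hc
        simp [Test.Holds, e49, hc] at hz
      refine Tri.nil ?_
      rwa [levelVertices_succ, if_neg hz', List.append_nil]
  · rintro v ⟨hV, hf⟩ -
    refine Tri.nil ⟨(hf.reg 34 rfl).trans ?_, by rwa [verticesUpTo_succ]⟩
    simp only [State.setReg_reg, Ex.eval_mul, Ex.eval_var,
        Nat.reduceEqDiff, reduceIte, f34, hD'.reg0, hpj]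

theorem writeArray_spec {a i n : ℕ} (hin : i ≠ n) {L : List ℤ} (hT : Tape a n L s)
    (hL : L.length ≤ M) (hM : 1 ≤ M) :
    Tri M (forTo i n (write (get a (var i)))) ((L.length + 1) * (10 + 20)) s
      (fun t => t.out = s.out ++ L ∧ Frame (forTo i n (write (get a (var i)))) s t) := by
  refine Tri.imp (Tri.forTo (c := 10) (I := fun k t => t.out = s.out ++ L.take k) L.length hT.len
    hL hM ?_ (fun j t v h => by simpa using h) (by simp) ?_) ?_
  · simp [Program.write, writesReg, Ex.compile, hin]
  · rintro j t hj ei eo hf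
    refine Tri.weaken (Tri.write (by simp) ?_) (by simp)
    have : t.arr a = s.arr a := hf.arr a (by
      simp [Program.forTo, Program.rep, Program.write, Program.assign, both, writesArr,
        Ex.compile])
    rw [State.emit_out, eo, Ex.eval_get, Ex.eval_var, ei, this, hT.entries j hj,
      List.take_add_one, List.append_assoc, List.getElem?_eq_getElem hj]
    rfl
  · rintro t ⟨ho, hf⟩
    exact ⟨by simpa using ho, hf⟩

theorem writeLists_spec {V : List (ℕ × ℕ)} (hV : V.length ≤ (l + 1) * q + 1)
    (hB : TreeBounds M p l q d R e) (hT : TreeTapes p l q R e V s) :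
    Tri M writeLists (((l + 1) * q + 1) * 300 + 100) s (fun t => t.out = s.out ++
      ((V.length : ℤ) :: V.flatMap (vertexRow p l q R e) ++ V.flatMap (termRow p l q R e))) := by
  have hM1 := hB.one_le
  have hM := hB.size
  refine Tri.write_cons (by simp) ?_
  have h5 := length_vertexRows p l q R e V
  have h4 := length_termRows p l q R e V
  refine Tri.cons (writeArray_spec (by simp) (hT.rows.of_eq (by simp) (by simp)) (by omega) hM1)
    ?_
  rintro t ⟨ho, hf⟩ -
  refine Tri.cons (writeArray_spec (by simp) (hT.terms.of_eq ((hf.reg 53 rfl).trans (by simp))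
    ((hf.arr 10 rfl).trans (by simp))) (by omega) hM1) ?_
  rintro u ⟨ho', -⟩ -
  refine Tri.nil ?_
  rw [ho', ho]
  simp [hT.num]

end specs

end IgusaZeta

namespace IgusaZeta

/-! ### Integer roots of the normalized polynomial -/

theorem toRat_ne_zero {f : ℤ[X]} (hf : f ≠ 0) : toRat f ≠ 0 :=
  (Polynomial.map_ne_zero_iff Int.cast_injective).2 hf

theorem leadingCoeff_toRat (f : ℤ[X]) : (toRat f).leadingCoeff = f.leadingCoeff :=
  leadingCoeff_map_of_injective Int.cast_injective _

theorem natDegree_toRat (f : ℤ[X]) : (toRat f).natDegree = f.natDegree :=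
  natDegree_map_eq_of_injective Int.cast_injective _

theorem abs_le_sum_sq {f : ℤ[X]} {S : ℤ}
    (hS : S = ∑ i ∈ Finset.range (f.natDegree + 1), f.coeff i ^ 2) (i : ℕ) : |f.coeff i| ≤ S := by
  have hS0 : 0 ≤ S := hS ▸ Finset.sum_nonneg fun _ _ => sq_nonneg _
  by_cases hi : i ≤ f.natDegree
  · have h1 : f.coeff i ^ 2 ≤ S := hS ▸ Finset.single_le_sum (f := fun i => f.coeff i ^ 2)
      (fun _ _ => sq_nonneg _) (by simpa [Nat.lt_succ_iff] using hi)
    rw [← sq_abs] at h1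
    nlinarith [abs_nonneg (f.coeff i), Int.le_self_sq |f.coeff i|]
  · rw [coeff_eq_zero_of_natDegree_lt (by omega)]
    simpa

/-- Cauchy's bound `|α| ≤ 1 + max |c_i| / |a|`, multiplied by `|a|`, gives `|a| + max |c_i|`, and
every coefficient is at most `S` in absolute value. -/
theorem abs_root_mul_leadingCoeff_le {f : ℤ[X]} {S : ℤ} (hf : f ≠ 0)
    (hS : S = ∑ i ∈ Finset.range (f.natDegree + 1), f.coeff i ^ 2) {α : ℚ}
    (hα : (toRat f).IsRoot α) : |α * f.leadingCoeff| ≤ 2 * S := by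
  have hα' : (f.map (Int.castRingHom ℝ)).IsRoot (α : ℝ) := by
    have : f.map (Int.castRingHom ℝ) = (toRat f).map (algebraMap ℚ ℝ) := by
      rw [toRat, Polynomial.map_map]; congr 1
    rw [this]
    exact hα.map (f := algebraMap ℚ ℝ)
  have hne : f.map (Int.castRingHom ℝ) ≠ 0 := (Polynomial.map_ne_zero_iff Int.cast_injective).2 hf
  have h1 := hα'.norm_lt_cauchyBound hne
  have ha : (0 : ℝ) < |(f.leadingCoeff : ℝ)| := by simpa using hf
  have h2 : (cauchyBound (f.map (Int.castRingHom ℝ)) : ℝ) ≤ S / |(f.leadingCoeff : ℝ)| + 1 := by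
    unfold cauchyBound
    rw [NNReal.coe_add, NNReal.coe_div, leadingCoeff_map_of_injective Int.cast_injective]
    simp only [coe_nnnorm, NNReal.coe_one]
    gcongr
    · exact (show (0 : ℝ) ≤ S by exact_mod_cast (abs_nonneg _).trans (abs_le_sum_sq hS 0))
    · have hS0 : (0 : ℝ) ≤ S := by
        exact_mod_cast (abs_nonneg _).trans (abs_le_sum_sq hS 0)
      rw [← NNReal.coe_mk (S : ℝ) hS0, NNReal.coe_le_coe, Finset.sup_le_iff]
      intro i _
      rw [← NNReal.coe_le_coe, NNReal.coe_mk, coe_nnnorm, coeff_map]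
      simpa using (show (|f.coeff i| : ℝ) ≤ S by exact_mod_cast abs_le_sum_sq hS i)
    · simp
  have h3 : |(f.leadingCoeff : ℝ)| ≤ S := by
    exact_mod_cast abs_le_sum_sq hS f.natDegree
  have h4 : |(α : ℝ) * f.leadingCoeff| ≤ 2 * S := by
    rw [abs_mul]
    have h5 : |(α : ℝ)| ≤ S / |(f.leadingCoeff : ℝ)| + 1 := by
      rw [← Real.norm_eq_abs]; exact (NNReal.coe_le_coe.2 h1.le).trans h2
    calc |(α : ℝ)| * |(f.leadingCoeff : ℝ)|
        ≤ (S / |(f.leadingCoeff : ℝ)| + 1) * |(f.leadingCoeff : ℝ)| := by gcongr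
      _ = S + |(f.leadingCoeff : ℝ)| := by field_simp
      _ ≤ 2 * S := by linarith
  exact_mod_cast h4

/-- `a * α` is integral over the integers and rational, hence an integer. The coefficients of the
polynomial with these roots are read off from the substitution `X ↦ a * X`, and they are the ones
computed by `normalize`. -/
theorem exists_integer_roots {f : ℤ[X]} (hs : (toRat f).Splits) (hf : f ≠ 0) {S : ℤ}
    (hS : S = ∑ i ∈ Finset.range (f.natDegree + 1), f.coeff i ^ 2) :
    ∃ ys : Multiset ℤ, ys.card = f.natDegree ∧ (∀ y ∈ ys, |y| ≤ 2 * S) ∧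
      toRat f = C (f.leadingCoeff : ℚ) *
        (ys.map fun y : ℤ => X - C ((y : ℚ) / f.leadingCoeff)).prod ∧
      ∀ i < f.natDegree,
        (ofRoots ys).coeff i = f.coeff i * f.leadingCoeff ^ (f.natDegree - 1 - i) := by
  have hf' := toRat_ne_zero hf
  have ha : (f.leadingCoeff : ℚ) ≠ 0 := by simpa using hf
  have hint : ∀ α ∈ (toRat f).roots, (((α * f.leadingCoeff).num : ℤ) : ℚ) = α * f.leadingCoeff := by
    intro α hα
    have h0 : aeval α f = 0 := by
      have := (mem_roots hf').1 hα
      rwa [toRat, IsRoot, eval_map] at this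
    have h1 := isIntegral_leadingCoeff_smul f α h0
    obtain ⟨y, hy⟩ := IsIntegrallyClosed.isIntegral_iff.1 h1
    have : α * f.leadingCoeff = (y : ℚ) := by
      rw [mul_comm, ← zsmul_eq_mul]; exact hy.symm
    rw [this, Rat.num_intCast]
  have hcast : ((toRat f).roots.map fun α => X - C α) =
      (((toRat f).roots.map fun α : ℚ => (α * (f.leadingCoeff : ℚ)).num).map
        fun y : ℤ => X - C ((y : ℚ) / f.leadingCoeff)) := by
    rw [Multiset.map_map]
    refine Multiset.map_congr rfl fun α hα => ?_
    rw [Function.comp_apply, hint α hα, mul_div_cancel_right₀ _ ha]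
  have hprod : toRat f = C (f.leadingCoeff : ℚ) *
      (((toRat f).roots.map fun α : ℚ => (α * (f.leadingCoeff : ℚ)).num).map
        fun y : ℤ => X - C ((y : ℚ) / f.leadingCoeff)).prod := by
    rw [← hcast, ← leadingCoeff_toRat]
    exact hs.eq_prod_roots
  have hcard : ((toRat f).roots.map fun α : ℚ => (α * (f.leadingCoeff : ℚ)).num).card =
      f.natDegree := by
    rw [Multiset.card_map, ← natDegree_toRat, hs.natDegree_eq_card_roots]
  refine ⟨_, hcard, ?_, hprod, ?_⟩
  · simp only [Multiset.mem_map, forall_exists_index, and_imp, forall_apply_eq_imp_iff₂]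
    intro α hα
    have := abs_root_mul_leadingCoeff_le hf hS ((mem_roots hf').1 hα)
    rw [← hint α hα] at this
    exact_mod_cast this
  · intro i hi
    set ys := (toRat f).roots.map fun α : ℚ => (α * (f.leadingCoeff : ℚ)).num
    -- Each of the `d` factors `a * X - y` is `a * (X - y / a)`, so the substitution produces `a ^
    -- d` times the monic polynomial with the roots of `f`.
    have key : C (f.leadingCoeff : ℚ) * ((ofRoots ys).map (Int.castRingHom ℚ)).comp
        (C (f.leadingCoeff : ℚ) * X) = C ((f.leadingCoeff : ℚ) ^ f.natDegree) * toRat f := by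
      rw [hprod, ← hcard, ofRoots]
      induction ys using Multiset.induction_on with
      | empty => simp
      | cons y ys ih =>
        simp only [Multiset.map_cons, Multiset.prod_cons, Polynomial.map_mul, mul_comp,
          Polynomial.map_sub, map_X, Polynomial.map_C, sub_comp, X_comp, C_comp,
          Multiset.card_cons, pow_succ, map_mul] at ih ⊢
        have : (C (f.leadingCoeff : ℚ) * X - C ((Int.castRingHom ℚ) y)) =
            C (f.leadingCoeff : ℚ) * (X - C ((y : ℚ) / f.leadingCoeff)) := by
          rw [mul_sub, ← C_mul, mul_div_cancel₀ _ ha]; rfl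
        rw [this]
        linear_combination (C (f.leadingCoeff : ℚ) * (X - C ((y : ℚ) / f.leadingCoeff))) * ih
    have h1 := congrArg (fun g => coeff g i) key
    simp only [coeff_C_mul, comp_C_mul_X_coeff, coeff_map, toRat] at h1
    have h2 : (f.leadingCoeff : ℤ) * ((ofRoots ys).coeff i * f.leadingCoeff ^ i) =
        f.leadingCoeff ^ f.natDegree * f.coeff i := by
      have : (Int.castRingHom ℚ) (f.leadingCoeff * ((ofRoots ys).coeff i * f.leadingCoeff ^ i)) =
          (Int.castRingHom ℚ) (f.leadingCoeff ^ f.natDegree * f.coeff i) := by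
        simpa using h1
      exact (Int.castRingHom ℚ).injective_int this
    have ha' : f.leadingCoeff ≠ 0 := by simpa using hf
    apply mul_left_cancel₀ (pow_ne_zero (i + 1) ha')
    have e1 : f.leadingCoeff ^ f.natDegree =
        f.leadingCoeff ^ (i + 1) * f.leadingCoeff ^ (f.natDegree - 1 - i) := by
      rw [← pow_add]; congr 1; omega
    rw [e1] at h2
    linear_combination h2

/-! ### Factorizations -/

section factorization

variable {p : ℕ} {g : ℚ[X]} {F : List (ℚ × ℕ)}

/-- The product of the powers of linear factors in the list. -/
noncomputable def linearProd (F : List (ℚ × ℕ)) : ℚ[X] :=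
  (F.map fun x => (X - C x.1) ^ x.2).prod

theorem monic_linearProd (F : List (ℚ × ℕ)) : (linearProd F).Monic := by
  induction F with
  | nil => simp [linearProd]
  | cons x F ih =>
    rw [linearProd, List.map_cons, List.prod_cons]
    exact ((monic_X_sub_C _).pow _).mul ih

theorem roots_linearProd (F : List (ℚ × ℕ)) :
    (linearProd F).roots = (F.map fun x => Multiset.replicate x.2 x.1).sum := by
  induction F with
  | nil => simp [linearProd]
  | cons x F ih =>
    have : linearProd (x :: F) = (X - C x.1) ^ x.2 * linearProd F := by
      simp [linearProd]
    rw [this, roots_mul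
      (((monic_X_sub_C _).pow _).mul (monic_linearProd F)).ne_zero, roots_pow, roots_X_sub_C,
      Multiset.nsmul_singleton, List.map_cons, List.sum_cons, ih]

theorem mem_sum_replicate {α : ℚ} : α ∈ (F.map fun x => Multiset.replicate x.2 x.1).sum ↔
    ∃ x ∈ F, x.1 = α ∧ 0 < x.2 := by
  induction F with
  | nil => simp
  | cons x F ih =>
    rw [List.map_cons, List.sum_cons, Multiset.mem_add, ih, Multiset.mem_replicate]
    simp only [List.mem_cons, exists_eq_or_imp, Nat.pos_iff_ne_zero]
    rw [and_comm, eq_comm]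

theorem count_sum_replicate (hF : (F.map Prod.fst).Nodup) {x : ℚ × ℕ} (hx : x ∈ F) :
    (F.map fun x => Multiset.replicate x.2 x.1).sum.count x.1 = x.2 := by
  induction F with
  | nil => simp at hx
  | cons y F ih =>
    rw [List.map_cons, List.nodup_cons] at hF
    rw [List.map_cons, List.sum_cons, Multiset.count_add, Multiset.count_replicate]
    rcases List.mem_cons.1 hx with rfl | hx
    · rw [if_pos rfl, Multiset.count_eq_zero_of_notMem, add_zero]
      rw [mem_sum_replicate]
      rintro ⟨y, hy, hyx, -⟩
      exact hF.1 (hyx ▸ List.mem_map_of_mem hy)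
    · rw [if_neg, ih hF.2 hx, zero_add]
      intro h
      exact hF.1 (h ▸ List.mem_map_of_mem hx)

namespace IsFactorization

theorem roots_eq (h : IsFactorization g F) (hg : g ≠ 0) : g.roots = (F.map fun x =>
    Multiset.replicate x.2 x.1).sum := by
  rw [h.eq_prod, roots_C_mul _ (leadingCoeff_ne_zero.2 hg), ← roots_linearProd]
  rfl

theorem rootSet_eq (h : IsFactorization g F) (hg : g ≠ 0) : rootSet g = (F.map Prod.fst).toFinset
    := by
  ext α
  rw [rootSet, Multiset.mem_toFinset, h.roots_eq hg, mem_sum_replicate]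
  simp only [List.mem_toFinset, List.mem_map]
  exact ⟨fun ⟨x, hx, h1, _⟩ => ⟨x, hx, h1⟩, fun ⟨x, hx, h1⟩ => ⟨x, hx, h1, h.pos x hx⟩⟩

theorem rootMultiplicity_eq (h : IsFactorization g F) (hg : g ≠ 0) {x : ℚ × ℕ} (hx : x ∈ F) :
    g.rootMultiplicity x.1 = x.2 := by
  rw [← count_roots, h.roots_eq hg, count_sum_replicate h.distinct hx]

/-- Transfers products over the set of roots to products over the list `F`. The positive part, the
shift and the factorization of `|f|_p` are all products of this kind, for different `φ`. -/
theorem prod_filter_rootSet (h : IsFactorization g F) (hg : g ≠ 0) {M : Type*} [CommMonoid M] (P :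
    ℚ → Prop) [DecidablePred P]
    (φ : ℚ → ℕ → M) : ∏ α ∈ (rootSet g).filter P, φ α (g.rootMultiplicity α) =
      ((F.filter fun x => decide (P x.1)).map fun x => φ x.1 x.2).prod := by
  have h1 : (rootSet g).filter P = ((F.filter fun x => decide (P x.1)).map Prod.fst).toFinset := by
    rw [h.rootSet_eq hg]
    ext α
    simp only [Finset.mem_filter, List.mem_toFinset, List.mem_map, List.mem_filter,
      decide_eq_true_eq]
    constructor
    · rintro ⟨⟨x, hx, rfl⟩, hP⟩
      exact ⟨x, ⟨hx, hP⟩, rfl⟩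
    · rintro ⟨x, ⟨hx, hP⟩, rfl⟩
      exact ⟨⟨x, hx, rfl⟩, hP⟩
  rw [h1, List.prod_toFinset _ (h.distinct.sublist (List.Sublist.map _ List.filter_sublist)),
    List.map_map]
  refine congrArg _ (List.map_congr_left fun x hx => ?_)
  rw [Function.comp_apply, h.rootMultiplicity_eq hg (List.mem_of_mem_filter hx)]

theorem plusPart_eq (h : IsFactorization g F) (hg : g ≠ 0) (p : ℕ) :
    plusPart p g = linearProd (F.filter fun x => decide (0 ≤ padicValRat p x.1)) :=
  h.prod_filter_rootSet hg (fun α => 0 ≤ padicValRat p α) fun α e => (X - C α) ^ e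

theorem plusPart (h : IsFactorization g F) (hg : g ≠ 0) (p : ℕ) : IsFactorization (plusPart p g)
    (F.filter fun x => decide (0 ≤ padicValRat p x.1)) where
  distinct := h.distinct.sublist (List.Sublist.map _ List.filter_sublist)
  pos x hx := h.pos x (List.mem_of_mem_filter hx)
  eq_prod := by
    rw [h.plusPart_eq hg, (monic_linearProd _).leadingCoeff, C_1, one_mul]
    rfl

/-- A root with negative order has order `-v_p(den)`, and for the other roots `v_p(den) = 0`. So the
sum may run over all of `F`, as in the program. -/
theorem shift_eq (h : IsFactorization g F) (hg : g ≠ 0) (p : ℕ) [hp : Fact p.Prime] : shift p g =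
    padicValRat p g.leadingCoeff -
    (F.map fun x => (x.2 * padicValNat p x.1.den : ℤ)).sum := by
  rw [shift, h.prod_filter_rootSet hg (fun α => padicValRat p α < 0) fun α e => α ^ e]
  -- The list is generalized for the induction, and the product is shown to be nonzero at the same
  -- time, as required for the additivity of `padicValRat`.
  suffices ∀ (G : List (ℚ × ℕ)),
      ((G.filter fun x => decide (padicValRat p x.1 < 0)).map fun x => x.1 ^ x.2).prod ≠ 0 ∧
      padicValRat p ((G.filter fun x => decide (padicValRat p x.1 < 0)).map
        fun x => x.1 ^ x.2).prod =
      - (G.map fun x => (x.2 * padicValNat p x.1.den : ℤ)).sum by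
    rw [padicValRat.mul (leadingCoeff_ne_zero.2 hg) (this F).1, (this F).2, sub_eq_add_neg]
  intro G
  induction G with
  | nil => simp
  | cons x G ih =>
    by_cases hx : padicValRat p x.1 < 0
    · have hx0 : x.1 ≠ 0 := by
        intro h0
        simp [h0] at hx
      rw [List.filter_cons_of_pos (by simpa using hx), List.map_cons, List.prod_cons,
        padicValRat.mul (pow_ne_zero _ hx0) ih.1, ih.2, padicValRat.pow]
      refine ⟨mul_ne_zero (pow_ne_zero _ hx0) ih.1, ?_⟩
      have : padicValRat p x.1 = -padicValNat p x.1.den := by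
        have hd : p ∣ x.1.den := by
          by_contra hd
          exact hx.not_ge ((padicValRat_nonneg_iff p _).2 hd)
        have hn : ¬ (p : ℤ) ∣ x.1.num := fun h' => by
          have := Nat.dvd_gcd (Int.natCast_dvd.1 h') hd
          rw [Nat.Coprime.gcd_eq_one x.1.reduced] at this
          exact hp.out.one_lt.ne' (Nat.dvd_one.1 this)
        rw [padicValRat, padicValInt.eq_zero_of_not_dvd hn]
        simp
      rw [this, List.map_cons, List.sum_cons]
      ring
    · rw [List.filter_cons_of_neg (by simpa using hx)]
      refine ⟨ih.1, ?_⟩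
      rw [ih.2, List.map_cons, List.sum_cons,
        padicValNat.eq_zero_of_not_dvd ((padicValRat_nonneg_iff p _).1 (not_lt.1 hx))]
      simp

end IsFactorization

/-- The roots of `g` are the `α i`, for `i < q`, with multiplicities `e i`. -/
structure Enumerates (g : ℚ[X]) (q : ℕ) (α : ℕ → ℚ) (e : ℕ → ℕ) : Prop where
  inj : Set.InjOn α (Finset.range q)
  image : rootSet g = (Finset.range q).image α
  mult : ∀ i < q, g.rootMultiplicity (α i) = e i

theorem IsFactorization.enumerates (h : IsFactorization g F) (hg : g ≠ 0) :
    Enumerates g F.length (fun i => (F.getD i default).1) (fun i => (F.getD i default).2) where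
  inj := by
    intro i hi j hj hij
    simp only [Finset.coe_range, Set.mem_Iio] at hi hj
    have := List.nodup_iff_injective_get.1 h.distinct
      (a₁ := ⟨i, by simpa using hi⟩) (a₂ := ⟨j, by simpa using hj⟩) (by
        simp only [List.getD_eq_getElem _ _ hi, List.getD_eq_getElem _ _ hj] at hij
        simpa using hij)
    simpa using this
  image := by
    rw [h.rootSet_eq hg]
    ext α
    simp only [List.mem_toFinset, List.mem_map, Finset.mem_image, Finset.mem_range]
    constructor
    · rintro ⟨x, hx, rfl⟩
      obtain ⟨i, hi, rfl⟩ := List.getElem_of_mem hx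
      exact ⟨i, hi, by rw [List.getD_eq_getElem _ _ hi]⟩
    · rintro ⟨i, hi, rfl⟩
      exact ⟨_, by rw [List.getD_eq_getElem _ _ hi]; exact List.getElem_mem hi, rfl⟩
  mult i hi := by
    rw [List.getD_eq_getElem _ _ hi]
    exact h.rootMultiplicity_eq hg (List.getElem_mem hi)

/-- Multiplying the difference by the two denominators, which are prime to `p`, does not change its
order. If the two numbers are equal, both sides are zero by convention. -/
theorem padicValRat_sub_eq (p : ℕ) [hp : Fact p.Prime] {α β : ℚ} (hα : ¬ p ∣ α.den)
    (hβ : ¬ p ∣ β.den) : padicValRat p (α - β) = pairOrder p α β := by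
  by_cases hαβ : α = β
  · simp [hαβ, pairOrder]
  have h1 : (α - β) * (α.den * β.den : ℕ) = (α.num * β.den - β.num * α.den : ℤ) := by
    push_cast
    linear_combination (β.den : ℚ) * (Rat.mul_den_eq_num α) - (α.den : ℚ) * Rat.mul_den_eq_num β
  have hd : ¬ p ∣ α.den * β.den := fun h => (hp.out.dvd_mul.1 h).elim hα hβ
  have h2 := congrArg (padicValRat p) h1
  rw [padicValRat.mul (sub_ne_zero.2 hαβ) (by simp), padicValRat.of_int, padicValRat.of_nat,
    padicValNat.eq_zero_of_not_dvd hd, Nat.cast_zero, add_zero] at h2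
  exact h2

theorem pairOrder_comm (p : ℕ) (α β : ℚ) : pairOrder p α β = pairOrder p β α := by
  rw [pairOrder, pairOrder, padicValInt, padicValInt, ← Int.natAbs_neg, neg_sub]

/-- The order of a difference is symmetric, so the maximum over ordered pairs is one over `j < i`.
-/
theorem Enumerates.depth_eq (p : ℕ) [Fact p.Prime] {q : ℕ} {α : ℕ → ℚ} {e : ℕ → ℕ}
    (h : Enumerates g q α e) (hα : ∀ i < q, ¬ p ∣ (α i).den) :
    depth p g = 1 + (Finset.range q).sup fun i =>
        (Finset.range i).sup fun j => pairOrder p (α i) (α j) := by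
  rw [depth]
  congr 1
  have hv : ∀ i < q, ∀ j < q, (padicValRat p (α i - α j)).toNat = pairOrder p (α i) (α j) :=
    fun i hi j hj => by rw [padicValRat_sub_eq p (hα i hi) (hα j hj), Int.toNat_natCast]
  have hle : ∀ i < q, ∀ j < i, pairOrder p (α i) (α j) ≤ (Finset.range q).sup fun i =>
        (Finset.range i).sup fun j => pairOrder p (α i) (α j) := fun i hi j hj =>
    (Finset.le_sup (f := fun j => pairOrder p (α i) (α j)) (Finset.mem_range.2 hj)).trans
      (Finset.le_sup (f := fun i => (Finset.range i).sup fun j => pairOrder p (α i) (α j))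
        (Finset.mem_range.2 hi))
  apply le_antisymm
  · refine Finset.sup_le fun a ha => ?_
    rw [Finset.mem_offDiag, h.image, Finset.mem_image, Finset.mem_image] at ha
    obtain ⟨⟨i, hi, hi'⟩, ⟨j, hj, hj'⟩, hne⟩ := ha
    rw [Finset.mem_range] at hi hj
    rw [← hi', ← hj', hv i hi j hj]
    rcases lt_trichotomy j i with hij | rfl | hij
    · exact hle i hi j hij
    · exact absurd (hi'.symm.trans hj') hne
    · rw [pairOrder_comm]; exact hle j hj i hij
  · refine Finset.sup_le fun i hi => Finset.sup_le fun j hj => ?_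
    rw [Finset.mem_range] at hi hj
    rw [← hv i hi j (hj.trans hi)]
    refine Finset.le_sup (f := fun a : ℚ × ℚ => (padicValRat p (a.1 - a.2)).toNat)
      (b := (α i, α j)) ?_
    rw [Finset.mem_offDiag, h.image]
    refine ⟨Finset.mem_image_of_mem _ (by simpa using hi),
      Finset.mem_image_of_mem _ (by simpa using hj.trans hi), fun hij => ?_⟩
    have := h.inj (by simpa using hi) (by simpa using hj.trans hi) hij
    omega

end factorization

end IgusaZeta

namespace IgusaZeta

/-! ### The tree in terms of residues -/

/-- The vertex of level `u.1` with representative `u.2`. -/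
def vertexOf (p : ℕ) (u : ℕ × ℕ) : Vertex p := ⟨u.1, (u.2 : ZMod (p ^ u.1))⟩

section

variable {p : ℕ} {l q : ℕ} {g : ℚ[X]} {α : ℕ → ℚ} {e R : ℕ → ℕ}

theorem vertexOf_eq_iff {m z z' : ℕ} : vertexOf p (m, z) = vertexOf p (m, z') ↔
    z % p ^ m = z' % p ^ m := by
  rw [vertexOf, vertexOf, Sigma.mk.injEq]
  simp only [heq_eq_eq, true_and]
  exact ZMod.natCast_eq_natCast_iff' _ _ _

theorem vertexOf_ge_iff {m z k z' : ℕ} : (vertexOf p (m, z)).Ge (vertexOf p (k, z')) ↔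
    k ≤ m ∧ z % p ^ k = z' % p ^ k := by
  have key : ∀ h : k ≤ m, ZMod.castHom (pow_dvd_pow p h) (ZMod (p ^ k)) (z : ZMod (p ^ m)) = z' ↔
      z % p ^ k = z' % p ^ k := fun h => by
    rw [map_natCast]
    exact ZMod.natCast_eq_natCast_iff' _ _ _
  exact ⟨fun ⟨h, h'⟩ => ⟨h, (key h).1 h'⟩, fun ⟨h, h'⟩ => ⟨h, (key h).2 h'⟩⟩

theorem vertexOf_zero (z : ℕ) : vertexOf p (0, z) = ⟨0, 0⟩ := by
  have : Subsingleton (ZMod (p ^ 0)) := by rw [pow_zero]; infer_instance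
  exact congrArg (Sigma.mk 0) (Subsingleton.elim _ _)

theorem mem_verticesUpTo {k : ℕ} {u : ℕ × ℕ} : u ∈ verticesUpTo p q R k ↔
    u = (0, 0) ∨ ∃ i < k, ∃ j < q, IsFirst R (p ^ (i + 1)) j ∧ (i + 1, R j % p ^ (i + 1)) = u := by
  simp only [verticesUpTo, levelVertices, List.mem_cons, List.mem_flatMap, List.mem_range,
    List.mem_map, List.mem_filter, decide_eq_true_eq, and_assoc]

theorem weightN_ne_zero {m z i : ℕ} (he : ∀ i < q, 0 < e i) (hm : m ≠ 0) (hi : i < q)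
    (hiz : R i % p ^ m = z % p ^ m) : weightN p q R e m z ≠ 0 := by
  rw [weightN, if_neg hm, classSum]
  intro h0
  have := Finset.sum_eq_zero_iff.1 h0 i (by simpa using hi)
  rw [if_pos hiz] at this
  exact (he i hi).ne' this

/-- The summand of a vertex. -/
def termOf (p l q : ℕ) (R e : ℕ → ℕ) (u : ℕ × ℕ) : Term where
  c := termNum p l q R e u.1 u.2
  k := u.1 + 1
  a := pathSum p q R e u.1 u.2
  b := termExp p l q R e u.1 u.2

theorem writeTerms_eq (l q : ℕ) (R e : ℕ → ℕ) (V : List (ℕ × ℕ)) :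
    writeTerms (V.map (termOf p l q R e)) = V.flatMap (termRow p l q R e) := by
  rw [writeTerms, List.flatMap_map]
  rfl

variable [hp : Fact p.Prime]

/-- Reduction maps the inverse of the denominator to the inverse. Hence the single number `R i`, a
representative modulo `p ^ (l + 1)`, determines the classes of the root on all levels of the tree.
-/
theorem residue_eq_natCast {α : ℚ} (hα : ¬ p ∣ α.den) {m n : ℕ} (hmn : m ≤ n) :
    residue p m α = ((residue p n α).val : ℕ) := by
  have : NeZero (p ^ n) := ⟨pow_ne_zero _ hp.out.ne_zero⟩
  have h1 : ZMod.castHom (pow_dvd_pow p hmn) (ZMod (p ^ m)) (residue p n α) = residue p m α := by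
    have hc : ∀ k, Nat.Coprime α.den (p ^ k) := fun k =>
      (((Nat.Prime.coprime_iff_not_dvd hp.out).2 hα).symm).pow_right k
    have h2 : ∀ k, (α.den : ZMod (p ^ k)) * (α.den : ZMod (p ^ k))⁻¹ = 1 := fun k =>
      ZMod.coe_mul_inv_eq_one _ (hc k)
    have h3 := congrArg (ZMod.castHom (pow_dvd_pow p hmn) (ZMod (p ^ m))) (h2 n)
    rw [map_mul, map_natCast, map_one] at h3
    rw [residue, residue, map_mul, map_intCast]
    linear_combination (α.num : ZMod (p ^ m)) * (α.den : ZMod (p ^ m))⁻¹ * h3 -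
      (α.num : ZMod (p ^ m)) * ZMod.castHom (pow_dvd_pow p hmn) (ZMod (p ^ m))
        (α.den : ZMod (p ^ n))⁻¹ * h2 m
  rw [← h1, ← map_natCast (ZMod.castHom (pow_dvd_pow p hmn) (ZMod (p ^ m))), ZMod.natCast_zmod_val]

/-- The data of the roots of a polynomial whose roots are `p`-adic integers: the representatives
of the residue classes modulo `p ^ (l + 1)` are the `R i`. -/
structure ResidueData (p : ℕ) (g : ℚ[X]) (l q : ℕ) (α : ℕ → ℚ) (e R : ℕ → ℕ) : Prop
    extends Enumerates g q α e where
  integral : ∀ i < q, ¬ p ∣ (α i).den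
  residue : ∀ i < q, R i = (residue p (l + 1) (α i)).val

namespace ResidueData

theorem mk_residue (h : ResidueData p g l q α e R) {i m : ℕ} (hi : i < q) (hm : m ≤ l + 1) :
    (⟨m, IgusaZeta.residue p m (α i)⟩ : Vertex p) = vertexOf p (m, R i) := by
  rw [vertexOf, residue_eq_natCast (h.integral i hi) hm, h.residue i hi]

theorem mem_tree (h : ResidueData p g l q α e R) {m z : ℕ} : vertexOf p (m, z) ∈ tree p g l ↔
    m = 0 ∨ m ≤ l + 1 ∧ ∃ i < q, R i % p ^ m = z % p ^ m := by
  rw [tree, Finset.mem_insert, ← vertexOf_zero 0]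
  simp only [Finset.mem_image, Finset.mem_product, Finset.mem_range, Prod.exists, h.image]
  constructor
  · rintro (h0 | ⟨k, β, ⟨hk, i, hi, rfl⟩, h1⟩)
    · exact .inl (congrArg Sigma.fst h0)
    · rw [h.mk_residue hi (by omega)] at h1
      obtain rfl : k = m := congrArg Sigma.fst h1
      exact .inr ⟨by omega, i, hi, vertexOf_eq_iff.1 h1⟩
  · rintro (rfl | ⟨hm, i, hi, h1⟩)
    · left; rw [vertexOf_zero, vertexOf_zero]
    · exact .inr ⟨m, α i, ⟨by omega, i, hi, rfl⟩, by
        rw [h.mk_residue hi hm]; exact vertexOf_eq_iff.2 h1⟩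

theorem exists_of_mem_tree (h : ResidueData p g l q α e R) {u : Vertex p} (hu : u ∈ tree p g l) :
    ∃ m z, m ≤ l + 1 ∧ u = vertexOf p (m, z) := by
  have : NeZero (p ^ u.1) := ⟨pow_ne_zero _ hp.out.ne_zero⟩
  have hu' : u = vertexOf p (u.1, u.2.val) := by
    rw [vertexOf, ZMod.natCast_zmod_val]
  refine ⟨u.1, u.2.val, ?_, hu'⟩
  rw [hu', h.mem_tree] at hu
  omega

theorem weight_eq (h : ResidueData p g l q α e R) {m z : ℕ} (hm : m ≤ l + 1) :
    weight p g (vertexOf p (m, z)) = weightN p q R e m z := by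
  rw [weight, weightN]
  refine if_congr Iff.rfl rfl ?_
  rw [Finset.sum_filter, h.image, Finset.sum_image h.inj, classSum]
  refine Finset.sum_congr rfl fun i hi => ?_
  rw [Finset.mem_range] at hi
  refine if_congr ?_ (h.mult i hi) rfl
  rw [← vertexOf_eq_iff, ← h.mk_residue hi hm, vertexOf, Sigma.mk.injEq]
  simp

theorem le_tree (h : ResidueData p g l q α e R) {m z k : ℕ} (hu : vertexOf p (m, z) ∈ tree p g l)
    (hk : k ≤ m) : vertexOf p (k, z) ∈ tree p g l := by
  rw [h.mem_tree] at hu ⊢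
  rcases hu with rfl | ⟨hm, i, hi, h1⟩
  · exact .inl (by omega)
  · refine .inr ⟨by omega, i, hi, ?_⟩
    have := congrArg (· % p ^ k) h1
    simpa only [Nat.mod_mod_of_dvd _ (pow_dvd_pow p hk)] using this

/-- Below `u` there is one vertex on each level, the reduction of `u`, and it belongs to the tree
because the same root lies in it. -/
theorem stalk_eq (h : ResidueData p g l q α e R) {m z : ℕ} (hu : vertexOf p (m, z) ∈ tree p g l)
    [DecidablePred (Vertex.Ge (vertexOf p (m, z)))] :
    (tree p g l).filter (fun v => (vertexOf p (m, z)).Ge v) =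
      (Finset.range (m + 1)).image fun k => vertexOf p (k, z) := by
  ext v
  simp only [Finset.mem_filter, Finset.mem_image, Finset.mem_range]
  constructor
  · rintro ⟨hv, hge⟩
    obtain ⟨k, y, hk, rfl⟩ := h.exists_of_mem_tree hv
    rw [vertexOf_ge_iff] at hge
    exact ⟨k, by omega, vertexOf_eq_iff.2 hge.2⟩
  · rintro ⟨k, hk, rfl⟩
    exact ⟨h.le_tree hu (by omega), vertexOf_ge_iff.2 ⟨by omega, rfl⟩⟩

theorem level_le (h : ResidueData p g l q α e R) {m z : ℕ} (hu : vertexOf p (m, z) ∈ tree p g l) :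
    m ≤ l + 1 := by
  rw [h.mem_tree] at hu
  omega

open Classical in
theorem stalkWeight_eq (h : ResidueData p g l q α e R) {m z : ℕ}
    (hu : vertexOf p (m, z) ∈ tree p g l) :
    stalkWeight p g l (vertexOf p (m, z)) = pathSum p q R e m z := by
  rw [stalkWeight, h.stalk_eq hu, Finset.sum_image fun k _ k' _ hk => congrArg Sigma.fst hk,
    Finset.sum_range_succ', h.weight_eq (by omega), pathSum, weightN, if_pos rfl, add_zero]
  have := h.level_le hu
  refine Finset.sum_congr rfl fun k hk => ?_
  rw [Finset.mem_range] at hk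
  rw [h.weight_eq (by omega), weightN, if_neg (by omega)]

/-- The vertices strictly below `u` of positive level are its reductions on the levels `1, …, m -
1`. If `u` itself contributes one to `pathOnes`, none of them has weight one exactly when the count
is one. -/
theorem isFirstSimple_iff (h : ResidueData p g l q α e R) {m z : ℕ}
    (hu : vertexOf p (m, z) ∈ tree p g l) : IsFirstSimple p g l (vertexOf p (m, z)) ↔
      weightN p q R e m z = 1 ∧ pathOnes p q R e m z = 1 := by
  have hm := h.level_le hu
  rw [IsFirstSimple, h.weight_eq hm]
  refine (and_iff_right hu).trans (and_congr_right fun hw => ?_)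
  have hm0 : m ≠ 0 := by rintro rfl; simp [weightN] at hw
  obtain ⟨n, rfl⟩ := Nat.exists_eq_succ_of_ne_zero hm0
  have hO : pathOnes p q R e (n + 1) z = 1 ↔
      ∀ k < n, classSum q R e (p ^ (k + 1)) z ≠ 1 := by
    rw [weightN, if_neg hm0] at hw
    rw [pathOnes, Finset.sum_range_succ, if_pos hw, Nat.add_eq_right, Finset.sum_eq_zero_iff]
    simp
  rw [Nat.succ_eq_add_one, hO]
  constructor
  · intro hno k hk hk1
    refine hno ⟨vertexOf p (k + 1, z), h.le_tree hu (by omega), ?_,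
      vertexOf_ge_iff.2 ⟨by omega, rfl⟩, fun heq => ?_⟩
    · rw [h.weight_eq (by omega), weightN, if_neg (by omega), hk1]
    · have := congrArg Sigma.fst heq
      simp only [vertexOf] at this
      omega
  · rintro hall ⟨v, hv, hv1, hge, hne⟩
    obtain ⟨k, y, hk, rfl⟩ := h.exists_of_mem_tree hv
    rw [vertexOf_ge_iff] at hge
    rw [← vertexOf_eq_iff.2 hge.2] at hv1 hne
    have hkn : k ≠ n + 1 := fun hk => hne (by rw [hk])
    rw [h.weight_eq hk, weightN] at hv1
    split_ifs at hv1 with hk0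
    obtain ⟨j, rfl⟩ := Nat.exists_eq_succ_of_ne_zero hk0
    exact hall j (by omega) hv1

theorem exists_isFirst (n : ℕ) {i : ℕ} (hi : i < q) :
    ∃ j < q, IsFirst R n j ∧ R j % n = R i % n := by
  classical
  have hex : ∃ j, R j % n = R i % n := ⟨i, rfl⟩
  have hle : Nat.find hex ≤ i := Nat.find_min' hex rfl
  refine ⟨Nat.find hex, by omega, fun k hk hk' => ?_, Nat.find_spec hex⟩
  exact Nat.find_min hex hk (hk'.trans (Nat.find_spec hex))

theorem IsFirst.eq {n i j : ℕ} (hi : IsFirst R n i) (hj : IsFirst R n j)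
    (hij : R i % n = R j % n) : i = j := by
  rcases lt_trichotomy i j with hlt | heq | hlt
  · exact absurd hij (hj i hlt)
  · exact heq
  · exact absurd hij.symm (hi j hlt)

-- The children correspond to the first roots that represent them. The representative `z` has to be
-- reduced, since `childrenN` compares remainders with `z` itself. Beyond level `l` both sides are
-- zero.
open Classical in
theorem valence_eq (h : ResidueData p g l q α e R) {m z : ℕ} (hz : z < p ^ m) :
    valence p g l (vertexOf p (m, z)) = childrenN p l q R m z := by
  rw [valence, childrenN]
  split_ifs with hm
  · rw [Finset.sum_boole, Nat.cast_id]
    symm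
    refine Finset.card_bij (fun j _ => vertexOf p (m + 1, R j)) ?_ ?_ ?_
    · simp only [Finset.mem_filter, Finset.mem_range]
      rintro j ⟨hj, hjz, -⟩
      refine ⟨h.mem_tree.2 (.inr ⟨by omega, j, hj, rfl⟩), rfl, vertexOf_ge_iff.2 ⟨by omega, ?_⟩⟩
      rw [hjz, Nat.mod_eq_of_lt hz]
    · simp only [Finset.mem_filter, Finset.mem_range]
      rintro i ⟨-, -, hi⟩ j ⟨-, -, hj⟩ hij
      exact IsFirst.eq hi hj (vertexOf_eq_iff.1 hij)
    · intro v hv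
      rw [Finset.mem_filter] at hv
      obtain ⟨hv, hv1, hge⟩ := hv
      obtain ⟨k, y, hk, rfl⟩ := h.exists_of_mem_tree hv
      obtain rfl : k = m + 1 := hv1
      rw [vertexOf_ge_iff] at hge
      rw [h.mem_tree] at hv
      obtain ⟨-, i, hi, hiy⟩ := hv.resolve_left (by omega)
      obtain ⟨j, hj, hjf, hji⟩ := exists_isFirst (R := R) (p ^ (m + 1)) hi
      refine ⟨j, ?_, vertexOf_eq_iff.2 (hji.trans hiy)⟩
      simp only [Finset.mem_filter, Finset.mem_range]
      refine ⟨hj, ?_, hjf⟩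
      have := congrArg (· % p ^ m) (hji.trans hiy)
      simp only [Nat.mod_mod_of_dvd _ (pow_dvd_pow p (Nat.le_succ m))] at this
      rw [this, hge.2, Nat.mod_eq_of_lt hz]
  · rw [Finset.card_eq_zero, Finset.filter_eq_empty_iff]
    rintro v hv ⟨hv1, -⟩
    obtain ⟨k, y, hk, rfl⟩ := h.exists_of_mem_tree hv
    have : k = m + 1 := hv1
    omega

theorem snd_lt_of_mem {k : ℕ} {u : ℕ × ℕ} (hu : u ∈ verticesUpTo p q R k) : u.2 < p ^ u.1 := by
  rw [mem_verticesUpTo] at hu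
  rcases hu with rfl | ⟨i, -, j, -, -, rfl⟩
  · simp
  · exact Nat.mod_lt _ (pow_pos hp.out.pos _)

theorem mem_vertices_iff (h : ResidueData p g l q α e R) {u : Vertex p} :
    u ∈ (verticesUpTo p q R (l + 1)).map (vertexOf p) ↔ u ∈ tree p g l := by
  rw [List.mem_map]
  constructor
  · rintro ⟨u, hu, rfl⟩
    rcases mem_verticesUpTo.1 hu with rfl | ⟨i, hi, j, hj, -, rfl⟩
    · exact h.mem_tree.2 (.inl rfl)
    · exact h.mem_tree.2 (.inr ⟨by omega, j, hj, by rw [Nat.mod_mod]⟩)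
  · intro hu
    obtain ⟨m, z, hm, rfl⟩ := h.exists_of_mem_tree hu
    by_cases hm0 : m = 0
    · subst hm0
      exact ⟨(0, 0), mem_verticesUpTo.2 (.inl rfl), by rw [vertexOf_zero, vertexOf_zero]⟩
    · obtain ⟨-, i, hi, hiz⟩ := (h.mem_tree.1 hu).resolve_left hm0
      obtain ⟨n, rfl⟩ := Nat.exists_eq_succ_of_ne_zero hm0
      obtain ⟨j, hj, hjf, hji⟩ := exists_isFirst (R := R) (p ^ (n + 1)) hi
      refine ⟨(n + 1, R j % p ^ (n + 1)), mem_verticesUpTo.2 (.inr ⟨n, by omega, j, hj, hjf, rfl⟩),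
        vertexOf_eq_iff.2 ?_⟩
      rw [Nat.mod_mod]
      exact hji.trans hiz

theorem nodup_vertices (k : ℕ) : ((verticesUpTo p q R k).map (vertexOf p)).Nodup := by
  refine List.Nodup.map_on ?_ ?_
  · rintro ⟨m, z⟩ hu ⟨m', z'⟩ hu' heq
    obtain rfl : m = m' := congrArg Sigma.fst heq
    have h1 := snd_lt_of_mem hu
    have h2 := snd_lt_of_mem hu'
    rw [vertexOf_eq_iff, Nat.mod_eq_of_lt h1, Nat.mod_eq_of_lt h2] at heq
    exact congrArg (Prod.mk m) heq
  · rw [verticesUpTo, List.nodup_cons]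
    refine ⟨?_, List.nodup_flatMap.2 ⟨fun i _ => ?_, ?_⟩⟩
    · simp [levelVertices]
    · refine List.Nodup.map_on ?_ (List.nodup_range.filter _)
      intro j hj j' hj' heq
      rw [List.mem_filter, decide_eq_true_eq] at hj hj'
      exact IsFirst.eq hj.2 hj'.2 (congrArg Prod.snd heq)
    · refine List.Nodup.pairwise_of_forall_ne List.nodup_range ?_
      intro i _ j _ hij u hu hu'
      simp only [levelVertices, List.mem_map] at hu hu'
      obtain ⟨a, -, rfl⟩ := hu
      obtain ⟨b, -, hb⟩ := hu'
      have := congrArg Prod.fst hb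
      simp only at this
      omega

theorem vertexRow_eq (h : ResidueData p g l q α e R) {u : ℕ × ℕ}
    (hu : u ∈ verticesUpTo p q R (l + 1)) : vertexRow p l q R e u =
      [((vertexOf p u).1 : ℤ), ((vertexOf p u).2.val : ℤ), (weight p g (vertexOf p u) : ℤ),
        (valence p g l (vertexOf p u) : ℤ), (stalkWeight p g l (vertexOf p u) : ℤ)] := by
  have hlt := snd_lt_of_mem hu
  have hT := h.mem_vertices_iff.1 (List.mem_map_of_mem hu)
  obtain ⟨m, z⟩ := u
  rw [h.weight_eq (h.level_le hT), h.valence_eq hlt, h.stalkWeight_eq hT, vertexRow]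
  simp only [vertexOf]
  rw [ZMod.val_natCast, Nat.mod_eq_of_lt hlt]

theorem termOf_eq (h : ResidueData p g l q α e R) (he : ∀ i < q, 0 < e i) {u : ℕ × ℕ}
    (hu : u ∈ verticesUpTo p q R (l + 1)) :
    (termOf p l q R e u).toRatFunc p = vertexFunction p g l (vertexOf p u) := by
  have hlt := snd_lt_of_mem hu
  have hT := h.mem_vertices_iff.1 (List.mem_map_of_mem hu)
  obtain ⟨m, z⟩ := u
  have hm := h.level_le hT
  have hp0 : (p : ℚ) ≠ 0 := by exact_mod_cast hp.out.ne_zero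
  have hpow : ((p : ℚ) ^ (m + 1))⁻¹ = (p : ℚ)⁻¹ * ((p : ℚ) ^ m)⁻¹ := by
    rw [pow_succ, mul_inv, mul_comm]
  have hc1 : ((p : ℚ) - 1) * ((p : ℚ) ^ (m + 1))⁻¹ = (1 - (p : ℚ)⁻¹) * ((p : ℚ) ^ m)⁻¹ := by
    rw [hpow, ← mul_assoc, sub_mul, mul_inv_cancel₀ hp0, one_mul]
  have hc2 : ∀ v : ℚ, ((p : ℚ) - v) * ((p : ℚ) ^ (m + 1))⁻¹ =
      (p : ℚ)⁻¹ * ((p : ℚ) - v) * ((p : ℚ) ^ m)⁻¹ := fun v => by rw [hpow]; ring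
  rw [vertexFunction, h.weight_eq hm, h.valence_eq hlt, h.stalkWeight_eq hT, h.isFirstSimple_iff hT,
    Term.toRatFunc, termOf]
  simp only [termNum, termExp]
  have h1 : (vertexOf p (m, z)).1 = m := rfl
  simp only [h1]
  by_cases hw : weightN p q R e m z = 1
  · rw [if_neg (c := m = 1 + l ∧ 2 ≤ weightN p q R e m z) (by omega),
      if_neg (c := m ≤ l ∧ weightN p q R e m z ≠ 1) (by omega), if_pos hw, if_pos hw]
    by_cases ho : pathOnes p q R e m z = 1
    · rw [if_pos ho, if_pos ho, if_neg one_ne_zero, if_pos ⟨hw, ho⟩, pow_one, ← hc1]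
      push_cast
      rfl
    · rw [if_neg ho, if_neg ho,
        if_neg (c := weightN p q R e m z = 1 ∧ pathOnes p q R e m z = 1) fun h => ho h.2]
      simp
  · rw [if_neg hw, if_neg hw]
    by_cases hml : m ≤ l
    · rw [if_neg (c := m = 1 + l ∧ 2 ≤ weightN p q R e m z) (by omega),
        if_pos (c := m ≤ l ∧ weightN p q R e m z ≠ 1) ⟨hml, hw⟩, if_pos hml, if_pos hml, if_pos
            rfl, div_one, ← hc2]
      push_cast
      rfl
    -- On level `l + 1` the class contains a root, so its weight is not zero; it is not one either,
    -- hence at least two, and the first case of `vertexFunction` applies.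
    · obtain ⟨-, i, hi, hiz⟩ := (h.mem_tree.1 hT).resolve_left (by omega)
      have hw0 := weightN_ne_zero he (by omega : m ≠ 0) hi hiz
      rw [if_pos (c := m = 1 + l ∧ 2 ≤ weightN p q R e m z) (by omega), if_neg hml, if_neg hml,
          if_neg hw0, ← hc1]
      push_cast
      rfl

theorem forall₂_termOf (h : ResidueData p g l q α e R) (he : ∀ i < q, 0 < e i) :
    List.Forall₂ (fun u t => t.toRatFunc p = vertexFunction p g l u)
      ((verticesUpTo p q R (l + 1)).map (vertexOf p))
      ((verticesUpTo p q R (l + 1)).map (termOf p l q R e)) := by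
  rw [List.forall₂_map_left_iff, List.forall₂_map_right_iff, List.forall₂_same]
  exact fun u hu => h.termOf_eq he hu

theorem writeTree_eq (h : ResidueData p g l q α e R) :
    writeTree p g l ((verticesUpTo p q R (l + 1)).map (vertexOf p)) =
      ((verticesUpTo p q R (l + 1)).length : ℤ) ::
        (verticesUpTo p q R (l + 1)).flatMap (vertexRow p l q R e) := by
  rw [writeTree, List.length_map, List.flatMap_map]
  congr 1
  exact List.flatMap_congr fun u hu => (h.vertexRow_eq hu).symm

end ResidueData

end

end IgusaZeta

/-! ### The complete program and its correctness. -/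

namespace IgusaZeta

open Ex Program

/-- The algorithm, on a state with the degree in variable 1. -/
def computeZeta : Program := block [normalize, findRoots, processRoots, findDepth, findModulus,
  findResidues, buildTree, writeLists]

/-- Bounds for the numbers in the algorithm: `d` is the degree, `S` the sum of the squares of the
coefficients, `l` the depth. -/
structure MachineBounds (M p d l : ℕ) (S : ℤ) : Prop where
  one_le : 1 ≤ S
  roots : (2 * S + 1) ^ (2 * d + 1) ≤ M
  degree : (d + 1 : ℤ) * S ≤ M
  roots_sq : 8 * S * S + 1 ≤ M
  modulus : (p ^ (l + 1) : ℤ) * p ^ (l + 1) + p ^ (l + 1) ≤ M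
  modulus_mul : 2 * S * p ^ (l + 1) ≤ M
  depth : (l + 1) * d + l + 2 ≤ M
  size : 5 * ((l + 1) * d + 1) ≤ M

/-- A bound for the number of operations: `z` is a bound for the length of the numbers, `k` for the
number of rounds in the search for the roots. -/
def totalCost (d l k z : ℕ) : ℕ :=
  100 * (d + 1) + (120 * (d + 4) * (k + 1) + 30) +
    ((d + 1) * (90 * (z + 2) + 150 + 20) + (30 * (z + 2) + 100)) +
    ((d + 1) * ((d + 1) * ((30 * (z + 2) + 60) + 20) + 20) + 10) + ((l + 1) * (10 + 20) + 50) +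
    ((d + 1) * ((60 * (z + 2) + 40 + (l + 2) * (20 + 20)) + 20)) +
    ((l + 1 + 1) * (((d + 1) * ((vertexCost l d + ((d + 1) * (30 + 20)) + 60) + 20) +
      20) + 20) + vertexCost l d + 40) + (((l + 1) * d + 1) * 300 + 100)

theorem vertexCost_mono {l q d : ℕ} (h : q ≤ d) : vertexCost l q ≤ vertexCost l d := by
  unfold vertexCost
  gcongr

theorem ArrayIs.map_getD {β : Type*} [Inhabited β] {f : ℤ → ℤ} {φ : β → ℤ} {L : List β}
    (h : ArrayIs f (L.map φ)) {i : ℕ} (hi : i < L.length) : f i = φ (L.getD i default) := by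
  rw [h i (by simpa using hi), List.getElem_map, List.getD_eq_getElem _ _ hi]

/-- Compare the multisets of roots of the two sides. -/
theorem eq_sum_of_prod_eq {ys : Multiset ℤ} {r : ℕ} {y : ℕ → ℤ} {e : ℕ → ℕ}
    (h : ∏ i ∈ Finset.range r, (X - C (y i)) ^ e i = ofRoots ys) :
    ys = ∑ i ∈ Finset.range r, e i • {y i} := by
  have h1 := congrArg Polynomial.roots h
  rw [ofRoots, roots_multiset_prod_X_sub_C, roots_prod _ _ (by
    rw [h]
    intro h0
    have := natDegree_ofRoots ys
    exact (monic_multiset_prod_of_monic _ _ fun y _ => monic_X_sub_C y).ne_zero h0)] at h1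
  rw [← h1]
  simp only [roots_pow, roots_X_sub_C]
  rfl

theorem isFactorization_of_roots {f : ℤ[X]} {a : ℤ} (ha : f.leadingCoeff = a) (ha0 : a ≠ 0)
    {r : ℕ} {y : ℕ → ℤ} {e : ℕ → ℕ} {ys : Multiset ℤ}
    (hys : toRat f = C (a : ℚ) * (ys.map fun y : ℤ => X - C ((y : ℚ) / a)).prod)
    (hy : ∀ i < r, ∀ j < i, y i ≠ y j) (he : ∀ i < r, 0 < e i)
    (h : ∏ i ∈ Finset.range r, (X - C (y i)) ^ e i = ofRoots ys) :
    IsFactorization (toRat f) ((List.range r).map fun i => ((y i : ℚ) / a, e i)) where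
  distinct := by
    rw [List.map_map]
    refine List.Nodup.map_on ?_ List.nodup_range
    intro i hi j hj hij
    rw [List.mem_range] at hi hj
    have ha0' : (a : ℚ) ≠ 0 := by exact_mod_cast ha0
    simp only [Function.comp_apply, div_left_inj' ha0', Int.cast_inj] at hij
    rcases lt_trichotomy i j with h | h | h
    · exact absurd hij.symm (hy j hj i h)
    · exact h
    · exact absurd hij (hy i hi j h)
  pos := by
    intro x hx
    obtain ⟨i, hi, rfl⟩ := List.mem_map.1 hx
    exact he i (List.mem_range.1 hi)
  eq_prod := by
    rw [leadingCoeff_toRat, ha, List.map_map, hys]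
    congr 1
    rw [eq_sum_of_prod_eq h, ← Multiset.coe_mapAddMonoidHom, map_sum]
    simp only [map_nsmul, Multiset.coe_mapAddMonoidHom, Multiset.map_singleton,
      Multiset.prod_sum, Multiset.prod_nsmul, Multiset.prod_singleton]
    rfl

theorem RootTable.abs_entry_le {g : ℤ[X]} {d r : ℕ} {B x : ℤ} {t : State}
    (h : RootTable g d B 0 r x t) {i : ℕ} (hi : i < r) : |t.arr 3 (i + 1)| ≤ B := by
  have h1 := h.anti 0 (i + 1) (by omega) (by omega)
  have h2 := h.above (i + 1) (by omega)
  have h3 := h.ge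
  have h4 := h.first
  push_cast at h1 h2
  exact abs_le.2 ⟨by omega, by omega⟩

theorem abs_num_div_le {y a : ℤ} (ha : a ≠ 0) : |((y : ℚ) / a).num| ≤ |y| := by
  rw [← Rat.divInt_eq_div]
  rcases eq_or_ne y 0 with rfl | hy
  · simp
  · exact Int.le_of_dvd (abs_pos.2 hy) ((abs_dvd_abs _ _).2 (Rat.num_dvd y ha))

theorem List.eq_map_range_getD {β : Type*} [Inhabited β] (L : List β) :
    L = (List.range L.length).map fun i => L.getD i default := by
  refine List.ext_getElem (by simp) fun i h1 h2 => ?_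
  rw [List.getElem_map, List.getElem_range, List.getD_eq_getElem _ _ h1]

theorem writeDigits_eq (p l : ℕ) (F : List (ℚ × ℕ)) : writeDigits p l F =
    (F.filter (fun x => decide (0 ≤ padicValRat p x.1))).flatMap
      fun x => (digits p (l + 1) x.1).map (Nat.cast : ℕ → ℤ) := by
  rw [writeDigits]
  refine List.flatMap_congr fun x _ => ?_
  simp only [List.map_id', List.bind_eq_flatMap, List.pure_def]
  exact List.flatMap_pure_eq_map _ _

/-- The second half of the program depends on the first only through the factorization `F`, the
bounds for its entries, and the state after `processRoots`. All further data are those of the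
sublist of integral roots, which enumerates the roots of the positive part. -/
theorem treePhase_spec {M p : ℕ} [hp : Fact p.Prime] {f : ℤ[X]} (hf : f ≠ 0) {S : ℤ} {d l : ℕ}
    (hl : l = depth p (plusPart p (toRat f))) (hd : 0 < d) (hB : MachineBounds M p d l S)
    {F : List (ℚ × ℕ)} (hF : IsFactorization (toRat f) F) (hFlen : F.length ≤ d)
    (hFsum : (F.map Prod.snd).sum ≤ d)
    (hFnum : ∀ x ∈ F, |x.1.num| ≤ 2 * S ∧ (x.1.den : ℤ) ≤ 2 * S) {v : State} (v0 : v.reg 0 = p)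
    (hv : RootsProcessed p f.leadingCoeff [f.leadingCoeff, (F.length : ℤ)] F v) :
    Tri M (block [findDepth, findModulus, findResidues, buildTree, writeLists])
      (((d + 1) * ((d + 1) * ((30 * (M.size + 2) + 60) + 20) + 20) + 10) +
        ((l + 1) * (10 + 20) + 50) +
        ((d + 1) * ((60 * (M.size + 2) + 40 + (l + 2) * (20 + 20)) + 20)) +
        ((l + 1 + 1) * (((d + 1) * ((vertexCost l d + ((d + 1) * (30 + 20)) + 60) + 20) +
          20) + 20) + vertexCost l d + 40) + (((l + 1) * d + 1) * 300 + 100)) v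
      (fun t => IsComputeZetaOutput p f t.out) := by
  have hg := toRat_ne_zero hf
  obtain ⟨hS1, hB1, hB2, hB3, hB4, hB5, hB6, hB7⟩ := hB
  have hdM : d + 1 ≤ M := by nlinarith
  have hP : 1 ≤ p ^ (l + 1) := Nat.one_le_pow _ _ hp.out.pos
  have hP' : (1 : ℤ) ≤ p ^ (l + 1) := by exact_mod_cast hP
  have hPM : p ^ (l + 1) ≤ M := by
    have : (p ^ (l + 1) : ℤ) ≤ M := by nlinarith
    exact_mod_cast this
  have hpM : p ≤ M := (Nat.le_self_pow (by omega) p).trans hPM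
  have hlM : l + 1 ≤ M := by nlinarith
  clear hB1 hB2
  obtain ⟨vout, vshift, v16, v5, v6, v7⟩ := hv
  obtain ⟨Fp, hFp⟩ : ∃ Fp, Fp = F.filter fun x => decide (0 ≤ padicValRat p x.1) := ⟨_, rfl⟩
  have hne : plusPart p (toRat f) ≠ 0 := by
    rw [hF.plusPart_eq hg]; exact (monic_linearProd _).ne_zero
  have hFp' := hF.plusPart hg p
  rw [← hFp] at v16 v5 v6 v7 hFp'
  have hE := hFp'.enumerates hne
  have hsub : Fp.Sublist F := hFp ▸ List.filter_sublist
  obtain ⟨α, hα⟩ : ∃ α : ℕ → ℚ, α = fun i => (Fp.getD i default).1 := ⟨_, rfl⟩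
  obtain ⟨e', he'⟩ : ∃ e' : ℕ → ℕ, e' = fun i => (Fp.getD i default).2 := ⟨_, rfl⟩
  obtain ⟨q, hq⟩ : ∃ q, q = Fp.length := ⟨_, rfl⟩
  rw [← hα, ← he', ← hq] at hE
  rw [← hq] at v16
  have hqd : q ≤ d := by rw [hq]; exact hsub.length_le.trans hFlen
  have hmem : ∀ i < q, Fp.getD i default ∈ Fp := fun i hi => by
    rw [List.getD_eq_getElem _ _ (hq ▸ hi)]; exact List.getElem_mem _
  have hint : ∀ i < q, ¬ p ∣ (α i).den := fun i hi => by
    have key : ∀ x ∈ Fp, ¬ p ∣ x.1.den := fun x hx => by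
      rw [hFp, List.mem_filter, decide_eq_true_eq, padicValRat_nonneg_iff] at hx
      exact hx.2
    rw [hα]; exact key _ (hmem i hi)
  have he'pos : ∀ i < q, 0 < e' i := fun i hi => by
    rw [he']; exact hFp'.pos _ (hmem i hi)
  have hnum : ∀ i < q, |(α i).num| ≤ 2 * S ∧ ((α i).den : ℤ) ≤ 2 * S := fun i hi => by
    rw [hα]; exact hFnum _ (hsub.subset (hmem i hi))
  have a5 : ∀ i < q, v.arr 5 i = (α i).num := fun i hi => by
    rw [hα]; exact v5.map_getD (hq ▸ hi)
  have a6 : ∀ i < q, v.arr 6 i = (α i).den := fun i hi => by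
    rw [hα]; exact v6.map_getD (φ := fun x : ℚ × ℕ => (x.1.den : ℤ)) (hq ▸ hi)
  have a7 : ∀ i < q, v.arr 7 i = e' i := fun i hi => by
    rw [he']; exact v7.map_getD (φ := fun x : ℚ × ℕ => (x.2 : ℤ)) (hq ▸ hi)
  have hdepth := hE.depth_eq p hint
  rw [← hl] at hdepth
  refine Tri.cons ((findDepth_spec (T := 2 * S) (fun i hi j hj hij => ?_) (fun i hi => (hnum i
      hi).1)
    (fun i hi => (hnum i hi).2) (by nlinarith) (by omega) hpM v0 v16 a5 a6).weaken
    (c' := (d + 1) * ((d + 1) * ((30 * (M.size + 2) + 60) + 20) + 20) + 10) (by gcongr)) ?_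
  · have := hE.inj (by simpa using hi) (by simpa using hj.trans hi) hij
    omega
  rintro w ⟨hf4, w19⟩ -
  rw [← hdepth] at w19
  have w0 : w.reg 0 = p := (hf4.reg 0 rfl).trans v0
  refine Tri.cons (findModulus_spec hp.out.one_lt.le hPM hlM w0 w19) ?_
  rintro x ⟨hf5, x29, x32, xo⟩ -
  rw [hf4.reg 15 rfl, hf4.out rfl] at xo
  have x0 : x.reg 0 = p := (hf5.reg 0 rfl).trans w0
  have x16 : x.reg 16 = q := (hf5.reg 16 rfl).trans ((hf4.reg 16 rfl).trans v16)
  have x19 : x.reg 19 = l := (hf5.reg 19 rfl).trans w19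
  have x5 : x.arr 5 = v.arr 5 := (hf5.arr 5 rfl).trans (hf4.arr 5 rfl)
  have x6 : x.arr 6 = v.arr 6 := (hf5.arr 6 rfl).trans (hf4.arr 6 rfl)
  have x7 : x.arr 7 = v.arr 7 := (hf5.arr 7 rfl).trans (hf4.arr 7 rfl)
  clear hf4 hf5 v0 v16 v5 v6 v7 w19 w0
  refine Tri.cons ((findResidues_spec hint (fun i hi => (hnum i hi).1) hB4 hB5 (by omega) hlM x0 x16
    x29 x32 (by rwa [x5]) (by rwa [x6])).weaken
    (c' := (d + 1) * ((60 * (M.size + 2) + 40 + (l + 2) * (20 + 20)) + 20)) (by gcongr)) ?_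
  rintro z ⟨z8, zo⟩ hf6
  have hRes : ResidueData p (plusPart p (toRat f)) l q α e'
      (fun i => (residue p (l + 1) (α i)).val) := ⟨hE, hint, fun _ _ => rfl⟩
  have hTD : TreeData p l q (fun i => (residue p (l + 1) (α i)).val) e' z :=
    ⟨(hf6.reg 0 rfl).trans x0, (hf6.reg 16 rfl).trans x16, (hf6.reg 19 rfl).trans x19,
      (hf6.reg 32 rfl).trans x32, fun i hi => by rw [hf6.arr 7 rfl, x7, a7 i hi], z8⟩
  have hTB : TreeBounds M p l q d (fun i => (residue p (l + 1) (α i)).val) e' := by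
    refine ⟨hp.out.pos, ?_, hPM, hB6, ?_⟩
    · have h1 := congrArg (fun L : List (ℚ × ℕ) => (L.map Prod.snd).sum) (List.eq_map_range_getD Fp)
      simp only [List.map_map] at h1
      rw [he', hq]
      exact (h1.symm.le.trans ((hsub.map Prod.snd).sum_le_sum fun _ _ => Nat.zero_le _)).trans hFsum
    · refine le_trans ?_ hB7
      gcongr
  refine Tri.cons ((buildTree_spec hTD hTB).weaken (c' := ((l + 1 + 1) * (((d + 1) *
    ((vertexCost l d + ((d + 1) * (30 + 20)) + 60) + 20) + 20) + 20) + vertexCost l d + 40))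
    (by have := vertexCost_mono (l := l) hqd; gcongr)) ?_
  rintro y' ⟨hf7, hy'⟩ -
  have yo := hf7.out rfl
  refine Tri.cons ((writeLists_spec (length_verticesUpTo_le _ _ _ _) hTB hy').weaken
    (c' := ((l + 1) * d + 1) * 300 + 100) (by gcongr)) ?_
  rintro t ht -
  refine Tri.nil ?_
  dsimp only [IsComputeZetaOutput]
  rw [← hl]
  refine ⟨F, (verticesUpTo p q _ (l + 1)).map (vertexOf p),
    (verticesUpTo p q _ (l + 1)).map (termOf p l q _ e'), hF,
    ⟨ResidueData.nodup_vertices _, fun u => hRes.mem_vertices_iff⟩,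
    hRes.forall₂_termOf he'pos, ?_⟩
  have hdig : writeDigits p l F = (List.range q).flatMap
      (fun i => (digits p (l + 1) (α i)).map (Nat.cast : ℕ → ℤ)) := by
    rw [writeDigits_eq, ← hFp, hα, hq]
    conv_lhs => rw [List.eq_map_range_getD Fp]
    rw [List.flatMap_map]
  rw [hRes.writeTree_eq, writeTerms_eq, ht, yo, zo, xo, vout, hdig, writeFactorization,
    hF.shift_eq hg, vshift, leadingCoeff_toRat, padicValRat.of_int]
  simp [List.append_assoc]

theorem computeZeta_spec {M p : ℕ} [hp : Fact p.Prime] {f : ℤ[X]} (hd : 0 < f.natDegree)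
    (hs : (toRat f).Splits) {S : ℤ} (hS : S = ∑ i ∈ Finset.range (f.natDegree + 1), f.coeff i ^ 2)
    (hB : MachineBounds M p f.natDegree (depth p (plusPart p (toRat f))) S) {k : ℕ}
    (hk : f.natDegree * (2 * f.natDegree * Real.log (1 + 4 * S) + 1) ≤ k) {s : State}
    (h0 : s.reg 0 = p) (h1 : s.reg 1 = f.natDegree)
    (hc : ∀ i ≤ f.natDegree, s.arr 0 i = f.coeff i) (ho : s.out = []) :
    Tri M computeZeta
      (totalCost f.natDegree (depth p (plusPart p (toRat f))) k M.size) s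
      (fun t => IsComputeZetaOutput p f t.out) := by
  have hf : f ≠ 0 := by rintro rfl; simp at hd
  have hg := toRat_ne_zero hf
  obtain ⟨ys, hcard, hyS, hprod, hcoeff⟩ := exists_integer_roots hs hf hS
  set d := f.natDegree with hd'
  set l := depth p (plusPart p (toRat f)) with hl
  have ha : f.coeff d = f.leadingCoeff := rfl
  have ha0 : f.leadingCoeff ≠ 0 := by simpa using hf
  have haS : |f.leadingCoeff| ≤ S := abs_le_sum_sq hS _
  have hB' := hB
  obtain ⟨hS1, hB1, hB2, hB3, hB4, hB5, hB6, hB7⟩ := hB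
  have hdM : d + 1 ≤ M := by nlinarith
  have hP : 1 ≤ p ^ (l + 1) := Nat.one_le_pow _ _ hp.out.pos
  have hP' : (1 : ℤ) ≤ p ^ (l + 1) := by exact_mod_cast hP
  have hPM : p ^ (l + 1) ≤ M := by
    have : (p ^ (l + 1) : ℤ) ≤ M := by nlinarith
    exact_mod_cast this
  have hpM : p ≤ M := (Nat.le_self_pow (by omega) p).trans hPM
  have hlM : l + 1 ≤ M := by nlinarith
  have hpow : S ^ (d + 1) ≤ M := by
    refine le_trans ?_ hB1
    calc S ^ (d + 1) ≤ (2 * S + 1) ^ (d + 1) := by gcongr; omega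
      _ ≤ (2 * S + 1) ^ (2 * d + 1) := pow_le_pow_right₀ (by omega) (by omega)
  have hsq : 0 ≤ S * S := mul_self_nonneg S
  unfold totalCost
  refine Tri.cons (normalize_spec (c := fun i => f.coeff i) hd h1 hc (by simpa [ha] using hf) hS
    hpow (by omega)) ?_
  rintro t ⟨hf1, e2, e3, ed, e1⟩ -
  have t0 : t.reg 0 = p := (hf1.reg 0 rfl).trans h0
  have t1 : t.reg 1 = d := (hf1.reg 1 rfl).trans h1
  have tout : t.out = [] := (hf1.out rfl).trans ho
  rw [ha] at e2
  clear hf1 h0 h1 hc ho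
  refine Tri.cons (findRoots_spec hS1 hB1 hdM hcard hyS t1 e3 (fun i hi => ?_) hk) ?_
  · rcases hi.lt_or_eq with hi | rfl
    · rw [e1 i hi, hcoeff i hi]; rfl
    · rw [ed, ← hcard, ← natDegree_ofRoots]
      exact ((monic_multiset_prod_of_monic _ _ fun y _ => monic_X_sub_C y).coeff_natDegree).symm
  clear e1 ed e3 t1
  rintro u ⟨hf2, r, x, hR⟩ -
  have u0 : u.reg 0 = p := (hf2.reg 0 rfl).trans t0
  have u2 : u.reg 2 = f.leadingCoeff := (hf2.reg 2 rfl).trans e2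
  have uo : u.out = [] := (hf2.out rfl).trans tout
  clear hf2 t0 e2 tout
  obtain ⟨y, hy⟩ : ∃ y : ℕ → ℤ, ∀ i : ℕ, u.arr 3 (i + 1) = y i := ⟨_, fun _ => rfl⟩
  obtain ⟨e, he⟩ : ∃ e : ℕ → ℕ, ∀ i < r, u.arr 4 (i + 1) = e i :=
    ⟨fun i => (u.arr 4 (i + 1)).toNat, fun i hi => by
      have := hR.pos i hi
      push_cast at this
      rw [Int.toNat_of_nonneg this.le]⟩
  have hepos : ∀ i < r, 0 < e i := fun i hi => by
    have := hR.pos i hi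
    push_cast at this
    rw [he i hi] at this
    exact_mod_cast this
  have hrd : r ≤ d := by simpa using hR.num_le
  have hesum : ∑ i ∈ Finset.range r, e i = d := by
    have := hR.sum
    rw [Multiset.card_zero, Nat.cast_zero, add_zero] at this
    have h2 : ((∑ i ∈ Finset.range r, e i : ℕ) : ℤ) = d := by
      rw [← this, Nat.cast_sum]
      refine Finset.sum_congr rfl fun i hi => ?_
      rw [← he i (by simpa using hi)]
      push_cast
      rfl
    exact_mod_cast h2
  have hyS' : ∀ i < r, |y i| ≤ 2 * S := fun i hi => hy i ▸ hR.abs_entry_le hi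
  have hprod' : ∏ i ∈ Finset.range r, (X - C (y i)) ^ e i = ofRoots ys := by
    have := hR.prod
    rw [ofRoots_zero, mul_one] at this
    rw [← this]
    refine Finset.prod_congr rfl fun i hi => ?_
    push_cast
    rw [hy, he i (by simpa using hi), Int.toNat_natCast]
  have hF := isFactorization_of_roots rfl ha0 hprod (fun i hi j hj => by
    have := hR.anti (j + 1) (i + 1) (by omega) (by omega)
    push_cast at this
    rw [hy, hy] at this
    exact this.ne) hepos hprod'
  refine Tri.cons ((processRoots_spec (S := S) ha0 haS hyS' hesum hrd (by nlinarith) hB2 hdM hpM u0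
    u2 hR.num (fun i _ => hy i) he).weaken (c' := (d + 1) * (90 * (M.size + 2) + 150 + 20) +
      (30 * (M.size + 2) + 100)) (by gcongr)) ?_
  clear hR
  rintro v ⟨hf3, hv⟩ -
  rw [uo, List.nil_append] at hv
  have v0 : v.reg 0 = p := (hf3.reg 0 rfl).trans u0
  clear hf3 u0 u2 uo
  have hFlen : ((List.range r).map fun i => ((y i : ℚ) / f.leadingCoeff, e i)).length ≤ d := by
    simpa using hrd
  have hFsum : (((List.range r).map fun i => ((y i : ℚ) / f.leadingCoeff, e i)).map
      Prod.snd).sum ≤ d := by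
    rw [List.map_map]
    exact hesum.le
  have hFnum : ∀ x ∈ (List.range r).map fun i => ((y i : ℚ) / f.leadingCoeff, e i),
      |x.1.num| ≤ 2 * S ∧ (x.1.den : ℤ) ≤ 2 * S := by
    intro x hx
    obtain ⟨i, hi, rfl⟩ := List.mem_map.1 hx
    refine ⟨(abs_num_div_le ha0).trans (hyS' i (List.mem_range.1 hi)), ?_⟩
    exact (den_div_le ha0).trans (by omega)
  have hFr : ((List.range r).map fun i => ((y i : ℚ) / f.leadingCoeff, e i)).length = r := by simp
  refine (treePhase_spec hf hl hd hB' hF hFlen hFsum hFnum v0 (by rw [hFr]; exact hv)).weaken ?_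
  omega

end IgusaZeta

namespace IgusaZeta

open Program

/-! ### The bounds -/

theorem exists_int_of_mem_rootSet {f : ℤ[X]} (hs : (toRat f).Splits) (hf : f ≠ 0) {S : ℤ}
    (hS : S = ∑ i ∈ Finset.range (f.natDegree + 1), f.coeff i ^ 2) {α : ℚ}
    (hα : α ∈ rootSet (toRat f)) : ∃ y : ℤ, α = (y : ℚ) / f.leadingCoeff ∧ |y| ≤ 2 * S := by
  obtain ⟨ys, -, hy, hprod, -⟩ := exists_integer_roots hs hf hS
  rw [rootSet, Multiset.mem_toFinset, mem_roots (toRat_ne_zero hf), hprod, IsRoot, eval_mul,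
    eval_C, eval_multiset_prod, Multiset.map_map, mul_eq_zero, Multiset.prod_eq_zero_iff] at hα
  rcases hα with h0 | h
  · simp [hf] at h0
  · obtain ⟨y, hy', h⟩ := Multiset.mem_map.1 h
    refine ⟨y, ?_, hy y hy'⟩
    simpa [sub_eq_zero] using h

theorem rootSet_plusPart_subset {p : ℕ} (g : ℚ[X]) : rootSet (plusPart p g) ⊆ rootSet g := by
  intro α hα
  rw [rootSet, Multiset.mem_toFinset, mem_roots', IsRoot, plusPart, eval_prod,
    Finset.prod_eq_zero_iff] at hα
  obtain ⟨β, hβ, h⟩ := hα.2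
  rw [eval_pow, eval_sub, eval_X, eval_C] at h
  rw [sub_eq_zero.1 (eq_zero_of_pow_eq_zero h)]
  exact (Finset.mem_filter.1 hβ).1

/-- For integral roots, `p ^ v_p(α - β)` divides the numerator of `α - β = (y - w) / a`, which is at
most `|y - w| ≤ 4 * S` in absolute value. The depth is one more than the maximal order, which leaves
a factor `p ^ 2` for `p ^ (l + 1)`. Without this bound the word length would involve `l * log p`. -/
theorem pow_depth_le {p : ℕ} [hp : Fact p.Prime] {f : ℤ[X]} (hs : (toRat f).Splits) (hf : f ≠ 0)
    {S : ℤ} (hS1 : 1 ≤ S) (hS : S = ∑ i ∈ Finset.range (f.natDegree + 1), f.coeff i ^ 2) :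
    (p : ℤ) ^ (depth p (plusPart p (toRat f)) + 1) ≤ 4 * S * p ^ 2 := by
  rw [depth, show ∀ n, 1 + n + 1 = n + 2 by intro; ring, pow_add]
  gcongr
  rcases (rootSet (plusPart p (toRat f))).offDiag.eq_empty_or_nonempty with h0 | h0
  · rw [h0, Finset.sup_empty, Nat.bot_eq_zero, pow_zero]
    omega
  obtain ⟨⟨α, β⟩, hmem, heq⟩ := Finset.exists_mem_eq_sup _ h0
    (fun a : ℚ × ℚ => (padicValRat p (a.1 - a.2)).toNat)
  rw [heq]
  rw [Finset.mem_offDiag] at hmem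
  obtain ⟨hα, hβ, hne⟩ := hmem
  obtain ⟨y, hy, hy'⟩ := exists_int_of_mem_rootSet hs hf hS (rootSet_plusPart_subset _ hα)
  obtain ⟨w, hw, hw'⟩ := exists_int_of_mem_rootSet hs hf hS (rootSet_plusPart_subset _ hβ)
  have ha0 : f.leadingCoeff ≠ 0 := by simpa using hf
  simp only at hy hw hne ⊢
  have hnum0 : (α - β).num ≠ 0 := by rw [Rat.num_ne_zero]; exact sub_ne_zero.2 hne
  have hle : |(α - β).num| ≤ 4 * S := by
    have : α - β = ((y - w : ℤ) : ℚ) / f.leadingCoeff := by rw [hy, hw]; push_cast; ring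
    rw [this]
    refine (abs_num_div_le ha0).trans ((abs_sub _ _).trans ?_)
    linarith
  refine le_trans ?_ hle
  have hv : (padicValRat p (α - β)).toNat ≤ padicValInt p (α - β).num := by
    rw [padicValRat]; omega
  calc (p : ℤ) ^ (padicValRat p (α - β)).toNat ≤ (p : ℤ) ^ padicValInt p (α - β).num :=
        pow_le_pow_right₀ (by exact_mod_cast hp.out.one_lt.le) hv
    _ ≤ |(α - β).num| := by
        rw [Int.abs_eq_natAbs]
        exact_mod_cast Nat.le_of_dvd (Int.natAbs_pos.2 hnum0) pow_padicValNat_dvd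

theorem one_le_sum_sq {f : ℤ[X]} (hf : f ≠ 0) :
    1 ≤ ∑ i ∈ Finset.range (f.natDegree + 1), f.coeff i ^ 2 := by
  have h1 : f.coeff f.natDegree ^ 2 ≤ _ := Finset.single_le_sum (f := fun i => f.coeff i ^ 2)
    (fun _ _ => sq_nonneg _) (Finset.self_mem_range_succ f.natDegree)
  have h2 : f.coeff f.natDegree ≠ 0 := by simpa using hf
  have h3 : 0 < f.coeff f.natDegree ^ 2 := by positivity
  exact h3.trans_le h1

/-- A bound for the numbers in the algorithm. -/
def wordBound (p d : ℕ) (S : ℤ) : ℤ := 100 * d * p ^ 4 * (2 * S + 1) ^ (2 * d + 4)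

theorem machineBounds {M p d l : ℕ} {S : ℤ} (hp : 2 ≤ p) (hd : 0 < d) (hS : 1 ≤ S)
    (hl : (p : ℤ) ^ (l + 1) ≤ 4 * S * p ^ 2) (hM : (M : ℤ) = wordBound p d S) :
    MachineBounds M p d l S := by
  have hp' : (1 : ℤ) ≤ p ^ 2 := by exact_mod_cast Nat.one_le_pow _ _ (by omega)
  have hd' : (1 : ℤ) ≤ d := by exact_mod_cast hd
  have hA : (2 * S + 1) ^ 2 ≤ (2 * S + 1) ^ (2 * d + 4) :=
    pow_le_pow_right₀ (by omega) (by omega)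
  have hA' : (2 * S + 1) ^ (2 * d + 1) ≤ (2 * S + 1) ^ (2 * d + 4) :=
    pow_le_pow_right₀ (by omega) (by omega)
  have hP : (l : ℤ) + 1 ≤ p ^ (l + 1) := by
    exact_mod_cast (Nat.lt_pow_self (by omega : 1 < p)).le
  have hU : (0 : ℤ) ≤ (2 * S + 1) ^ (2 * d + 4) := pow_nonneg (by omega) _
  rw [wordBound] at hM
  -- From here on the powers are unknowns `U`, `Q`, `P`. The inequalities between monomials
  -- collected below make the remaining goals linear.
  generalize (2 * S + 1) ^ (2 * d + 4) = U at *
  have e4 : (p : ℤ) ^ 4 = p ^ 2 * p ^ 2 := by ring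
  rw [e4] at hM
  generalize (p : ℤ) ^ 2 = Q at *
  generalize hPdef : (p : ℤ) ^ (l + 1) = P at *
  have hQ0 : (0 : ℤ) ≤ Q := by omega
  have hS0 : (0 : ℤ) ≤ S := by omega
  have hd0 : (0 : ℤ) ≤ d := by omega
  have hSS : S ≤ S * S := le_mul_of_one_le_left hS0 hS
  have hU1 : 4 * (S * S) + 4 * S + 1 ≤ U := by linarith
  have hSU : S ≤ U := by omega
  have hP0 : 0 ≤ P := by omega
  have hQU : U ≤ Q * U := le_mul_of_one_le_left hU hp'
  have hQQU : Q * U ≤ Q * (Q * U) := le_mul_of_one_le_left (by omega) hp'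
  have hdV : Q * (Q * U) ≤ d * (Q * (Q * U)) := le_mul_of_one_le_left (by omega) hd'
  have hdQU : (d : ℤ) * (Q * U) ≤ d * (Q * (Q * U)) := mul_le_mul_of_nonneg_left hQQU hd0
  have hdU : (d : ℤ) * U ≤ d * (Q * U) := mul_le_mul_of_nonneg_left hQU hd0
  have hdS : d * S ≤ d * U := mul_le_mul_of_nonneg_left hSU hd0
  have hdQS : (d : ℤ) * (Q * S) ≤ d * (Q * U) :=
    mul_le_mul_of_nonneg_left (mul_le_mul_of_nonneg_left hSU hQ0) hd0
  have hQSS : Q * (4 * (S * S)) ≤ Q * U := mul_le_mul_of_nonneg_left (by omega) hQ0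
  have hQQSS : Q * (Q * (4 * (S * S))) ≤ Q * (Q * U) := mul_le_mul_of_nonneg_left hQSS hQ0
  have hPP : P * P ≤ (4 * S * Q) * (4 * S * Q) :=
    mul_le_mul hl hl hP0 (mul_nonneg (by omega) hQ0)
  have hPP' : P ≤ P * P := le_mul_of_one_le_left hP0 (by omega)
  have hSP : S * P ≤ S * (4 * S * Q) := mul_le_mul_of_nonneg_left hl hS0
  have hld : ((l : ℤ) + 1) * d ≤ 4 * (d * (Q * S)) := by
    calc ((l : ℤ) + 1) * d ≤ (4 * S * Q) * d := mul_le_mul_of_nonneg_right (hP.trans hl) hd0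
      _ = _ := by ring
  have hld' : (l : ℤ) + 1 ≤ ((l : ℤ) + 1) * d := le_mul_of_one_le_right (by omega) hd'
  have hl0 : (0 : ℤ) ≤ l := by omega
  have hM' : (M : ℤ) = 100 * (d * (Q * (Q * U))) := by rw [hM]; ring
  clear hM hl hP
  refine ⟨hS, by omega, ?_, ?_, ?_, ?_, ?_, ?_⟩
  · linarith
  · linarith
  · rw [hPdef]; linarith
  · rw [hPdef]; linarith
  · have : (((l + 1) * d + l + 2 : ℕ) : ℤ) ≤ M := by push_cast; omega
    exact_mod_cast this
  · have : ((5 * ((l + 1) * d + 1) : ℕ) : ℤ) ≤ M := by push_cast; omega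
    exact_mod_cast this

/-- The three terms are the costs of the root search (`k` rounds of `O(d)`), of the gcds and
valuations (at most `O(d ^ 2)` of them, each linear in the word length), and of the tree: `O(l * d)`
vertices at `O(l * d + d ^ 2)` each. Lower terms are absorbed as `l` and `d` are positive. -/
theorem totalCost_le {d l k z : ℕ} (hd : 0 < d) (hl : 0 < l) :
    totalCost d l k z + 1 ≤ 100000 * (d * (k + 1) + d ^ 2 * (z + 1) + l ^ 2 * d ^ 3) := by
  obtain ⟨d, rfl⟩ := Nat.exists_eq_succ_of_ne_zero hd.ne'
  obtain ⟨l, rfl⟩ := Nat.exists_eq_succ_of_ne_zero hl.ne'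
  simp only [totalCost, vertexCost, Nat.succ_eq_add_one]
  -- With `d + 1` and `l + 1` substituted, both sides are polynomials with nonnegative coefficients,
  -- and `omega` compares them with the monomials as atoms.
  ring_nf
  omega

/-- The factor `2` stands for `1 / log 2 < 2`. -/
theorem size_le_log {M : ℕ} (hM : 1 ≤ M) : (M.size : ℝ) ≤ 2 * Real.log M + 1 := by
  have h1 : 2 ^ (M.size - 1) ≤ M := Nat.lt_size.1 (by
    have := Nat.size_pos.2 hM
    omega)
  have h2 : ((M.size - 1 : ℕ) : ℝ) * Real.log 2 ≤ Real.log M := by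
    rw [← Real.log_pow]
    exact Real.log_le_log (by positivity) (by exact_mod_cast h1)
  have h3 : (M.size : ℝ) ≤ ((M.size - 1 : ℕ) : ℝ) + 1 := by
    have : M.size ≤ (M.size - 1) + 1 := by omega
    exact_mod_cast this
  have h4 := Real.log_two_gt_d9
  nlinarith [Nat.cast_nonneg (α := ℝ) (M.size - 1)]

theorem log_mul_le {c S : ℝ} (hc : 1 ≤ c) (hS : 1 ≤ S) : Real.log (c * S) ≤ c + Real.log S := by
  rw [Real.log_mul (by positivity) (by positivity)]
  have := Real.log_le_sub_one_of_pos (show 0 < c by linarith)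
  linarith

/-- The constant collects `log 100 ≤ 99`, `log d ≤ d - 1` and `6 * d * 3` from `log (2 * S + 1) ≤ 3
+ log S`; `6 * d` bounds the exponent `2 * d + 4`. -/
theorem log_wordBound_le {M p d : ℕ} {S : ℤ} (hp : 1 ≤ p) (hd : 0 < d) (hS : 1 ≤ S)
    (hM : (M : ℤ) = wordBound p d S) :
    Real.log M ≤ 118 * d + 4 * Real.log p + 6 * d * Real.log S := by
  have hM' : (M : ℝ) = 100 * d * p ^ 4 * (2 * S + 1) ^ (2 * d + 4) := by
    have : ((M : ℤ) : ℝ) = (wordBound p d S : ℤ) := by rw [hM]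
    rw [wordBound] at this
    exact_mod_cast this
  have hp' : (0 : ℝ) < p := by exact_mod_cast hp
  have hd' : (1 : ℝ) ≤ d := by exact_mod_cast hd
  have hS' : (1 : ℝ) ≤ S := by exact_mod_cast hS
  have hS0 := Real.log_nonneg hS'
  have h1 : Real.log (2 * S + 1) ≤ 3 + Real.log S := by
    refine le_trans (Real.log_le_log (by linarith) (by linarith)) (log_mul_le (c := 3) ?_ hS')
    norm_num
  have h2 := Real.log_le_sub_one_of_pos (show (0 : ℝ) < 100 by norm_num)
  have h3 := Real.log_le_sub_one_of_pos (show (0 : ℝ) < d by linarith)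
  rw [hM', Real.log_mul (by positivity) (by positivity), Real.log_mul (by positivity)
    (by positivity), Real.log_mul (by positivity) (by positivity), Real.log_pow, Real.log_pow]
  push_cast
  have h4 : (2 * (d : ℝ) + 4) * Real.log (2 * S + 1) ≤ (6 * d) * (3 + Real.log S) :=
    mul_le_mul (by linarith) h1 (Real.log_nonneg (by linarith)) (by linarith)
  nlinarith

theorem euclNorm_sq {f : ℤ[X]} {S : ℤ}
    (hS : S = ∑ i ∈ Finset.range (f.natDegree + 1), f.coeff i ^ 2) : euclNorm f ^ 2 = S := by
  rw [euclNorm, Real.sq_sqrt (Finset.sum_nonneg fun _ _ => sq_nonneg _), hS, Int.cast_sum]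
  have := f.sum_def fun _ c => (c : ℝ) ^ 2
  rw [← this, f.sum_over_range (by simp)]
  simp

/-- Here `y = log ‖f‖`, `z = log p`, `L = l ^ 2`, and `σ` is the word length. Root search and
valuations cost only `O(d ^ 3 + d ^ 3 * y + d ^ 2 * z)`, which is well below the required `d ^ 6 + d
^ 9 * y + d ^ 2 * z`. -/
theorem operations_le {d y z L k σ : ℝ} (hd : 1 ≤ d) (hy : 0 ≤ y) (hz : 0 ≤ z) (hL : 0 ≤ L)
    (hk : k ≤ d * (2 * d * (5 + 2 * y) + 1) + 1)
    (hσ : σ ≤ 2 * (118 * d + 4 * z + 6 * d * (2 * y)) + 1) :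
    100000 * (d * (k + 1) + d ^ 2 * (σ + 1) + L * d ^ 3) ≤
      100000000 * (d ^ 6 + d ^ 9 * y + L * d ^ 3 + d ^ 2 * z) := by
  have h1 : d * (k + 1) ≤ d * (d * (2 * d * (5 + 2 * y) + 1) + 2) :=
    mul_le_mul_of_nonneg_left (by linarith) (by positivity)
  have h2 : d ^ 2 * (σ + 1) ≤ d ^ 2 * (2 * (118 * d + 4 * z + 6 * d * (2 * y)) + 2) :=
    mul_le_mul_of_nonneg_left (by linarith) (by positivity)
  have d13 : d ≤ d ^ 3 := le_self_pow₀ hd (by norm_num)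
  have d23 : d ^ 2 ≤ d ^ 3 := pow_le_pow_right₀ hd (by norm_num)
  have d36 : d ^ 3 ≤ d ^ 6 := pow_le_pow_right₀ hd (by norm_num)
  have d39 : d ^ 3 * y ≤ d ^ 9 * y := by
    gcongr
    norm_num
  have hLd : 0 ≤ L * d ^ 3 := by positivity
  have hz2 : 0 ≤ d ^ 2 * z := by positivity
  have hy3 : 0 ≤ d ^ 3 * y := by positivity
  nlinarith

/-- The degree arrives in register `1`, a scratch register. The first instruction copies it to
register `2`, that is, to variable `1`, which is still zero. `M` is taken to be `wordBound`, `k` the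
rounded initial potential, and `M.size` the word length. -/
theorem exists_runs {p : ℕ} [hp : Fact p.Prime] {f : ℤ[X]} (hd : 0 < f.natDegree)
    (hs : (toRat f).Splits) : ∃ (τ : State) (n β : ℕ),
      Runs β (.seq (.arith 2 .add 1 2) computeZeta) (inputState p f) τ n ∧
      IsComputeZetaOutput p f τ.out ∧
      (n : ℝ) ≤ 100000000 * (f.natDegree ^ 6 + f.natDegree ^ 9 * Real.log (euclNorm f) +
        depth p (plusPart p (toRat f)) ^ 2 * f.natDegree ^ 3 + f.natDegree ^ 2 * Real.log p) ∧
      (β : ℝ) ≤ 237 * f.natDegree + 24 * f.natDegree * Real.log (euclNorm f) + 8 * Real.log p := by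
  have hf : f ≠ 0 := by rintro rfl; simp at hd
  obtain ⟨S, hS⟩ : ∃ S, S = ∑ i ∈ Finset.range (f.natDegree + 1), f.coeff i ^ 2 := ⟨_, rfl⟩
  have hS1 : 1 ≤ S := hS ▸ one_le_sum_sq hf
  have hpS := pow_depth_le (p := p) hs hf hS1 hS
  have hN := euclNorm_sq hS
  have hl1 : 0 < depth p (plusPart p (toRat f)) := by rw [depth]; omega
  obtain ⟨l, hl⟩ : ∃ l, l = depth p (plusPart p (toRat f)) := ⟨_, rfl⟩
  obtain ⟨d, hd'⟩ : ∃ d, d = f.natDegree := ⟨_, rfl⟩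
  have hw0 : 0 ≤ wordBound p f.natDegree S := by unfold wordBound; positivity
  obtain ⟨M, hM⟩ := Int.eq_ofNat_of_zero_le hw0
  have hB := machineBounds hp.out.two_le hd hS1 hpS hM.symm
  have hlogM := log_wordBound_le hp.out.one_lt.le hd hS1 hM.symm
  obtain ⟨k, hk⟩ : ∃ k : ℕ,
      k = ⌈f.natDegree * (2 * f.natDegree * Real.log (1 + 4 * S) + 1)⌉₊ := ⟨_, rfl⟩
  have hdM : f.natDegree + 1 ≤ M := by have := hB.degree; nlinarith
  have hSM : S ≤ M := by have := hB.roots_sq; nlinarith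
  have hpM : p ≤ M := by
    have h1 : (p ^ (l + 1) : ℤ) ≤ M := by
      rw [hl]
      have := hB.modulus
      nlinarith [pow_pos (Int.natCast_pos.2 hp.out.pos) (depth p (plusPart p (toRat f)) + 1)]
    exact (Nat.le_self_pow (Nat.succ_ne_zero l) p).trans (by exact_mod_cast h1)
  have hσ : ((inputState p f).setReg 2 f.natDegree).Bounded M := by
    refine State.Bounded.setReg ⟨fun i => ?_, fun a j => ?_⟩ (.natCast (by omega)) _
    · simp only [inputState]
      split_ifs
      exacts [.natCast hpM, .natCast (by omega), by simp]
    · simp only [inputState]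
      split_ifs
      exacts [.of_abs ((abs_le_sum_sq hS _).trans hSM), by simp]
  obtain ⟨τ, n, hrun, hn, -, hout⟩ := computeZeta_spec (k := k) hd hs hS hB (by
    rw [hk]; exact Nat.le_ceil _) (s := ((inputState p f).setReg 2 f.natDegree).vars)
    (by simp [State.vars, inputState]) (by simp [State.vars]) (by simp [State.vars, inputState])
    (by simp [State.vars, inputState]) _ rfl hσ
  have hM1 : 1 ≤ M := by omega
  have hsize := size_le_log hM1
  have hfd : Fits M.size (f.natDegree : ℤ) := fits_size (.natCast (by omega))
  have h0 : Fits M.size 0 := fits_size (by simp)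
  have hS1' : (1 : ℝ) ≤ S := by exact_mod_cast hS1
  have hN0 : 0 ≤ euclNorm f := Real.sqrt_nonneg _
  have hN1 : 1 ≤ euclNorm f := by nlinarith
  have hy := Real.log_nonneg hN1
  have hlogS : Real.log S = 2 * Real.log (euclNorm f) := by
    rw [← hN, Real.log_pow]; norm_num
  refine ⟨τ, 1 + n, M.size, .seq ?_ hrun, hout, ?_, ?_⟩
  · have := Runs.arith (β := M.size) (inputState p f) 2 .add 1 2 (by simpa [inputState] using hfd)
      (by simpa [inputState] using h0) (by simpa [inputState, Op.eval] using hfd) (by simp)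
    simpa [inputState, Op.eval] using this
  · have hcast : ((1 + n : ℕ) : ℝ) ≤ ((100000 * (f.natDegree * (k + 1) + f.natDegree ^ 2 *
        (M.size + 1) + depth p (plusPart p (toRat f)) ^ 2 * f.natDegree ^ 3) : ℕ) : ℝ) := by
      have := totalCost_le (k := k) (z := M.size) hd hl1
      exact_mod_cast (show 1 + n ≤ _ by omega)
    refine hcast.trans ?_
    push_cast
    have hD1 : (1 : ℝ) ≤ f.natDegree := by exact_mod_cast hd
    have hlogS' : Real.log (1 + 4 * S) ≤ 5 + Real.log S :=
      (Real.log_le_log (by linarith) (by linarith)).trans (log_mul_le (by norm_num) hS1')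
    have hk' : (k : ℝ) ≤ f.natDegree * (2 * f.natDegree * (5 + Real.log S) + 1) + 1 := by
      rw [hk]
      refine (Nat.ceil_lt_add_one ?_).le.trans ?_
      · have := Real.log_nonneg (show (1 : ℝ) ≤ 1 + 4 * S by linarith)
        positivity
      · gcongr
    exact operations_le hD1 hy (Real.log_nonneg (by exact_mod_cast hp.out.one_lt.le))
      (sq_nonneg _) (by rw [hlogS] at hk'; exact hk') (by rw [hlogS] at hlogM; linarith)
  · rw [hlogS] at hlogM
    have hD1 : (1 : ℝ) ≤ f.natDegree := by exact_mod_cast hd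
    linarith

end IgusaZeta

namespace IgusaZeta

/-! ### Residue classes in the `p`-adic integers, and their measure -/

section

variable {p : ℕ} [hp : Fact p.Prime]

instance : (haar p).IsAddHaarMeasure := Measure.isAddHaarMeasure_addHaarMeasure ⊤

instance : IsProbabilityMeasure (haar p) :=
  ⟨by rw [haar, ← TopologicalSpace.PositiveCompacts.coe_top, Measure.addHaarMeasure_self]⟩

/-- The residue class of a `p`-adic integer modulo `p ^ m`. -/
noncomputable def cls (m : ℕ) (x : ℤ_[p]) : Vertex p := ⟨m, PadicInt.toZModPow m x⟩

/-- The set of the `p`-adic integers in a residue class. -/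
def ball (u : Vertex p) : Set ℤ_[p] := {x | PadicInt.toZModPow u.1 x = u.2}

theorem mem_ball {u : Vertex p} {x : ℤ_[p]} : x ∈ ball u ↔ cls u.1 x = u := by
  obtain ⟨m, z⟩ := u
  simp [ball, cls]

theorem mem_ball_cls {m : ℕ} {x y : ℤ_[p]} : x ∈ ball (cls m y) ↔ cls m x = cls m y := mem_ball

theorem cls_eq_iff {m : ℕ} {x y : ℤ_[p]} : cls m x = cls m y ↔ ‖x - y‖ ≤ (p : ℝ) ^ (-m : ℤ) := by
  rw [PadicInt.norm_le_pow_iff_mem_span_pow, ← PadicInt.ker_toZModPow, RingHom.mem_ker, map_sub,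
    sub_eq_zero]
  simp [cls]

theorem cls_ge_iff {m k : ℕ} {x y : ℤ_[p]} :
    (cls m x).Ge (cls k y) ↔ k ≤ m ∧ cls k x = cls k y := by
  have key : ∀ h : k ≤ m, ZMod.castHom (pow_dvd_pow p h) (ZMod (p ^ k))
      (PadicInt.toZModPow m x) = PadicInt.toZModPow k x := fun h =>
    RingHom.congr_fun (PadicInt.zmod_cast_comp_toZModPow k m h) x
  constructor
  · rintro ⟨h, h'⟩
    refine ⟨h, ?_⟩
    rw [cls, cls, ← key h]
    exact congrArg _ h'
  · rintro ⟨h, h'⟩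
    refine ⟨h, (key h).trans ?_⟩
    simpa [cls] using h'

theorem cls_mono {m k : ℕ} {x y : ℤ_[p]} (hk : k ≤ m) (h : cls m x = cls m y) :
    cls k x = cls k y := by
  rw [cls_eq_iff] at h ⊢
  refine h.trans (zpow_le_zpow_right₀ (by exact_mod_cast hp.out.one_lt.le) (by omega))

theorem toZModPow_natCast_val {m : ℕ} (z : ZMod (p ^ m)) :
    PadicInt.toZModPow m ((z.val : ℕ) : ℤ_[p]) = z := by
  have : NeZero (p ^ m) := ⟨pow_ne_zero _ hp.out.ne_zero⟩
  rw [map_natCast, ZMod.natCast_zmod_val]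

theorem exists_cls_eq (u : Vertex p) : ∃ x : ℤ_[p], cls u.1 x = u :=
  ⟨((u.2.val : ℕ) : ℤ_[p]), mem_ball.1 (toZModPow_natCast_val u.2)⟩

theorem ball_cls (m : ℕ) (y : ℤ_[p]) :
    ball (cls m y) = Metric.closedBall y ((p : ℝ) ^ (-m : ℤ)) := by
  ext x
  rw [mem_ball_cls, cls_eq_iff, Metric.mem_closedBall, dist_eq_norm]

theorem measurableSet_ball (u : Vertex p) : MeasurableSet (ball u) := by
  obtain ⟨x, hx⟩ := exists_cls_eq u
  rw [← hx, ball_cls]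
  exact Metric.isClosed_closedBall.measurableSet

theorem measureReal_ball_eq (m : ℕ) (z : ZMod (p ^ m)) :
    (haar p).real (ball ⟨m, z⟩) = (haar p).real (ball ⟨m, 0⟩) := by
  have : ball (⟨m, 0⟩ : Vertex p) = (fun x => ((z.val : ℕ) : ℤ_[p]) + x) ⁻¹' ball ⟨m, z⟩ := by
    ext x
    simp only [ball, Set.mem_ofPred_eq, Set.mem_preimage, map_add, toZModPow_natCast_val]
    exact add_eq_left.symm
  rw [this, measureReal_def, measureReal_def, measure_preimage_add]

/-- The `p ^ m` balls of level `m` are translates of each other, hence of equal measure, and they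
partition a space of measure one. -/
theorem measureReal_ball (u : Vertex p) : (haar p).real (ball u) = ((p : ℝ) ^ u.1)⁻¹ := by
  obtain ⟨m, z⟩ := u
  have hne : NeZero (p ^ m) := ⟨pow_ne_zero _ hp.out.ne_zero⟩
  have h1 : (haar p).real (⋃ z : ZMod (p ^ m), ball ⟨m, z⟩) =
      ∑ z : ZMod (p ^ m), (haar p).real (ball ⟨m, z⟩) := by
    rw [measureReal_iUnion_fintype ?_ fun z => measurableSet_ball _]
    intro z z' hzz
    rw [Function.onFun, Set.disjoint_left]
    intro x hx hx'
    exact hzz (Eq.trans (Eq.symm hx) hx')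
  have h2 : (⋃ z : ZMod (p ^ m), ball ⟨m, z⟩) = Set.univ :=
    Set.eq_univ_of_forall fun x => Set.mem_iUnion.2 ⟨PadicInt.toZModPow m x, rfl⟩
  rw [h2, probReal_univ, Finset.sum_congr rfl fun z _ => measureReal_ball_eq m z,
    Finset.sum_const, Finset.card_univ, ZMod.card, nsmul_eq_mul] at h1
  rw [measureReal_ball_eq]
  push_cast at h1
  exact eq_inv_of_mul_eq_one_right h1.symm

/-! ### Distances from points in terms of residue classes -/

/-- `|x|_p ^ s`. -/
noncomputable def normCpow (s : ℂ) (x : ℤ_[p]) : ℂ := ((‖x‖ : ℝ) : ℂ) ^ s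

theorem inv_pow_cpow {p : ℕ} (s : ℂ) (n : ℕ) :
    ((((p : ℝ) ^ n)⁻¹ : ℝ) : ℂ) ^ s = ((p : ℂ) ^ (-s)) ^ n := by
  induction n with
  | zero => simp
  | succ n ih =>
    rw [pow_succ, mul_inv, Complex.ofReal_mul, Complex.mul_cpow_ofReal_nonneg (by positivity)
      (by positivity), ih, pow_succ, Complex.ofReal_inv, Complex.ofReal_natCast,
      Complex.inv_cpow _ _ (by rw [Complex.natCast_arg]; exact Real.pi_pos.ne), Complex.cpow_neg]

open Classical in
/-- The number of levels `1, …, m` at which `x` and `a` are in the same class. -/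
noncomputable def agreement (m : ℕ) (x a : ℤ_[p]) : ℕ :=
  ((Finset.range m).filter fun k => cls (k + 1) a = cls (k + 1) x).card

/-- `x` and `a` are congruent at level `k + 1` exactly if `k < v(x - a)`. If they differ at level `m
+ 1`, then `v(x - a) ≤ m`, so the levels of agreement among `1, …, m` are exactly `v(x - a)` in
number. -/
theorem norm_sub_eq_of_ne {x a : ℤ_[p]} {m : ℕ} (h : cls (m + 1) a ≠ cls (m + 1) x) :
    ‖x - a‖ = ((p : ℝ) ^ agreement m x a)⁻¹ := by
  have hp1 : (1 : ℝ) < p := by exact_mod_cast hp.out.one_lt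
  have h0 : x - a ≠ 0 := fun h0 => h (by rw [sub_eq_zero.1 h0])
  have hv := PadicInt.norm_eq_zpow_neg_valuation h0
  have key : ∀ k, cls (k + 1) a = cls (k + 1) x ↔ k < (x - a).valuation := by
    intro k
    rw [eq_comm, cls_eq_iff, hv, zpow_le_zpow_iff_right₀ hp1]
    omega
  have hm : (x - a).valuation ≤ m := not_lt.1 fun h' => h ((key m).2 h')
  have : agreement m x a = (x - a).valuation := by
    rw [agreement, Finset.filter_congr fun k _ => key k]
    rw [show (Finset.range m).filter (fun k => k < (x - a).valuation) =
      Finset.range (x - a).valuation by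
        ext k
        simp only [Finset.mem_filter, Finset.mem_range]
        omega,
      Finset.card_range]
  rw [this, hv, zpow_neg, zpow_natCast]

theorem normCpow_sub_of_ne {x a : ℤ_[p]} {m : ℕ} (h : cls (m + 1) a ≠ cls (m + 1) x) (s : ℂ) :
    normCpow s (x - a) = ((p : ℂ) ^ (-s)) ^ agreement m x a := by
  rw [normCpow, norm_sub_eq_of_ne h, inv_pow_cpow]

theorem continuous_normCpow {s : ℂ} (hs : 0 < s.re) : Continuous (normCpow (p := p) s) :=
  (Complex.continuous_ofReal_cpow_const hs).comp continuous_norm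

theorem norm_normCpow_le {s : ℂ} (hs : 0 < s.re) (x : ℤ_[p]) : ‖normCpow s x‖ ≤ 1 := by
  rw [normCpow, Complex.norm_cpow_eq_rpow_re_of_nonneg (norm_nonneg _) hs.ne']
  exact Real.rpow_le_one (norm_nonneg _) (PadicInt.norm_le_one x) hs.le

theorem norm_cpow_neg_lt_one {s : ℂ} (hs : 0 < s.re) : ‖(p : ℂ) ^ (-s)‖ < 1 := by
  rw [Complex.norm_natCast_cpow_of_pos hp.out.pos]
  exact Real.rpow_lt_one_of_one_lt_of_neg (by exact_mod_cast hp.out.one_lt) (by simpa using hs)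

theorem integrable_of_continuous {φ : ℤ_[p] → ℂ} (hφ : Continuous φ) : Integrable φ (haar p) := by
  simpa using hφ.continuousOn.integrableOn_compact (μ := haar p) isCompact_univ

theorem ball_succ_subset (m : ℕ) (a : ℤ_[p]) : ball (cls (m + 1) a) ⊆ ball (cls m a) :=
  fun _ hx => mem_ball_cls.2 (cls_mono (Nat.le_succ m) (mem_ball_cls.1 hx))

theorem agreement_eq_of_mem_ball {m : ℕ} {x a : ℤ_[p]} (h : x ∈ ball (cls m a)) :
    agreement m x a = m := by
  rw [agreement, Finset.filter_true_of_mem, Finset.card_range]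
  intro k hk
  exact (cls_mono (Finset.mem_range.1 hk) (mem_ball_cls.1 h)).symm

/-- `|p⁻¹ * t| ≤ 1 / 2`. This is why no denominator of a summand vanishes for `0 < re s`. -/
theorem one_sub_ne_zero {t : ℂ} (ht : ‖t‖ ≤ 1) : 1 - (p : ℂ)⁻¹ * t ≠ 0 := by
  intro h
  have h1 : ‖(p : ℂ)⁻¹ * t‖ = 1 := by rw [← sub_eq_zero.1 h, norm_one]
  rw [norm_mul, norm_inv, Complex.norm_natCast] at h1
  have h2 : (p : ℝ)⁻¹ ≤ 2⁻¹ := inv_anti₀ (by norm_num) (by exact_mod_cast hp.out.two_le)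
  nlinarith [norm_nonneg t, inv_nonneg.2 (Nat.cast_nonneg (α := ℝ) p)]

/-- Between the two balls `x - a` has order exactly `m`, so the integrand is constant there. -/
theorem setIntegral_ball_succ {s : ℂ} (hs : 0 < s.re) (e m : ℕ) (a : ℤ_[p]) :
    ∫ x in ball (cls m a), normCpow s (x - a) ^ e ∂haar p =
      (((p : ℂ) ^ m)⁻¹ - ((p : ℂ) ^ (m + 1))⁻¹) * (((p : ℂ) ^ (-s)) ^ e) ^ m +
        ∫ x in ball (cls (m + 1) a), normCpow s (x - a) ^ e ∂haar p := by
  have hint : Integrable (fun x => normCpow s (x - a) ^ e) (haar p) :=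
    integrable_of_continuous (((continuous_normCpow hs).comp (continuous_id.sub
        continuous_const)).pow e)
  have hsub := ball_succ_subset m a
  rw [← Set.sdiff_union_of_subset hsub, setIntegral_union Set.disjoint_sdiff_left
    (measurableSet_ball _) hint.integrableOn hint.integrableOn]
  congr 1
  rw [setIntegral_congr_fun ((measurableSet_ball _).diff (measurableSet_ball _))
    (g := fun _ => (((p : ℂ) ^ (-s)) ^ e) ^ m), setIntegral_const, measureReal_sdiff hsub
    (measurableSet_ball _), measureReal_ball, measureReal_ball]
  · rw [Complex.real_smul]
    push_cast
    rfl
  · rintro x ⟨hx, hx'⟩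
    change normCpow s (x - a) ^ e = _
    rw [normCpow_sub_of_ne (m := m) (fun h => hx' (mem_ball_cls.2 h.symm)),
      agreement_eq_of_mem_ball hx, ← pow_mul, ← pow_mul, mul_comm]

/-- Instead of summing the series over spheres: both sides satisfy the recursion of
`setIntegral_ball_succ` in `m`, so their difference does not depend on `m`, and both tend to zero as
`m` grows. -/
theorem setIntegral_ball {s : ℂ} (hs : 0 < s.re) (e m : ℕ) (a : ℤ_[p]) :
    ∫ x in ball (cls m a), normCpow s (x - a) ^ e ∂haar p =
      (1 - (p : ℂ)⁻¹) * ((p : ℂ) ^ m)⁻¹ * (((p : ℂ) ^ (-s)) ^ e) ^ m /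
        (1 - (p : ℂ)⁻¹ * ((p : ℂ) ^ (-s)) ^ e) := by
  set t := ((p : ℂ) ^ (-s)) ^ e with ht
  have ht1 : ‖t‖ ≤ 1 := by
    rw [ht, norm_pow]
    exact pow_le_one₀ (norm_nonneg _) (norm_cpow_neg_lt_one hs).le
  have hp0 : (p : ℂ) ≠ 0 := by exact_mod_cast hp.out.ne_zero
  have hp2 : (2 : ℝ) ≤ p := by exact_mod_cast hp.out.two_le
  have hden : 1 - (p : ℂ)⁻¹ * t ≠ 0 := one_sub_ne_zero ht1
  set J : ℕ → ℂ := fun m => (1 - (p : ℂ)⁻¹) * ((p : ℂ) ^ m)⁻¹ * t ^ m / (1 - (p : ℂ)⁻¹ * t) with hJ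
  set I : ℕ → ℂ := fun m => ∫ x in ball (cls m a), normCpow s (x - a) ^ e ∂haar p with hI
  have hrec : ∀ m, I m - J m = I (m + 1) - J (m + 1) := by
    intro m
    have h1 : I m = _ := setIntegral_ball_succ hs e m a
    have h2 : J m = (((p : ℂ) ^ m)⁻¹ - ((p : ℂ) ^ (m + 1))⁻¹) * t ^ m + J (m + 1) := by
      simp only [hJ]
      have : (p : ℂ) - t ≠ 0 := by
        intro h
        apply hden
        rw [← sub_eq_zero.1 h, inv_mul_cancel₀ hp0, sub_self]
      field_simp
      ring
    rw [h1, h2]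
    ring
  have hconst : ∀ n, I (m + n) - J (m + n) = I m - J m := by
    intro n
    induction n with
    | zero => rfl
    | succ n ih => rw [← ih, hrec (m + n), add_assoc]
  have hp0' : Filter.Tendsto (fun n : ℕ => ((p : ℝ)⁻¹) ^ n) Filter.atTop (nhds 0) :=
    tendsto_pow_atTop_nhds_zero_of_lt_one (by positivity) (inv_lt_one_of_one_lt₀ (by linarith))
  -- The integrand is bounded by one and the ball of level `n` has measure `p ^ (-n)`.
  have hIlim : Filter.Tendsto I Filter.atTop (nhds 0) := by
    refine squeeze_zero_norm (fun n => ?_) hp0'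
    refine (norm_setIntegral_le_of_norm_le_const (C := 1) (measure_lt_top _ _) fun x _ =>
        ?_).trans ?_
    · rw [norm_pow]
      exact pow_le_one₀ (norm_nonneg _) (norm_normCpow_le hs _)
    · rw [measureReal_ball, one_mul, inv_pow]
      rfl
  have hJlim : Filter.Tendsto J Filter.atTop (nhds 0) := by
    have : Filter.Tendsto (fun n : ℕ => ((p : ℂ)⁻¹ * t) ^ n) Filter.atTop (nhds 0) := by
      refine squeeze_zero_norm (fun n => ?_) hp0'
      rw [norm_pow, norm_mul, norm_inv, Complex.norm_natCast]
      gcongr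
      exact mul_le_of_le_one_right (by positivity) ht1
    have h2 := (this.const_mul ((1 - (p : ℂ)⁻¹) / (1 - (p : ℂ)⁻¹ * t)))
    rw [mul_zero] at h2
    refine h2.congr fun n => ?_
    simp only [hJ]
    rw [mul_pow, inv_pow]
    ring
  have hlim := hIlim.sub hJlim
  rw [sub_zero] at hlim
  have hlim2 := (hlim.comp (Filter.tendsto_add_atTop_nat m))
  have hc : (fun n => I n - J n) ∘ (fun n => n + m) = fun _ => I m - J m := by
    funext n
    rw [Function.comp_apply, add_comm n m, hconst]
  rw [hc] at hlim2
  exact sub_eq_zero.1 (tendsto_nhds_unique tendsto_const_nhds hlim2)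

end

end IgusaZeta

namespace IgusaZeta

/-! ### The weighted tree in terms of the residue classes of `p`-adic integers -/

section

variable {p : ℕ} [hp : Fact p.Prime] {g : ℚ[X]} {l : ℕ}

/-- A rational number that is a `p`-adic integer, as such. -/
noncomputable def toPadicInt (p : ℕ) [Fact p.Prime] (α : ℚ) : ℤ_[p] :=
  ⟨if ‖(α : ℚ_[p])‖ ≤ 1 then α else 0, by
    split_ifs with h
    · exact h
    · rw [norm_zero]
      exact zero_le_one⟩

theorem coe_toPadicInt {α : ℚ} (hα : ¬ p ∣ α.den) : (toPadicInt p α : ℚ_[p]) = α :=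
  if_pos (Padic.norm_rat_le_one hα)

/-- Links the combinatorial tree, defined by residues of rational numbers, with the classes of
`p`-adic integers. -/
theorem mk_residue_eq_cls {α : ℚ} (hα : ¬ p ∣ α.den) (m : ℕ) :
    (⟨m, residue p m α⟩ : Vertex p) = cls m (toPadicInt p α) := by
  have h1 : toPadicInt p α * (α.den : ℤ_[p]) = (α.num : ℤ_[p]) := by
    apply Subtype.coe_injective
    push_cast
    rw [coe_toPadicInt hα]
    exact_mod_cast Rat.mul_den_eq_num α
  have h2 := congrArg (PadicInt.toZModPow m) h1
  rw [map_mul, map_natCast, map_intCast] at h2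
  have hc : Nat.Coprime α.den (p ^ m) :=
    Nat.Coprime.pow_right m ((Nat.Prime.coprime_iff_not_dvd hp.out).2 hα).symm
  rw [cls, residue, ← h2, mul_assoc, ZMod.coe_mul_inv_eq_one _ hc, mul_one]

theorem cls_zero (x : ℤ_[p]) : cls 0 x = ⟨0, 0⟩ := by
  have : Subsingleton (ZMod (p ^ 0)) := by rw [pow_zero]; infer_instance
  exact Sigma.ext rfl (heq_of_eq (Subsingleton.elim (α := ZMod (p ^ 0)) _ _))

theorem cls_inj_level {m k : ℕ} {x y : ℤ_[p]} (h : cls m x = cls k y) : m = k :=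
  congrArg Sigma.fst h

theorem rootMultiplicity_pos_of_mem {g : ℚ[X]} {α : ℚ} (hα : α ∈ rootSet g) : 0 <
    g.rootMultiplicity α := by
  rw [← Polynomial.count_roots]
  exact Multiset.count_pos.2 (Multiset.mem_toFinset.1 hα)

/-- All roots of `g` are `p`-adic integers, and they are distinct modulo `p ^ l`. -/
structure IsSeparated (p : ℕ) [Fact p.Prime] (g : ℚ[X]) (l : ℕ) : Prop where
  not_dvd_den : ∀ α ∈ rootSet g, ¬ p ∣ α.den
  cls_ne : ∀ α ∈ rootSet g, ∀ β ∈ rootSet g, α ≠ β →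
    cls l (toPadicInt p α) ≠ cls l (toPadicInt p β)

namespace IsSeparated

theorem cls_mem_tree (h : IsSeparated p g l) {m : ℕ} {x : ℤ_[p]} : cls m x ∈ tree p g l ↔
    m = 0 ∨ m ≤ l + 1 ∧ ∃ α ∈ rootSet g, cls m (toPadicInt p α) = cls m x := by
  rw [tree, Finset.mem_insert, Finset.mem_image]
  refine or_congr ⟨fun hm => congrArg Sigma.fst hm, ?_⟩ ⟨?_, ?_⟩
  · rintro rfl
    exact cls_zero x
  · rintro ⟨⟨k, α⟩, hk, hx⟩
    rw [Finset.mem_product, Finset.mem_range] at hk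
    obtain rfl : k = m := congrArg Sigma.fst hx
    exact ⟨by omega, α, hk.2, by rw [← hx, mk_residue_eq_cls (h.not_dvd_den α hk.2)]⟩
  · rintro ⟨hm, α, hα, hx⟩
    refine ⟨(m, α), Finset.mem_product.2 ⟨Finset.mem_range.2 (by omega), hα⟩, ?_⟩
    rw [← hx, mk_residue_eq_cls (h.not_dvd_den α hα)]

open Classical in
theorem weight_cls_succ (h : IsSeparated p g l) (m : ℕ) (x : ℤ_[p]) : weight p g (cls (m + 1) x) =
    ∑ α ∈ (rootSet g).filter (fun α => cls (m + 1) (toPadicInt p α) = cls (m + 1) x),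
      g.rootMultiplicity α := by
  rw [weight, if_neg (show (cls (m + 1) x).1 ≠ 0 from Nat.succ_ne_zero m)]
  refine Finset.sum_congr (Finset.filter_congr fun α hα => ?_) fun _ _ => rfl
  rw [← mk_residue_eq_cls (h.not_dvd_den α hα), cls]
  simp

theorem tree_of_le (h : IsSeparated p g l) {m k : ℕ} {x : ℤ_[p]} (hkm : k ≤ m) (hm : cls m x ∈
    tree p g l) :
    cls k x ∈ tree p g l := by
  rw [h.cls_mem_tree] at hm ⊢
  rcases hm with hm | ⟨hm, α, hα, hx⟩
  · exact Or.inl (by omega)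
  · exact Or.inr ⟨by omega, α, hα, cls_mono hkm hx⟩

theorem stalkWeight_cls (h : IsSeparated p g l) {m : ℕ} {x : ℤ_[p]} (hm : cls m x ∈ tree p g l) :
    stalkWeight p g l (cls m x) = ∑ k ∈ Finset.range m, weight p g (cls (k + 1) x) := by
  classical
  have : (tree p g l).filter (fun v => (cls m x).Ge v) =
      (Finset.range (m + 1)).image fun k => cls k x := by
    ext v
    obtain ⟨y, hy⟩ := exists_cls_eq v
    rw [Finset.mem_filter, Finset.mem_image, ← hy, cls_ge_iff]
    constructor
    · rintro ⟨-, hv, hxy⟩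
      exact ⟨v.1, Finset.mem_range.2 (by omega), hxy⟩
    · rintro ⟨k, hk, hx⟩
      obtain rfl := cls_inj_level hx
      rw [Finset.mem_range] at hk
      exact ⟨hx ▸ h.tree_of_le (by omega) hm, by omega, hx⟩
  rw [stalkWeight, this, Finset.sum_image fun _ _ _ _ hk => cls_inj_level hk,
    Finset.sum_range_succ', cls_zero, weight, if_pos rfl, add_zero]

/-- Double counting of pairs of a level and a root congruent to `x` at that level. The right side is
the order of `g(x)` as soon as no root agrees with `x` at level `m + 1`. -/
theorem sum_weight_cls (h : IsSeparated p g l) (m : ℕ) (x : ℤ_[p]) :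
    ∑ k ∈ Finset.range m, weight p g (cls (k + 1) x) =
      ∑ α ∈ rootSet g, agreement m x (toPadicInt p α) * g.rootMultiplicity α := by
  classical
  simp only [h.weight_cls_succ, Finset.sum_filter]
  rw [Finset.sum_comm]
  refine Finset.sum_congr rfl fun α _ => ?_
  rw [← Finset.sum_filter, Finset.sum_const, smul_eq_mul, agreement]

/-- Smaller classes contain fewer roots. Level zero is excluded, as the weight there is zero by
convention. -/
theorem weight_cls_anti (h : IsSeparated p g l) {m k : ℕ} (hm : 1 ≤ m) (hmk : m ≤ k) (x : ℤ_[p]) :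
    weight p g (cls k x) ≤ weight p g (cls m x) := by
  classical
  obtain ⟨m, rfl⟩ := Nat.exists_eq_add_of_le' hm
  obtain ⟨k, rfl⟩ := Nat.exists_eq_add_of_le' (hm.trans hmk)
  rw [h.weight_cls_succ, h.weight_cls_succ]
  exact Finset.sum_le_sum_of_subset
    (Finset.monotone_filter_right _ fun α _ hα => cls_mono hmk hα)

theorem weight_cls_pos (h : IsSeparated p g l) {m : ℕ} {x : ℤ_[p]} (hm : 1 ≤ m) (ht : cls m x ∈
    tree p g l) :
    1 ≤ weight p g (cls m x) := by
  classical
  obtain ⟨m, rfl⟩ := Nat.exists_eq_add_of_le' hm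
  rw [h.cls_mem_tree] at ht
  obtain ⟨-, α, hα, hx⟩ := ht.resolve_left (by omega)
  rw [h.weight_cls_succ]
  exact (rootMultiplicity_pos_of_mem hα).trans_le (Finset.single_le_sum (f := fun α =>
      g.rootMultiplicity α)
    (fun _ _ => Nat.zero_le _) (Finset.mem_filter.2 ⟨hα, hx⟩))

end IsSeparated

/-! ### The integral over a ball that contains one root, and off the tree -/

/-- `|g(x)|_p ^ s` for monic `g`. -/
noncomputable def rootCpow (g : ℚ[X]) (s : ℂ) (x : ℤ_[p]) : ℂ :=
  ∏ α ∈ rootSet g, normCpow s (x - toPadicInt p α) ^ g.rootMultiplicity α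

theorem continuous_rootCpow {s : ℂ} (hs : 0 < s.re) : Continuous (rootCpow (p := p) g s) :=
  continuous_finsetProd _ fun _ _ =>
    ((continuous_normCpow hs).comp (continuous_id.sub continuous_const)).pow _

theorem agreement_congr {m : ℕ} {x y : ℤ_[p]} (hxy : cls m x = cls m y) (a : ℤ_[p]) :
    agreement m x a = agreement m y a := by
  classical
  refine congrArg _ (Finset.filter_congr fun k hk => ?_)
  rw [cls_mono (Finset.mem_range.1 hk) hxy]

theorem measurableSet_cls_mem (m : ℕ) (V : Finset (Vertex p)) :
    MeasurableSet {x : ℤ_[p] | cls m x ∈ V} := by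
  have : {x : ℤ_[p] | cls m x ∈ V} = ⋃ v ∈ V.filter (fun v => v.1 = m), ball v := by
    ext x
    simp only [Set.mem_ofPred_eq, Set.mem_iUnion, exists_prop, Finset.mem_filter]
    constructor
    · exact fun hx => ⟨cls m x, ⟨hx, rfl⟩, mem_ball_cls.2 rfl⟩
    · rintro ⟨v, ⟨hv, rfl⟩, hxv⟩
      rwa [mem_ball.1 hxv]
  rw [this]
  exact Finset.measurableSet_biUnion _ fun v _ => measurableSet_ball v

theorem measurableSet_off_tree (u : Vertex p) (m : ℕ) :
    MeasurableSet {x | x ∈ ball u ∧ cls m x ∉ tree p g l} :=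
  (measurableSet_ball u).inter (measurableSet_cls_mem m _).compl

/-- From the ball of measure `p ^ (-m)` the disjoint balls of the children, of measure `p ^ (-(m +
1))` each, are removed. -/
theorem measureReal_off_tree {m : ℕ} (y : ℤ_[p]) :
    (haar p).real {x | x ∈ ball (cls m y) ∧ cls (m + 1) x ∉ tree p g l} =
      (p : ℝ)⁻¹ * (p - valence p g l (cls m y)) * ((p : ℝ) ^ m)⁻¹ := by
  classical
  set V := (tree p g l).filter (fun v => v.1 = (cls m y).1 + 1 ∧ v.Ge (cls m y))
  have hV : ∀ v ∈ V, v.1 = m + 1 := fun v hv => (Finset.mem_filter.1 hv).2.1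
  have hset : {x | x ∈ ball (cls m y) ∧ cls (m + 1) x ∉ tree p g l} =
      ball (cls m y) \ ⋃ v ∈ V, ball v := by
    ext x
    simp only [Set.mem_ofPred_eq, Set.mem_sdiff, Set.mem_iUnion, exists_prop]
    refine and_congr_right fun hx => not_congr ⟨fun ht => ⟨cls (m + 1) x, ?_, mem_ball_cls.2 rfl⟩,
        ?_⟩
    · exact Finset.mem_filter.2 ⟨ht, rfl, cls_ge_iff.2 ⟨Nat.le_succ m, mem_ball_cls.1 hx⟩⟩
    · rintro ⟨v, hv, hxv⟩
      rw [mem_ball, hV v hv] at hxv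
      rw [hxv]
      exact (Finset.mem_filter.1 hv).1
  have hsub : ⋃ v ∈ V, ball v ⊆ ball (cls m y) := by
    refine Set.iUnion₂_subset fun v hv x hx => ?_
    rw [mem_ball, hV v hv] at hx
    have := (Finset.mem_filter.1 hv).2.2
    rw [← hx, cls_ge_iff] at this
    exact mem_ball_cls.2 this.2
  have hmeas : MeasurableSet (⋃ v ∈ V, ball v) :=
    V.measurableSet_biUnion fun v _ => measurableSet_ball v
  have hdisj : (V : Set (Vertex p)).PairwiseDisjoint ball := by
    intro v hv w hw hvw
    rw [Function.onFun, Set.disjoint_left]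
    intro x hx hx'
    rw [mem_ball, hV _ hv] at hx
    rw [mem_ball, hV _ hw] at hx'
    exact hvw (hx.symm.trans hx')
  rw [hset, measureReal_sdiff hsub hmeas, measureReal_ball,
    measureReal_biUnion_finset hdisj fun v _ => measurableSet_ball v,
    Finset.sum_congr rfl fun v hv => by rw [measureReal_ball, hV v hv], Finset.sum_const,
    nsmul_eq_mul]
  change ((p : ℝ) ^ m)⁻¹ - (valence p g l (cls m y) : ℝ) * ((p : ℝ) ^ (m + 1))⁻¹ = _
  have hp0 : (p : ℝ) ≠ 0 := by exact_mod_cast hp.out.ne_zero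
  rw [pow_succ]
  field_simp

namespace IsSeparated

/-- The other roots lie outside the ball, so their distance from `x` is constant on it and their
factors can be taken out; what is left is the integral of a power of `|x - α|`. By `sum_weight_cls`
the exponents combine to the sum of the weights on the path. -/
theorem setIntegral_ball_of_unique (h : IsSeparated p g l) {s : ℂ} (hs : 0 < s.re) {m : ℕ} {α : ℚ}
    (hα : α ∈ rootSet g)
    (hu : ∀ β ∈ rootSet g, cls m (toPadicInt p β) = cls m (toPadicInt p α) → β = α) :
    ∫ x in ball (cls m (toPadicInt p α)), rootCpow g s x ∂haar p =
      (1 - (p : ℂ)⁻¹) * ((p : ℂ) ^ m)⁻¹ * ((p : ℂ) ^ (-s)) ^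
        (∑ k ∈ Finset.range m, weight p g (cls (k + 1) (toPadicInt p α))) /
        (1 - (p : ℂ)⁻¹ * ((p : ℂ) ^ (-s)) ^ g.rootMultiplicity α) := by
  set a := toPadicInt p α with ha
  set c := ∑ β ∈ (rootSet g).erase α, agreement m a (toPadicInt p β) * g.rootMultiplicity β
  have hsum : ∑ k ∈ Finset.range m, weight p g (cls (k + 1) a) =
      c + g.rootMultiplicity α * m := by
    rw [h.sum_weight_cls, ← Finset.sum_erase_add _ _ hα,
      agreement_eq_of_mem_ball (mem_ball_cls.2 rfl), mul_comm m]
  have hF : ∀ x ∈ ball (cls m a), rootCpow g s x =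
      ((p : ℂ) ^ (-s)) ^ c * normCpow s (x - a) ^ g.rootMultiplicity α := by
    intro x hx
    rw [mem_ball_cls] at hx
    rw [rootCpow, ← Finset.prod_erase_mul _ _ hα, ← Finset.prod_pow_eq_pow_sum]
    congr 1
    refine Finset.prod_congr rfl fun β hβ => ?_
    rw [Finset.mem_erase] at hβ
    rw [normCpow_sub_of_ne (m := m), agreement_congr hx, pow_mul]
    intro hβx
    exact hβ.1 (hu β hβ.2 ((cls_mono (Nat.le_succ m) hβx).trans hx))
  rw [setIntegral_congr_fun (measurableSet_ball _) hF, integral_const_mul, setIntegral_ball hs,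
    hsum, pow_add, pow_mul]
  ring

/-- A root congruent to `x` at level `m + 1 ≤ l + 1` would put the class of `x` into the tree. Hence
every factor is constant on the set, and the exponents add up to the sum of weights. -/
theorem setIntegral_off_tree (h : IsSeparated p g l) (s : ℂ) {m : ℕ} (hm : m ≤ l) (y : ℤ_[p]) :
    ∫ x in {x | x ∈ ball (cls m y) ∧ cls (m + 1) x ∉ tree p g l}, rootCpow g s x ∂haar p =
      (p : ℂ)⁻¹ * (p - valence p g l (cls m y)) * ((p : ℂ) ^ m)⁻¹ * ((p : ℂ) ^ (-s)) ^
        (∑ k ∈ Finset.range m, weight p g (cls (k + 1) y)) := by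
  have hF : ∀ x ∈ {x | x ∈ ball (cls m y) ∧ cls (m + 1) x ∉ tree p g l}, rootCpow g s x =
      ((p : ℂ) ^ (-s)) ^ (∑ k ∈ Finset.range m, weight p g (cls (k + 1) y)) := by
    rintro x ⟨hx, hxt⟩
    rw [mem_ball_cls] at hx
    rw [rootCpow, h.sum_weight_cls, ← Finset.prod_pow_eq_pow_sum]
    refine Finset.prod_congr rfl fun β hβ => ?_
    rw [normCpow_sub_of_ne (m := m), agreement_congr hx, pow_mul]
    intro hβx
    exact hxt (h.cls_mem_tree.2 (Or.inr ⟨by omega, β, hβ, hβx⟩))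
  rw [setIntegral_congr_fun (measurableSet_off_tree _ _) hF, setIntegral_const,
    measureReal_off_tree, Complex.real_smul]
  push_cast
  rfl

end IsSeparated

/-! ### The partition of the `p`-adic integers that is indexed by the tree -/

/-- Levels of a descending path of classes, `t` telling which of them are in the tree and `w` being
their weights: exactly one level contributes to the generating function. -/
theorem existsUnique_level {t : ℕ → Prop} {w : ℕ → ℕ} {l : ℕ} (h0 : t 0) (w0 : w 0 = 0)
    (hl : ∀ m, t m → m ≤ l + 1) (ht : ∀ k m, k ≤ m → t m → t k) (hw : ∀ m, 1 ≤ m → t m → 1 ≤ w m)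
    (hanti : ∀ m k, 1 ≤ m → m ≤ k → w k ≤ w m) :
    ∃! m, t m ∧ ((m = 1 + l ∧ 2 ≤ w m) ∨ (m ≤ l ∧ w m ≠ 1 ∧ ¬ t (m + 1)) ∨
      (w m = 1 ∧ ∀ k < m, w k ≠ 1)) := by
  classical
  refine existsUnique_of_exists_of_unique ?_ ?_
  -- Existence: let `m` be the deepest level in the tree. If weight one occurs up to `m`, its first
  -- occurrence serves; otherwise `m` itself does, by leaving the tree or by having weight at least
  -- two on level `l + 1`.
  · set m := Nat.findGreatest t (l + 1) with hm
    have htm : t m := Nat.findGreatest_spec (P := t) (Nat.zero_le _) h0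
    by_cases hk : ∃ k, k ≤ m ∧ w k = 1
    · refine ⟨Nat.find hk, ht _ _ (Nat.find_spec hk).1 htm,
        Or.inr (Or.inr ⟨(Nat.find_spec hk).2, fun k hk' hk1 => Nat.find_min hk hk' ⟨?_, hk1⟩⟩)⟩
      exact hk'.le.trans (Nat.find_spec hk).1
    · have hm1 : w m ≠ 1 := fun h => hk ⟨m, le_rfl, h⟩
      have hml := hl m htm
      rcases hml.lt_or_eq with h | h
      · refine ⟨m, htm, Or.inr (Or.inl ⟨by omega, hm1, fun h' => ?_⟩)⟩
        exact absurd (Nat.le_findGreatest (hl _ h') h') (by omega)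
      · have := hw m (by omega) htm
        exact ⟨m, htm, Or.inl ⟨by omega, by omega⟩⟩
  -- Uniqueness: since the path continues to `n`, the upper level `m` can only be the one of first
  -- weight one. Then the weight at `n` is one too, by monotonicity and positivity, and this
  -- excludes all three cases for `n`.
  · have key : ∀ m n, m < n → t m → t n →
        ((m = 1 + l ∧ 2 ≤ w m) ∨ (m ≤ l ∧ w m ≠ 1 ∧ ¬ t (m + 1)) ∨ (w m = 1 ∧ ∀ k < m, w k ≠ 1)) →
        ¬ ((n = 1 + l ∧ 2 ≤ w n) ∨ (n ≤ l ∧ w n ≠ 1 ∧ ¬ t (n + 1)) ∨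
          (w n = 1 ∧ ∀ k < n, w k ≠ 1)) := by
      intro m n hmn htm htn hm hn
      have h1 := hl n htn
      have h2 := ht (m + 1) n hmn htn
      rcases hm with ⟨hm, -⟩ | ⟨-, -, hm⟩ | ⟨hm, -⟩
      · omega
      · exact hm h2
      · have hm0 : m ≠ 0 := by rintro rfl; omega
        have h3 := hanti m n (by omega) hmn.le
        have h4 := hw n (by omega) htn
        rcases hn with ⟨-, hn⟩ | ⟨-, hn, -⟩ | ⟨-, hn⟩
        · omega
        · omega
        · exact hn m hmn hm
    rintro m n ⟨htm, hm⟩ ⟨htn, hn⟩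
    rcases lt_trichotomy m n with h | h | h
    · exact absurd hn (key m n h htm htn hm)
    · exact h
    · exact absurd hm (key n m h htn htm hn)

open Classical in
/-- The part of the ball of `u` over which the integral is `L_u`. -/
def piece (g : ℚ[X]) (l : ℕ) (u : Vertex p) : Set ℤ_[p] :=
  if u.1 = 1 + l ∧ 2 ≤ weight p g u then ball u
  else if u.1 ≤ l ∧ weight p g u ≠ 1 then {x | x ∈ ball u ∧ cls (u.1 + 1) x ∉ tree p g l}
  else if IsFirstSimple p g l u then ball u
  else ∅

theorem piece_subset_ball (u : Vertex p) : piece g l u ⊆ ball u := by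
  unfold piece
  split_ifs
  exacts [subset_rfl, fun x hx => hx.1, subset_rfl, Set.empty_subset _]

theorem measurableSet_piece (u : Vertex p) : MeasurableSet (piece g l u) := by
  unfold piece
  split_ifs
  exacts [measurableSet_ball u, measurableSet_off_tree u _, measurableSet_ball u,
      MeasurableSet.empty]

open Classical in
/-- The value of `L_u` at `t = p ^ (-s)`. -/
noncomputable def vertexValue (g : ℚ[X]) (l : ℕ) (t : ℂ) (u : Vertex p) : ℂ :=
  if u.1 = 1 + l ∧ 2 ≤ weight p g u then
    (1 - (p : ℂ)⁻¹) * ((p : ℂ) ^ u.1)⁻¹ * t ^ stalkWeight p g l u /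
      (1 - (p : ℂ)⁻¹ * t ^ weight p g u)
  else if u.1 ≤ l ∧ weight p g u ≠ 1 then
    (p : ℂ)⁻¹ * (p - valence p g l u) * ((p : ℂ) ^ u.1)⁻¹ * t ^ stalkWeight p g l u
  else if IsFirstSimple p g l u then
    (1 - (p : ℂ)⁻¹) * ((p : ℂ) ^ u.1)⁻¹ * t ^ stalkWeight p g l u / (1 - (p : ℂ)⁻¹ * t)
  else 0

namespace IsSeparated

theorem isFirstSimple_cls (h : IsSeparated p g l) {m : ℕ} {x : ℤ_[p]}
    (hm : cls m x ∈ tree p g l) : IsFirstSimple p g l (cls m x) ↔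
      weight p g (cls m x) = 1 ∧ ∀ k < m, weight p g (cls k x) ≠ 1 := by
  refine (and_iff_right hm).trans (and_congr_right fun _ => ?_)
  constructor
  · intro hn k hk hk1
    refine hn ⟨cls k x, h.tree_of_le hk.le hm, hk1, cls_ge_iff.2 ⟨hk.le, rfl⟩, fun he => ?_⟩
    exact hk.ne' (cls_inj_level he)
  · rintro hn ⟨v, -, hv1, hv, hne⟩
    obtain ⟨y, hy⟩ := exists_cls_eq v
    rw [← hy, cls_ge_iff] at hv
    rw [← hy, ← hv.2] at hv1 hne
    exact hn v.1 (lt_of_le_of_ne hv.1 fun he => hne (by rw [he])) hv1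

theorem mem_piece_cls (h : IsSeparated p g l) {m : ℕ} {x : ℤ_[p]} (hm : cls m x ∈ tree p g l) :
    x ∈ piece g l (cls m x) ↔ (m = 1 + l ∧ 2 ≤ weight p g (cls m x)) ∨
      (m ≤ l ∧ weight p g (cls m x) ≠ 1 ∧ cls (m + 1) x ∉ tree p g l) ∨
      (weight p g (cls m x) = 1 ∧ ∀ k < m, weight p g (cls k x) ≠ 1) := by
  have hx : x ∈ ball (cls m x) := mem_ball_cls.2 rfl
  have hfst : (cls m x).1 = m := rfl
  have h3 := h.isFirstSimple_cls hm
  unfold piece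
  rw [hfst]
  split_ifs with h1 h2 h2'
  · exact ⟨fun _ => Or.inl h1, fun _ => hx⟩
  · simp only [Set.mem_ofPred_eq, hx, true_and]
    constructor
    · exact fun hn => Or.inr (Or.inl ⟨h2.1, h2.2, hn⟩)
    · rintro (hn | hn | hn)
      exacts [absurd hn h1, hn.2.2, absurd hn.1 h2.2]
  · simp only [hx, true_iff]
    exact Or.inr (Or.inr (h3.1 h2'))
  · simp only [Set.mem_empty_iff_false, false_iff]
    rintro (hn | hn | hn)
    exacts [h1 hn, h2 ⟨hn.1, hn.2.1⟩, h2' (h3.2 hn)]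

theorem existsUnique_piece (h : IsSeparated p g l) (x : ℤ_[p]) :
    ∃! m, cls m x ∈ tree p g l ∧ x ∈ piece g l (cls m x) := by
  have := existsUnique_level (t := fun m => cls m x ∈ tree p g l)
    (w := fun m => weight p g (cls m x)) (l := l) (h.cls_mem_tree.2 (Or.inl rfl))
    (by rw [cls_zero, weight, if_pos rfl])
    (fun m hm => (h.cls_mem_tree.1 hm).elim (fun h' => by omega) fun h' => h'.1)
    (fun k m hkm hm => h.tree_of_le hkm hm) (fun m hm => h.weight_cls_pos hm)
    (fun m k hm hmk => h.weight_cls_anti hm hmk x)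
  refine (existsUnique_congr fun m => ?_).2 this
  exact and_congr_right fun hm => h.mem_piece_cls hm

/-- In both cases the class contains exactly one root: on level `l + 1` because the roots are
distinct modulo `p ^ l`, and for weight one because two roots would contribute at least two. The
weight is then the multiplicity of that root. -/
theorem setIntegral_ball_of_weight (h : IsSeparated p g l) {s : ℂ} (hs : 0 < s.re) {u : Vertex p}
    (hu : u ∈ tree p g l) (h0 : weight p g u ≠ 0) (h1 : u.1 = 1 + l ∨ weight p g u = 1) :
    ∫ x in ball u, rootCpow g s x ∂haar p =
      (1 - (p : ℂ)⁻¹) * ((p : ℂ) ^ u.1)⁻¹ * ((p : ℂ) ^ (-s)) ^ stalkWeight p g l u /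
        (1 - (p : ℂ)⁻¹ * ((p : ℂ) ^ (-s)) ^ weight p g u) := by
  classical
  obtain ⟨x, hx⟩ := exists_cls_eq u
  have hm0 : u.1 ≠ 0 := fun hz => h0 (by rw [weight, if_pos hz])
  obtain ⟨α, hα, hαx⟩ := (((h.cls_mem_tree (m := u.1) (x := x)).1 (by rwa [hx])).resolve_left hm0).2
  rw [hx] at hαx
  obtain ⟨m, hm⟩ := Nat.exists_eq_succ_of_ne_zero hm0
  rw [hm] at hαx
  subst hαx
  set a := toPadicInt p α with ha
  have hw := h.weight_cls_succ m a
  have hmem : α ∈ (rootSet g).filter fun β => cls (m + 1) (toPadicInt p β) = cls (m + 1) a :=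
    Finset.mem_filter.2 ⟨hα, rfl⟩
  have huniq : ∀ β ∈ rootSet g, cls (m + 1) (toPadicInt p β) = cls (m + 1) a → β = α := by
    intro β hβ hβα
    by_contra hne
    rcases h1 with h1 | h1
    · have h2 : m + 1 = 1 + l := h1
      exact h.cls_ne β hβ α hα hne (cls_mono (by omega) hβα)
    · have hsub : {β, α} ⊆ (rootSet g).filter
          fun β => cls (m + 1) (toPadicInt p β) = cls (m + 1) a := by
        intro γ hγ
        rcases Finset.mem_insert.1 hγ with rfl | hγ
        · exact Finset.mem_filter.2 ⟨hβ, hβα⟩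
        · rwa [Finset.mem_singleton.1 hγ]
      have := Finset.sum_le_sum_of_subset (f := fun γ => g.rootMultiplicity γ) hsub
      rw [Finset.sum_pair hne, ← hw, show weight p g (cls (m + 1) a) = 1 from h1] at this
      have h2 := rootMultiplicity_pos_of_mem hα
      have h3 := rootMultiplicity_pos_of_mem hβ
      omega
  have hw' : weight p g (cls (m + 1) a) = g.rootMultiplicity α := by
    rw [hw, Finset.sum_eq_single_of_mem α hmem]
    intro β hβ hne
    rw [Finset.mem_filter] at hβ
    exact absurd (huniq β hβ.1 hβ.2) hne
  rw [h.setIntegral_ball_of_unique hs hα huniq, hw', h.stalkWeight_cls hu]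
  rfl

theorem setIntegral_piece (h : IsSeparated p g l) {s : ℂ} (hs : 0 < s.re) {u : Vertex p}
    (hu : u ∈ tree p g l) :
    ∫ x in piece g l u, rootCpow g s x ∂haar p = vertexValue g l ((p : ℂ) ^ (-s)) u := by
  unfold piece vertexValue
  split_ifs with h1 h2 h3
  · exact h.setIntegral_ball_of_weight hs hu (by omega) (Or.inl h1.1)
  · obtain ⟨x, hx⟩ := exists_cls_eq u
    have := h.setIntegral_off_tree s h2.1 x
    rwa [← h.stalkWeight_cls (hx.symm ▸ hu), hx] at this
  · have := h.setIntegral_ball_of_weight hs hu (by rw [h3.2.1]; exact one_ne_zero) (Or.inr h3.2.1)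
    rwa [h3.2.1, pow_one] at this
  · simp

/-- The pieces cover everything and are disjoint by `existsUnique_piece`: a point lies only in
pieces of its own classes, and exactly one level is right. -/
theorem integral_rootCpow (h : IsSeparated p g l) {s : ℂ} (hs : 0 < s.re) :
    ∫ x, rootCpow g s x ∂haar p =
      ∑ u ∈ tree p g l, vertexValue g l ((p : ℂ) ^ (-s)) u := by
  have hun : ⋃ u ∈ tree p g l, piece g l u = (Set.univ : Set ℤ_[p]) := by
    refine Set.eq_univ_of_forall fun x => ?_
    obtain ⟨m, ⟨hm, hx⟩, -⟩ := h.existsUnique_piece x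
    exact Set.mem_biUnion hm hx
  have hdisj : (tree p g l : Set (Vertex p)).PairwiseDisjoint (piece g l) := by
    intro u hu v hv huv
    rw [Function.onFun, Set.disjoint_left]
    intro x hxu hxv
    have hu' := mem_ball.1 (piece_subset_ball u hxu)
    have hv' := mem_ball.1 (piece_subset_ball v hxv)
    have := (h.existsUnique_piece x).unique (y₁ := u.1) (y₂ := v.1) (by rw [hu']; exact ⟨hu, hxu⟩)
      (by rw [hv']; exact ⟨hv, hxv⟩)
    exact huv (by rw [← hu', ← hv', this])
  rw [← setIntegral_univ, ← hun, integral_biUnion_finset _ (fun u _ => measurableSet_piece u) hdisj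
    fun u _ => (integrable_of_continuous (continuous_rootCpow hs)).integrableOn]
  exact Finset.sum_congr rfl fun u hu => h.setIntegral_piece hs hu

end IsSeparated

end

end IgusaZeta

namespace IgusaZeta

/-! ### Values of rational functions -/

section

variable {z : ℂ} {R R' : RatFunc ℚ} {w w' : ℂ}

/-- The rational function `R` has no pole at `z`, and its value there is `w`. -/
def HasValue (z : ℂ) (R : RatFunc ℚ) (w : ℂ) : Prop :=
  ∃ P Q : ℚ[X], Q.eval₂ (algebraMap ℚ ℂ) z ≠ 0 ∧
    R = algebraMap ℚ[X] (RatFunc ℚ) P / algebraMap ℚ[X] (RatFunc ℚ) Q ∧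
    w = P.eval₂ (algebraMap ℚ ℂ) z / Q.eval₂ (algebraMap ℚ ℂ) z

theorem algebraMap_ne_zero_of_eval₂ {Q : ℚ[X]} (hQ : Q.eval₂ (algebraMap ℚ ℂ) z ≠ 0) :
    algebraMap ℚ[X] (RatFunc ℚ) Q ≠ 0 := by
  refine RatFunc.algebraMap_ne_zero ?_
  rintro rfl
  exact hQ (eval₂_zero _ _)

namespace HasValue

/-- The reduced denominator divides every denominator `Q`, so a zero at `z` would be a zero of `Q`.
Thus values can be computed with unreduced fractions. -/
theorem denom_ne_zero (h : HasValue z R w) : R.denom.eval₂ (algebraMap ℚ ℂ) z ≠ 0 := by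
  obtain ⟨P, Q, hQ, hR, -⟩ := h
  have hQ0 : Q ≠ 0 := by rintro rfl; exact hQ (eval₂_zero _ _)
  obtain ⟨D, hD⟩ := (RatFunc.denom_dvd hQ0).2 ⟨P, hR⟩
  intro h0
  rw [hD, eval₂_mul, h0, zero_mul] at hQ
  exact hQ rfl

theorem eval_eq (h : HasValue z R w) : RatFunc.eval (algebraMap ℚ ℂ) z R = w := by
  have hd := h.denom_ne_zero
  obtain ⟨P, Q, hQ, hR, rfl⟩ := h
  rw [RatFunc.eval, div_eq_div_iff hd hQ, ← eval₂_mul, ← eval₂_mul]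
  congr 1
  apply RatFunc.algebraMap_injective ℚ
  rw [map_mul, map_mul, ← div_eq_div_iff (RatFunc.algebraMap_ne_zero R.denom_ne_zero)
    (algebraMap_ne_zero_of_eval₂ hQ), RatFunc.num_div_denom, hR]

theorem polynomial (z : ℂ) (P : ℚ[X]) :
    HasValue z (algebraMap ℚ[X] (RatFunc ℚ) P) (P.eval₂ (algebraMap ℚ ℂ) z) :=
  ⟨P, 1, by simp, by simp, by simp⟩

theorem const (z : ℂ) (c : ℚ) : HasValue z (RatFunc.C c) (c : ℂ) := by
  simpa using polynomial z (C c)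

theorem variable_pow (z : ℂ) (n : ℕ) : HasValue z (RatFunc.X ^ n) (z ^ n) := by
  simpa using polynomial z (X ^ n)

theorem add (h : HasValue z R w) (h' : HasValue z R' w') : HasValue z (R + R') (w + w') := by
  obtain ⟨P, Q, hQ, rfl, rfl⟩ := h
  obtain ⟨P', Q', hQ', rfl, rfl⟩ := h'
  refine ⟨P * Q' + Q * P', Q * Q', ?_, ?_, ?_⟩
  · rw [eval₂_mul]
    exact mul_ne_zero hQ hQ'
  · rw [div_add_div _ _ (algebraMap_ne_zero_of_eval₂ hQ) (algebraMap_ne_zero_of_eval₂ hQ')]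
    simp only [map_add, map_mul]
  · rw [div_add_div _ _ hQ hQ']
    simp only [eval₂_add, eval₂_mul]

theorem mul (h : HasValue z R w) (h' : HasValue z R' w') : HasValue z (R * R') (w * w') := by
  obtain ⟨P, Q, hQ, rfl, rfl⟩ := h
  obtain ⟨P', Q', hQ', rfl, rfl⟩ := h'
  refine ⟨P * P', Q * Q', ?_, ?_, ?_⟩
  · rw [eval₂_mul]
    exact mul_ne_zero hQ hQ'
  · rw [div_mul_div_comm, map_mul, map_mul]
  · rw [div_mul_div_comm, eval₂_mul, eval₂_mul]

theorem inv (h : HasValue z R w) (hw : w ≠ 0) : HasValue z R⁻¹ w⁻¹ := by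
  obtain ⟨P, Q, hQ, rfl, rfl⟩ := h
  exact ⟨Q, P, (div_ne_zero_iff.1 hw).1, inv_div _ _, inv_div _ _⟩

theorem div (h : HasValue z R w) (h' : HasValue z R' w') (hw : w' ≠ 0) :
    HasValue z (R / R') (w / w') := by
  rw [div_eq_mul_inv, div_eq_mul_inv]
  exact h.mul (h'.inv hw)

theorem one_sub (h : HasValue z R w) : HasValue z (1 - R) (1 - w) := by
  have := (const z 1).add ((const z (-1)).mul h)
  simpa [sub_eq_add_neg] using this

theorem sum {ι : Type*} (s : Finset ι) {φ : ι → RatFunc ℚ} {ψ : ι → ℂ}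
    (h : ∀ i ∈ s, HasValue z (φ i) (ψ i)) : HasValue z (∑ i ∈ s, φ i) (∑ i ∈ s, ψ i) := by
  classical
  induction s using Finset.induction_on with
  | empty => simpa using const z 0
  | insert i s hi ih =>
    rw [Finset.sum_insert hi, Finset.sum_insert hi]
    exact (h i (Finset.mem_insert_self i s)).add
      (ih fun j hj => h j (Finset.mem_insert_of_mem hj))

theorem variable_zpow (hz : z ≠ 0) (n : ℤ) : HasValue z (RatFunc.X ^ n) (z ^ n) := by
  obtain ⟨k, rfl | rfl⟩ := n.eq_nat_or_neg
  · simpa using variable_pow z k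
  · simpa using (variable_pow z k).inv (pow_ne_zero k hz)

end HasValue

/-- Numerator and denominator are polynomials in the entire function `a ^ (-s)`. -/
theorem meromorphicOn_eval {a : ℂ} (ha : a ≠ 0) (R : RatFunc ℚ) :
    MeromorphicOn (fun s : ℂ => RatFunc.eval (algebraMap ℚ ℂ) (a ^ (-s)) R) Set.univ := by
  have hpow : Differentiable ℂ fun s : ℂ => a ^ (-s) := fun s =>
    (differentiableAt_id.neg).const_cpow (Or.inl ha)
  have hP : ∀ (P : ℚ[X]) (s : ℂ),
      MeromorphicAt (fun s : ℂ => P.eval₂ (algebraMap ℚ ℂ) (a ^ (-s))) s := by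
    intro P s
    refine (Differentiable.analyticAt ?_ s).meromorphicAt
    simp only [eval₂_eq_eval_map]
    exact (Polynomial.differentiable _).comp hpow
  exact fun s _ => (hP R.num s).div (hP R.denom s)

end

/-! ### The meromorphic continuation -/

section

variable {p : ℕ} [hp : Fact p.Prime] {g : ℚ[X]} {l : ℕ}

theorem hasValue_vertexFunction {t : ℂ} (ht : ‖t‖ ≤ 1) (u : Vertex p) :
    HasValue t (vertexFunction p g l u) (vertexValue g l t u) := by
  have hden : ∀ n : ℕ, HasValue t (1 - RatFunc.C (p : ℚ)⁻¹ * RatFunc.X ^ n)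
      (1 - (p : ℂ)⁻¹ * t ^ n) := fun n => by
    have := ((HasValue.const t (p : ℚ)⁻¹).mul (HasValue.variable_pow t n)).one_sub
    simpa using this
  have hne : ∀ n : ℕ, 1 - (p : ℂ)⁻¹ * t ^ n ≠ 0 := fun n =>
    one_sub_ne_zero (by rw [norm_pow]; exact pow_le_one₀ (norm_nonneg _) ht)
  unfold vertexFunction vertexValue
  split_ifs
  · have := ((HasValue.const t ((1 - (p : ℚ)⁻¹) * ((p : ℚ) ^ u.1)⁻¹)).mul
      (HasValue.variable_pow t (stalkWeight p g l u))).div (hden (weight p g u)) (hne _)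
    push_cast at this
    exact this
  · have := (HasValue.const t ((p : ℚ)⁻¹ * ((p : ℚ) - valence p g l u) * ((p : ℚ) ^ u.1)⁻¹)).mul
      (HasValue.variable_pow t (stalkWeight p g l u))
    push_cast at this
    exact this
  · have := ((HasValue.const t ((1 - (p : ℚ)⁻¹) * ((p : ℚ) ^ u.1)⁻¹)).mul
      (HasValue.variable_pow t (stalkWeight p g l u))).div (hden 1) (hne _)
    rw [pow_one, pow_one] at this
    push_cast at this
    exact this
  · simpa using HasValue.const t 0

theorem exists_isFactorization (hs : g.Splits) : ∃ F, IsFactorization g F := by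
  refine ⟨(rootSet g).toList.map fun α => (α, g.rootMultiplicity α), ?_, ?_, ?_⟩
  · rw [List.map_map]
    simpa [Function.comp_def] using (rootSet g).nodup_toList
  · intro x hx
    obtain ⟨α, hα, rfl⟩ := List.mem_map.1 hx
    exact rootMultiplicity_pos_of_mem (Finset.mem_toList.1 hα)
  · conv_lhs => rw [hs.eq_prod_roots]
    rw [List.map_map, Finset.prod_multiset_map_count]
    simp only [count_roots]
    exact congrArg _ (Finset.prod_map_toList (rootSet g) _).symm

namespace IsFactorization

variable {F : List (ℚ × ℕ)}

theorem prod_rootSet (h : IsFactorization g F) (hg : g ≠ 0) {M : Type*} [CommMonoid M]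
    (φ : ℚ → ℕ → M) : ∏ α ∈ rootSet g, φ α (g.rootMultiplicity α) =
      (F.map fun x => φ x.1 x.2).prod := by
  have := h.prod_filter_rootSet hg (fun _ => True) φ
  simpa using this

theorem prod_rootSet_plusPart (h : IsFactorization g F) (hg : g ≠ 0) (p : ℕ) {M : Type*}
    [CommMonoid M] (φ : ℚ → ℕ → M) :
    ∏ α ∈ rootSet (IgusaZeta.plusPart p g), φ α ((IgusaZeta.plusPart p g).rootMultiplicity α) =
      ∏ α ∈ (rootSet g).filter (fun α => 0 ≤ padicValRat p α), φ α (g.rootMultiplicity α) := by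
  have hg' : IgusaZeta.plusPart p g ≠ 0 := by
    rw [h.plusPart_eq hg]
    exact (monic_linearProd _).ne_zero
  rw [(h.plusPart hg p).prod_rootSet hg', h.prod_filter_rootSet hg (fun α => 0 ≤ padicValRat p α)]

theorem padicValRat_nonneg (h : IsFactorization g F) (hg : g ≠ 0) {p : ℕ} {α : ℚ}
    (hα : α ∈ rootSet (IgusaZeta.plusPart p g)) : 0 ≤ padicValRat p α := by
  have hg' : IgusaZeta.plusPart p g ≠ 0 := by
    rw [h.plusPart_eq hg]
    exact (monic_linearProd _).ne_zero
  rw [(h.plusPart hg p).rootSet_eq hg', List.mem_toFinset, List.mem_map] at hα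
  obtain ⟨x, hx, rfl⟩ := hα
  simpa using (List.mem_filter.1 hx).2

end IsFactorization

theorem norm_ratCast {α : ℚ} (hα : α ≠ 0) : ‖(α : ℚ_[p])‖ = (p : ℝ) ^ (-padicValRat p α) := by
  rw [Padic.eq_padicNorm, padicNorm.eq_zpow_of_nonzero hα]
  push_cast
  rfl

/-- The summand one in the depth makes it exceed the order of every difference of roots, so distinct
roots are incongruent modulo `p ^ depth`. -/
theorem isSeparated_depth (hint : ∀ α ∈ rootSet g, 0 ≤ padicValRat p α) :
    IsSeparated p g (depth p g) := by
  have hden : ∀ α ∈ rootSet g, ¬ p ∣ α.den := fun α hα =>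
    (padicValRat_nonneg_iff p α).1 (hint α hα)
  refine ⟨hden, fun α hα β hβ hne hcls => ?_⟩
  have hle : (padicValRat p (α - β)).toNat < depth p g := by
    rw [depth, Nat.lt_one_add_iff]
    exact Finset.le_sup (f := fun a : ℚ × ℚ => (padicValRat p (a.1 - a.2)).toNat)
      (b := (α, β)) (Finset.mem_offDiag.2 ⟨hα, hβ, hne⟩)
  rw [cls_eq_iff, PadicInt.norm_def] at hcls
  push_cast at hcls
  rw [coe_toPadicInt (hden α hα), coe_toPadicInt (hden β hβ), ← Rat.cast_sub,
    norm_ratCast (sub_ne_zero.2 hne),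
    zpow_le_zpow_iff_right₀ (by exact_mod_cast hp.out.one_lt)] at hcls
  omega

/-- Ultrametric inequality: `|x|_p ≤ 1 < |α|_p`. -/
theorem norm_sub_of_padicValRat_neg (x : ℤ_[p]) {α : ℚ} (hα : padicValRat p α < 0) :
    ‖(x : ℚ_[p]) - α‖ = ‖(α : ℚ_[p])‖ := by
  have h0 : α ≠ 0 := by
    rintro rfl
    simp at hα
  have h1 : 1 < ‖(α : ℚ_[p])‖ := by
    rw [norm_ratCast h0]
    exact one_lt_zpow₀ (by exact_mod_cast hp.out.one_lt) (by omega)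
  have h2 : ‖(x : ℚ_[p])‖ < ‖-(α : ℚ_[p])‖ := by
    rw [norm_neg]
    exact (PadicInt.norm_le_one x).trans_lt h1
  rw [sub_eq_add_neg, IsUltrametricDist.norm_add_eq_max_of_norm_ne_norm h2.ne, max_eq_right h2.le,
    norm_neg]

theorem coe_aeval (f : ℤ[X]) (x : ℤ_[p]) :
    ((aeval x f : ℤ_[p]) : ℚ_[p]) = aeval (x : ℚ_[p]) (toRat f) := by
  rw [toRat, aeval_def, aeval_def, eval₂_map,
    show ((eval₂ (algebraMap ℤ ℤ_[p]) x f : ℤ_[p]) : ℚ_[p]) =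
      PadicInt.Coe.ringHom (eval₂ (algebraMap ℤ ℤ_[p]) x f) from rfl, hom_eval₂]
  congr 1

/-- Over `ℚ_[p]` the polynomial splits into linear factors. The factors of non-integral roots have
constant norm and, with the leading coefficient, form the constant `p ^ (-v)`; the rest is the
positive part. -/
theorem norm_aeval {f : ℤ[X]} (hf : f ≠ 0) (hs : (toRat f).Splits) (x : ℤ_[p]) :
    ‖aeval x f‖ = (p : ℝ) ^ (-shift p (toRat f)) *
      ∏ α ∈ rootSet (plusPart p (toRat f)), ‖x - toPadicInt p α‖ ^
        (plusPart p (toRat f)).rootMultiplicity α := by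
  obtain ⟨F, hF⟩ := exists_isFactorization hs
  have hg := toRat_ne_zero hf
  set g := toRat f with hg_def
  have hprod : aeval (x : ℚ_[p]) g = (g.leadingCoeff : ℚ_[p]) *
      ∏ α ∈ rootSet g, ((x : ℚ_[p]) - α) ^ g.rootMultiplicity α := by
    conv_lhs => rw [hs.eq_prod_roots]
    rw [map_mul, aeval_C, Finset.prod_multiset_map_count, map_prod]
    simp only [count_roots, map_pow, map_sub, aeval_X, aeval_C]
    rfl
  rw [PadicInt.norm_def, coe_aeval, hprod, norm_mul, norm_prod,
    ← Finset.prod_filter_mul_prod_filter_not _ (fun α => 0 ≤ padicValRat p α),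
    hF.prod_rootSet_plusPart hg p fun α e => ‖x - toPadicInt p α‖ ^ e, mul_left_comm, mul_comm]
  congr 1
  · have h0 : g.leadingCoeff * ∏ α ∈ (rootSet g).filter (fun α => padicValRat p α < 0),
        α ^ g.rootMultiplicity α ≠ 0 := by
      refine mul_ne_zero (leadingCoeff_ne_zero.2 hg) (Finset.prod_ne_zero_iff.2 fun α hα => ?_)
      refine pow_ne_zero _ ?_
      rintro rfl
      simp at hα
    rw [shift, ← norm_ratCast h0, Rat.cast_mul, norm_mul, Rat.cast_prod, norm_prod]
    simp only [not_le]
    congr 1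
    refine Finset.prod_congr rfl fun α hα => ?_
    rw [norm_pow, norm_sub_of_padicValRat_neg x (Finset.mem_filter.1 hα).2, Rat.cast_pow, norm_pow]
  · refine Finset.prod_congr rfl fun α hα => ?_
    have hα' := (padicValRat_nonneg_iff p α).1 (Finset.mem_filter.1 hα).2
    rw [norm_pow, PadicInt.norm_def]
    push_cast
    rw [coe_toPadicInt hα']

theorem ofReal_pow_cpow {r : ℝ} (hr : 0 ≤ r) (n : ℕ) (s : ℂ) :
    (((r ^ n : ℝ) : ℂ)) ^ s = ((r : ℂ) ^ s) ^ n := by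
  induction n with
  | zero => simp
  | succ n ih =>
    rw [pow_succ, Complex.ofReal_mul, Complex.mul_cpow_ofReal_nonneg (pow_nonneg hr n) hr, ih,
      pow_succ]

theorem ofReal_prod_cpow {ι : Type*} (A : Finset ι) {r : ι → ℝ} (hr : ∀ i, 0 ≤ r i) (s : ℂ) :
    (((∏ i ∈ A, r i : ℝ) : ℂ)) ^ s = ∏ i ∈ A, ((r i : ℝ) : ℂ) ^ s := by
  classical
  induction A using Finset.induction_on with
  | empty => simp
  | insert i A hi ih =>
    rw [Finset.prod_insert hi, Finset.prod_insert hi, Complex.ofReal_mul,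
      Complex.mul_cpow_ofReal_nonneg (hr i) (Finset.prod_nonneg fun i _ => hr i), ih]

theorem zpow_neg_cpow {p : ℕ} (n : ℤ) (s : ℂ) :
    (((p : ℝ) ^ (-n) : ℝ) : ℂ) ^ s = ((p : ℂ) ^ (-s)) ^ n := by
  obtain ⟨k, rfl | rfl⟩ := n.eq_nat_or_neg
  · rw [zpow_neg, zpow_natCast, zpow_natCast, inv_pow_cpow]
  · rw [neg_neg, zpow_natCast, zpow_neg, zpow_natCast, ofReal_pow_cpow (Nat.cast_nonneg p),
      Complex.cpow_neg, inv_pow, inv_inv, Complex.ofReal_natCast]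

theorem integrand_eq {f : ℤ[X]} (hf : f ≠ 0) (hs : (toRat f).Splits) (s : ℂ) (x : ℤ_[p]) :
    integrand p f s x = ((p : ℂ) ^ (-s)) ^ shift p (toRat f) *
      rootCpow (plusPart p (toRat f)) s x := by
  rw [integrand, norm_aeval hf hs, Complex.ofReal_mul, Complex.mul_cpow_ofReal_nonneg
    (zpow_nonneg (Nat.cast_nonneg p) _) (Finset.prod_nonneg fun _ _ => pow_nonneg (norm_nonneg _)
        _),
    zpow_neg_cpow, ofReal_prod_cpow _ fun α => pow_nonneg (norm_nonneg _) _]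
  congr 1
  exact Finset.prod_congr rfl fun α _ => ofReal_pow_cpow (norm_nonneg _) _ s

/-- The integral is matched with the rational function summand by summand through `HasValue`, which
gives the value and the absence of a pole together. The integrand is continuous on a compact group,
hence integrable. -/
theorem isMeromorphicContinuation_computedZeta {f : ℤ[X]} (hf : f ≠ 0) (hs : (toRat f).Splits) :
    IsMeromorphicContinuation p f (computedZeta p f) := by
  obtain ⟨F, hF⟩ := exists_isFactorization hs
  have hg := toRat_ne_zero hf
  have hp0 : (p : ℂ) ≠ 0 := by exact_mod_cast hp.out.ne_zero
  have hsep : IsSeparated p (plusPart p (toRat f)) (depth p (plusPart p (toRat f))) :=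
    isSeparated_depth fun α hα => hF.padicValRat_nonneg hg hα
  have hint : ∀ s, integrand p f s = fun x => ((p : ℂ) ^ (-s)) ^ shift p (toRat f) *
      rootCpow (plusPart p (toRat f)) s x := fun s => funext fun x => integrand_eq hf hs s x
  have hval : ∀ s : ℂ, 0 < s.re →
      HasValue ((p : ℂ) ^ (-s)) (computedZeta p f) (localZeta p f s) := by
    intro s hs'
    have hz : (p : ℂ) ^ (-s) ≠ 0 := by
      rw [Complex.cpow_ne_zero_iff]
      exact Or.inl hp0
    rw [localZeta, hint, integral_const_mul, hsep.integral_rootCpow hs']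
    exact (HasValue.variable_zpow hz _).mul (HasValue.sum _ fun u _ =>
      hasValue_vertexFunction (norm_cpow_neg_lt_one hs').le u)
  refine ⟨meromorphicOn_eval hp0 _, fun s hs' => ?_, fun s hs' => (hval s hs').denom_ne_zero,
    fun s hs' => (hval s hs').eval_eq.symm⟩
  rw [hint]
  exact integrable_of_continuous (continuous_const.mul (continuous_rootCpow hs'))

end

end IgusaZeta

/-! ### Comparison with the stated bounds. -/

namespace IgusaZeta

theorem euclNorm_log_nonneg {f : ℤ[X]} (hf : f ≠ 0) : 0 ≤ Real.log (euclNorm f) := by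
  have h1 : ((1 : ℤ) : ℝ) ≤ _ := Int.cast_le.2 (one_le_sum_sq hf)
  rw [← euclNorm_sq rfl, Int.cast_one] at h1
  exact Real.log_nonneg ((one_le_sq_iff₀ (Real.sqrt_nonneg _)).1 h1)

end IgusaZeta

theorem mainTheorem2 :
    ∃ (P : IgusaZeta.Program) (K : ℝ),
      ∀ (p : ℕ) [Fact p.Prime] (f : Polynomial ℤ),
        0 < f.natDegree → (IgusaZeta.toRat f).Splits →
        IgusaZeta.IsMeromorphicContinuation p f (IgusaZeta.computedZeta p f) ∧
        ∃ (τ : IgusaZeta.State) (n β : ℕ),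
          IgusaZeta.Runs β P (IgusaZeta.inputState p f) τ n ∧
          IgusaZeta.IsComputeZetaOutput p f τ.out ∧
          let d : ℝ := (f.natDegree : ℝ)
          let N : ℝ := IgusaZeta.euclNorm f
          let l : ℝ :=
            (IgusaZeta.depth p (IgusaZeta.plusPart p (IgusaZeta.toRat f)) : ℝ)
          let B : ℝ := (IgusaZeta.differenceHeight (IgusaZeta.toRat f) : ℝ)
          (n : ℝ) ≤ K * (d ^ 6 + d ^ 9 * Real.log N + l ^ 2 * d ^ 3
              + d ^ 2 * Real.log (max B (p : ℝ))) ∧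
          (β : ℝ) ≤ K * max (max (Real.log (p : ℝ)) (Real.log (l * d)))
              (max (Real.log B) (d ^ 3 + d ^ 2 * Real.log N)) := by
  refine ⟨.seq (.arith 2 .add 1 2) IgusaZeta.computeZeta, 100000000, ?_⟩
  intro p hp f hd hs
  have hf : f ≠ 0 := by
    rintro rfl
    simp at hd
  refine ⟨IgusaZeta.isMeromorphicContinuation_computedZeta hf hs, ?_⟩
  obtain ⟨τ, n, β, hrun, hout, hn, hβ⟩ := IgusaZeta.exists_runs (p := p) hd hs
  refine ⟨τ, n, β, hrun, hout, ?_⟩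
  intro d N l B
  have hd1 : 1 ≤ d := Nat.one_le_cast.2 hd
  have hy : 0 ≤ Real.log N := IgusaZeta.euclNorm_log_nonneg hf
  have hp0 : (0 : ℝ) < p := Nat.cast_pos.2 hp.out.pos
  constructor
  · refine hn.trans ?_
    gcongr
    -- `exists_runs` has `log p` in place of `log max {B, p}`: the sizes of the root differences are
    -- already controlled by `‖f‖`.
    exact le_max_right _ _
  · set m := max (max (Real.log (p : ℝ)) (Real.log (l * d)))
      (max (Real.log B) (d ^ 3 + d ^ 2 * Real.log N)) with hm
    have h1 : Real.log p ≤ m := (le_max_left _ _).trans (le_max_left _ _)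
    have h2 : d ^ 3 + d ^ 2 * Real.log N ≤ m := (le_max_right _ _).trans (le_max_right _ _)
    -- The word length found is only `O(d + d log ‖f‖ + log p)`, so two of the four quantities in
    -- the maximum suffice.
    have h3 : d ≤ d ^ 3 := le_self_pow₀ hd1 (by norm_num)
    have h4 : d * Real.log N ≤ d ^ 2 * Real.log N :=
      mul_le_mul_of_nonneg_right (le_self_pow₀ hd1 (by norm_num)) hy
    have h5 : 0 ≤ d * Real.log N := mul_nonneg (by linarith) hy
    have h6 : (β : ℝ) ≤ 237 * d + 24 * (d * Real.log N) + 8 * Real.log p := by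
      rw [← mul_assoc]
      exact hβ
    linarith
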